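/- Let $m,n\ge 2$, $k=m+n$, $D=k+1$. Let $(M,g)$, $(N,h)$ be (non-empty) Einstein manifolds of dimensions $m,n$ with $\mathrm{Ric}_g=-(k-1)g$, $\mathrm{Ric}_h=-(k-1)h$, and consider the solutions $-dt^2+a(t)^2g+b(t)^2h$ ($a,b>0$, of class $C^2$ on an open interval $I$) of the $D$-dimensional vacuum Einstein equations $\mathrm{Ric}=0$ that are maximal in time, with time oriented so that they are expanding at some time. Put $p=-\dot a/a$, $q=-\dot b/b$, $H=mp+nq$ (expansion means $H<0$), and $A=-1/(aH)$, $B=-1/(bH)$, $P=p/H$, $Q=q/H$. With respect to the time $\tau$, $\partial_\tau=H^{-1}\partial_t$, the quantities $(A,B,P,Q)$ satisfy, with $\Sigma=mP^2+nQ^2$, $$A'=A(P-\Sigma),\quad B'=B(Q-\Sigma),\quad P'=P(1-\Sigma)-(k-1)A^2,\quad Q'=Q(1-\Sigma)-(k-1)B^2$$ on the state space $S=\{A,B>0,\ mP+nQ=1,\ \Sigma+(k-1)(mA^2+nB^2)=1\}$. Let $F_*$ be the fixed point $A=B=P=Q=1/k$, $F_A$ the fixed point $A=0$, $B^2=\frac{n-1}{n^2(k-1)}$,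 $B>0$, $P=0$, $Q=1/n$, and $F_B$ the fixed point $A^2=\frac{m-1}{m^2(k-1)}$, $A>0$, $B=0$, $P=1/m$, $Q=0$. 1. The linearization of the system at $F_*$ on the tangent plane of $S$ has eigenvalues with positive real part; they are non-real ($F_*$ is a spiral) if and only if $k<9$, and real ($F_*$ is a node) if and only if $k\ge 9$. 2. There are an orbit $E_A\subset S$ tending to $F_A$ and an orbit $E_B\subset S$ tending to $F_B$ as $\tau\to\infty$ such that $S\setminus(\{F_*\}\cup E_A\cup E_B)$ is open and dense in $S$, and such that the following holds for every $(M,g)$, $(N,h)$ and every maximal, expanding solution as above. The solution exists exactly on an interval $(T_0,\infty)$ with $T_0\in\mathbb R$, has $H<0$ there, and $(A,B,P,Q)$ stays in $S$. If the solution is generic, i.e. at some time $(A,B,P,Q)\notin\{F_*\}\cup E_A\cup E_B$, then: (i) (Kasner type at the singularity) there are $a_0,b_0>0$ and $P_0,Q_0$ with $mP_0+nQ_0=1=mP_0^2+nQ_0^2$ such that $a/(t-T_0)^{P_0}\to a_0$ and $b/(t-T_0)^{Q_0}\to b_0$ as $t\searrow T_0$; (ii) (Friedmann type at late times) there is a time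 translation $T_1\in\mathbb R$ such that, with $s=t-T_1\to\infty$: - if $k<9$, there are constants $c_0\neq0$, $d_0>0$ such that, modulo $O(s^{-(k-2)})$, $$a=s\big[1-nc_0\sqrt{9-k}\,s^{-(k-1)/2}\cos\varphi+nc_0\sqrt{k-1}\,s^{-(k-1)/2}\sin\varphi\big],$$ $$b=s\big[1-mc_0\sqrt{k-1}\,s^{-(k-1)/2}\sin\varphi+mc_0\sqrt{9-k}\,s^{-(k-1)/2}\cos\varphi\big],$$ where $\varphi=-\tfrac12\sqrt{k-1}\sqrt{9-k}\,\log(s/d_0)$; - if $k=9$, there are constants $c_0,d_0$ such that $a=s[1+nc_0(\log s)s^{-4}+nd_0s^{-4}+O((\log s)^2s^{-8})]$ and $b=s[1-mc_0(\log s)s^{-4}-md_0s^{-4}+O((\log s)^2s^{-8})]$; - if $k\ge10$, there is a constant $c_0$ such that $a=s[1+nc_0s^{-\lambda}+O(R(s))]$ and $b=s[1-mc_0s^{-\lambda}+O(R(s))]$, where $\lambda=\frac12\big(k-1-\sqrt{(k-1)(k-9)}\big)$, and $R(s)=s^{-2\lambda}$ except that $R(s)=s^{-6}\log s$ (where $2\lambda=6$)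 when $k=10$ and $m\ne n$; (iii) with the same $T_1$, the approach to the Friedmann solution is oscillatory, i.e. $a-s$ takes both signs at arbitrarily late times, if and only if $k<9$ (that is, $D<10$); the same holds for $b-s$. -/

import Mathlib

open Filter Topology Asymptotics
open scoped ContDiff Manifold

noncomputable section

namespace WarpedVacuum

/-! ### Curvature of a (pseudo-)Riemannian metric in coordinates -/

section Curvature

variable {ι : Type} [Fintype ι] [DecidableEq ι]

/-- Partial derivative of `f` in the `i`-th coordinate direction. -/
def pd (i : ι) (f : (ι → ℝ) → ℝ) (x : ι → ℝ) : ℝ :=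
  fderiv ℝ f x (Pi.single i 1)

/-- Christoffel symbols `Γ^k_{ij}` of the metric with components `G x i j`. -/
def christoffel (G : (ι → ℝ) → Matrix ι ι ℝ) (k i j : ι) (x : ι → ℝ) : ℝ :=
  (1 / 2) * ∑ l, (G x)⁻¹ k l *
    (pd i (fun y => G y j l) x + pd j (fun y => G y i l) x - pd l (fun y => G y i j) x)

/-- Components `Ric_{ij}` of the Ricci tensor (with the sign for which round spheres are
positive). -/
def ricci (G : (ι → ℝ) → Matrix ι ι ℝ) (x : ι → ℝ) : Matrix ι ι ℝ :=
  fun i j =>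
    (∑ k, pd k (christoffel G k i j) x) - (∑ k, pd j (christoffel G k i k) x)
      + (∑ k, ∑ l, christoffel G k k l x * christoffel G l i j x)
      - (∑ k, ∑ l, christoffel G k j l x * christoffel G l i k x)

end Curvature

/-! ### Einstein manifolds -/

section Einstein

variable {d : ℕ} {M : Type*} [TopologicalSpace M] [ChartedSpace (Fin d → ℝ) M]
  [IsManifold 𝓘(ℝ, Fin d → ℝ) ∞ M]

/-- Smooth Riemannian metrics on the `d`-dimensional manifold `M`. -/
abbrev RMetric (d : ℕ) (M : Type*) [TopologicalSpace M] [ChartedSpace (Fin d → ℝ) M]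
    [IsManifold 𝓘(ℝ, Fin d → ℝ) ∞ M] : Type _ :=
  Bundle.ContMDiffRiemannianMetric 𝓘(ℝ, Fin d → ℝ) ∞ (Fin d → ℝ)
    (fun x : M => TangentSpace 𝓘(ℝ, Fin d → ℝ) x)

/-- The components `g_{ij} = g(∂_i, ∂_j)` of the metric in the chart at `p`, as functions of
the coordinates `x` in the target of that chart. -/
def metricComp (g : RMetric d M) (p : M) (x : Fin d → ℝ) : Matrix (Fin d) (Fin d) ℝ :=
  fun i j => g.inner ((extChartAt 𝓘(ℝ, Fin d → ℝ) p).symm x)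
    (mfderiv 𝓘(ℝ, Fin d → ℝ) 𝓘(ℝ, Fin d → ℝ) (extChartAt 𝓘(ℝ, Fin d → ℝ) p).symm x
      (Pi.single i 1 : Fin d → ℝ))
    (mfderiv 𝓘(ℝ, Fin d → ℝ) 𝓘(ℝ, Fin d → ℝ) (extChartAt 𝓘(ℝ, Fin d → ℝ) p).symm x
      (Pi.single j 1 : Fin d → ℝ))

/-- `Ric_g = c g` on `M`. -/
def IsEinstein (c : ℝ) (g : RMetric d M) : Prop :=
  ∀ p : M, ∀ x ∈ (extChartAt 𝓘(ℝ, Fin d → ℝ) p).target,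
    ricci (metricComp g p) x = c • metricComp g p x

end Einstein

/-! ### Doubly warped products and the vacuum Einstein equations -/

section Spacetime

variable {m n : ℕ}

/-- Index set of the coordinates `(t, x, y)` on `I × M × N`. -/
abbrev STIndex (m n : ℕ) : Type := Unit ⊕ (Fin m ⊕ Fin n)

/-- The time coordinate. -/
def tCoord (z : STIndex m n → ℝ) : ℝ := z (Sum.inl ())

/-- The coordinates of the point of the first factor `M`. -/
def xCoord (z : STIndex m n → ℝ) : Fin m → ℝ := fun i => z (Sum.inr (Sum.inl i))

/-- The coordinates of the point of the second factor `N`. -/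
def yCoord (z : STIndex m n → ℝ) : Fin n → ℝ := fun j => z (Sum.inr (Sum.inr j))

/-- The components of the line element `-dt² + a(t)² g + b(t)² h`, where `g` and `h` are given
by their components in charts of the factors. -/
def warpedMetric (a b : ℝ → ℝ) (g : (Fin m → ℝ) → Matrix (Fin m) (Fin m) ℝ)
    (h : (Fin n → ℝ) → Matrix (Fin n) (Fin n) ℝ) (z : STIndex m n → ℝ) :
    Matrix (STIndex m n) (STIndex m n) ℝ :=
  Matrix.fromBlocks (-1) 0 0
    (Matrix.fromBlocks (a (tCoord z) ^ 2 • g (xCoord z)) 0 0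
      (b (tCoord z) ^ 2 • h (yCoord z)))

variable {M : Type*} [TopologicalSpace M] [ChartedSpace (Fin m → ℝ) M]
  [IsManifold 𝓘(ℝ, Fin m → ℝ) ∞ M]
  {N : Type*} [TopologicalSpace N] [ChartedSpace (Fin n → ℝ) N]
  [IsManifold 𝓘(ℝ, Fin n → ℝ) ∞ N]

/-- The metric `-dt² + a(t)² g + b(t)² h` on `I × M × N`, with `I` an open interval, is a
solution of the vacuum Einstein equations `Ric = 0` (evaluated in the product charts). -/
structure IsVacuum (g : RMetric m M) (h : RMetric n N) (I : Set ℝ) (a b : ℝ → ℝ) : Prop where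
  isOpen : IsOpen I
  ordConnected : I.OrdConnected
  nonempty : I.Nonempty
  a_pos : ∀ t ∈ I, 0 < a t
  b_pos : ∀ t ∈ I, 0 < b t
  a_reg : ContDiffOn ℝ 2 a I
  b_reg : ContDiffOn ℝ 2 b I
  ricci_flat : ∀ (p : M) (q : N) (z : STIndex m n → ℝ), tCoord z ∈ I →
    xCoord z ∈ (extChartAt 𝓘(ℝ, Fin m → ℝ) p).target →
    yCoord z ∈ (extChartAt 𝓘(ℝ, Fin n → ℝ) q).target →
    ricci (warpedMetric a b (metricComp g p) (metricComp h q)) z = 0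

/-- A vacuum solution which cannot be extended to a larger time interval. -/
def IsMaximalVacuum (g : RMetric m M) (h : RMetric n N) (I : Set ℝ) (a b : ℝ → ℝ) : Prop :=
  IsVacuum g h I a b ∧
    ∀ (J : Set ℝ) (a' b' : ℝ → ℝ), IsVacuum g h J a' b' → I ⊆ J →
      Set.EqOn a' a I → Set.EqOn b' b I → J = I

end Spacetime

/-! ### Scale invariant dynamics -/

/-- The mean curvature `H = m p + n q`, `p = -ȧ/a`, `q = -ḃ/b`; the model is expanding
when `H < 0`. -/
def meanCurv (m n : ℕ) (a b : ℝ → ℝ) (t : ℝ) : ℝ :=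
  m * (-(deriv a t / a t)) + n * (-(deriv b t / b t))

/-- Scale invariant variables `(A, B, P, Q)`. -/
abbrev Vars : Type := ℝ × ℝ × ℝ × ℝ

/-- The values `A = -1/(aH)`, `B = -1/(bH)`, `P = p/H`, `Q = q/H` at time `t`. -/
def varsAt (m n : ℕ) (a b : ℝ → ℝ) (t : ℝ) : Vars :=
  (-(1 / (a t * meanCurv m n a b t)), -(1 / (b t * meanCurv m n a b t)),
    -(deriv a t / a t) / meanCurv m n a b t, -(deriv b t / b t) / meanCurv m n a b t)

/-- Right-hand side of the reduced evolution equations for `(A, B, P, Q)` (both Einstein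
constants negative), with respect to the time `τ`, `∂_τ = H⁻¹ ∂_t`. -/
def field (m n : ℕ) : Vars → Vars := fun ⟨A, B, P, Q⟩ =>
  (A * (P - (m * P ^ 2 + n * Q ^ 2)),
   B * (Q - (m * P ^ 2 + n * Q ^ 2)),
   P * (1 - (m * P ^ 2 + n * Q ^ 2)) - ((m : ℝ) + n - 1) * A ^ 2,
   Q * (1 - (m * P ^ 2 + n * Q ^ 2)) - ((m : ℝ) + n - 1) * B ^ 2)

/-- The two constraint functions `(C₁, C₂)`. -/
def constraints (m n : ℕ) : Vars → ℝ × ℝ := fun ⟨A, B, P, Q⟩ =>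
  (m * P + n * Q - 1,
   (m * P ^ 2 + n * Q ^ 2) + ((m : ℝ) + n - 1) * (m * A ^ 2 + n * B ^ 2) - 1)

/-- The physical state space. -/
def stateSpace (m n : ℕ) : Set Vars :=
  {X | constraints m n X = 0 ∧ 0 < X.1 ∧ 0 < X.2.1}

/-- The fixed point `F_A`. -/
def fixedA (m n : ℕ) : Vars :=
  (0, √(((n : ℝ) - 1) / n ^ 2 * (1 / ((m : ℝ) + n - 1))), 0, 1 / n)

/-- The fixed point `F_B`. -/
def fixedB (m n : ℕ) : Vars :=
  (√(((m : ℝ) - 1) / m ^ 2 * (1 / ((m : ℝ) + n - 1))), 0, 1 / m, 0)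

/-- The Friedmann fixed point `F_*`. -/
def fixedStar (m n : ℕ) : Vars :=
  (1 / ((m : ℝ) + n), 1 / ((m : ℝ) + n), 1 / ((m : ℝ) + n), 1 / ((m : ℝ) + n))

/-- `E` is an orbit in the physical state space which converges to `F` as `τ → ∞`. -/
def IsOrbitTendingTo (m n : ℕ) (F : Vars) (E : Set Vars) : Prop :=
  ∃ γ : ℝ → Vars, (∀ τ, HasDerivAt γ (field m n (γ τ)) τ) ∧
    (∀ τ, γ τ ∈ stateSpace m n) ∧ Set.range γ = E ∧ Tendsto γ atTop (𝓝 F)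

/-- The complex eigenvalues of the linearization of the reduced system at `F`, restricted to
the tangent space of the constraint surface at `F` (`u + i v` is the eigenvector). -/
def linEigenvalues (m n : ℕ) (F : Vars) : Set ℂ :=
  {c | ∃ u v : Vars, fderiv ℝ (constraints m n) F u = 0 ∧
    fderiv ℝ (constraints m n) F v = 0 ∧ (u, v) ≠ 0 ∧
    fderiv ℝ (field m n) F u = c.re • u - c.im • v ∧
    fderiv ℝ (field m n) F v = c.im • u + c.re • v}

/-- `F` is a spiral point which is a repellor in `τ` (so attracts towards `t → ∞`). -/
def IsSpiral (m n : ℕ) (F : Vars) : Prop :=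
  ∀ c ∈ linEigenvalues m n F, 0 < c.re ∧ c.im ≠ 0

/-- `F` is a node (possibly degenerate) which is a repellor in `τ`. -/
def IsNode (m n : ℕ) (F : Vars) : Prop :=
  ∀ c ∈ linEigenvalues m n F, 0 < c.re ∧ c.im = 0

/-! ### Asymptotic behavior -/

/-- Kasner type towards the singularity at `t = T₀`. -/
def IsKasnerType (m n : ℕ) (T₀ : ℝ) (a b : ℝ → ℝ) : Prop :=
  ∃ P Q a₀ b₀ : ℝ, m * P + n * Q = 1 ∧ m * P ^ 2 + n * Q ^ 2 = 1 ∧ 0 < a₀ ∧ 0 < b₀ ∧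
    Tendsto (fun t => a t / (t - T₀) ^ P) (𝓝[>] T₀) (𝓝 a₀) ∧
    Tendsto (fun t => b t / (t - T₀) ^ Q) (𝓝[>] T₀) (𝓝 b₀)

/-- Friedmann expansion at late times `s` for `m + n < 9`. -/
def FriedmannSpiral (m n : ℕ) (a b : ℝ → ℝ) : Prop :=
  ∃ c₀ d₀ : ℝ, c₀ ≠ 0 ∧ 0 < d₀ ∧
    let k : ℝ := (m : ℝ) + n
    let φ : ℝ → ℝ := fun s => -(1 / 2) * √(k - 1) * √(9 - k) * Real.log (s / d₀)
    ((fun s => a s - s * (1 - n * c₀ * √(9 - k) * s ^ (-(k - 1) / 2) * Real.cos (φ s)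
        + n * c₀ * √(k - 1) * s ^ (-(k - 1) / 2) * Real.sin (φ s)))
      =O[atTop] fun s => s ^ (-(k - 2))) ∧
    ((fun s => b s - s * (1 - m * c₀ * √(k - 1) * s ^ (-(k - 1) / 2) * Real.sin (φ s)
        + m * c₀ * √(9 - k) * s ^ (-(k - 1) / 2) * Real.cos (φ s)))
      =O[atTop] fun s => s ^ (-(k - 2)))

/-- Friedmann expansion at late times `s` for `m + n = 9`. -/
def FriedmannDegenerate (m n : ℕ) (a b : ℝ → ℝ) : Prop :=
  ∃ c₀ d₀ : ℝ,
    ((fun s => a s - s * (1 + n * c₀ * Real.log s * s ^ (-4 : ℝ) + n * d₀ * s ^ (-4 : ℝ)))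
      =O[atTop] fun s => s * ((Real.log s) ^ 2 * s ^ (-8 : ℝ))) ∧
    ((fun s => b s - s * (1 - m * c₀ * Real.log s * s ^ (-4 : ℝ) - m * d₀ * s ^ (-4 : ℝ)))
      =O[atTop] fun s => s * ((Real.log s) ^ 2 * s ^ (-8 : ℝ)))

/-- Friedmann expansion at late times `s` for `m + n ≥ 10`. When `m + n = 10` the second
exponent equals `2 * lam`, and this resonance produces a logarithm unless `m = n`. -/
def FriedmannNode (m n : ℕ) (a b : ℝ → ℝ) : Prop :=
  ∃ c₀ : ℝ,
    let k : ℝ := (m : ℝ) + n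
    let lam : ℝ := (1 / 2) * (k - 1 - √((k - 1) * (k - 9)))
    let err : ℝ → ℝ := fun s =>
      s * (s ^ (-2 * lam) * if m + n = 10 ∧ m ≠ n then Real.log s else 1)
    ((fun s => a s - s * (1 + n * c₀ * s ^ (-lam))) =O[atTop] err) ∧
    ((fun s => b s - s * (1 - m * c₀ * s ^ (-lam))) =O[atTop] err)

/-- Friedmann type as `s → ∞`, with the expansion belonging to the dimension. -/
def IsFriedmannType (m n : ℕ) (a b : ℝ → ℝ) : Prop :=
  (m + n < 9 → FriedmannSpiral m n a b) ∧
  (m + n = 9 → FriedmannDegenerate m n a b) ∧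
  (10 ≤ m + n → FriedmannNode m n a b)

/-- The scale factor `f` oscillates about the Friedmann scale factor `s` as `s → ∞`. -/
def OscillatesAboutFriedmann (f : ℝ → ℝ) : Prop :=
  (∃ᶠ s in atTop, s < f s) ∧ (∃ᶠ s in atTop, f s < s)

end WarpedVacuum

end

open WarpedVacuum

/-! ### Metric components in a chart: smoothness and positivity. -/

noncomputable section
namespace WarpedVacuum
section Geometry
open Bundle

variable {d : ℕ} {M : Type*} [TopologicalSpace M] [ChartedSpace (Fin d → ℝ) M]
  [IsManifold 𝓘(ℝ, Fin d → ℝ) ∞ M]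

/-! Write k = m + n and K = k - 1. The Ricci tensor of a doubly warped product reduces the vacuum
equations to ordinary differential equations for a, b, p, q with one constraint
(`WarpedData.ricci_warpedMetric`, `IsVacuum.scaleODE`, and conversely `ScaleODE.isVacuum`).

The state space is a plane. Take w = log (A / B) and P - Q = V tanh θ, where V (`maxShear`) is the
bound that the constraints put on |P - Q|. Since 1 - Σ is a multiple of 1 - tanh² θ, this factor
cancels, and the flow becomes w' = V tanh θ, θ' = κ (tanh θ - g w) with g increasing and bounded
(`hasDerivAt_stateOf`). The energy E = U(w) + 2 log cosh θ has derivative 2 κ tanh² θ. Backwards in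
τ, which is towards late proper time, E decreases and is bounded below, so every orbit tends to the
origin, the Friedmann point (`Osc.IsOrbit.tendsto_atBot`). Forwards, E tends to infinity off the
origin. Either tanh θ leaves the closure of the range of g and θ runs off linearly, which is Kasner
behavior, or w tends to ±∞ and the orbit tends to F_A or F_B (`Osc.IsOrbit.fate`). The second
alternative happens on one orbit for each of the two points: existence is a shooting argument,
uniqueness a cone argument (`Osc.exists_isOrbit_tendsToSaddle`, `Osc.IsOrbit.eq_shift_of_saddle`).
Together with the origin these two curves form a closed set with dense complement.

Proper time and the scale factors are explicit along an orbit: -1/H is a constant times exp (-τ/k -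
E/2), and a, b are exponentials in τ and w. Hence τ ranges over ℝ exactly when t ranges over some
(T₀, ∞); uniqueness for the differential equations and the blow-up of H at T₀ identify every maximal
expanding solution with such a reconstruction (`IsMaximalVacuum.exists_orbit`). For Kasner orbits
the exponential convergence of tanh θ to ±1 gives the power laws (`isKasnerType_of_fate`).

At late times set r = -τ/k. Then w solves the damped oscillator w'' + K w' + 2 K w = N with N of
second order. The characteristic roots have discriminant K (k - 9), which is the source of the
critical value k = 9; the same polynomial gives the eigenvalues at F_*. Crude decay estimates
(`decay_upper`, `decay_lower`) followed by variation of constants give the leading term of w and an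
error of the order of its square q = w² + w'² (`PerturbedOsc.spiral`, `PerturbedOsc.degenerate`,
`PerturbedOsc.node`). At k = 10 the fast rate is twice the slow one; this resonance produces a
logarithm unless m = n, when g is odd and N cubic. Since exp r q is integrable, t - T₁ = c exp r (1
+ O(q)) for a suitable T₁ (`PerturbedOsc.exists_clock_limit`), so a - s and b - s are s times fixed
nonzero multiples of w, of opposite signs, up to O(s q). The expansions follow, and the sign of a -
s is that of -w whenever |w| dominates q. For k ≥ 9 this is eventually always so; if the slow mode
is absent, a cone argument still bounds w' by w. -/

lemma contMDiffOn_pushforward (p : M) (v : Fin d → ℝ) :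
    ContMDiffOn 𝓘(ℝ, Fin d → ℝ) (𝓘(ℝ, Fin d → ℝ).prod 𝓘(ℝ, Fin d → ℝ)) ∞
      (fun x => TotalSpace.mk' (Fin d → ℝ) (E := fun x : M => TangentSpace 𝓘(ℝ, Fin d → ℝ) x)
        ((extChartAt 𝓘(ℝ, Fin d → ℝ) p).symm x)
        (mfderiv 𝓘(ℝ, Fin d → ℝ) 𝓘(ℝ, Fin d → ℝ) (extChartAt 𝓘(ℝ, Fin d → ℝ) p).symm x v))
      (extChartAt 𝓘(ℝ, Fin d → ℝ) p).target := by
  have h1 := (contMDiffOn_extChartAt_symm (n := ∞) (I := 𝓘(ℝ, Fin d → ℝ)) p)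
  -- The field is the tangent map of the inverse chart composed with the constant section `x ↦ (x,
  -- v)`.
  have h2 := h1.contMDiffOn_tangentMapWithin (m := ∞) (by simp)
    (isOpen_extChartAt_target p).uniqueMDiffOn
  have h3 : ContMDiff 𝓘(ℝ, Fin d → ℝ) (𝓘(ℝ, Fin d → ℝ).prod 𝓘(ℝ, Fin d → ℝ)) ∞
      (fun x : Fin d → ℝ => (⟨x, v⟩ : TangentBundle 𝓘(ℝ, Fin d → ℝ) (Fin d → ℝ))) :=
    contMDiff_vectorSpace_iff_contDiff.2 contDiff_const
  refine (h2.comp h3.contMDiffOn (s := (extChartAt 𝓘(ℝ, Fin d → ℝ) p).target)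
    (fun x hx => hx)).congr ?_
  intro x hx
  simp only [Function.comp, tangentMapWithin]
  rw [mfderivWithin_of_isOpen (isOpen_extChartAt_target p) hx]

lemma contDiffOn_metricComp (g : RMetric d M) (p : M) (i j : Fin d) :
    ContDiffOn ℝ ∞ (fun x => metricComp g p x i j) (extChartAt 𝓘(ℝ, Fin d → ℝ) p).target := by
  rw [← contMDiffOn_iff_contDiffOn]
  intro x hx
  have hb := (contMDiffOn_extChartAt_symm (n := ∞) (I := 𝓘(ℝ, Fin d → ℝ)) p) x hx
  have : ContMDiffWithinAt 𝓘(ℝ, Fin d → ℝ) (𝓘(ℝ, Fin d → ℝ).prod 𝓘(ℝ)) ∞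
      (fun x ↦ TotalSpace.mk' ℝ (E := Bundle.Trivial M ℝ)
        ((extChartAt 𝓘(ℝ, Fin d → ℝ) p).symm x) (metricComp g p x i j))
        (extChartAt 𝓘(ℝ, Fin d → ℝ) p).target x := by
    apply ContMDiffWithinAt.clm_bundle_apply₂ (F₁ := Fin d → ℝ) (F₂ := Fin d → ℝ)
    · exact ContMDiffAt.comp_contMDiffWithinAt x g.contMDiff.contMDiffAt hb
    · exact contMDiffOn_pushforward p _ x hx
    · exact contMDiffOn_pushforward p _ x hx
  simp only [contMDiffWithinAt_totalSpace] at this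
  exact this.2

lemma metricComp_symm (g : RMetric d M) (p : M) (x : Fin d → ℝ) (i j : Fin d) :
    metricComp g p x i j = metricComp g p x j i :=
  g.symm _ _ _

/-- Bilinearity; this turns definiteness of the matrix of components into definiteness of the metric
on the image of `L`. -/
lemma dotProduct_gram_mulVec {E : Type*} [AddCommGroup E] [TopologicalSpace E] [Module ℝ E]
    (L : (Fin d → ℝ) →L[ℝ] E) (B : E →L[ℝ] E →L[ℝ] ℝ) (v : Fin d → ℝ) :
    v ⬝ᵥ (Matrix.of fun i j => B (L (Pi.single i 1)) (L (Pi.single j 1))).mulVec v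
      = B (L v) (L v) := by
  have hv : L v = ∑ i, v i • L (Pi.single i 1 : Fin d → ℝ) := by
    conv_lhs => rw [← Finset.univ_sum_single v]
    rw [map_sum]
    refine Finset.sum_congr rfl fun i _ => ?_
    rw [← map_smul]
    congr 1
    ext k
    simp [Pi.single_apply]
  rw [hv]
  simp only [dotProduct, Matrix.mulVec, map_sum, map_smul, sum_apply, Matrix.of_apply,
    smul_apply, smul_eq_mul, Finset.mul_sum]
  refine Finset.sum_comm.trans (Finset.sum_congr rfl fun i _ => Finset.sum_congr rfl fun j _ => ?_)
  ring

lemma metricComp_dotProduct (g : RMetric d M) (p : M) (x v : Fin d → ℝ) :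
    v ⬝ᵥ (metricComp g p x).mulVec v = g.inner ((extChartAt 𝓘(ℝ, Fin d → ℝ) p).symm x)
      (mfderiv 𝓘(ℝ, Fin d → ℝ) 𝓘(ℝ, Fin d → ℝ) (extChartAt 𝓘(ℝ, Fin d → ℝ) p).symm x v)
      (mfderiv 𝓘(ℝ, Fin d → ℝ) 𝓘(ℝ, Fin d → ℝ) (extChartAt 𝓘(ℝ, Fin d → ℝ) p).symm x v) :=
  dotProduct_gram_mulVec
    (E := TangentSpace 𝓘(ℝ, Fin d → ℝ) ((extChartAt 𝓘(ℝ, Fin d → ℝ) p).symm x))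
    (mfderiv 𝓘(ℝ, Fin d → ℝ) 𝓘(ℝ, Fin d → ℝ) (extChartAt 𝓘(ℝ, Fin d → ℝ) p).symm x)
    (g.inner ((extChartAt 𝓘(ℝ, Fin d → ℝ) p).symm x)) v

lemma metricComp_posDef (g : RMetric d M) (p : M) {x : Fin d → ℝ}
    (hx : x ∈ (extChartAt 𝓘(ℝ, Fin d → ℝ) p).target) : (metricComp g p x).PosDef := by
  refine Matrix.PosDef.of_dotProduct_mulVec_pos ?_ ?_
  · ext i j
    simpa using metricComp_symm g p x j i
  · intro v hv
    simp only [star_trivial]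
    rw [metricComp_dotProduct]
    refine g.pos _ _ ?_
    intro h0
    -- Positivity of `g` needs a nonzero tangent vector: the inverse chart has an invertible
    -- derivative.
    have hinv := isInvertible_mfderivWithin_extChartAt_symm (I := 𝓘(ℝ, Fin d → ℝ)) hx
    rw [ModelWithCorners.range_eq_univ, mfderivWithin_univ] at hinv
    exact hv (hinv.injective (by rw [h0]; exact (map_zero _).symm))

end Geometry
end WarpedVacuum
end

/-! ### Coordinate metrics and partial derivatives on the product. -/

noncomputable section
namespace WarpedVacuum
section WarpedRicci

/-- `γ` gives the components of a smooth Riemannian metric on the open set `U`. -/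
structure IsMetricOn {d : ℕ} (U : Set (Fin d → ℝ)) (γ : (Fin d → ℝ) → Matrix (Fin d) (Fin d) ℝ) :
    Prop where
  isOpen : IsOpen U
  smooth : ∀ i j, ContDiffOn ℝ ∞ (fun x => γ x i j) U
  symm : ∀ x ∈ U, ∀ i j, γ x i j = γ x j i
  posDef : ∀ x ∈ U, (γ x).PosDef

lemma isMetricOn_metricComp {d : ℕ} {M : Type*} [TopologicalSpace M] [ChartedSpace (Fin d → ℝ) M]
    [IsManifold 𝓘(ℝ, Fin d → ℝ) ∞ M] (g : RMetric d M) (p : M) :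
    IsMetricOn (extChartAt 𝓘(ℝ, Fin d → ℝ) p).target (metricComp g p) :=
  ⟨isOpen_extChartAt_target p, contDiffOn_metricComp g p,
    fun x _ i j => metricComp_symm g p x i j, fun _ hx => metricComp_posDef g p hx⟩

lemma contDiffOn_det {E : Type*} [NormedAddCommGroup E] [NormedSpace ℝ E] {d : ℕ} {U : Set E}
    {γ : E → Matrix (Fin d) (Fin d) ℝ} (h : ∀ i j, ContDiffOn ℝ ∞ (fun x => γ x i j) U) :
    ContDiffOn ℝ ∞ (fun x => (γ x).det) U := by
  simp only [Matrix.det_apply, Units.smul_def, zsmul_eq_mul]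
  exact ContDiffOn.sum fun σ _ => contDiffOn_const.mul (contDiffOn_prod fun i _ => h _ _)

namespace IsMetricOn

variable {d : ℕ} {U : Set (Fin d → ℝ)} {γ : (Fin d → ℝ) → Matrix (Fin d) (Fin d) ℝ}

lemma det_ne_zero (h : IsMetricOn U γ) {x : Fin d → ℝ} (hx : x ∈ U) : (γ x).det ≠ 0 :=
  (h.posDef x hx).det_pos.ne'

lemma inv_mul (h : IsMetricOn U γ) {x : Fin d → ℝ} (hx : x ∈ U) : (γ x)⁻¹ * γ x = 1 :=
  Matrix.nonsing_inv_mul _ (h.det_ne_zero hx).isUnit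

lemma mul_inv (h : IsMetricOn U γ) {x : Fin d → ℝ} (hx : x ∈ U) : γ x * (γ x)⁻¹ = 1 :=
  Matrix.mul_nonsing_inv _ (h.det_ne_zero hx).isUnit

/-- Cramer's rule: the entries of the inverse are quotients of determinants of smooth matrices. -/
lemma contDiffOn_inv (h : IsMetricOn U γ) (i j : Fin d) :
    ContDiffOn ℝ ∞ (fun x => (γ x)⁻¹ i j) U := by
  simp only [Matrix.inv_def, Ring.inverse_eq_inv', Matrix.smul_apply, smul_eq_mul,
    Matrix.adjugate_apply]
  refine ((contDiffOn_det h.smooth).inv fun x hx => h.det_ne_zero hx).mul (contDiffOn_det ?_)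
  intro k l
  by_cases hk : k = j
  · subst hk
    simp only [Matrix.updateRow_self]
    exact contDiffOn_const
  · simp only [Matrix.updateRow_ne hk]
    exact h.smooth k l

lemma contDiffOn_pd (h : IsMetricOn U γ) (i j k : Fin d) :
    ContDiffOn ℝ ∞ (pd k fun x => γ x i j) U :=
  ((h.smooth i j).fderiv_of_isOpen h.isOpen (m := ∞) (by simp)).clm_apply contDiffOn_const

lemma contDiffOn_christoffel (h : IsMetricOn U γ) (i j k : Fin d) :
    ContDiffOn ℝ ∞ (christoffel γ k i j) U := by
  unfold christoffel
  refine contDiffOn_const.mul (ContDiffOn.sum fun l _ => ?_)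
  exact (h.contDiffOn_inv k l).mul
    (((h.contDiffOn_pd j l i).add (h.contDiffOn_pd i l j)).sub (h.contDiffOn_pd i j l))

lemma christoffel_symm (h : IsMetricOn U γ) {x : Fin d → ℝ} (hx : x ∈ U) (i j k : Fin d) :
    christoffel γ k i j x = christoffel γ k j i x := by
  unfold christoffel
  congr 1
  refine Finset.sum_congr rfl fun l _ => ?_
  have : (fun y => γ y i j) =ᶠ[𝓝 x] fun y => γ y j i := by
    filter_upwards [h.isOpen.mem_nhds hx] with y hy using h.symm y hy i j
  have h2 : pd l (fun y => γ y i j) x = pd l (fun y => γ y j i) x := by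
    simp only [pd, this.fderiv_eq]
  rw [h2]
  ring

lemma differentiableAt (h : IsMetricOn U γ) {x : Fin d → ℝ} (hx : x ∈ U) (i j : Fin d) :
    DifferentiableAt ℝ (fun x => γ x i j) x :=
  ((h.smooth i j).contDiffAt (h.isOpen.mem_nhds hx)).differentiableAt (by simp)

lemma differentiableAt_christoffel (h : IsMetricOn U γ) {x : Fin d → ℝ} (hx : x ∈ U)
    (i j k : Fin d) : DifferentiableAt ℝ (christoffel γ k i j) x :=
  ((h.contDiffOn_christoffel i j k).contDiffAt (h.isOpen.mem_nhds hx)).differentiableAt (by simp)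

end IsMetricOn

variable {m n : ℕ}

/-- Projection to the time coordinate. -/
def tProj (m n : ℕ) : (STIndex m n → ℝ) →L[ℝ] ℝ := ContinuousLinearMap.proj (Sum.inl ())
/-- Projection to the coordinates of the first factor. -/
def xProj (m n : ℕ) : (STIndex m n → ℝ) →L[ℝ] (Fin m → ℝ) :=
  ContinuousLinearMap.pi fun i => ContinuousLinearMap.proj (Sum.inr (Sum.inl i))
/-- Projection to the coordinates of the second factor. -/
def yProj (m n : ℕ) : (STIndex m n → ℝ) →L[ℝ] (Fin n → ℝ) :=
  ContinuousLinearMap.pi fun i => ContinuousLinearMap.proj (Sum.inr (Sum.inr i))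

lemma continuous_tCoord : Continuous (tCoord (m := m) (n := n)) := (tProj m n).continuous
lemma continuous_xCoord : Continuous (xCoord (m := m) (n := n)) := (xProj m n).continuous
lemma continuous_yCoord : Continuous (yCoord (m := m) (n := n)) := (yProj m n).continuous

/-- Every nonconstant entry of the warped metric and of its Christoffel symbols is a function of
time times a function of the coordinates of one factor, so this single product rule yields all
partial derivatives that occur. -/
lemma hasFDerivAt_time_mul {φ : ℝ → ℝ} {φ' : ℝ} {d : ℕ} {ψ : (Fin d → ℝ) → ℝ}
    (c : (STIndex m n → ℝ) →L[ℝ] (Fin d → ℝ)) {z : STIndex m n → ℝ}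
    (hφ : HasDerivAt φ φ' (tCoord z)) (hψ : DifferentiableAt ℝ ψ (c z)) :
    HasFDerivAt (fun z => φ (tCoord z) * ψ (c z))
      (φ (tCoord z) • (fderiv ℝ ψ (c z)).comp c + ψ (c z) • φ' • tProj m n) z := by
  have h1 : HasFDerivAt (fun z : STIndex m n → ℝ => φ (tCoord z)) (φ' • tProj m n) z :=
    hφ.comp_hasFDerivAt z (tProj m n).hasFDerivAt
  have h2 := hψ.hasFDerivAt.comp z c.hasFDerivAt
  exact h1.mul h2

lemma pd_time_mul {φ : ℝ → ℝ} {φ' : ℝ} {d : ℕ} {ψ : (Fin d → ℝ) → ℝ}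
    (c : (STIndex m n → ℝ) →L[ℝ] (Fin d → ℝ)) {z : STIndex m n → ℝ}
    (hφ : HasDerivAt φ φ' (tCoord z)) (hψ : DifferentiableAt ℝ ψ (c z)) (i : STIndex m n) :
    pd i (fun z => φ (tCoord z) * ψ (c z)) z =
      φ (tCoord z) * fderiv ℝ ψ (c z) (c (Pi.single i 1))
        + ψ (c z) * (φ' * tProj m n (Pi.single i 1)) := by
  rw [pd, (hasFDerivAt_time_mul c hφ hψ).fderiv]
  simp

@[simp] lemma tProj_inl (u : Unit) : tProj m n (Pi.single (Sum.inl u) 1) = 1 := by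
  simp [tProj]
@[simp] lemma tProj_inr (i : Fin m ⊕ Fin n) : tProj m n (Pi.single (Sum.inr i) 1) = 0 := by
  simp [tProj]
@[simp] lemma xProj_t (u : Unit) : xProj m n (Pi.single (Sum.inl u) 1) = 0 := by
  ext; simp [xProj]
@[simp] lemma xProj_x (i : Fin m) :
    xProj m n (Pi.single (Sum.inr (Sum.inl i)) 1) = Pi.single i 1 := by
  ext j; simp [xProj, Pi.single_apply]
@[simp] lemma xProj_y (j : Fin n) : xProj m n (Pi.single (Sum.inr (Sum.inr j)) 1) = 0 := by
  ext; simp [xProj]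
@[simp] lemma yProj_t (u : Unit) : yProj m n (Pi.single (Sum.inl u) 1) = 0 := by
  ext; simp [yProj]
@[simp] lemma yProj_x (i : Fin m) : yProj m n (Pi.single (Sum.inr (Sum.inl i)) 1) = 0 := by
  ext; simp [yProj]
@[simp] lemma yProj_y (j : Fin n) :
    yProj m n (Pi.single (Sum.inr (Sum.inr j)) 1) = Pi.single j 1 := by
  ext k; simp [yProj, Pi.single_apply]

section
variable {φ : ℝ → ℝ} {φ' : ℝ} {z : STIndex m n → ℝ} (hφ : HasDerivAt φ φ' (tCoord z))
include hφ

lemma pd_t_mul_x {ψ : (Fin m → ℝ) → ℝ} (hψ : DifferentiableAt ℝ ψ (xCoord z)) (u : Unit) :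
    pd (Sum.inl u) (fun z => φ (tCoord z) * ψ (xCoord z)) z = φ' * ψ (xCoord z) := by
  refine (pd_time_mul (xProj m n) hφ hψ _).trans ?_
  simp [mul_comm]; left; rfl

lemma pd_x_mul_x {ψ : (Fin m → ℝ) → ℝ} (hψ : DifferentiableAt ℝ ψ (xCoord z)) (i : Fin m) :
    pd (Sum.inr (Sum.inl i)) (fun z => φ (tCoord z) * ψ (xCoord z)) z =
      φ (tCoord z) * pd i ψ (xCoord z) := by
  refine (pd_time_mul (xProj m n) hφ hψ _).trans ?_
  simp; left; rfl

lemma pd_y_mul_x {ψ : (Fin m → ℝ) → ℝ} (hψ : DifferentiableAt ℝ ψ (xCoord z)) (j : Fin n) :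
    pd (Sum.inr (Sum.inr j)) (fun z => φ (tCoord z) * ψ (xCoord z)) z = 0 := by
  refine (pd_time_mul (xProj m n) hφ hψ _).trans ?_
  simp

lemma pd_t_mul_y {ψ : (Fin n → ℝ) → ℝ} (hψ : DifferentiableAt ℝ ψ (yCoord z)) (u : Unit) :
    pd (Sum.inl u) (fun z => φ (tCoord z) * ψ (yCoord z)) z = φ' * ψ (yCoord z) := by
  refine (pd_time_mul (yProj m n) hφ hψ _).trans ?_
  simp [mul_comm]; left; rfl

lemma pd_x_mul_y {ψ : (Fin n → ℝ) → ℝ} (hψ : DifferentiableAt ℝ ψ (yCoord z)) (i : Fin m) :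
    pd (Sum.inr (Sum.inl i)) (fun z => φ (tCoord z) * ψ (yCoord z)) z = 0 := by
  refine (pd_time_mul (yProj m n) hφ hψ _).trans ?_
  simp

lemma pd_y_mul_y {ψ : (Fin n → ℝ) → ℝ} (hψ : DifferentiableAt ℝ ψ (yCoord z)) (j : Fin n) :
    pd (Sum.inr (Sum.inr j)) (fun z => φ (tCoord z) * ψ (yCoord z)) z =
      φ (tCoord z) * pd j ψ (yCoord z) := by
  refine (pd_time_mul (yProj m n) hφ hψ _).trans ?_
  simp; left; rfl

lemma pd_t_time (u : Unit) : pd (Sum.inl u) (fun z => φ (tCoord z)) z = φ' := by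
  have := pd_t_mul_x hφ (ψ := fun _ => 1) (differentiableAt_const _) u
  simpa using this

lemma pd_inr_time (i : Fin m ⊕ Fin n) : pd (Sum.inr i) (fun z => φ (tCoord z)) z = 0 := by
  have := pd_time_mul (xProj m n) hφ (ψ := fun _ => 1) (differentiableAt_const _) (Sum.inr i)
  simpa using this

end

section
variable {z : STIndex m n → ℝ}

lemma pd_t_x {ψ : (Fin m → ℝ) → ℝ} (hψ : DifferentiableAt ℝ ψ (xCoord z)) (u : Unit) :
    pd (Sum.inl u) (fun z => ψ (xCoord z)) z = 0 := by
  simpa using pd_t_mul_x (hasDerivAt_const (tCoord z) (1 : ℝ)) hψ u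
lemma pd_x_x {ψ : (Fin m → ℝ) → ℝ} (hψ : DifferentiableAt ℝ ψ (xCoord z)) (i : Fin m) :
    pd (Sum.inr (Sum.inl i)) (fun z => ψ (xCoord z)) z = pd i ψ (xCoord z) := by
  simpa using pd_x_mul_x (hasDerivAt_const (tCoord z) (1 : ℝ)) hψ i
lemma pd_y_x {ψ : (Fin m → ℝ) → ℝ} (hψ : DifferentiableAt ℝ ψ (xCoord z)) (j : Fin n) :
    pd (Sum.inr (Sum.inr j)) (fun z => ψ (xCoord z)) z = 0 := by
  simpa using pd_y_mul_x (hasDerivAt_const (tCoord z) (1 : ℝ)) hψ j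
lemma pd_t_y {ψ : (Fin n → ℝ) → ℝ} (hψ : DifferentiableAt ℝ ψ (yCoord z)) (u : Unit) :
    pd (Sum.inl u) (fun z => ψ (yCoord z)) z = 0 := by
  simpa using pd_t_mul_y (hasDerivAt_const (tCoord z) (1 : ℝ)) hψ u
lemma pd_x_y {ψ : (Fin n → ℝ) → ℝ} (hψ : DifferentiableAt ℝ ψ (yCoord z)) (i : Fin m) :
    pd (Sum.inr (Sum.inl i)) (fun z => ψ (yCoord z)) z = 0 := by
  simpa using pd_x_mul_y (hasDerivAt_const (tCoord z) (1 : ℝ)) hψ i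
lemma pd_y_y {ψ : (Fin n → ℝ) → ℝ} (hψ : DifferentiableAt ℝ ψ (yCoord z)) (j : Fin n) :
    pd (Sum.inr (Sum.inr j)) (fun z => ψ (yCoord z)) z = pd j ψ (yCoord z) := by
  simpa using pd_y_mul_y (hasDerivAt_const (tCoord z) (1 : ℝ)) hψ j
lemma pd_const {ι : Type} [Fintype ι] [DecidableEq ι] (i : ι) (c : ℝ) (x : ι → ℝ) :
    pd i (fun _ => c) x = 0 := by simp [pd]
end

end WarpedRicci
end WarpedVacuum
end

/-! ### Christoffel symbols and Ricci tensor of the doubly warped product. -/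

noncomputable section
namespace WarpedVacuum
section WarpedRicci
variable {m n : ℕ}

/-- Pointwise data for the curvature of `-dt² + a² γ + b² χ`: the metrics of the factors on
coordinate domains and two derivatives of the scale factors on an open time domain. -/
structure WarpedData (I : Set ℝ) (a a₁ a₂ b b₁ b₂ : ℝ → ℝ) (U : Set (Fin m → ℝ))
    (γ : (Fin m → ℝ) → Matrix (Fin m) (Fin m) ℝ) (V : Set (Fin n → ℝ))
    (χ : (Fin n → ℝ) → Matrix (Fin n) (Fin n) ℝ) : Prop where
  isOpen : IsOpen I
  a_ne : ∀ t ∈ I, a t ≠ 0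
  b_ne : ∀ t ∈ I, b t ≠ 0
  a_deriv : ∀ t ∈ I, HasDerivAt a (a₁ t) t
  a_deriv2 : ∀ t ∈ I, HasDerivAt a₁ (a₂ t) t
  b_deriv : ∀ t ∈ I, HasDerivAt b (b₁ t) t
  b_deriv2 : ∀ t ∈ I, HasDerivAt b₁ (b₂ t) t
  left : IsMetricOn U γ
  right : IsMetricOn V χ

/-- The Christoffel symbols of `-dt² + a² γ + b² χ`. -/
def warpedChristoffel (a a₁ b b₁ : ℝ → ℝ)
    (γ : (Fin m → ℝ) → Matrix (Fin m) (Fin m) ℝ) (χ : (Fin n → ℝ) → Matrix (Fin n) (Fin n) ℝ) :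
    STIndex m n → STIndex m n → STIndex m n → (STIndex m n → ℝ) → ℝ
  | .inl _, .inr (.inl i), .inr (.inl j) =>
      fun z => (a (tCoord z) * a₁ (tCoord z)) * γ (xCoord z) i j
  | .inl _, .inr (.inr i), .inr (.inr j) =>
      fun z => (b (tCoord z) * b₁ (tCoord z)) * χ (yCoord z) i j
  | .inr (.inl k), .inl _, .inr (.inl j) =>
      fun z => a₁ (tCoord z) / a (tCoord z) * (if k = j then 1 else 0)
  | .inr (.inl k), .inr (.inl i), .inl _ =>
      fun z => a₁ (tCoord z) / a (tCoord z) * (if k = i then 1 else 0)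
  | .inr (.inl k), .inr (.inl i), .inr (.inl j) => fun z => christoffel γ k i j (xCoord z)
  | .inr (.inr k), .inl _, .inr (.inr j) =>
      fun z => b₁ (tCoord z) / b (tCoord z) * (if k = j then 1 else 0)
  | .inr (.inr k), .inr (.inr i), .inl _ =>
      fun z => b₁ (tCoord z) / b (tCoord z) * (if k = i then 1 else 0)
  | .inr (.inr k), .inr (.inr i), .inr (.inr j) => fun z => christoffel χ k i j (yCoord z)
  | _, _, _ => fun _ => 0

namespace WarpedData
variable {I : Set ℝ} {a a₁ a₂ b b₁ b₂ : ℝ → ℝ} {U : Set (Fin m → ℝ)}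
    {γ : (Fin m → ℝ) → Matrix (Fin m) (Fin m) ℝ} {V : Set (Fin n → ℝ)}
    {χ : (Fin n → ℝ) → Matrix (Fin n) (Fin n) ℝ}
    (D : WarpedData I a a₁ a₂ b b₁ b₂ U γ V χ) {z : STIndex m n → ℝ}
include D

lemma warpedMetric_inv (ht : tCoord z ∈ I) (hx : xCoord z ∈ U) (hy : yCoord z ∈ V) :
    (warpedMetric a b γ χ z)⁻¹ = Matrix.fromBlocks (-1) 0 0
      (Matrix.fromBlocks ((a (tCoord z) ^ 2)⁻¹ • (γ (xCoord z))⁻¹) 0 0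
        ((b (tCoord z) ^ 2)⁻¹ • (χ (yCoord z))⁻¹)) := by
  refine Matrix.inv_eq_right_inv ?_
  have ha : a (tCoord z) ^ 2 ≠ 0 := pow_ne_zero 2 (D.a_ne _ ht)
  have hb : b (tCoord z) ^ 2 ≠ 0 := pow_ne_zero 2 (D.b_ne _ ht)
  simp [warpedMetric, Matrix.fromBlocks_multiply, D.left.mul_inv hx, D.right.mul_inv hy, smul_smul,
    inv_mul_cancel₀ ha, inv_mul_cancel₀ hb]

lemma a_sq_deriv (ht : tCoord z ∈ I) :
    HasDerivAt (fun t => a t ^ 2) (2 * a (tCoord z) * a₁ (tCoord z)) (tCoord z) := by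
  simpa using (D.a_deriv _ ht).fun_pow 2

lemma b_sq_deriv (ht : tCoord z ∈ I) :
    HasDerivAt (fun t => b t ^ 2) (2 * b (tCoord z) * b₁ (tCoord z)) (tCoord z) := by
  simpa using (D.b_deriv _ ht).fun_pow 2

lemma christoffel_eq (ht : tCoord z ∈ I) (hx : xCoord z ∈ U) (hy : yCoord z ∈ V)
    (k i j : STIndex m n) :
    christoffel (warpedMetric a b γ χ) k i j z = warpedChristoffel a a₁ b b₁ γ χ k i j z := by
  have ha := D.a_ne _ ht
  have hb := D.b_ne _ ht
  have hda := D.a_sq_deriv ht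
  have hdb := D.b_sq_deriv ht
  have hγ := fun i j => D.left.differentiableAt hx i j
  have hχ := fun i j => D.right.differentiableAt hy i j
  have eγ : ∀ i j, ∑ l, (γ (xCoord z))⁻¹ i l * γ (xCoord z) l j = if i = j then 1 else 0 := by
    intro i j
    have := congrFun (congrFun (D.left.inv_mul hx) i) j
    rwa [Matrix.mul_apply, Matrix.one_apply] at this
  have eχ : ∀ i j, ∑ l, (χ (yCoord z))⁻¹ i l * χ (yCoord z) l j = if i = j then 1 else 0 := by
    intro i j
    have := congrFun (congrFun (D.right.inv_mul hy) i) j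
    rwa [Matrix.mul_apply, Matrix.one_apply] at this
  have sγ := fun i j => D.left.symm _ hx i j
  have sχ := fun i j => D.right.symm _ hy i j
  have ptγ := fun i j u => pd_t_mul_x hda (hγ i j) u
  have pxγ := fun i j u => pd_x_mul_x hda (hγ i j) u
  have pyγ := fun i j u => pd_y_mul_x hda (hγ i j) u
  have ptχ := fun i j u => pd_t_mul_y hdb (hχ i j) u
  have pxχ := fun i j u => pd_x_mul_y hdb (hχ i j) u
  have pyχ := fun i j u => pd_y_mul_y hdb (hχ i j) u
  rw [christoffel, D.warpedMetric_inv ht hx hy]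
  rcases k with _ | k | k <;> rcases i with _ | i | i <;> rcases j with _ | j | j <;>
  simp only [Fintype.sum_sum_type, warpedMetric, Matrix.fromBlocks_apply₁₁,
    Matrix.fromBlocks_apply₁₂, Matrix.fromBlocks_apply₂₁, Matrix.fromBlocks_apply₂₂,
    Matrix.smul_apply, Matrix.zero_apply, Matrix.neg_apply, Matrix.one_apply, smul_eq_mul,
    ptγ, pxγ, pyγ, ptχ, pxχ, pyχ, pd_const, warpedChristoffel, zero_mul, mul_zero,
    Finset.sum_const_zero, add_zero, zero_add, sub_zero, Finset.univ_unique,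
    Finset.sum_singleton, if_true, PUnit.default_eq_unit]
  · ring
  · ring
  -- A symbol with one time index below: contracting the inverse metric with the time derivative a
  -- multiple of the metric gives a Kronecker delta.
  · rw [← eγ, Finset.mul_sum, Finset.mul_sum]
    refine Finset.sum_congr rfl fun l _ => ?_
    rw [sγ j l]; field_simp
  · rw [← eγ, Finset.mul_sum, Finset.mul_sum]
    refine Finset.sum_congr rfl fun l _ => ?_
    rw [sγ i l]; field_simp
  · rw [christoffel]
    congr 1
    refine Finset.sum_congr rfl fun l _ => ?_
    field_simp
  · rw [← eχ, Finset.mul_sum, Finset.mul_sum]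
    refine Finset.sum_congr rfl fun l _ => ?_
    rw [sχ j l]; field_simp
  · rw [← eχ, Finset.mul_sum, Finset.mul_sum]
    refine Finset.sum_congr rfl fun l _ => ?_
    rw [sχ i l]; field_simp
  · rw [christoffel]
    congr 1
    refine Finset.sum_congr rfl fun l _ => ?_
    field_simp

/-- The formula for the symbols holds on a neighborhood because all three domains are open, so it
may be differentiated. -/
lemma pd_christoffel (ht : tCoord z ∈ I) (hx : xCoord z ∈ U) (hy : yCoord z ∈ V)
    (l k i j : STIndex m n) :
    pd l (christoffel (warpedMetric a b γ χ) k i j) z =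
      pd l (warpedChristoffel a a₁ b b₁ γ χ k i j) z := by
  have : christoffel (warpedMetric a b γ χ) k i j =ᶠ[𝓝 z] warpedChristoffel a a₁ b b₁ γ χ k i j := by
    filter_upwards [continuous_tCoord.continuousAt.preimage_mem_nhds (D.isOpen.mem_nhds ht),
      continuous_xCoord.continuousAt.preimage_mem_nhds (D.left.isOpen.mem_nhds hx),
      continuous_yCoord.continuousAt.preimage_mem_nhds (D.right.isOpen.mem_nhds hy)]
      with w h1 h2 h3 using D.christoffel_eq h1 h2 h3 k i j
  simp only [pd, this.fderiv_eq]

-- The off-diagonal blocks vanish: what remains in them cancels by the symmetry of the Christoffel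
-- symbols of the factors. In a diagonal block of a factor the purely spatial terms assemble to the
-- Ricci tensor of that factor, and all others are multiples of its metric.
set_option maxHeartbeats 2000000 in
lemma ricci_warpedMetric (ht : tCoord z ∈ I) (hx : xCoord z ∈ U) (hy : yCoord z ∈ V) :
    ricci (warpedMetric a b γ χ) z = Matrix.fromBlocks
      (-(m * (a₂ (tCoord z) / a (tCoord z)) + n * (b₂ (tCoord z) / b (tCoord z))) • 1) 0 0
      (Matrix.fromBlocks
        (ricci γ (xCoord z) + (a (tCoord z) * a₂ (tCoord z) + (m - 1) * a₁ (tCoord z) ^ 2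
          + n * (a (tCoord z) * a₁ (tCoord z) * b₁ (tCoord z) / b (tCoord z))) • γ (xCoord z)) 0 0
        (ricci χ (yCoord z) + (b (tCoord z) * b₂ (tCoord z) + (n - 1) * b₁ (tCoord z) ^ 2
          + m * (b (tCoord z) * b₁ (tCoord z) * a₁ (tCoord z) / a (tCoord z))) • χ (yCoord z))) := by
  have ha := D.a_ne _ ht
  have hb := D.b_ne _ ht
  have dγ := fun i j => D.left.differentiableAt hx i j
  have dχ := fun i j => D.right.differentiableAt hy i j
  have cγ := fun i j k => D.left.differentiableAt_christoffel hx i j k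
  have cχ := fun i j k => D.right.differentiableAt_christoffel hy i j k
  have sγ := fun i j k => D.left.christoffel_symm hx i j k
  have sχ := fun i j k => D.right.christoffel_symm hy i j k
  have h1 := (D.a_deriv _ ht).mul (D.a_deriv2 _ ht)
  have h2 := (D.b_deriv _ ht).mul (D.b_deriv2 _ ht)
  have h3 := (D.a_deriv2 _ ht).div (D.a_deriv _ ht) ha
  have h4 := (D.b_deriv2 _ ht).div (D.b_deriv _ ht) hb
  have h3' := fun c => h3.mul_const c
  have h4' := fun c => h4.mul_const c
  have q1 := fun i j u => pd_t_mul_x h1 (dγ i j) u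
  have q4 := fun i j u => pd_t_mul_y h2 (dχ i j) u
  have r1 := fun c u => pd_t_time (h3' c) u
  have r2 := fun c u => pd_inr_time (h3' c) u
  have r3 := fun c u => pd_t_time (h4' c) u
  have r4 := fun c u => pd_inr_time (h4' c) u
  have t1 := fun i j k u => pd_t_x (cγ i j k) u
  have t2 := fun i j k u => pd_x_x (cγ i j k) u
  have t3 := fun i j k u => pd_y_x (cγ i j k) u
  have t4 := fun i j k u => pd_t_y (cχ i j k) u
  have t5 := fun i j k u => pd_x_y (cχ i j k) u
  have t6 := fun i j k u => pd_y_y (cχ i j k) u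
  simp only [Pi.mul_apply, Pi.div_apply] at q1 q4 r1 r2 r3 r4
  ext i j
  simp only [ricci, D.pd_christoffel ht hx hy, D.christoffel_eq ht hx hy]
  rcases i with _ | i | i <;> rcases j with _ | j | j <;>
  simp only [Fintype.sum_sum_type, Matrix.fromBlocks_apply₁₁,
    Matrix.fromBlocks_apply₁₂, Matrix.fromBlocks_apply₂₁, Matrix.fromBlocks_apply₂₂,
    Matrix.smul_apply, Matrix.zero_apply, Matrix.one_apply, smul_eq_mul, Matrix.add_apply,
    warpedChristoffel, zero_mul, mul_zero, q1, q4, r1, r2, r3, r4,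
    t1, t2, t3, t4, t5, t6, pd_const] <;>
  simp only [zero_mul, mul_zero,
    Finset.sum_const_zero, add_zero, zero_add, zero_sub, Finset.univ_unique,
    PUnit.default_eq_unit, mul_ite, ite_mul, mul_one,
    Finset.sum_ite_eq, Finset.sum_ite_eq', Finset.mem_univ, if_true, Finset.sum_const,
    Finset.card_univ, Fintype.card_fin, nsmul_eq_mul, sub_self]
  · field_simp; ring
  · rw [sub_eq_zero]; exact Finset.sum_congr rfl fun l _ => by rw [sγ]
  · rw [sub_eq_zero]; exact Finset.sum_congr rfl fun l _ => by rw [sχ]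
  · rw [sub_eq_zero]; exact Finset.sum_congr rfl fun l _ => by rw [sγ l i, mul_comm]
  · simp only [Finset.card_singleton, Nat.cast_one, one_mul, Finset.sum_add_distrib,
      Finset.sum_ite_eq', Finset.mem_univ, if_true, Finset.sum_const,
      Finset.card_univ, Fintype.card_fin, nsmul_eq_mul, ricci, D.left.symm _ hx j i]
    field_simp
    ring
  · rw [sub_eq_zero]; exact Finset.sum_congr rfl fun l _ => by rw [sχ l i, mul_comm]
  · simp only [Finset.card_singleton, Nat.cast_one, one_mul, Finset.sum_add_distrib,
      Finset.sum_ite_eq', Finset.mem_univ, if_true, Finset.sum_const,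
      Finset.card_univ, Fintype.card_fin, nsmul_eq_mul, ricci, D.right.symm _ hy j i]
    field_simp
    ring
end WarpedData

end WarpedRicci
end WarpedVacuum
end

/-! ### The vacuum equations as differential equations for the scale factors. -/

noncomputable section
namespace WarpedVacuum
section ScaleFactors
variable {m n : ℕ}

/-- The reduced field equations for the scale factors `a`, `b` and `p = -ȧ/a`, `q = -ḃ/b`. -/
structure ScaleODE (m n : ℕ) (I : Set ℝ) (a b p q : ℝ → ℝ) : Prop where
  isOpen : IsOpen I
  ordConnected : I.OrdConnected
  nonempty : I.Nonempty
  a_pos : ∀ t ∈ I, 0 < a t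
  b_pos : ∀ t ∈ I, 0 < b t
  a_deriv : ∀ t ∈ I, HasDerivAt a (-(a t * p t)) t
  b_deriv : ∀ t ∈ I, HasDerivAt b (-(b t * q t)) t
  p_deriv : ∀ t ∈ I, HasDerivAt p (p t * (m * p t + n * q t) - (m + n - 1) / a t ^ 2) t
  q_deriv : ∀ t ∈ I, HasDerivAt q (q t * (m * p t + n * q t) - (m + n - 1) / b t ^ 2) t
  constraint : ∀ t ∈ I, (m * p t + n * q t) ^ 2 =
    m * p t ^ 2 + n * q t ^ 2 + (m + n - 1) * (m / a t ^ 2 + n / b t ^ 2)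

lemma ContDiffOn.hasDerivAt_deriv_deriv {f : ℝ → ℝ} {I : Set ℝ} (hI : IsOpen I)
    (hf : ContDiffOn ℝ 2 f I) {t : ℝ} (ht : t ∈ I) :
    HasDerivAt f (deriv f t) t ∧ HasDerivAt (deriv f) (deriv (deriv f) t) t := by
  refine ⟨((hf.contDiffAt (hI.mem_nhds ht)).differentiableAt (by simp)).hasDerivAt, ?_⟩
  have := (contDiffOn_succ_iff_deriv_of_isOpen (n := 1) hI).1 hf
  exact ((this.2.2.contDiffAt (hI.mem_nhds ht)).differentiableAt (by simp)).hasDerivAt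

variable {M : Type*} [TopologicalSpace M] [ChartedSpace (Fin m → ℝ) M]
  [IsManifold 𝓘(ℝ, Fin m → ℝ) ∞ M]
  {N : Type*} [TopologicalSpace N] [ChartedSpace (Fin n → ℝ) N]
  [IsManifold 𝓘(ℝ, Fin n → ℝ) ∞ N]
  {g : RMetric m M} {h : RMetric n N} {I : Set ℝ} {a b : ℝ → ℝ}

/-- The point of the coordinate domain with given components. -/
def stPoint (t : ℝ) (x : Fin m → ℝ) (y : Fin n → ℝ) : STIndex m n → ℝ :=
  Sum.elim (fun _ => t) (Sum.elim x y)

lemma IsVacuum.warpedData (hv : IsVacuum g h I a b) (P : M) (Q : N) :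
    WarpedData I a (deriv a) (deriv (deriv a)) b (deriv b) (deriv (deriv b))
      (extChartAt 𝓘(ℝ, Fin m → ℝ) P).target (metricComp g P)
      (extChartAt 𝓘(ℝ, Fin n → ℝ) Q).target (metricComp h Q) where
  isOpen := hv.isOpen
  a_ne t ht := (hv.a_pos t ht).ne'
  b_ne t ht := (hv.b_pos t ht).ne'
  a_deriv _ ht := (ContDiffOn.hasDerivAt_deriv_deriv hv.isOpen hv.a_reg ht).1
  a_deriv2 _ ht := (ContDiffOn.hasDerivAt_deriv_deriv hv.isOpen hv.a_reg ht).2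
  b_deriv _ ht := (ContDiffOn.hasDerivAt_deriv_deriv hv.isOpen hv.b_reg ht).1
  b_deriv2 _ ht := (ContDiffOn.hasDerivAt_deriv_deriv hv.isOpen hv.b_reg ht).2
  left := isMetricOn_metricComp g P
  right := isMetricOn_metricComp h Q

/-- One point of each factor and one diagonal entry of each block are enough: diagonal entries of a
positive definite matrix are positive and can be cancelled. -/
lemma IsVacuum.field_equations [Nonempty M] [Nonempty N] (hm : 0 < m) (hn : 0 < n)
    (hg : IsEinstein (-((m : ℝ) + n - 1)) g) (hh : IsEinstein (-((m : ℝ) + n - 1)) h)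
    (hv : IsVacuum g h I a b) {t : ℝ} (ht : t ∈ I) :
    m * (deriv (deriv a) t / a t) + n * (deriv (deriv b) t / b t) = 0 ∧
    a t * deriv (deriv a) t + (m - 1) * deriv a t ^ 2 + n * (a t * deriv a t * deriv b t / b t)
      = m + n - 1 ∧
    b t * deriv (deriv b) t + (n - 1) * deriv b t ^ 2 + m * (b t * deriv b t * deriv a t / a t)
      = m + n - 1 := by
  obtain ⟨P⟩ := ‹Nonempty M›
  obtain ⟨Q⟩ := ‹Nonempty N›
  have hx := mem_extChartAt_target (I := 𝓘(ℝ, Fin m → ℝ)) P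
  have hy := mem_extChartAt_target (I := 𝓘(ℝ, Fin n → ℝ)) Q
  set x := extChartAt 𝓘(ℝ, Fin m → ℝ) P P
  set y := extChartAt 𝓘(ℝ, Fin n → ℝ) Q Q
  have D := hv.warpedData P Q
  have hz := D.ricci_warpedMetric (z := stPoint t x y) ht hx hy
  rw [hv.ricci_flat P Q (stPoint t x y) ht hx hy, show tCoord (stPoint t x y) = t from rfl,
    show xCoord (stPoint t x y) = x from rfl, show yCoord (stPoint t x y) = y from rfl,
    hg P x hx, hh Q y hy] at hz
  let i : Fin m := ⟨0, hm⟩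
  let j : Fin n := ⟨0, hn⟩
  have e1 := congrFun (congrFun hz (Sum.inl ())) (Sum.inl ())
  have e2 := congrFun (congrFun hz (Sum.inr (Sum.inl i))) (Sum.inr (Sum.inl i))
  have e3 := congrFun (congrFun hz (Sum.inr (Sum.inr j))) (Sum.inr (Sum.inr j))
  have p2 : metricComp g P x i i ≠ 0 := ((metricComp_posDef g P hx).diag_pos).ne'
  have p3 : metricComp h Q y j j ≠ 0 := ((metricComp_posDef h Q hy).diag_pos).ne'
  simp only [Matrix.zero_apply, Matrix.fromBlocks_apply₁₁, Matrix.fromBlocks_apply₂₂,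
    Matrix.smul_apply, Matrix.add_apply, smul_eq_mul, Matrix.one_apply, if_true] at e1 e2 e3
  refine ⟨by linarith, ?_, ?_⟩
  · refine mul_right_cancel₀ p2 ?_
    linarith
  · refine mul_right_cancel₀ p3 ?_
    linarith

lemma IsVacuum.scaleODE [Nonempty M] [Nonempty N] (hm : 0 < m) (hn : 0 < n)
    (hg : IsEinstein (-((m : ℝ) + n - 1)) g) (hh : IsEinstein (-((m : ℝ) + n - 1)) h)
    (hv : IsVacuum g h I a b) :
    ScaleODE m n I a b (fun t => -(deriv a t / a t)) (fun t => -(deriv b t / b t)) where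
  isOpen := hv.isOpen
  ordConnected := hv.ordConnected
  nonempty := hv.nonempty
  a_pos := hv.a_pos
  b_pos := hv.b_pos
  a_deriv t ht := by
    have ha := (hv.a_pos t ht).ne'
    refine (ContDiffOn.hasDerivAt_deriv_deriv hv.isOpen hv.a_reg ht).1.congr_deriv ?_
    field_simp
  b_deriv t ht := by
    have hb := (hv.b_pos t ht).ne'
    refine (ContDiffOn.hasDerivAt_deriv_deriv hv.isOpen hv.b_reg ht).1.congr_deriv ?_
    field_simp
  p_deriv t ht := by
    have ha := (hv.a_pos t ht).ne'
    have hb := (hv.b_pos t ht).ne'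
    obtain ⟨h1, h2⟩ := ContDiffOn.hasDerivAt_deriv_deriv hv.isOpen hv.a_reg ht
    obtain ⟨-, e2, -⟩ := hv.field_equations hm hn hg hh ht
    refine (h2.fun_div h1 ha).fun_neg.congr_deriv ?_
    field_simp at e2 ⊢
    linear_combination -e2
  q_deriv t ht := by
    have ha := (hv.a_pos t ht).ne'
    have hb := (hv.b_pos t ht).ne'
    obtain ⟨h1, h2⟩ := ContDiffOn.hasDerivAt_deriv_deriv hv.isOpen hv.b_reg ht
    obtain ⟨-, -, e3⟩ := hv.field_equations hm hn hg hh ht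
    refine (h2.fun_div h1 hb).fun_neg.congr_deriv ?_
    field_simp at e3 ⊢
    linear_combination -e3
  constraint t ht := by
    have ha := (hv.a_pos t ht).ne'
    have hb := (hv.b_pos t ht).ne'
    obtain ⟨e1, e2, e3⟩ := hv.field_equations hm hn hg hh ht
    field_simp at e1 e2 e3 ⊢
    -- The trace of the spatial equations minus the time equation eliminates the second derivatives.
    linear_combination m * b t * e2 + n * a t * e3 - a t * b t * e1

lemma ScaleODE.contDiffOn_of_deriv {I : Set ℝ} (hI : IsOpen I) {f f₁ f₂ : ℝ → ℝ}
    (h1 : ∀ t ∈ I, HasDerivAt f (f₁ t) t) (h2 : ∀ t ∈ I, HasDerivAt f₁ (f₂ t) t)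
    (h3 : ContinuousOn f₂ I) : ContDiffOn ℝ 2 f I := by
  have key : ∀ {f f₁ : ℝ → ℝ} {k : ℕ}, (∀ t ∈ I, HasDerivAt f (f₁ t) t) → ContDiffOn ℝ k f₁ I →
      ContDiffOn ℝ (k + 1) f I := by
    intro f f₁ k hf hc
    rw [contDiffOn_succ_iff_deriv_of_isOpen hI]
    refine ⟨fun t ht => (hf t ht).differentiableAt.differentiableWithinAt, by simp, ?_⟩
    exact hc.congr fun t ht => (hf t ht).deriv
  have h4 : ContDiffOn ℝ (1 : ℕ) f₁ I := by
    have := key (k := 0) h2 (by simpa using h3)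
    simpa using this
  simpa [one_add_one_eq_two] using key (k := 1) h1 h4

/-- This converse makes maximality usable: a solution reconstructed from an orbit must be admissible
as an extension of the given one. -/
lemma ScaleODE.isVacuum {p q : ℝ → ℝ}
    (hg : IsEinstein (-((m : ℝ) + n - 1)) g) (hh : IsEinstein (-((m : ℝ) + n - 1)) h)
    (hs : ScaleODE m n I a b p q) : IsVacuum g h I a b := by
  have ca : ContinuousOn a I := fun t ht => (hs.a_deriv t ht).continuousAt.continuousWithinAt
  have cb : ContinuousOn b I := fun t ht => (hs.b_deriv t ht).continuousAt.continuousWithinAt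
  have cp : ContinuousOn p I := fun t ht => (hs.p_deriv t ht).continuousAt.continuousWithinAt
  have cq : ContinuousOn q I := fun t ht => (hs.q_deriv t ht).continuousAt.continuousWithinAt
  have ha2 := fun t ht => ((hs.a_deriv t ht).fun_mul (hs.p_deriv t ht)).fun_neg
  have hb2 := fun t ht => ((hs.b_deriv t ht).fun_mul (hs.q_deriv t ht)).fun_neg
  have na : ∀ t ∈ I, a t ^ 2 ≠ 0 := fun t ht => pow_ne_zero 2 (hs.a_pos t ht).ne'
  have nb : ∀ t ∈ I, b t ^ 2 ≠ 0 := fun t ht => pow_ne_zero 2 (hs.b_pos t ht).ne'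
  refine ⟨hs.isOpen, hs.ordConnected, hs.nonempty, hs.a_pos, hs.b_pos,
    ScaleODE.contDiffOn_of_deriv hs.isOpen hs.a_deriv ha2 ?_,
    ScaleODE.contDiffOn_of_deriv hs.isOpen hs.b_deriv hb2 ?_, ?_⟩
  · exact ((((ca.mul cp).neg).mul cp).add (ca.mul ((cp.mul ((continuousOn_const.mul cp).add
      (continuousOn_const.mul cq))).sub (continuousOn_const.div (ca.pow 2) na)))).neg
  · exact ((((cb.mul cq).neg).mul cq).add (cb.mul ((cq.mul ((continuousOn_const.mul cp).add
      (continuousOn_const.mul cq))).sub (continuousOn_const.div (cb.pow 2) nb)))).neg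
  · intro P Q z ht hx hy
    have D : WarpedData I a _ _ b _ _ (extChartAt 𝓘(ℝ, Fin m → ℝ) P).target (metricComp g P)
        (extChartAt 𝓘(ℝ, Fin n → ℝ) Q).target (metricComp h Q) :=
      ⟨hs.isOpen, fun t ht => (hs.a_pos t ht).ne', fun t ht => (hs.b_pos t ht).ne',
        hs.a_deriv, ha2, hs.b_deriv, hb2, isMetricOn_metricComp g P, isMetricOn_metricComp h Q⟩
    rw [D.ricci_warpedMetric ht hx hy, hg P _ hx, hh Q _ hy]
    have ha := (hs.a_pos _ ht).ne'
    have hb := (hs.b_pos _ ht).ne'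
    have hc := hs.constraint _ ht
    rw [← add_smul, ← add_smul]
    have e1 : ∀ x y w : ℝ, x = 0 → y = 0 → w = 0 → Matrix.fromBlocks (x • (1 : Matrix Unit Unit ℝ)) 0 0
        (Matrix.fromBlocks (y • metricComp g P (xCoord z)) 0 0
          (w • metricComp h Q (yCoord z))) = 0 := by
      rintro x y w rfl rfl rfl
      simp
    refine e1 _ _ _ ?_ ?_ ?_
    -- Modulo the evolution equations the time component is the constraint; the blocks of the
    -- factors need the evolution equations only.
    · field_simp at hc ⊢
      linear_combination hc
    · field_simp
      ring
    · field_simp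
      ring

end ScaleFactors
end WarpedVacuum
end

/-! ### The planar system: symmetry, uniqueness and global existence. -/

noncomputable section
namespace WarpedVacuum
section Oscillator
open Real

lemma hasDerivAt_tanh (x : ℝ) : HasDerivAt tanh (1 - tanh x ^ 2) x := by
  have h : HasDerivAt (fun x => sinh x / cosh x) _ x :=
    (Real.hasDerivAt_sinh x).fun_div (Real.hasDerivAt_cosh x) (Real.cosh_pos x).ne'
  have e : tanh = fun x => sinh x / cosh x := funext Real.tanh_eq_sinh_div_cosh
  rw [e]
  refine h.congr_deriv ?_
  have := (Real.cosh_pos x).ne'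
  field_simp

lemma strictMono_tanh : StrictMono tanh :=
  strictMono_of_hasDerivAt_pos hasDerivAt_tanh fun x => by linarith [tanh_sq_lt_one x]

lemma continuous_tanh : Continuous tanh :=
  continuous_iff_continuousAt.2 fun x => (hasDerivAt_tanh x).continuousAt

lemma contDiff_tanh : ContDiff ℝ 1 tanh := by
  rw [contDiff_one_iff_deriv]
  refine ⟨fun x => (hasDerivAt_tanh x).differentiableAt, ?_⟩
  have : deriv tanh = fun x => 1 - tanh x ^ 2 := funext fun x => (hasDerivAt_tanh x).deriv
  rw [this]
  exact continuous_const.sub (continuous_tanh.pow 2)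

/-- A planar system `w' = V tanh θ`, `θ' = κ (tanh θ - g w)` with an increasing bounded `g`. -/
structure Osc where
  V : ℝ
  κ : ℝ
  γ₁ : ℝ
  γ₂ : ℝ
  g : ℝ → ℝ
  g' : ℝ → ℝ
  U : ℝ → ℝ
  V_pos : 0 < V
  κ_pos : 0 < κ
  γ₁_pos : 0 < γ₁
  γ₂_pos : 0 < γ₂
  γ₁_lt : γ₁ < 1
  γ₂_lt : γ₂ < 1
  g_deriv : ∀ w, HasDerivAt g (g' w) w
  g'_pos : ∀ w, 0 < g' w
  g'_bdd : ∃ L, ∀ w, g' w ≤ L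
  g'_cont : Continuous g'
  g_zero : g 0 = 0
  g_bot : Tendsto g atBot (𝓝 (-γ₁))
  g_top : Tendsto g atTop (𝓝 γ₂)
  g'_bot : Tendsto g' atBot (𝓝 0)
  g'_top : Tendsto g' atTop (𝓝 0)
  U_deriv : ∀ w, HasDerivAt U (2 * κ / V * g w) w
  U_zero : U 0 = 0
  U_bot : Tendsto U atBot atTop
  U_top : Tendsto U atTop atTop

namespace Osc
variable (O : Osc)

lemma g_strictMono : StrictMono O.g := strictMono_of_hasDerivAt_pos O.g_deriv O.g'_pos

lemma neg_γ₁_lt (w : ℝ) : -O.γ₁ < O.g w :=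
  lt_of_le_of_lt (O.g_strictMono.monotone.le_of_tendsto O.g_bot (w - 1))
    (O.g_strictMono (by linarith))

lemma lt_γ₂ (w : ℝ) : O.g w < O.γ₂ :=
  lt_of_lt_of_le (O.g_strictMono (by linarith : w < w + 1))
    (O.g_strictMono.monotone.ge_of_tendsto O.g_top (w + 1))

lemma g_pos {w : ℝ} (hw : 0 < w) : 0 < O.g w := O.g_zero ▸ O.g_strictMono hw

lemma g_neg {w : ℝ} (hw : w < 0) : O.g w < 0 := O.g_zero ▸ O.g_strictMono hw

/-- The derivative of `U` has the sign of `g`, hence of `w`, so `U` has its strict minimum at the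
origin. -/
lemma U_pos {w : ℝ} (hw : w ≠ 0) : 0 < O.U w := by
  have hc : 0 < 2 * O.κ / O.V := by have := O.V_pos; have := O.κ_pos; positivity
  have hU : Continuous O.U := continuous_iff_continuousAt.2 fun x => (O.U_deriv x).continuousAt
  rcases lt_or_gt_of_ne hw with h | h
  · have : StrictAntiOn O.U (Set.Iic 0) := by
      refine strictAntiOn_of_deriv_neg (convex_Iic 0) hU.continuousOn fun x hx => ?_
      rw [(O.U_deriv x).deriv]
      rw [interior_Iic] at hx
      exact mul_neg_of_pos_of_neg hc (O.g_neg hx)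
    have := this (Set.mem_Iic.2 h.le) (Set.mem_Iic.2 le_rfl) h
    rwa [O.U_zero] at this
  · have : StrictMonoOn O.U (Set.Ici 0) := by
      refine strictMonoOn_of_deriv_pos (convex_Ici 0) hU.continuousOn fun x hx => ?_
      rw [(O.U_deriv x).deriv]
      rw [interior_Ici] at hx
      exact mul_pos hc (O.g_pos hx)
    have := this (Set.mem_Ici.2 le_rfl) (Set.mem_Ici.2 h.le) h
    rwa [O.U_zero] at this

lemma U_nonneg (w : ℝ) : 0 ≤ O.U w := by
  rcases eq_or_ne w 0 with rfl | h
  · exact O.U_zero.ge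
  · exact (O.U_pos h).le

/-- The system obtained by the reflection `w ↦ -w`, `θ ↦ -θ`. -/
def reflect : Osc where
  V := O.V
  κ := O.κ
  γ₁ := O.γ₂
  γ₂ := O.γ₁
  g w := -O.g (-w)
  g' w := O.g' (-w)
  U w := O.U (-w)
  V_pos := O.V_pos
  κ_pos := O.κ_pos
  γ₁_pos := O.γ₂_pos
  γ₂_pos := O.γ₁_pos
  γ₁_lt := O.γ₂_lt
  γ₂_lt := O.γ₁_lt
  g_deriv w := by
    simpa using ((O.g_deriv (-w)).scomp w (hasDerivAt_neg w)).fun_neg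
  g'_pos w := O.g'_pos _
  g'_bdd := O.g'_bdd.imp fun L h w => h _
  g'_cont := O.g'_cont.comp continuous_neg
  g_zero := by simp [O.g_zero]
  g_bot := (O.g_top.comp tendsto_neg_atBot_atTop).neg
  g_top := by simpa using (O.g_bot.comp tendsto_neg_atTop_atBot).neg
  g'_bot := O.g'_top.comp tendsto_neg_atBot_atTop
  g'_top := O.g'_bot.comp tendsto_neg_atTop_atBot
  U_deriv w := ((O.U_deriv (-w)).scomp w (hasDerivAt_neg w)).congr_deriv (by simp)
  U_zero := by simp [O.U_zero]
  U_bot := O.U_top.comp tendsto_neg_atBot_atTop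
  U_top := O.U_bot.comp tendsto_neg_atTop_atBot

/-- Solutions of the planar system, defined for all times. -/
structure IsOrbit (w θ : ℝ → ℝ) : Prop where
  dw : ∀ t, HasDerivAt w (O.V * tanh (θ t)) t
  dθ : ∀ t, HasDerivAt θ (O.κ * (tanh (θ t) - O.g (w t))) t

variable {O} {w θ w₁ θ₁ w₂ θ₂ : ℝ → ℝ}

lemma IsOrbit.reflect (h : O.IsOrbit w θ) :
    O.reflect.IsOrbit (fun t => -w t) (fun t => -θ t) where
  dw t := by simpa [Osc.reflect] using (h.dw t).fun_neg
  dθ t := by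
    refine (h.dθ t).fun_neg.congr_deriv ?_
    simp [Osc.reflect]; ring

lemma IsOrbit.shift (h : O.IsOrbit w θ) (c : ℝ) :
    O.IsOrbit (fun t => w (t + c)) (fun t => θ (t + c)) where
  dw t := (h.dw (t + c)).comp_add_const t c
  dθ t := (h.dθ (t + c)).comp_add_const t c

lemma IsOrbit.continuous_w (h : O.IsOrbit w θ) : Continuous w :=
  continuous_iff_continuousAt.2 fun t => (h.dw t).continuousAt

lemma IsOrbit.continuous_θ (h : O.IsOrbit w θ) : Continuous θ :=
  continuous_iff_continuousAt.2 fun t => (h.dθ t).continuousAt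

variable (O)

/-- The vector field of the planar system. -/
def vf (X : ℝ × ℝ) : ℝ × ℝ := (O.V * tanh X.2, O.κ * (tanh X.2 - O.g X.1))

variable {O}

lemma isOrbit_iff : O.IsOrbit w θ ↔ ∀ t, HasDerivAt (fun t => (w t, θ t)) (O.vf (w t, θ t)) t := by
  refine ⟨fun h t => (h.dw t).prodMk (h.dθ t), fun h => ⟨fun t => ?_, fun t => ?_⟩⟩
  · exact (h t).fst
  · exact (h t).snd

lemma abs_tanh_sub_le (x y : ℝ) : |tanh x - tanh y| ≤ |x - y| := by
  have := Convex.norm_image_sub_le_of_norm_hasDerivWithin_le (f := tanh) (s := Set.univ)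
    (C := 1) (fun x _ => (hasDerivAt_tanh x).hasDerivWithinAt) (fun x _ => by
      rw [Real.norm_eq_abs, abs_le]; constructor <;> nlinarith [tanh_sq_lt_one x, sq_nonneg (tanh x)])
    convex_univ (Set.mem_univ y) (Set.mem_univ x)
  simpa using this

lemma abs_g_sub_le {s : Set ℝ} (hs : Convex ℝ s) {L : ℝ} (hL : ∀ w ∈ s, O.g' w ≤ L) {x y : ℝ}
    (hx : x ∈ s) (hy : y ∈ s) : |O.g x - O.g y| ≤ L * |x - y| := by
  have := Convex.norm_image_sub_le_of_norm_hasDerivWithin_le (f := O.g) (s := s)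
    (C := L) (fun x _ => (O.g_deriv x).hasDerivWithinAt) (fun x hx => by
      rw [Real.norm_eq_abs, abs_of_pos (O.g'_pos x)]; exact hL x hx) hs hy hx
  simpa using this

/-- The global Lipschitz bound serves uniqueness, continuous dependence and completeness alike. -/
lemma exists_lipschitzWith_vf : ∃ L, LipschitzWith L O.vf := by
  obtain ⟨L, hL⟩ := O.g'_bdd
  have hL0 : 0 < L := (O.g'_pos 0).trans_le (hL 0)
  have hV := O.V_pos
  have hκ := O.κ_pos
  refine ⟨⟨O.V + O.κ * (1 + L), by positivity⟩, LipschitzWith.of_dist_le_mul fun X Y => ?_⟩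
  have h1 : |X.1 - Y.1| ≤ dist X Y := by rw [Prod.dist_eq, ← Real.dist_eq]; exact le_max_left _ _
  have h2 : |X.2 - Y.2| ≤ dist X Y := by rw [Prod.dist_eq, ← Real.dist_eq]; exact le_max_right _ _
  have h3 := abs_tanh_sub_le X.2 Y.2
  have h4 := abs_g_sub_le (O := O) convex_univ (fun w _ => hL w) (Set.mem_univ X.1)
    (Set.mem_univ Y.1)
  have hd : 0 ≤ dist X Y := dist_nonneg
  rw [Prod.dist_eq (x := O.vf X)]
  simp only [vf, Real.dist_eq]
  change _ ≤ (O.V + O.κ * (1 + L)) * _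
  refine max_le ?_ ?_
  · rw [← mul_sub, abs_mul, abs_of_pos hV]
    have : O.V * |tanh X.2 - tanh Y.2| ≤ O.V * dist X Y := by gcongr; exact h3.trans h2
    nlinarith [mul_nonneg (mul_nonneg hκ.le (by positivity : 0 ≤ 1 + L)) hd]
  · rw [← mul_sub, abs_mul, abs_of_pos hκ]
    have h5 : |tanh X.2 - O.g X.1 - (tanh Y.2 - O.g Y.1)| ≤ (1 + L) * dist X Y := by
      calc _ = |(tanh X.2 - tanh Y.2) - (O.g X.1 - O.g Y.1)| := by ring_nf
        _ ≤ |tanh X.2 - tanh Y.2| + |O.g X.1 - O.g Y.1| := abs_sub _ _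
        _ ≤ dist X Y + L * dist X Y := by
          gcongr
          · exact h3.trans h2
          · exact h4.trans (by gcongr)
        _ = _ := by ring
    have : O.κ * |tanh X.2 - O.g X.1 - (tanh Y.2 - O.g Y.1)| ≤ O.κ * ((1 + L) * dist X Y) := by
      gcongr
    nlinarith [mul_nonneg hV.le hd]

lemma contDiff_vf : ContDiff ℝ 1 O.vf := by
  have hg : ContDiff ℝ 1 O.g := by
    rw [contDiff_one_iff_deriv]
    refine ⟨fun x => (O.g_deriv x).differentiableAt, ?_⟩
    rw [show deriv O.g = O.g' from funext fun x => (O.g_deriv x).deriv]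
    exact O.g'_cont
  exact (contDiff_const.mul (contDiff_tanh.comp contDiff_snd)).prodMk
    (contDiff_const.mul ((contDiff_tanh.comp contDiff_snd).sub (hg.comp contDiff_fst)))

lemma IsOrbit.unique (h₁ : O.IsOrbit w₁ θ₁) (h₂ : O.IsOrbit w₂ θ₂) {t₀ : ℝ}
    (hw : w₁ t₀ = w₂ t₀) (hθ : θ₁ t₀ = θ₂ t₀) : w₁ = w₂ ∧ θ₁ = θ₂ := by
  obtain ⟨L, hL⟩ := O.exists_lipschitzWith_vf
  have := ODE_solution_unique_univ (v := fun _ => O.vf) (s := fun _ => Set.univ) (K := L)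
    (fun _ => hL.lipschitzOnWith) (fun t => ⟨isOrbit_iff.1 h₁ t, Set.mem_univ _⟩)
    (fun t => ⟨isOrbit_iff.1 h₂ t, Set.mem_univ _⟩) (t₀ := t₀) (by simp [hw, hθ])
  exact ⟨funext fun t => congrArg Prod.fst (congrFun this t),
    funext fun t => congrArg Prod.snd (congrFun this t)⟩

lemma isOrbit_zero : O.IsOrbit (fun _ => 0) (fun _ => 0) where
  dw t := by simpa using hasDerivAt_const t (0 : ℝ)
  dθ t := by simpa [O.g_zero] using hasDerivAt_const t (0 : ℝ)

lemma IsOrbit.ne_zero (h : O.IsOrbit w θ) {t₀ : ℝ} (h0 : (w t₀, θ t₀) ≠ 0) (t : ℝ) :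
    (w t, θ t) ≠ 0 := by
  intro h1
  obtain ⟨h2, h3⟩ := Prod.mk_eq_zero.1 h1
  obtain ⟨rfl, rfl⟩ := h.unique isOrbit_zero h2 h3
  exact h0 rfl

lemma IsOrbit.dist_le (h₁ : O.IsOrbit w₁ θ₁) (h₂ : O.IsOrbit w₂ θ₂) {L : NNReal}
    (hL : LipschitzWith L O.vf) {t : ℝ} (ht : 0 ≤ t) :
    dist (w₁ t, θ₁ t) (w₂ t, θ₂ t) ≤ dist (w₁ 0, θ₁ 0) (w₂ 0, θ₂ 0) * exp (L * t) := by
  have := dist_le_of_trajectories_ODE (v := fun _ => O.vf) (K := L) (fun _ => hL)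
    (f := fun t => (w₁ t, θ₁ t)) (g := fun t => (w₂ t, θ₂ t)) (a := 0) (b := t)
    (fun s _ => (isOrbit_iff.1 h₁ s).continuousAt.continuousWithinAt)
    (fun s _ => (isOrbit_iff.1 h₁ s).hasDerivWithinAt)
    (fun s _ => (isOrbit_iff.1 h₂ s).continuousAt.continuousWithinAt)
    (fun s _ => (isOrbit_iff.1 h₂ s).hasDerivWithinAt) le_rfl t ⟨ht, le_rfl⟩
  simpa using this

lemma exists_isOrbit (O : Osc) (x y : ℝ) : ∃ w θ, O.IsOrbit w θ ∧ w 0 = x ∧ θ 0 = y := by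
  obtain ⟨L, hL⟩ := O.exists_lipschitzWith_vf
  have hv : ContMDiff 𝓘(ℝ, ℝ × ℝ) (𝓘(ℝ, ℝ × ℝ).prod 𝓘(ℝ, ℝ × ℝ)) 1
      (fun X : ℝ × ℝ => (⟨X, O.vf X⟩ : TangentBundle 𝓘(ℝ, ℝ × ℝ) (ℝ × ℝ))) :=
    contMDiff_vectorSpace_iff_contDiff.2 contDiff_vf
  -- On the ball of radius `‖O.vf X‖ + 1` about `X` the field is at most `1 + L` times that radius.
  -- So Picard-Lindelöf works on a time interval whose length does not depend on `X`, and the local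
  -- solutions continue to all times.
  set ε : ℝ := 1 / (L + 1) with hε
  have hL1 : (0 : ℝ) < L + 1 := by positivity
  have hε0 : 0 < ε := by positivity
  have key : ∀ X : ℝ × ℝ, ∃ γ : ℝ → ℝ × ℝ, γ 0 = X ∧
      IsMIntegralCurveOn (I := 𝓘(ℝ, ℝ × ℝ)) γ O.vf (Set.Ioo (-ε) ε) := by
    intro X
    set A : NNReal := ⟨‖O.vf X‖ + 1, by positivity⟩ with hA
    have hpl : IsPicardLindelof (fun _ => O.vf) (tmin := -ε) (tmax := ε) ⟨0, by simp [hε0.le]⟩ X A 0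
        ((1 + L) * A) L := by
      refine IsPicardLindelof.of_time_independent (fun Y hY => ?_) hL.lipschitzOnWith ?_
      · have h1 := hL.dist_le_mul Y X
        rw [dist_eq_norm] at h1
        have h2 : dist Y X ≤ A := hY
        have h3 : ‖O.vf Y‖ ≤ ‖O.vf X‖ + ‖O.vf Y - O.vf X‖ := norm_le_norm_add_norm_sub' _ _
        have h4 : (L : ℝ) * dist Y X ≤ L * A := by gcongr
        have h5 : (A : ℝ) = ‖O.vf X‖ + 1 := rfl
        push_cast
        nlinarith
      · have : ((1 + L) * A : ℝ) * ε = A := by rw [hε]; field_simp; ring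
        simp [this]
    obtain ⟨α, hα0, hα⟩ := hpl.exists_eq_forall_mem_Icc_hasDerivWithinAt₀
    refine ⟨α, hα0, ?_⟩
    intro t ht
    have := ((hα t (Set.Ioo_subset_Icc_self ht)).mono Set.Ioo_subset_Icc_self)
    exact this.hasFDerivWithinAt.hasMFDerivWithinAt
  obtain ⟨γ, h0, hγ⟩ := exists_isMIntegralCurve_of_isMIntegralCurveOn hv hε0 key (x, y)
  refine ⟨fun t => (γ t).1, fun t => (γ t).2, isOrbit_iff.2 fun t => ?_, by simp [h0],
      by simp [h0]⟩
  have h : HasFDerivAt γ ((1 : ℝ →L[ℝ] ℝ).smulRight (O.vf (γ t))) t := (hγ t).hasFDerivAt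
  simpa using h.hasDerivAt

end Osc
end Oscillator
end WarpedVacuum
end

/-! ### The energy, and the possible fates of an orbit. -/

noncomputable section
namespace WarpedVacuum
section OscillatorDynamics
open Real

lemma le_of_hasDerivAt_nonneg {f f' : ℝ → ℝ} {t₀ : ℝ} (hf : ∀ t ≥ t₀, HasDerivAt f (f' t) t)
    (h0 : ∀ t ≥ t₀, 0 ≤ f' t) : ∀ t ≥ t₀, f t₀ ≤ f t := by
  have : MonotoneOn f (Set.Ici t₀) := by
    refine monotoneOn_of_hasDerivWithinAt_nonneg (convex_Ici t₀)
      (fun t ht => (hf t ht).continuousAt.continuousWithinAt)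
      (f' := f') (fun t ht => (hf t (interior_subset ht)).hasDerivWithinAt)
      (fun t ht => h0 t (interior_subset ht))
  exact fun t ht => this (Set.mem_Ici.2 le_rfl) ht ht

lemma add_mul_le_of_le_hasDerivAt {f f' : ℝ → ℝ} {t₀ δ : ℝ}
    (hf : ∀ t ≥ t₀, HasDerivAt f (f' t) t) (h0 : ∀ t ≥ t₀, δ ≤ f' t) :
    ∀ t ≥ t₀, f t₀ + δ * (t - t₀) ≤ f t := by
  intro t ht
  have := le_of_hasDerivAt_nonneg (f := fun t => f t - δ * (t - t₀)) (f' := fun t => f' t - δ)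
    (t₀ := t₀) (fun t ht => by
      simpa using (hf t ht).fun_sub (((hasDerivAt_id t).sub_const t₀).const_mul δ))
    (fun t ht => sub_nonneg.2 (h0 t ht)) t ht
  simp at this
  linarith

/-- A function that increases whenever it meets a level cannot cross that level downwards; all
trapping arguments below rest on this. -/
lemma le_of_barrier {f f' : ℝ → ℝ} {t₀ c : ℝ} (hf : ∀ t, HasDerivAt f (f' t) t) (h0 : c ≤ f t₀)
    (h : ∀ t ≥ t₀, f t = c → 0 < f' t) : ∀ t ≥ t₀, c ≤ f t := by
  intro t ht
  exact image_le_of_deriv_right_lt_deriv_boundary (f := fun _ => c) (f' := fun _ => 0) (a := t₀)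
    (b := t) continuousOn_const (fun x _ => hasDerivWithinAt_const _ _ _) h0 hf
    (fun x hx hc => h x hx.1 hc.symm) ⟨ht, le_rfl⟩

/-- Barbalat's lemma. -/
lemma tendsto_zero_of_lipschitz_deriv {G f : ℝ → ℝ} {L l : ℝ} (hG : ∀ t, HasDerivAt G (f t) t)
    (hL : ∀ s t, |f s - f t| ≤ L * |s - t|) (hl : Tendsto G atTop (𝓝 l)) :
    Tendsto f atTop (𝓝 0) := by
  have hL0 : 0 ≤ L := by have := (abs_nonneg _).trans (hL 1 0); simpa using this
  rw [Metric.tendsto_nhds]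
  intro ε hε
  -- On a window of this length `f` varies by at most `ε / 2`, while its mean over the window is a
  -- difference quotient of `G` and tends to zero.
  set δ := ε / (2 * (L + 1)) with hδ
  have hδ0 : 0 < δ := by positivity
  have hLδ : L * δ ≤ ε / 2 := by
    have : (L + 1) * δ = ε / 2 := by rw [hδ]; field_simp
    nlinarith
  have h1 : Tendsto (fun t => (G (t + δ) - G t) / δ) atTop (𝓝 0) := by
    have := ((hl.comp (tendsto_atTop_add_const_right atTop δ tendsto_id)).sub hl).div_const δ
    simpa using this
  filter_upwards [(Metric.tendsto_nhds.1 h1) (ε / 2) (by positivity)] with t ht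
  obtain ⟨c, ⟨hc1, hc2⟩, hc⟩ := exists_hasDerivAt_eq_slope G f (show t < t + δ by linarith)
    (fun x _ => (hG x).continuousAt.continuousWithinAt) (fun x _ => hG x)
  simp only [add_sub_cancel_left] at hc
  rw [Real.dist_0_eq_abs, ← hc] at ht
  rw [Real.dist_0_eq_abs]
  have h2 := hL t c
  have h3 : |t - c| ≤ δ := by rw [abs_le]; constructor <;> linarith
  have h4 : L * |t - c| ≤ L * δ := by gcongr
  have h5 : |f t| ≤ |f c| + |f t - f c| := by
    have := abs_add_le (f c) (f t - f c); simpa using this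
  linarith

lemma tendsto_of_strictMono_comp {α : Type*} {l : Filter α} {h : ℝ → ℝ} (hm : StrictMono h)
    {f : α → ℝ} {a : ℝ} (hf : Tendsto (fun x => h (f x)) l (𝓝 (h a))) : Tendsto f l (𝓝 a) := by
  rw [tendsto_order] at hf ⊢
  refine ⟨fun b hb => ?_, fun b hb => ?_⟩
  · filter_upwards [hf.1 _ (hm hb)] with x hx using hm.lt_iff_lt.1 hx
  · filter_upwards [hf.2 _ (hm hb)] with x hx using hm.lt_iff_lt.1 hx

namespace Osc
variable {O : Osc} {w θ : ℝ → ℝ}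

variable (O) in
/-- The energy of the planar system. -/
def energy (x y : ℝ) : ℝ := O.U x + 2 * log (cosh y)

lemma log_cosh_nonneg (y : ℝ) : 0 ≤ log (cosh y) := log_nonneg (one_le_cosh y)

lemma log_cosh_pos {y : ℝ} (hy : y ≠ 0) : 0 < log (cosh y) := log_pos (one_lt_cosh.2 hy)

lemma energy_nonneg (x y : ℝ) : 0 ≤ O.energy x y := by
  have := O.U_nonneg x; have := log_cosh_nonneg y; unfold energy; positivity

lemma energy_pos {x y : ℝ} (h : (x, y) ≠ 0) : 0 < O.energy x y := by
  have h1 := O.U_nonneg x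
  have h2 := log_cosh_nonneg y
  unfold energy
  by_cases hx : x = 0
  · have hy : y ≠ 0 := by rintro rfl; exact h (by simp [hx])
    have := log_cosh_pos hy
    positivity
  · have := O.U_pos hx
    positivity

lemma continuous_energy {α : Type*} {l : Filter α} {x y : α → ℝ} (hx : Tendsto x l (𝓝 0))
    (hy : Tendsto y l (𝓝 0)) : Tendsto (fun t => O.energy (x t) (y t)) l (𝓝 0) := by
  have h1 : Tendsto (fun t => O.U (x t)) l (𝓝 (O.U 0)) :=
    (O.U_deriv 0).continuousAt.tendsto.comp hx
  have h2 : Tendsto (fun t => log (cosh (y t))) l (𝓝 (log (cosh 0))) :=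
    ((continuous_cosh.continuousAt (x := (0 : ℝ))).log (by simp)).tendsto.comp hy
  simpa [energy, O.U_zero] using h1.add (h2.const_mul 2)

lemma hasDerivAt_log_cosh (y : ℝ) : HasDerivAt (fun y => log (cosh y)) (tanh y) y := by
  refine ((Real.hasDerivAt_cosh y).log (cosh_pos y).ne').congr_deriv ?_
  rw [tanh_eq_sinh_div_cosh]

/-- The potential is normalized so that the two terms containing `g` cancel. -/
lemma IsOrbit.energy_deriv (h : O.IsOrbit w θ) (t : ℝ) :
    HasDerivAt (fun t => O.energy (w t) (θ t)) (2 * O.κ * tanh (θ t) ^ 2) t := by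
  have h1 := (O.U_deriv (w t)).comp t (h.dw t)
  have h2 := ((hasDerivAt_log_cosh (θ t)).comp t (h.dθ t)).const_mul 2
  refine (h1.add h2).congr_deriv ?_
  have := O.V_pos.ne'
  field_simp
  ring

lemma IsOrbit.energy_monotone (h : O.IsOrbit w θ) :
    Monotone fun t => O.energy (w t) (θ t) :=
  monotone_of_hasDerivAt_nonneg h.energy_deriv fun t => by
    have := O.κ_pos
    positivity

lemma abs_tanh_sub_g_le (x y : ℝ) : |tanh y - O.g x| ≤ 2 := by
  have h1 := abs_lt.1 (abs_tanh_lt_one y)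
  have h2 := O.neg_γ₁_lt x
  have h3 := O.lt_γ₂ x
  have h4 := O.γ₁_lt
  have h5 := O.γ₂_lt
  rw [abs_le]; constructor <;> linarith

lemma abs_sub_le_of_hasDerivAt {f f' : ℝ → ℝ} {C : ℝ} (hf : ∀ t, HasDerivAt f (f' t) t)
    (hC : ∀ t, |f' t| ≤ C) (s t : ℝ) : |f s - f t| ≤ C * |s - t| := by
  have := Convex.norm_image_sub_le_of_norm_hasDerivWithin_le (f := f) (s := Set.univ)
    (C := C) (fun x _ => (hf x).hasDerivWithinAt) (fun x _ => hC x)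
    convex_univ (Set.mem_univ t) (Set.mem_univ s)
  simpa using this

/-- A curve which follows the flow forwards (`σ = 1`) or backwards (`σ = -1`) and along which the
energy converges, converges to the origin. -/
lemma tendsto_zero_of_energy {σ l : ℝ} (hσ : σ = 1 ∨ σ = -1)
    (dw : ∀ t, HasDerivAt w (σ * (O.V * tanh (θ t))) t)
    (dθ : ∀ t, HasDerivAt θ (σ * (O.κ * (tanh (θ t) - O.g (w t)))) t)
    (dE : ∀ t, HasDerivAt (fun t => O.energy (w t) (θ t)) (σ * (2 * O.κ * tanh (θ t) ^ 2)) t)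
    (hE : Tendsto (fun t => O.energy (w t) (θ t)) atTop (𝓝 l)) :
    Tendsto w atTop (𝓝 0) ∧ Tendsto θ atTop (𝓝 0) := by
  have hκ := O.κ_pos
  have hV := O.V_pos
  have hσ1 : |σ| = 1 := by rcases hσ with rfl | rfl <;> simp
  have hσ2 : σ * σ = 1 := by rcases hσ with rfl | rfl <;> simp
  have lθ := abs_sub_le_of_hasDerivAt dθ (C := 2 * O.κ) fun t => by
    rw [abs_mul, hσ1, one_mul, abs_mul, abs_of_pos hκ]
    nlinarith [O.abs_tanh_sub_g_le (w t) (θ t)]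
  have lw := abs_sub_le_of_hasDerivAt dw (C := O.V) fun t => by
    rw [abs_mul, hσ1, one_mul, abs_mul, abs_of_pos hV]
    nlinarith [abs_tanh_lt_one (θ t)]
  -- Barbalat's lemma is used twice. Applied to the energy it gives `θ → 0`; applied to `θ` it then
  -- gives `tanh θ - g w → 0`, hence `g w → 0`.
  have h1 : Tendsto (fun t => tanh (θ t) ^ 2) atTop (𝓝 0) := by
    refine tendsto_zero_of_lipschitz_deriv (G := fun t => σ / (2 * O.κ) * O.energy (w t) (θ t))
      (L := 4 * O.κ) (fun t => ?_) (fun s t => ?_) (hE.const_mul _)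
    · refine ((dE t).const_mul _).congr_deriv ?_
      field_simp
      rw [pow_two, hσ2, one_mul]
    · have e : tanh (θ s) ^ 2 - tanh (θ t) ^ 2 =
          (tanh (θ s) + tanh (θ t)) * (tanh (θ s) - tanh (θ t)) := by ring
      rw [e, abs_mul]
      have a1 : |tanh (θ s) + tanh (θ t)| ≤ 2 := by
        have := abs_add_le (tanh (θ s)) (tanh (θ t))
        linarith [abs_tanh_lt_one (θ s), abs_tanh_lt_one (θ t)]
      have a2 := (abs_tanh_sub_le (θ s) (θ t)).trans (lθ s t)
      calc _ ≤ 2 * (2 * O.κ * |s - t|) := by gcongr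
        _ = _ := by ring
  have h2 : Tendsto (fun t => tanh (θ t)) atTop (𝓝 0) := by
    rw [tendsto_zero_iff_abs_tendsto_zero]
    have := h1.sqrt
    simpa [Function.comp_def, sqrt_sq_eq_abs] using this
  have h3 : Tendsto θ atTop (𝓝 0) :=
    tendsto_of_strictMono_comp strictMono_tanh (by simpa using h2)
  refine ⟨?_, h3⟩
  obtain ⟨L, hL⟩ := O.g'_bdd
  have hL0 : 0 < L := (O.g'_pos 0).trans_le (hL 0)
  have h4 : Tendsto (fun t => tanh (θ t) - O.g (w t)) atTop (𝓝 0) := by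
    refine tendsto_zero_of_lipschitz_deriv (G := fun t => σ / O.κ * θ t)
      (L := 2 * O.κ + L * O.V) (fun t => ?_) (fun s t => ?_) (h3.const_mul _)
    · refine ((dθ t).const_mul _).congr_deriv ?_
      field_simp
      rw [pow_two, hσ2, one_mul]
    · have e : tanh (θ s) - O.g (w s) - (tanh (θ t) - O.g (w t)) =
          (tanh (θ s) - tanh (θ t)) - (O.g (w s) - O.g (w t)) := by ring
      have b1 := (abs_tanh_sub_le (θ s) (θ t)).trans (lθ s t)
      have b2 : |O.g (w s) - O.g (w t)| ≤ L * (O.V * |s - t|) :=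
        (abs_g_sub_le convex_univ (fun w _ => hL w) (Set.mem_univ _) (Set.mem_univ _)).trans
          (by gcongr; exact lw s t)
      rw [e]
      have := abs_sub (tanh (θ s) - tanh (θ t)) (O.g (w s) - O.g (w t))
      linarith
  have h5 : Tendsto (fun t => O.g (w t)) atTop (𝓝 (O.g 0)) := by
    rw [O.g_zero]
    simpa using h2.sub h4
  exact tendsto_of_strictMono_comp O.g_strictMono h5

/-- Backwards in time the energy decreases and is bounded below, so it converges. No orbit is
excluded: all of them emanate from the origin. -/
lemma IsOrbit.tendsto_atBot (h : O.IsOrbit w θ) :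
    Tendsto w atBot (𝓝 0) ∧ Tendsto θ atBot (𝓝 0) := by
  have hr : ∀ {f : ℝ → ℝ} {f' t : ℝ}, HasDerivAt f f' (-t) →
      HasDerivAt (fun t => f (-t)) (-1 * f') t := fun {f f' t} hf =>
    (hf.scomp t (hasDerivAt_neg t)).congr_deriv (by simp)
  have hb : BddBelow (Set.range fun t => O.energy (w (-t)) (θ (-t))) :=
    ⟨0, by rintro _ ⟨t, rfl⟩; exact energy_nonneg _ _⟩
  have := tendsto_zero_of_energy (O := O) (w := fun t => w (-t)) (θ := fun t => θ (-t))
    (σ := -1) (Or.inr rfl) (fun t => hr (h.dw (-t))) (fun t => hr (h.dθ (-t)))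
    (fun t => hr (f := fun t => O.energy (w t) (θ t)) (h.energy_deriv (-t)))
    (tendsto_atTop_ciInf (fun s t hst => h.energy_monotone (neg_le_neg hst)) hb)
  exact ⟨by simpa [Function.comp_def] using this.1.comp tendsto_neg_atBot_atTop,
    by simpa [Function.comp_def] using this.2.comp tendsto_neg_atBot_atTop⟩

/-- If the monotone energy converged, the orbit would tend to the origin, where the energy vanishes;
but it starts positive and does not decrease. -/
lemma IsOrbit.energy_tendsto_atTop (h : O.IsOrbit w θ) (h0 : (w 0, θ 0) ≠ 0) :
    Tendsto (fun t => O.energy (w t) (θ t)) atTop atTop := by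
  rcases tendsto_atTop_of_monotone h.energy_monotone with h1 | ⟨l, hl⟩
  · exact h1
  · exfalso
    obtain ⟨h2, h3⟩ := tendsto_zero_of_energy (O := O) (w := w) (θ := θ) (σ := 1) (Or.inl rfl)
      (fun t => by simpa using h.dw t) (fun t => by simpa using h.dθ t)
      (fun t => by simpa using h.energy_deriv t) hl
    have := h.energy_monotone.ge_of_tendsto (continuous_energy h2 h3) 0
    exact absurd this (not_le.2 (energy_pos h0))

/-- Once `tanh θ` exceeds the supremum of `g`, the velocity of `θ` has a positive lower bound that
persists because `θ` can only grow. -/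
lemma IsOrbit.kasner_pos (h : O.IsOrbit w θ) {t₀ : ℝ} (ht : O.γ₂ < tanh (θ t₀)) :
    ∃ δ > 0, ∀ t ≥ t₀, δ * (t - t₀) ≤ θ t := by
  have hκ := O.κ_pos
  set δ := O.κ * (tanh (θ t₀) - O.γ₂) with hδ
  have hδ0 : 0 < δ := mul_pos hκ (by linarith)
  have hd : ∀ t, θ t₀ ≤ θ t → δ ≤ O.κ * (tanh (θ t) - O.g (w t)) := by
    intro t h1
    have := strictMono_tanh.monotone h1
    have := O.lt_γ₂ (w t)
    rw [hδ]; gcongr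
  have h1 := le_of_barrier h.dθ le_rfl fun t _ hc => hδ0.trans_le (hd t hc.ge)
  have h2 := add_mul_le_of_le_hasDerivAt (fun t _ => h.dθ t) fun t ht => hd t (h1 t ht)
  have h3 : 0 ≤ θ t₀ := by
    have : tanh 0 < tanh (θ t₀) := by rw [tanh_zero]; linarith [O.γ₂_pos]
    exact (strictMono_tanh.lt_iff_lt.1 this).le
  exact ⟨δ, hδ0, fun t ht => by linarith [h2 t ht]⟩

lemma IsOrbit.kasner_neg (h : O.IsOrbit w θ) {t₀ : ℝ} (ht : tanh (θ t₀) < -O.γ₁) :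
    ∃ δ > 0, ∀ t ≥ t₀, θ t ≤ -(δ * (t - t₀)) := by
  obtain ⟨δ, hδ, h1⟩ := h.reflect.kasner_pos (t₀ := t₀) (by
    simp only [tanh_neg]; change O.γ₁ < _; linarith)
  exact ⟨δ, hδ, fun t ht => by linarith [h1 t ht]⟩

/-- When `g w` is already close to `-γ₁`, a value of `tanh θ` above `b > -γ₁` would make `θ` grow
linearly from then on, beyond the bound `artanh γ₂`. -/
lemma IsOrbit.tendsto_tanh_of_w_atBot (h : O.IsOrbit w θ) (hw : Tendsto w atTop atBot)
    (h1 : ∀ t, -O.γ₁ ≤ tanh (θ t)) (h2 : ∀ t, tanh (θ t) ≤ O.γ₂) :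
    Tendsto (fun t => tanh (θ t)) atTop (𝓝 (-O.γ₁)) := by
  rw [tendsto_order]
  refine ⟨fun b hb => Eventually.of_forall fun t => hb.trans_le (h1 t), fun b hb => ?_⟩
  have hg := (tendsto_order.1 (O.g_bot.comp hw)).2 ((-O.γ₁ + b) / 2) (by linarith)
  obtain ⟨t₁, ht₁⟩ := eventually_atTop.1 hg
  filter_upwards [eventually_ge_atTop t₁] with t ht
  by_contra! hc
  have hκ := O.κ_pos
  set δ := O.κ * ((b + O.γ₁) / 2)
  have hδ : 0 < δ := mul_pos hκ (by linarith)
  have hd : ∀ s ≥ t, θ t ≤ θ s → δ ≤ O.κ * (tanh (θ s) - O.g (w s)) := by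
    intro s hs h1
    have a1 := strictMono_tanh.monotone h1
    have a2 := ht₁ s (ht.trans hs)
    simp only [Function.comp] at a2
    have : (b + O.γ₁) / 2 ≤ tanh (θ s) - O.g (w s) := by linarith
    simp only [δ]; gcongr
  have h3 := le_of_barrier h.dθ le_rfl fun s hs hc => hδ.trans_le (hd s hs hc.ge)
  have h4 := add_mul_le_of_le_hasDerivAt (fun s _ => h.dθ s) fun s hs => hd s hs (h3 s hs)
  have hA : O.γ₂ ∈ Set.Ioo (-1 : ℝ) 1 := ⟨by linarith [O.γ₂_pos], O.γ₂_lt⟩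
  have h5 : ∀ s, θ s ≤ artanh O.γ₂ := fun s =>
    strictMono_tanh.le_iff_le.1 (by rw [tanh_artanh hA]; exact h2 s)
  have h6 := h4 (t + (artanh O.γ₂ - θ t + 1) / δ) (by
    have : 0 < (artanh O.γ₂ - θ t + 1) / δ := div_pos (by linarith [h5 t]) hδ
    linarith)
  rw [add_sub_cancel_left, mul_div_cancel₀ _ hδ.ne'] at h6
  linarith [h5 (t + (artanh O.γ₂ - θ t + 1) / δ)]

/-- The possible behaviors of orbits towards the singularity. -/
lemma IsOrbit.fate (h : O.IsOrbit w θ) (h0 : (w 0, θ 0) ≠ 0) :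
    (∃ δ > 0, ∃ t₀, ∀ t ≥ t₀, δ * (t - t₀) ≤ θ t) ∨
    (∃ δ > 0, ∃ t₀, ∀ t ≥ t₀, θ t ≤ -(δ * (t - t₀))) ∨
    (Tendsto w atTop atBot ∧ Tendsto (fun t => tanh (θ t)) atTop (𝓝 (-O.γ₁))) ∨
    (Tendsto w atTop atTop ∧ Tendsto (fun t => tanh (θ t)) atTop (𝓝 O.γ₂)) := by
  by_cases h1 : ∃ t₀, O.γ₂ < tanh (θ t₀)
  · obtain ⟨t₀, ht⟩ := h1
    obtain ⟨δ, hδ, h⟩ := h.kasner_pos ht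
    exact Or.inl ⟨δ, hδ, t₀, h⟩
  by_cases h2 : ∃ t₀, tanh (θ t₀) < -O.γ₁
  · obtain ⟨t₀, ht⟩ := h2
    obtain ⟨δ, hδ, h⟩ := h.kasner_neg ht
    exact Or.inr (Or.inl ⟨δ, hδ, t₀, h⟩)
  push Not at h1 h2
  -- In the remaining case `θ` is bounded, so the divergence of the energy must come from the
  -- potential; hence `|w|` tends to infinity, and by continuity `w` keeps one sign.
  have hE := h.energy_tendsto_atTop h0
  obtain ⟨C, hC⟩ : ∃ C, ∀ t, log (cosh (θ t)) ≤ C := by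
    refine ⟨log (cosh (artanh O.γ₂)) + log (cosh (artanh O.γ₁)), fun t => ?_⟩
    have a1 : O.γ₂ ∈ Set.Ioo (-1 : ℝ) 1 := ⟨by linarith [O.γ₂_pos], O.γ₂_lt⟩
    have a2 : O.γ₁ ∈ Set.Ioo (-1 : ℝ) 1 := ⟨by linarith [O.γ₁_pos], O.γ₁_lt⟩
    have b1 : θ t ≤ artanh O.γ₂ :=
      strictMono_tanh.le_iff_le.1 (by rw [tanh_artanh a1]; exact h1 t)
    have b2 : -artanh O.γ₁ ≤ θ t :=
      strictMono_tanh.le_iff_le.1 (by rw [tanh_neg, tanh_artanh a2]; exact h2 t)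
    rcases le_total 0 (θ t) with hs | hs
    · have : log (cosh (θ t)) ≤ log (cosh (artanh O.γ₂)) :=
        log_le_log (cosh_pos _) (cosh_le_cosh.2 (abs_le_abs b1 (by linarith)))
      linarith [log_cosh_nonneg (artanh O.γ₁)]
    · have : log (cosh (θ t)) ≤ log (cosh (artanh O.γ₁)) :=
        log_le_log (cosh_pos _) (cosh_le_cosh.2 (abs_le_abs (by linarith) (by linarith)))
      linarith [log_cosh_nonneg (artanh O.γ₂)]
  have hU : Tendsto (fun t => O.U (w t)) atTop atTop := by
    refine tendsto_atTop_mono (f := fun t => O.energy (w t) (θ t) + -(2 * C)) (fun t => ?_)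
      (tendsto_atTop_add_const_right _ _ hE)
    simp only [energy]; linarith [hC t]
  have habs : ∀ R, ∀ᶠ t in atTop, R < |w t| := by
    intro R
    obtain ⟨C', hC'⟩ := (isCompact_Icc (a := -R) (b := R)).bddAbove_image
      (f := O.U) (fun x _ => (O.U_deriv x).continuousAt.continuousWithinAt)
    filter_upwards [hU.eventually_gt_atTop C'] with t ht
    by_contra! hc
    exact absurd (hC' ⟨w t, abs_le.1 hc, rfl⟩) (not_le.2 ht)
  obtain ⟨t₁, ht₁⟩ := eventually_atTop.1 (habs 0)
  have hne : ∀ t ∈ Set.Ici t₁, w t ≠ 0 := fun t ht h => by simpa [h] using ht₁ t ht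
  have hsign : (∀ t ≥ t₁, w t < 0) ∨ ∀ t ≥ t₁, 0 < w t := by
    by_contra! hcon
    obtain ⟨⟨s, hs, hs'⟩, ⟨r, hr, hr'⟩⟩ := hcon
    obtain ⟨x, hx, hx0⟩ := isPreconnected_Ici.intermediate_value (show r ∈ Set.Ici t₁ from hr)
      (show s ∈ Set.Ici t₁ from hs) h.continuous_w.continuousOn ⟨hr', hs'⟩
    exact hne x hx hx0
  refine Or.inr (Or.inr ?_)
  rcases hsign with hs | hs
  · left
    have hw : Tendsto w atTop atBot := by
      rw [Filter.tendsto_atBot]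
      intro b
      filter_upwards [habs |b|, eventually_ge_atTop t₁] with t h3 h4
      rw [abs_of_neg (hs t h4)] at h3
      linarith [neg_abs_le b]
    exact ⟨hw, h.tendsto_tanh_of_w_atBot hw h2 h1⟩
  · right
    have hw : Tendsto w atTop atTop := by
      rw [Filter.tendsto_atTop]
      intro b
      filter_upwards [habs |b|, eventually_ge_atTop t₁] with t h3 h4
      rw [abs_of_pos (hs t h4)] at h3
      linarith [le_abs_self b]
    have := h.reflect.tendsto_tanh_of_w_atBot (tendsto_neg_atTop_atBot.comp hw)
      (fun t => by rw [tanh_neg]; exact neg_le_neg (h1 t))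
      (fun t => by rw [tanh_neg]; exact neg_le.1 (h2 t))
    exact ⟨hw, by simpa [Osc.reflect] using this.neg⟩

end Osc
end OscillatorDynamics
end WarpedVacuum
end

/-! ### The separatrices: existence and uniqueness. -/

noncomputable section
namespace WarpedVacuum
section Separatrix
open Real

namespace Osc
variable {O : Osc} {w θ w₁ θ₁ w₂ θ₂ : ℝ → ℝ}

variable (O) in
/-- Orbits which tend to the saddle at `w = -∞`. -/
def TendsToSaddle (w θ : ℝ → ℝ) : Prop :=
  Tendsto w atTop atBot ∧ Tendsto (fun t => tanh (θ t)) atTop (𝓝 (-O.γ₁))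

lemma mul_sq_le_tanh_sub_mul {c x y : ℝ} (hx : |tanh x| ≤ c) (hy : |tanh y| ≤ c) :
    (1 - c ^ 2) * (x - y) ^ 2 ≤ (tanh x - tanh y) * (x - y) := by
  wlog hxy : y ≤ x generalizing x y
  · have := this hy hx (le_of_not_ge hxy)
    nlinarith
  have h : (1 - c ^ 2) * (x - y) ≤ tanh x - tanh y := by
    refine Convex.mul_sub_le_image_sub_of_le_deriv (convex_Icc y x) continuous_tanh.continuousOn
      (fun z _ => (hasDerivAt_tanh z).differentiableAt.differentiableWithinAt) (fun z hz => ?_)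
      y ⟨le_rfl, hxy⟩ x ⟨hxy, le_rfl⟩ hxy
    rw [(hasDerivAt_tanh z).deriv]
    have hz' := interior_subset hz
    have h1 := strictMono_tanh.monotone hz'.1
    have h2 := strictMono_tanh.monotone hz'.2
    have : |tanh z| ≤ c := abs_le.2 ⟨by linarith [(abs_le.1 hy).1], by linarith [(abs_le.1 hx).2]⟩
    have := sq_le_sq' (abs_le.1 this).1 (abs_le.1 this).2
    linarith
  nlinarith

/-- A cone argument. Near the saddle the θ direction is expanding, so for the difference of two
orbits the form `Q = (Δθ)² - a² (Δw)²` satisfies `Q' ≥ κ e Q`. If the orbits start with the same `w`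
and different `θ`, then `Q` is positive, grows at least linearly, and contradicts the bound on `θ`.
-/
lemma IsOrbit.eq_shift_of_saddle_aux (h₁ : O.IsOrbit w₁ θ₁) (h₂ : O.IsOrbit w₂ θ₂) {c : ℝ}
    (hc0 : 0 < c) (hc1 : c < 1) {W : ℝ}
    (hW : ∀ x ∈ Set.Iic W, O.g' x ≤ O.κ * (1 - c ^ 2) / (2 * O.V) * (1 - c ^ 2) / 4)
    (a₁ : ∀ t ≥ 0, w₁ t ≤ W) (a₂ : ∀ t ≥ 0, w₂ t ≤ W)
    (b₁ : ∀ t ≥ 0, |tanh (θ₁ t)| ≤ c) (b₂ : ∀ t ≥ 0, |tanh (θ₂ t)| ≤ c)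
    (hw : w₁ 0 = w₂ 0) : θ₁ 0 = θ₂ 0 := by
  by_contra hne
  have hκ := O.κ_pos
  have hV := O.V_pos
  set e := 1 - c ^ 2 with he
  have he0 : 0 < e := by rw [he]; nlinarith
  have he1 : e ≤ 1 := by rw [he]; nlinarith
  -- For this opening of the cone, and with `g'` small by `hW`, the cross terms add up to at most
  -- 3/2 of `κ e a |Z| |D|`, which the expansion `2 κ e D²` absorbs.
  set a := O.κ * e / (2 * O.V) with ha
  have ha0 : 0 < a := by positivity
  have haV : a * O.V = O.κ * e / 2 := by rw [ha]; field_simp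
  let Q : ℝ → ℝ := fun t => (θ₁ t - θ₂ t) ^ 2 - a ^ 2 * (w₁ t - w₂ t) ^ 2
  let Q' : ℝ → ℝ := fun t =>
    2 * (θ₁ t - θ₂ t) * (O.κ * (tanh (θ₁ t) - O.g (w₁ t)) - O.κ * (tanh (θ₂ t) - O.g (w₂ t)))
      - a ^ 2 * (2 * (w₁ t - w₂ t) * (O.V * tanh (θ₁ t) - O.V * tanh (θ₂ t)))
  have hQ : ∀ t, HasDerivAt Q (Q' t) t := fun t => by
    refine ((((h₁.dθ t).fun_sub (h₂.dθ t)).fun_pow 2).fun_sub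
      ((((h₁.dw t).fun_sub (h₂.dw t)).fun_pow 2).const_mul (a ^ 2))).congr_deriv ?_
    simp [Q']
  have hQ' : ∀ t ≥ 0, O.κ * e * Q t ≤ Q' t := by
    intro t ht
    have k1 := mul_sq_le_tanh_sub_mul (b₁ t ht) (b₂ t ht)
    have k2 := abs_tanh_sub_le (θ₁ t) (θ₂ t)
    have k3 := abs_g_sub_le (O := O) (convex_Iic W) hW (a₁ t ht) (a₂ t ht)
    simp only [Q, Q']
    set D := θ₁ t - θ₂ t
    set Z := w₁ t - w₂ t
    set Δ := tanh (θ₁ t) - tanh (θ₂ t) with hΔ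
    set G := O.g (w₁ t) - O.g (w₂ t) with hG
    have hrw : 2 * D * (O.κ * (tanh (θ₁ t) - O.g (w₁ t)) - O.κ * (tanh (θ₂ t) - O.g (w₂ t)))
        - a ^ 2 * (2 * Z * (O.V * tanh (θ₁ t) - O.V * tanh (θ₂ t)))
        = 2 * O.κ * (Δ * D) - 2 * O.κ * (D * G) - 2 * a * (a * O.V) * (Z * Δ) := by
      rw [hΔ, hG]; ring
    rw [hrw, haV]
    have k4 : D * G ≤ e / 4 * (a * |Z| * |D|) := by
      calc D * G ≤ |D| * |G| := by rw [← abs_mul]; exact le_abs_self _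
        _ ≤ |D| * (a * e / 4 * |Z|) := by gcongr
        _ = _ := by ring
    have k5 : a * (Z * Δ) ≤ a * |Z| * |D| := by
      calc a * (Z * Δ) ≤ a * (|Z| * |Δ|) :=
            mul_le_mul_of_nonneg_left (by rw [← abs_mul]; exact le_abs_self _) ha0.le
        _ ≤ a * (|Z| * |D|) := by gcongr
        _ = _ := by ring
    have k6 : 2 * (a * |Z| * |D|) ≤ D ^ 2 + a ^ 2 * Z ^ 2 := by
      have := sq_nonneg (a * |Z| - |D|)
      have e1 := sq_abs Z
      have e2 := sq_abs D
      nlinarith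
    have hκe : 0 < O.κ * e := by positivity
    rw [← he] at k1
    have m1 := mul_le_mul_of_nonneg_left k1 hκ.le
    have m2 := mul_le_mul_of_nonneg_left k4 hκ.le
    have m3 := mul_le_mul_of_nonneg_left k5 hκe.le
    have m4 := mul_le_mul_of_nonneg_left k6 hκe.le
    have m5 := mul_nonneg hκe.le (sq_nonneg D)
    have m6 := mul_nonneg hκe.le (mul_nonneg (sq_nonneg a) (sq_nonneg Z))
    clear_value D Z Δ G e a
    linarith
  have hQ0 : 0 < Q 0 := by
    simp only [Q, hw, sub_self]
    have : 0 < (θ₁ 0 - θ₂ 0) ^ 2 := by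
      have := sub_ne_zero.2 hne
      positivity
    simpa using this
  have hκe : 0 < O.κ * e := by positivity
  have h3 := le_of_barrier hQ le_rfl fun t ht hc =>
    (mul_pos hκe (hc ▸ hQ0)).trans_le (hQ' t ht)
  have h4 := add_mul_le_of_le_hasDerivAt (δ := O.κ * e * Q 0) (fun t _ => hQ t) fun t ht =>
    (by have := h3 t ht; gcongr : O.κ * e * Q 0 ≤ O.κ * e * Q t).trans (hQ' t ht)
  have hA : c ∈ Set.Ioo (-1 : ℝ) 1 := ⟨by linarith, hc1⟩
  have hb : ∀ {x : ℝ}, |tanh x| ≤ c → |x| ≤ artanh c := by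
    intro x hx
    rw [abs_le] at hx ⊢
    constructor
    · exact strictMono_tanh.le_iff_le.1 (by rw [tanh_neg, tanh_artanh hA]; exact hx.1)
    · exact strictMono_tanh.le_iff_le.1 (by rw [tanh_artanh hA]; exact hx.2)
  set s := (2 * artanh c) ^ 2 / (O.κ * e * Q 0) with hs
  have hs0 : 0 ≤ s := by positivity
  have h5 := h4 s hs0
  have h6 : O.κ * e * Q 0 * (s - 0) = (2 * artanh c) ^ 2 := by
    rw [hs]; field_simp; ring
  have h7 : Q s ≤ (2 * artanh c) ^ 2 := by
    have a1 := abs_le.1 (hb (b₁ s hs0))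
    have a2 := abs_le.1 (hb (b₂ s hs0))
    have : (θ₁ s - θ₂ s) ^ 2 ≤ (2 * artanh c) ^ 2 := sq_le_sq' (by linarith) (by linarith)
    simp only [Q]
    linarith [mul_nonneg (sq_nonneg a) (sq_nonneg (w₁ s - w₂ s))]
  rw [h6] at h5
  have := h5.trans h7
  clear_value Q s
  linarith

/-- The orbits which tend to the saddle coincide up to a translation in time. -/
lemma IsOrbit.eq_shift_of_saddle (h₁ : O.IsOrbit w₁ θ₁) (h₂ : O.IsOrbit w₂ θ₂)
    (s₁ : O.TendsToSaddle w₁ θ₁) (s₂ : O.TendsToSaddle w₂ θ₂) :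
    ∃ c, ∀ t, w₂ t = w₁ (t + c) ∧ θ₂ t = θ₁ (t + c) := by
  set c := (1 + O.γ₁) / 2 with hc
  have hγ0 := O.γ₁_pos
  have hγ1 := O.γ₁_lt
  have hκ := O.κ_pos
  have hV := O.V_pos
  have hc0 : 0 < c := by linarith
  have hc1 : c < 1 := by linarith
  have he0 : 0 < 1 - c ^ 2 := by nlinarith
  obtain ⟨W, hW⟩ := eventually_atBot.1 ((tendsto_order.1 O.g'_bot).2
    (O.κ * (1 - c ^ 2) / (2 * O.V) * (1 - c ^ 2) / 4) (by positivity))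
  have ev : ∀ {w θ : ℝ → ℝ}, O.TendsToSaddle w θ →
      ∃ t₀, ∀ t ≥ t₀, w t ≤ W ∧ |tanh (θ t)| ≤ c := by
    intro w θ hs
    refine eventually_atTop.1 ((Filter.tendsto_atBot.1 hs.1 W).and ?_)
    filter_upwards [(tendsto_order.1 hs.2).1 (-c) (by linarith),
      (tendsto_order.1 hs.2).2 0 (by linarith)] with t k1 k2
    exact abs_le.2 ⟨k1.le, by linarith⟩
  -- As `w → -∞`, each orbit reaches every lower level at a later time; translating both orbits to a
  -- common level puts them in the situation of the cone argument.
  have hit : ∀ {w θ : ℝ → ℝ}, O.IsOrbit w θ → O.TendsToSaddle w θ → ∀ t₀ X, X ≤ w t₀ →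
      ∃ s ≥ t₀, w s = X := by
    intro w θ h hs t₀ X hX
    obtain ⟨r, hr1, hr2⟩ := ((Filter.tendsto_atBot.1 hs.1 X).and (eventually_ge_atTop t₀)).exists
    obtain ⟨x, hx, hx0⟩ := isPreconnected_Ici.intermediate_value (show r ∈ Set.Ici t₀ from hr2)
      (Set.mem_Ici.2 le_rfl : t₀ ∈ Set.Ici t₀) h.continuous_w.continuousOn ⟨hr1, hX⟩
    exact ⟨x, hx, hx0⟩
  obtain ⟨t₁, ht₁⟩ := ev s₁
  obtain ⟨t₂, ht₂⟩ := ev s₂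
  obtain ⟨r₁, hr₁, e₁⟩ := hit h₁ s₁ t₁ (min (w₁ t₁) (w₂ t₂)) (min_le_left _ _)
  obtain ⟨r₂, hr₂, e₂⟩ := hit h₂ s₂ t₂ (min (w₁ t₁) (w₂ t₂)) (min_le_right _ _)
  have key := (h₁.shift r₁).eq_shift_of_saddle_aux (h₂.shift r₂) hc0 hc1
    (fun x hx => (hW x hx).le) (fun t ht => (ht₁ (t + r₁) (by linarith)).1)
    (fun t ht => (ht₂ (t + r₂) (by linarith)).1) (fun t ht => (ht₁ (t + r₁) (by linarith)).2)
    (fun t ht => (ht₂ (t + r₂) (by linarith)).2) (by simp [e₁, e₂])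
  obtain ⟨u₁, u₂⟩ := (h₁.shift r₁).unique (h₂.shift r₂) (t₀ := 0) (by simp [e₁, e₂]) key
  refine ⟨r₁ - r₂, fun t => ⟨?_, ?_⟩⟩
  · have := congrFun u₁ (t - r₂)
    simp only [sub_add_cancel] at this
    rw [← this]; ring_nf
  · have := congrFun u₂ (t - r₂)
    simp only [sub_add_cancel] at this
    rw [← this]; ring_nf

/-- There is an orbit which tends to the saddle. -/
lemma exists_isOrbit_tendsToSaddle (O : Osc) : ∃ w θ, O.IsOrbit w θ ∧ O.TendsToSaddle w θ := by
  have hγ0 := O.γ₁_pos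
  have hγ1 := O.γ₁_lt
  have hκ := O.κ_pos
  have hV := O.V_pos
  have hg1 := O.g_neg (show (-1 : ℝ) < 0 by norm_num)
  have hg2 := O.neg_γ₁_lt (-1)
  -- Shooting from the line `w = -1` into the strip `α ≤ θ ≤ β`. Here `α` is the saddle value and
  -- `tanh β = T` lies strictly between `g (-1)` and 0: then `w` decreases in the strip, and `θ`
  -- increases strictly where it meets `β` with `w ≤ -1`.
  set T := O.g (-1) / 2 with hT
  have hAα : -O.γ₁ ∈ Set.Ioo (-1 : ℝ) 1 := ⟨by linarith, by linarith⟩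
  have hAβ : T ∈ Set.Ioo (-1 : ℝ) 1 := ⟨by linarith, by linarith⟩
  set α := artanh (-O.γ₁) with hα
  set β := artanh T with hβ
  have tα : tanh α = -O.γ₁ := tanh_artanh hAα
  have tβ : tanh β = T := tanh_artanh hAβ
  have hαβ : α < β := strictMono_tanh.lt_iff_lt.1 (by rw [tα, tβ]; linarith)
  have hβ0 : β < 0 := strictMono_tanh.lt_iff_lt.1 (by rw [tβ, tanh_zero]; linarith)
  choose w θ horb hw hθ using fun y => O.exists_isOrbit (-1) y
  obtain ⟨L, hL⟩ := O.exists_lipschitzWith_vf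
  have close : ∀ (y τ ε : ℝ), 0 < ε → ∃ δ > 0, ∀ y', dist y' y < δ →
      ∀ s ∈ Set.Icc 0 τ, |θ y' s - θ y s| < ε := by
    intro y τ ε hε
    refine ⟨ε / exp (L * τ), by positivity, fun y' hy s hs => ?_⟩
    have h1 := (horb y').dist_le (horb y) hL hs.1
    rw [hw, hw, hθ, hθ, Prod.dist_eq, Prod.dist_eq] at h1
    have h2 : |θ y' s - θ y s| ≤ dist y' y * exp (L * s) := by
      refine le_trans ?_ (h1.trans_eq ?_)
      · rw [← Real.dist_eq]; exact le_max_right _ _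
      · simp
    have h3 : exp (L * s) ≤ exp (L * τ) := by
      gcongr; exact hs.2
    calc _ ≤ dist y' y * exp (L * s) := h2
      _ ≤ dist y' y * exp (L * τ) := by gcongr
      _ < ε / exp (L * τ) * exp (L * τ) := by gcongr
      _ = ε := by field_simp
  have gap : ∀ (y τ : ℝ) (f : ℝ → ℝ), 0 ≤ τ → Continuous f → (∀ s ∈ Set.Icc 0 τ, 0 < f s) →
      ∃ ε > 0, ∀ s ∈ Set.Icc 0 τ, ε ≤ f s := by
    intro y τ f hτ hf hpos
    obtain ⟨x, hx, hmin⟩ := isCompact_Icc.exists_isMinOn ⟨0, ⟨le_rfl, hτ⟩⟩ hf.continuousOn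
    exact ⟨f x, hpos x hx, fun s hs => hmin hs⟩
  -- The initial values whose orbits pass `β` without having touched `α`, and vice versa. Both sets
  -- are open by continuous dependence, nonempty and disjoint, so by connectedness of the line some
  -- initial value is in neither.
  let up : Set ℝ := {y | ∃ τ ≥ 0, β < θ y τ ∧ ∀ s ∈ Set.Icc 0 τ, α < θ y s}
  let dn : Set ℝ := {y | ∃ τ ≥ 0, θ y τ < α ∧ ∀ s ∈ Set.Icc 0 τ, θ y s < β}
  have up_open : IsOpen up := by
    rw [Metric.isOpen_iff]
    rintro y ⟨τ, hτ, h1, h2⟩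
    obtain ⟨ε, hε, h3⟩ := gap y τ (fun s => θ y s - α) hτ
      ((horb y).continuous_θ.sub continuous_const) fun s hs => sub_pos.2 (h2 s hs)
    obtain ⟨δ, hδ, h4⟩ := close y τ (min ε (θ y τ - β)) (lt_min hε (by linarith))
    refine ⟨δ, hδ, fun y' hy' => ⟨τ, hτ, ?_, fun s hs => ?_⟩⟩
    · have := abs_lt.1 ((h4 y' hy' τ ⟨hτ, le_rfl⟩).trans_le (min_le_right _ _))
      linarith
    · have := abs_lt.1 ((h4 y' hy' s hs).trans_le (min_le_left _ _))
      linarith [h3 s hs]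
  have dn_open : IsOpen dn := by
    rw [Metric.isOpen_iff]
    rintro y ⟨τ, hτ, h1, h2⟩
    obtain ⟨ε, hε, h3⟩ := gap y τ (fun s => β - θ y s) hτ
      (continuous_const.sub (horb y).continuous_θ) fun s hs => sub_pos.2 (h2 s hs)
    obtain ⟨δ, hδ, h4⟩ := close y τ (min ε (α - θ y τ)) (lt_min hε (by linarith))
    refine ⟨δ, hδ, fun y' hy' => ⟨τ, hτ, ?_, fun s hs => ?_⟩⟩
    · have := abs_lt.1 ((h4 y' hy' τ ⟨hτ, le_rfl⟩).trans_le (min_le_right _ _))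
      linarith
    · have := abs_lt.1 ((h4 y' hy' s hs).trans_le (min_le_left _ _))
      linarith [h3 s hs]
  obtain ⟨y, hyu, hyd⟩ : ∃ y, y ∉ up ∧ y ∉ dn := by
    by_contra! hcon
    obtain ⟨y, -, ⟨τ, hτ, h1, h2⟩, ⟨σ, hσ, h3, h4⟩⟩ := (isPreconnected_univ (α := ℝ)) up dn up_open
      dn_open (fun y _ => by by_cases h : y ∈ up; exacts [Or.inl h, Or.inr (hcon y h)])
      ⟨β + 1, trivial, 0, le_rfl, by rw [hθ]; linarith, fun s hs => by
        rw [show s = 0 from le_antisymm hs.2 hs.1, hθ]; linarith⟩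
      ⟨α - 1, trivial, 0, le_rfl, by rw [hθ]; linarith, fun s hs => by
        rw [show s = 0 from le_antisymm hs.2 hs.1, hθ]; linarith⟩
    rcases le_total τ σ with h | h
    · linarith [h4 τ ⟨hτ, h⟩]
    · linarith [h2 σ ⟨hσ, h⟩]
  have h := horb y
  -- At the level `α` the velocity of `θ` is negative wherever `w` is, because `g > -γ₁`.
  have trap : ∀ s, θ y s ≤ α → ∀ t ≥ s, θ y t ≤ α := by
    intro s hs t ht
    have := le_of_barrier (f := fun t => -θ y t) (c := -α) (t₀ := s)
      (fun t => (h.dθ t).fun_neg) (by linarith) (fun r _ hr => by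
        have e : θ y r = α := by linarith
        rw [e, tα]
        have := O.neg_γ₁_lt (w y r)
        nlinarith) t ht
    linarith
  have le_β : ∀ t ≥ 0, θ y t ≤ β := by
    intro t ht
    by_contra! hc
    refine hyu ⟨t, ht, hc, fun s hs => ?_⟩
    by_contra! hs'
    linarith [trap s hs' t hs.2]
  have ge_α : ∀ t ≥ 0, α ≤ θ y t := by
    intro t ht
    by_contra! hc
    refine hyd ⟨t, ht, hc, fun s hs => ?_⟩
    by_contra! hs'
    -- An orbit that falls below `α` without belonging to `dn` must have touched `β`; but there it
    -- crosses `β` upwards, against `le_β`.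
    have es : θ y s = β := le_antisymm (le_β s hs.1) hs'
    have hws : w y s ≤ -1 := by
      have := le_of_hasDerivAt_nonneg (f := fun t => -w y t) (t₀ := 0)
        (fun r _ => (h.dw r).fun_neg) (fun r hr => by
          have : tanh (θ y r) ≤ tanh 0 := strictMono_tanh.monotone ((le_β r hr).trans hβ0.le)
          rw [tanh_zero] at this
          nlinarith) s hs.1
      simp only [hw] at this
      linarith
    have hd := h.dθ s
    have hpos : 0 < O.κ * (tanh (θ y s) - O.g (w y s)) := by
      rw [es, tβ]
      have := O.g_strictMono.monotone hws
      exact mul_pos hκ (by linarith)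
    have hsl := (hasDerivAt_iff_tendsto_slope.1 hd).eventually (eventually_gt_nhds hpos)
    have hsl' : ∀ᶠ r in 𝓝[>] s, 0 < slope (θ y) s r :=
      hsl.filter_mono (nhdsWithin_mono _ fun r hr => ne_of_gt hr)
    have hlt : ∀ᶠ r in 𝓝[>] s, s < r := eventually_mem_nhdsWithin
    obtain ⟨r, hr1, hr2⟩ := (hsl'.and hlt).exists
    rw [slope_pos_iff_of_le hr2.le] at hr1
    linarith [le_β r (by linarith [hs.1])]
  -- In the strip `w' ≤ V tanh β < 0`. Of the four fates only the saddle at `w = -∞` is then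
  -- compatible with bounded `θ`.
  have hwb : Tendsto (w y) atTop atBot := by
    have h1 := add_mul_le_of_le_hasDerivAt (f := fun t => -w y t) (t₀ := 0) (δ := -(O.V * T))
        (fun r _ => (h.dw r).fun_neg) (fun r hr => by
          have : tanh (θ y r) ≤ tanh β := strictMono_tanh.monotone (le_β r hr)
          rw [tβ] at this
          nlinarith)
    have hVT : 0 < -(O.V * T) := by nlinarith
    have h2 : Tendsto (fun t => -w y t) atTop atTop := by
      refine tendsto_atTop_mono' _ (f₁ := fun t => -w y 0 + -(O.V * T) * t) ?_
        (tendsto_atTop_add_const_left _ _ (tendsto_id.const_mul_atTop hVT))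
      filter_upwards [eventually_ge_atTop 0] with t ht
      simpa using h1 t ht
    simpa [Function.comp_def] using tendsto_neg_atTop_atBot.comp h2
  refine ⟨w y, θ y, h, hwb, ?_⟩
  rcases h.fate (by rw [hw]; simp) with ⟨δ, hδ, t₀, h1⟩ | ⟨δ, hδ, t₀, h1⟩ | h1 | h1
  · exfalso
    have h2 : Tendsto (θ y) atTop atTop := by
      refine tendsto_atTop_mono' _ (f₁ := fun t => δ * (t - t₀)) ?_
        ((tendsto_atTop_add_const_right _ _ tendsto_id).const_mul_atTop hδ)
      filter_upwards [eventually_ge_atTop t₀] with t ht using h1 t ht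
    obtain ⟨t, k1, k2⟩ := ((h2.eventually_gt_atTop β).and (eventually_ge_atTop 0)).exists
    linarith [le_β t k2]
  · exfalso
    have h2 : Tendsto (fun t => -θ y t) atTop atTop := by
      refine tendsto_atTop_mono' _ (f₁ := fun t => δ * (t - t₀)) ?_
        ((tendsto_atTop_add_const_right _ _ tendsto_id).const_mul_atTop hδ)
      filter_upwards [eventually_ge_atTop t₀] with t ht
      linarith [h1 t ht]
    obtain ⟨t, k1, k2⟩ := ((h2.eventually_gt_atTop (-α)).and (eventually_ge_atTop 0)).exists
    linarith [ge_α t k2]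
  · exact h1.2
  · exact absurd hwb (h1.1.not_tendsto disjoint_atTop_atBot)

end Osc
end Separatrix
end WarpedVacuum
end

/-! ### Integrable perturbations and decay rates. -/

noncomputable section
namespace WarpedVacuum
section Perturbation
open Real

lemma norm_sub_le_of_norm_deriv_le {E : Type*} [NormedAddCommGroup E] [NormedSpace ℝ E]
    {u u' : ℝ → E} {B b : ℝ → ℝ} {r₀ : ℝ} (hu : ∀ r ≥ r₀, HasDerivAt u (u' r) r)
    (hB : ∀ r ≥ r₀, HasDerivAt B (b r) r) (hb : ∀ r ≥ r₀, ‖u' r‖ ≤ b r) {r s : ℝ} (hr : r₀ ≤ r)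
    (hs : r ≤ s) : ‖u s - u r‖ ≤ B s - B r := by
  refine image_norm_le_of_norm_deriv_right_le_deriv_boundary' (f := fun s => u s - u r)
    (f' := u') (B := fun s => B s - B r) (B' := b) (a := r) (b := s) ?_ ?_ (by simp) ?_ ?_ ?_
    ⟨hs, le_rfl⟩
  · exact fun x hx => ((hu x (hr.trans hx.1)).continuousAt.sub
      continuousAt_const).continuousWithinAt
  · exact fun x hx => ((hu x (hr.trans hx.1)).sub_const _).hasDerivWithinAt
  · exact fun x hx => ((hB x (hr.trans hx.1)).continuousAt.sub
      continuousAt_const).continuousWithinAt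
  · exact fun x hx => ((hB x (hr.trans hx.1)).sub_const _).hasDerivWithinAt
  · exact fun x hx => hb x (hr.trans hx.1)

/-- `B` is the tail integral of the majorant of the derivative, so it measures the distance to the
limit as well as giving the Cauchy property. -/
lemma exists_limit_of_norm_deriv_le {E : Type*} [NormedAddCommGroup E] [NormedSpace ℝ E]
    [CompleteSpace E] {u u' : ℝ → E} {B b : ℝ → ℝ} {r₀ : ℝ}
    (hu : ∀ r ≥ r₀, HasDerivAt u (u' r) r)
    (hB : ∀ r ≥ r₀, HasDerivAt B (-b r) r) (hb : ∀ r ≥ r₀, ‖u' r‖ ≤ b r)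
    (hB0 : Tendsto B atTop (𝓝 0)) : ∃ ℓ, ∀ r ≥ r₀, ‖u r - ℓ‖ ≤ B r := by
  have h1 : ∀ r s, r₀ ≤ r → r ≤ s → ‖u s - u r‖ ≤ B r - B s := by
    intro r s hr hs
    have := norm_sub_le_of_norm_deriv_le (B := fun r => -B r) (b := b) hu
      (fun r hr => by simpa using (hB r hr).fun_neg) hb hr hs
    linarith
  have hc : CauchySeq u := by
    rw [Metric.cauchySeq_iff']
    intro ε hε
    obtain ⟨R, hR⟩ := eventually_atTop.1 ((Metric.tendsto_nhds.1 hB0) (ε / 2) (by positivity))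
    refine ⟨max R r₀, fun s hs => ?_⟩
    rw [dist_eq_norm]
    have h2 := h1 _ s (le_max_right R r₀) hs
    have h3 := hR _ (le_max_left R r₀)
    have h4 := hR s ((le_max_left R r₀).trans hs)
    rw [Real.dist_0_eq_abs] at h3 h4
    linarith [le_abs_self (B (max R r₀)), neg_abs_le (B s)]
  obtain ⟨ℓ, hℓ⟩ := cauchySeq_tendsto_of_complete hc
  refine ⟨ℓ, fun r hr => ?_⟩
  have h2 : Tendsto (fun s => ‖u s - u r‖) atTop (𝓝 ‖ℓ - u r‖) := (hℓ.sub_const _).norm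
  have h3 : Tendsto (fun s => B r - B s) atTop (𝓝 (B r)) := by simpa using hB0.const_sub (B r)
  rw [norm_sub_rev]
  refine le_of_tendsto_of_tendsto h2 h3 ?_
  filter_upwards [eventually_ge_atTop r] with s hs using h1 r s hr hs

lemma tendsto_exp_neg_mul {μ : ℝ} (hμ : 0 < μ) : Tendsto (fun r => exp (-(μ * r))) atTop (𝓝 0) :=
  tendsto_exp_neg_atTop_nhds_zero.comp (tendsto_id.const_mul_atTop hμ)

lemma hasDerivAt_exp_mul (μ r : ℝ) : HasDerivAt (fun r => exp (μ * r)) (μ * exp (μ * r)) r := by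
  simpa [mul_comm] using ((hasDerivAt_id r).const_mul μ).exp

lemma exists_limit_of_exp_decay {E : Type*} [NormedAddCommGroup E] [NormedSpace ℝ E]
    [CompleteSpace E] {u u' : ℝ → E} {C μ r₀ : ℝ} (hμ : 0 < μ)
    (hu : ∀ r ≥ r₀, HasDerivAt u (u' r) r) (hb : ∀ r ≥ r₀, ‖u' r‖ ≤ C * exp (-(μ * r))) :
    ∃ ℓ, ∀ r ≥ r₀, ‖u r - ℓ‖ ≤ C / μ * exp (-(μ * r)) := by
  refine exists_limit_of_norm_deriv_le (b := fun r => C * exp (-(μ * r))) hu (fun r _ => ?_) hb ?_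
  · have := (hasDerivAt_exp_mul (-μ) r).const_mul (C / μ)
    simp only [neg_mul] at this
    refine this.congr_deriv ?_
    field_simp
  · simpa using (tendsto_exp_neg_mul hμ).const_mul (C / μ)

/-- The negative derivative of `r² exp (-4 r)` is `(4 r² - 2 r) exp (-4 r)`, which dominates `r² exp
(-4 r)` for `r ≥ 1`. So the tail has the same form as the integrand, without loss of a power. -/
lemma exists_limit_of_sq_exp_decay {u u' : ℝ → ℝ} {C r₀ : ℝ} (hr₀ : 1 ≤ r₀)
    (hu : ∀ r ≥ r₀, HasDerivAt u (u' r) r) (hC : 0 ≤ C)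
    (hb : ∀ r ≥ r₀, |u' r| ≤ C * (r ^ 2 * exp (-(4 * r)))) :
    ∃ ℓ, ∀ r ≥ r₀, |u r - ℓ| ≤ C * (r ^ 2 * exp (-(4 * r))) := by
  refine exists_limit_of_norm_deriv_le (b := fun r => C * ((4 * r ^ 2 - 2 * r) * exp (-(4 * r))))
    hu (fun r _ => ?_) (fun r hr => (hb r hr).trans ?_) ?_
  · have h1 := hasDerivAt_exp_mul (-4) r
    simp only [neg_mul] at h1
    refine ((((hasDerivAt_id r).fun_pow 2).fun_mul h1).const_mul C).congr_deriv ?_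
    simp
    ring
  · gcongr
    nlinarith
  · have h1 := tendsto_pow_mul_exp_neg_atTop_nhds_zero 2
    have h2 : Tendsto (fun r : ℝ => exp (-(3 * r))) atTop (𝓝 0) := tendsto_exp_neg_mul (by norm_num)
    have h3 := (h1.mul h2).const_mul C
    simp only [mul_zero] at h3
    refine h3.congr fun r => ?_
    rw [mul_assoc (r ^ 2), ← exp_add]
    ring_nf

/-- The Bernoulli substitution `φ = B^(-1/2)` makes the inequality linear: `φ' ≥ μ φ - C / 2`. Since
`B → 0`, at some time `φ` exceeds the equilibrium `C / (2 μ)`, and from then on it grows like `exp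
(μ r)`. Thus the error term does not spoil the rate. -/
lemma decay_upper {B B' : ℝ → ℝ} {μ C r₀ : ℝ} (hμ : 0 < μ) (hpos : ∀ r, 0 < B r)
    (hB : ∀ r, HasDerivAt B (B' r) r) (h0 : Tendsto B atTop (𝓝 0))
    (hb : ∀ r ≥ r₀, B' r ≤ -(2 * μ) * B r + C * (B r * √(B r))) :
    ∃ c > 0, ∃ r₁ ≥ r₀, ∀ r ≥ r₁, B r ≤ c * exp (-(2 * μ * r)) := by
  let φ : ℝ → ℝ := fun r => (√(B r))⁻¹
  have hs : ∀ r, 0 < √(B r) := fun r => sqrt_pos.2 (hpos r)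
  have hφ : ∀ r, HasDerivAt φ (-(B' r / (2 * √(B r))) / √(B r) ^ 2) r := fun r =>
    ((hB r).sqrt (hpos r).ne').inv (hs r).ne'
  have hφ' : ∀ r ≥ r₀, μ * φ r - C / 2 ≤ -(B' r / (2 * √(B r))) / √(B r) ^ 2 := by
    intro r hr
    have h1 := hb r hr
    have h2 := hs r
    have h3 : B r = √(B r) ^ 2 := (sq_sqrt (hpos r).le).symm
    simp only [φ]
    rw [h3, sqrt_sq h2.le] at h1
    set S := √(B r)
    rw [le_div_iff₀ (by positivity), mul_comm (_ - _), ← sub_nonneg]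
    have : -(B' r / (2 * S)) - S ^ 2 * (μ * S⁻¹ - C / 2) =
        (-(2 * μ) * S ^ 2 + C * (S ^ 2 * S) - B' r) / (2 * S) := by field_simp; ring
    rw [this]
    exact div_nonneg (by linarith) (by positivity)
  have hφtop : Tendsto φ atTop atTop := by
    have h1 : Tendsto (fun r => √(B r)) atTop (𝓝[>] 0) := by
      rw [tendsto_nhdsWithin_iff]
      exact ⟨by simpa using h0.sqrt, Eventually.of_forall fun r => hs r⟩
    exact tendsto_inv_nhdsGT_zero.comp h1
  obtain ⟨r₁, hr₁, hr₁'⟩ :=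
    ((hφtop.eventually_gt_atTop (C / (2 * μ))).and (eventually_ge_atTop r₀)).exists
  have hmono := le_of_hasDerivAt_nonneg (t₀ := r₁)
    (f := fun r => exp (-μ * r) * (φ r - C / (2 * μ)))
    (fun r _ => (hasDerivAt_exp_mul (-μ) r).fun_mul ((hφ r).sub_const _)) (fun r hr => by
      have h1 := hφ' r (hr₁'.trans hr)
      have : -μ * exp (-μ * r) * (φ r - C / (2 * μ)) = -(exp (-μ * r) * (μ * φ r - C / 2)) := by
        field_simp
      rw [this]
      have := mul_le_mul_of_nonneg_left h1 (exp_pos (-μ * r)).le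
      linarith)
  set d := exp (-μ * r₁) * (φ r₁ - C / (2 * μ)) with hd
  have hd0 : 0 < d := mul_pos (exp_pos _) (by linarith)
  have hlow : ∀ r ≥ r₁, d * exp (μ * r) - |C / (2 * μ)| ≤ φ r := by
    intro r hr
    have h1 := hmono r hr
    have h2 : exp (-μ * r) * exp (μ * r) = 1 := by rw [← exp_add]; simp
    have h3 := mul_le_mul_of_nonneg_right h1 (exp_pos (μ * r)).le
    have h4 : exp (-μ * r) * (φ r - C / (2 * μ)) * exp (μ * r) = φ r - C / (2 * μ) := by
      rw [mul_right_comm, h2, one_mul]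
    rw [h4] at h3
    linarith [neg_abs_le (C / (2 * μ))]
  have hexp : Tendsto (fun r => d / 2 * exp (μ * r)) atTop atTop :=
    (tendsto_exp_atTop.comp (tendsto_id.const_mul_atTop hμ)).const_mul_atTop (by positivity)
  obtain ⟨r₂, hr₂⟩ := eventually_atTop.1 (hexp.eventually_ge_atTop |C / (2 * μ)|)
  refine ⟨4 / d ^ 2, by positivity, max r₁ r₂, hr₁'.trans (le_max_left _ _), fun r hr => ?_⟩
  have h1 := hlow r ((le_max_left _ _).trans hr)
  have h2 := hr₂ r ((le_max_right _ _).trans hr)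
  have h3 : d / 2 * exp (μ * r) ≤ φ r := by linarith
  have h4 : √(B r) ≤ (d / 2 * exp (μ * r))⁻¹ := by
    rw [← inv_inv (√(B r))]
    exact inv_anti₀ (by positivity) h3
  have h5 : B r ≤ ((d / 2 * exp (μ * r))⁻¹) ^ 2 := by
    rw [← sq_sqrt (hpos r).le]
    exact pow_le_pow_left₀ (hs r).le h4 2
  refine h5.trans_eq ?_
  have : exp (-(2 * μ * r)) = (exp (μ * r) ^ 2)⁻¹ := by
    rw [exp_neg, ← exp_nat_mul]
    push_cast; ring_nf
  rw [this]
  field_simp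
  norm_num

/-- The same substitution, now with `φ' ≤ μ φ + C / 2`; no smallness of `B` is needed. The bound
serves to exclude solutions that decay faster than the linear ones. -/
lemma decay_lower {B B' : ℝ → ℝ} {μ C r₀ : ℝ} (hμ : 0 < μ) (hC : 0 ≤ C) (hpos : ∀ r, 0 < B r)
    (hB : ∀ r, HasDerivAt B (B' r) r)
    (hb : ∀ r ≥ r₀, -(2 * μ) * B r - C * (B r * √(B r)) ≤ B' r) :
    ∃ c > 0, ∀ r ≥ r₀, c * exp (-(2 * μ * r)) ≤ B r := by
  let φ : ℝ → ℝ := fun r => (√(B r))⁻¹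
  have hs : ∀ r, 0 < √(B r) := fun r => sqrt_pos.2 (hpos r)
  have hφ : ∀ r, HasDerivAt φ (-(B' r / (2 * √(B r))) / √(B r) ^ 2) r := fun r =>
    ((hB r).sqrt (hpos r).ne').inv (hs r).ne'
  have hφ' : ∀ r ≥ r₀, -(B' r / (2 * √(B r))) / √(B r) ^ 2 ≤ μ * φ r + C / 2 := by
    intro r hr
    have h1 := hb r hr
    have h2 := hs r
    have h3 : B r = √(B r) ^ 2 := (sq_sqrt (hpos r).le).symm
    simp only [φ]
    rw [h3, sqrt_sq h2.le] at h1
    set S := √(B r)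
    rw [div_le_iff₀ (by positivity), mul_comm (_ + _), ← sub_nonneg]
    have : S ^ 2 * (μ * S⁻¹ + C / 2) - -(B' r / (2 * S)) =
        (B' r - (-(2 * μ) * S ^ 2 - C * (S ^ 2 * S))) / (2 * S) := by field_simp; ring
    rw [this]
    exact div_nonneg (by linarith) (by positivity)
  have hmono := le_of_hasDerivAt_nonneg (t₀ := r₀)
    (f := fun r => -(exp (-μ * r) * (φ r + C / (2 * μ))))
    (fun r _ => ((hasDerivAt_exp_mul (-μ) r).fun_mul ((hφ r).add_const _)).fun_neg)
    (fun r hr => by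
      have h1 := hφ' r hr
      have : -μ * exp (-μ * r) * (φ r + C / (2 * μ)) = -(exp (-μ * r) * (μ * φ r + C / 2)) := by
        field_simp
      rw [this]
      have := mul_le_mul_of_nonneg_left h1 (exp_pos (-μ * r)).le
      linarith)
  set d := exp (-μ * r₀) * (φ r₀ + C / (2 * μ)) with hd
  have hφ0 : 0 < φ r₀ := inv_pos.2 (hs r₀)
  have hd0 : 0 < d := by positivity
  refine ⟨1 / d ^ 2, by positivity, fun r hr => ?_⟩
  have hup : φ r ≤ d * exp (μ * r) := by
    have h1 := hmono r hr
    have h2 : exp (-μ * r) * exp (μ * r) = 1 := by rw [← exp_add]; simp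
    have h3 := mul_le_mul_of_nonneg_right (neg_le_neg_iff.1 h1) (exp_pos (μ * r)).le
    have h4 : exp (-μ * r) * (φ r + C / (2 * μ)) * exp (μ * r) = φ r + C / (2 * μ) := by
      rw [mul_right_comm, h2, one_mul]
    rw [h4] at h3
    have : 0 ≤ C / (2 * μ) := by positivity
    linarith
  have h4 : (d * exp (μ * r))⁻¹ ≤ √(B r) := by
    rw [← inv_inv (√(B r))]
    exact inv_anti₀ (inv_pos.2 (hs r)) hup
  have h5 : ((d * exp (μ * r))⁻¹) ^ 2 ≤ B r := by
    rw [← sq_sqrt (hpos r).le]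
    exact pow_le_pow_left₀ (by positivity) h4 2
  refine le_trans (le_of_eq ?_) h5
  have : exp (-(2 * μ * r)) = (exp (μ * r) ^ 2)⁻¹ := by
    rw [exp_neg, ← exp_nat_mul]
    push_cast; ring_nf
  rw [this]
  field_simp

end Perturbation
end WarpedVacuum
end

/-! ### The perturbed oscillator: underdamped case. -/

noncomputable section
namespace WarpedVacuum
section PerturbedOscillator
open Real

/-- A solution, tending to the origin, of the damped oscillator `w'' + K w' + 2 K w = N` with a
perturbation `N` which is of second order in `(w, w')`. -/
structure PerturbedOsc (K : ℝ) (w y N : ℝ → ℝ) : Prop where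
  dw : ∀ r, HasDerivAt w (y r) r
  dy : ∀ r, HasDerivAt y (-(K * y r) - 2 * K * w r + N r) r
  N_le : ∃ C ≥ 0, ∀ r, |N r| ≤ C * (w r ^ 2 + y r ^ 2)
  w_tendsto : Tendsto w atTop (𝓝 0)
  y_tendsto : Tendsto y atTop (𝓝 0)
  ne_zero : ∀ r, 0 < w r ^ 2 + y r ^ 2

variable {K : ℝ} {w y N : ℝ → ℝ}

namespace PerturbedOsc

lemma hasDerivAt_exp_mul_mode {x x' : ℝ → ℝ} {l : ℝ}
    (hx : ∀ r, HasDerivAt x (-(l * x r) + x' r) r) (r : ℝ) :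
    HasDerivAt (fun r => exp (l * r) * x r) (exp (l * r) * x' r) r :=
  ((hasDerivAt_exp_mul l r).fun_mul (hx r)).congr_deriv (by ring)

/-- With `l`, `l'` the negatives of the characteristic roots, this is the left eigenvector of the
linear part for the rate `l`. -/
lemma mode (h : PerturbedOsc K w y N) {l l' : ℝ} (h1 : l + l' = K) (h2 : l * l' = 2 * K) (r : ℝ) :
    HasDerivAt (fun r => y r + l' * w r) (-(l * (y r + l' * w r)) + N r) r :=
  ((h.dy r).fun_add ((h.dw r).const_mul l')).congr_deriv (by
    linear_combination (w r) * h2 + y r * h1)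

lemma isBigO_exp_of_le {f : ℝ → ℝ} {μ c r₀ : ℝ}
    (h : ∀ r ≥ r₀, |f r| ≤ c * exp (-(μ * r))) : f =O[atTop] fun r => exp (-(μ * r)) := by
  refine IsBigO.of_bound c ?_
  filter_upwards [eventually_ge_atTop r₀] with r hr
  simpa [abs_of_pos (exp_pos _)] using h r hr

/-- The underdamped case. -/
lemma spiral (h : PerturbedOsc K w y N) (hK : 0 < K) {ν : ℝ} (hν : 0 < ν)
    (hν2 : ν ^ 2 = 2 * K - K ^ 2 / 4) :
    (∃ α β : ℝ, (α ≠ 0 ∨ β ≠ 0) ∧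
      (fun r => w r - exp (-(K / 2 * r)) * (α * cos (ν * r) + β * sin (ν * r)))
        =O[atTop] fun r => exp (-(K * r))) ∧
    (fun r => w r ^ 2 + y r ^ 2) =O[atTop] fun r => exp (-(K * r)) := by
  obtain ⟨C, hC, hN⟩ := h.N_le
  -- In the variables `(x, ν w)` the linear part is damping by `K / 2` plus a rotation with
  -- frequency `ν`, so `B` satisfies `B' = -K B` up to the term with `N`.
  let x : ℝ → ℝ := fun r => y r + K / 2 * w r
  let B : ℝ → ℝ := fun r => x r ^ 2 + ν ^ 2 * w r ^ 2
  have hx : ∀ r, HasDerivAt x (-(K / 2 * x r) - ν ^ 2 * w r + N r) r := fun r =>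
    ((h.dy r).fun_add ((h.dw r).const_mul (K / 2))).congr_deriv (by
      simp only [x]; rw [hν2]; ring)
  have hw : ∀ r, HasDerivAt w (x r - K / 2 * w r) r := fun r =>
    (h.dw r).congr_deriv (by simp only [x]; ring)
  have hB : ∀ r, HasDerivAt B (-(2 * (K / 2)) * B r + 2 * x r * N r) r := fun r =>
    (((hx r).fun_pow 2).fun_add (((hw r).fun_pow 2).const_mul (ν ^ 2))).congr_deriv (by
      simp only [B]; push_cast; ring)
  set M : ℝ := 2 + (K ^ 2 / 2 + 1) / ν ^ 2 with hM
  have hM0 : 0 < M := by positivity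
  have hquad : ∀ r, w r ^ 2 + y r ^ 2 ≤ M * B r := by
    intro r
    have e : y r = x r - K / 2 * w r := by simp only [x]; ring
    have h1 : M * B r = 2 * x r ^ 2 + (K ^ 2 / 2 + 1) * w r ^ 2 + (2 * ν ^ 2 * w r ^ 2
        + (K ^ 2 / 2 + 1) / ν ^ 2 * x r ^ 2) := by
      simp only [hM, B]; field_simp; ring
    have h2 : 0 ≤ 2 * ν ^ 2 * w r ^ 2 + (K ^ 2 / 2 + 1) / ν ^ 2 * x r ^ 2 := by positivity
    rw [h1, e]
    nlinarith [sq_nonneg (x r + K / 2 * w r)]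
  have hBpos : ∀ r, 0 < B r := fun r => by
    have := (h.ne_zero r).trans_le (hquad r)
    exact (mul_pos_iff_of_pos_left hM0).1 this
  have hBt : Tendsto B atTop (𝓝 0) := by
    have := ((h.y_tendsto.add (h.w_tendsto.const_mul (K / 2))).pow 2).add
      ((h.w_tendsto.pow 2).const_mul (ν ^ 2))
    simpa using this
  have hxN : ∀ r, |2 * x r * N r| ≤ 2 * C * M * (B r * √(B r)) := by
    intro r
    have h1 : |x r| ≤ √(B r) := abs_le_sqrt (by simp only [B]; nlinarith [mul_nonneg (sq_nonneg ν) (sq_nonneg (w r))])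
    have h2 := (hN r).trans (mul_le_mul_of_nonneg_left (hquad r) hC)
    rw [abs_mul, abs_mul, abs_two]
    calc 2 * |x r| * |N r| ≤ 2 * √(B r) * (C * (M * B r)) := by gcongr
      _ = _ := by ring
  obtain ⟨c₁, hc₁, r₁, hr₁, hup⟩ := decay_upper (r₀ := 0) (C := 2 * C * M) (half_pos hK) hBpos hB hBt
    (fun r _ => by linarith [le_abs_self (2 * x r * N r), hxN r])
  obtain ⟨c₂, hc₂, hlow⟩ := decay_lower (r₀ := 0) (C := 2 * C * M) (half_pos hK) (by positivity) hBpos hB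
    (fun r _ => by linarith [neg_abs_le (2 * x r * N r), hxN r])
  have e2 : ∀ r, exp (-(2 * (K / 2) * r)) = exp (-(K * r)) := fun r => by ring_nf
  simp only [e2] at hup hlow
  have hE : ∀ r, exp (-(K / 2 * r)) * exp (-(K / 2 * r)) = exp (-(K * r)) := fun r => by
    rw [← exp_add]; ring_nf
  have hE' : ∀ r, exp (K / 2 * r) * exp (-(K * r)) = exp (-(K / 2 * r)) := fun r => by
    rw [← exp_add]; ring_nf
  have hE'' : ∀ r, exp (-(K / 2 * r)) * exp (K / 2 * r) = 1 := fun r => by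
    rw [← exp_add]; simp
  have hNe : ∀ r ≥ r₁, |exp (K / 2 * r) * N r| ≤ C * M * c₁ * exp (-(K / 2 * r)) := by
    intro r hr
    have h2 := (hN r).trans (mul_le_mul_of_nonneg_left (hquad r) hC)
    rw [abs_mul, abs_of_pos (exp_pos _)]
    calc exp (K / 2 * r) * |N r| ≤ exp (K / 2 * r) * (C * (M * (c₁ * exp (-(K * r))))) := by
          gcongr; exact h2.trans (by gcongr; exact hup r hr)
      _ = C * M * c₁ * (exp (K / 2 * r) * exp (-(K * r))) := by ring
      _ = _ := by rw [hE']
  have hcos : ∀ r, HasDerivAt (fun r => cos (ν * r)) (-(ν * sin (ν * r))) r := fun r =>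
    (((hasDerivAt_id r).const_mul ν).cos).congr_deriv (by simp; ring)
  have hsin : ∀ r, HasDerivAt (fun r => sin (ν * r)) (ν * cos (ν * r)) r := fun r =>
    (((hasDerivAt_id r).const_mul ν).sin).congr_deriv (by simp; ring)
  -- Undoing damping and rotation gives quantities that are constant for `N = 0`; as `N = O(exp (-K
  -- r))`, their derivatives are `O(exp (-K r / 2))` and they converge.
  let u₁ : ℝ → ℝ := fun r => exp (K / 2 * r) * (x r * cos (ν * r) + ν * w r * sin (ν * r))
  let u₂ : ℝ → ℝ := fun r => exp (K / 2 * r) * (x r * sin (ν * r) - ν * w r * cos (ν * r))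
  have hu₁ : ∀ r, HasDerivAt u₁ (exp (K / 2 * r) * N r * cos (ν * r)) r := fun r =>
    ((hasDerivAt_exp_mul (K / 2) r).fun_mul (((hx r).fun_mul (hcos r)).fun_add
      (((hw r).const_mul ν).fun_mul (hsin r)))).congr_deriv (by ring)
  have hu₂ : ∀ r, HasDerivAt u₂ (exp (K / 2 * r) * N r * sin (ν * r)) r := fun r =>
    ((hasDerivAt_exp_mul (K / 2) r).fun_mul (((hx r).fun_mul (hsin r)).fun_sub
      (((hw r).const_mul ν).fun_mul (hcos r)))).congr_deriv (by ring)
  obtain ⟨l₁, hl₁⟩ := exists_limit_of_exp_decay (C := C * M * c₁) (half_pos hK)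
    (fun r (_ : r ≥ r₁) => hu₁ r) (fun r hr => by
      rw [norm_eq_abs, abs_mul]
      exact (mul_le_of_le_one_right (abs_nonneg _) (abs_cos_le_one _)).trans (hNe r hr))
  obtain ⟨l₂, hl₂⟩ := exists_limit_of_exp_decay (C := C * M * c₁) (half_pos hK)
    (fun r (_ : r ≥ r₁) => hu₂ r) (fun r hr => by
      rw [norm_eq_abs, abs_mul]
      exact (mul_le_of_le_one_right (abs_nonneg _) (abs_sin_le_one _)).trans (hNe r hr))
  set c := C * M * c₁ / (K / 2) with hc
  have hc0 : 0 ≤ c := by positivity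
  simp only [norm_eq_abs] at hl₁ hl₂
  have hwu : ∀ r, w r = exp (-(K / 2 * r)) * (u₁ r * sin (ν * r) - u₂ r * cos (ν * r)) / ν := by
    intro r
    have : exp (-(K / 2 * r)) * (u₁ r * sin (ν * r) - u₂ r * cos (ν * r)) =
        (exp (-(K / 2 * r)) * exp (K / 2 * r)) * (ν * w r * (sin (ν * r) ^ 2 + cos (ν * r) ^ 2)) := by
      simp only [u₁, u₂]; ring
    rw [this, hE'', sin_sq_add_cos_sq]
    field_simp
  have hBu : ∀ r, u₁ r ^ 2 + u₂ r ^ 2 = exp (K * r) * B r := by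
    intro r
    have : u₁ r ^ 2 + u₂ r ^ 2 = (exp (K / 2 * r) * exp (K / 2 * r)) *
        (B r * (sin (ν * r) ^ 2 + cos (ν * r) ^ 2)) := by simp only [u₁, u₂, B]; ring
    rw [this, sin_sq_add_cos_sq, ← exp_add]; ring_nf
  refine ⟨⟨-l₂ / ν, l₁ / ν, ?_, ?_⟩, ?_⟩
  -- If both limits vanished, `B` would be `O(exp (-2 K r))`, against the lower bound by a multiple
  -- of `exp (-K r)`.
  · by_contra hcon
    push Not at hcon
    have z₁ : l₁ = 0 := by simpa [hν.ne'] using hcon.2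
    have z₂ : l₂ = 0 := by simpa [hν.ne'] using hcon.1
    rw [z₁] at hl₁
    rw [z₂] at hl₂
    have hlim : Tendsto (fun r => 2 * c ^ 2 * exp (-(K * r))) atTop (𝓝 0) := by
      simpa using (tendsto_exp_neg_mul hK).const_mul (2 * c ^ 2)
    obtain ⟨r, hr, hrr⟩ := ((hlim.eventually_lt_const hc₂).and (eventually_ge_atTop (max r₁ 0))).exists
    have h1 := hl₁ r ((le_max_left _ _).trans hrr)
    have h2 := hl₂ r ((le_max_left _ _).trans hrr)
    have h3 := hlow r ((le_max_right _ _).trans hrr)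
    rw [sub_zero] at h1 h2
    have h4 := pow_le_pow_left₀ (abs_nonneg _) h1 2
    have h5 := pow_le_pow_left₀ (abs_nonneg _) h2 2
    rw [sq_abs] at h4 h5
    have h6 : (c * exp (-(K / 2 * r))) ^ 2 = c ^ 2 * exp (-(K * r)) := by rw [← hE]; ring
    have h7 : c₂ ≤ exp (K * r) * B r := by
      have := mul_le_mul_of_nonneg_left h3 (exp_pos (K * r)).le
      have e : exp (K * r) * (c₂ * exp (-(K * r))) = c₂ := by
        rw [mul_left_comm, ← exp_add]; simp
      rwa [e] at this
    rw [← hBu] at h7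
    linarith
  · refine isBigO_exp_of_le (c := 2 * c / ν) (r₀ := r₁) fun r hr => ?_
    have h1 := hl₁ r hr
    have h2 := hl₂ r hr
    have e : w r - exp (-(K / 2 * r)) * (-l₂ / ν * cos (ν * r) + l₁ / ν * sin (ν * r)) =
        exp (-(K / 2 * r)) * ((u₁ r - l₁) * sin (ν * r) - (u₂ r - l₂) * cos (ν * r)) / ν := by
      rw [hwu r]; ring
    rw [e, abs_div, abs_mul, abs_of_pos (exp_pos _), abs_of_pos hν, div_mul_eq_mul_div (2 * c)]
    refine div_le_div_of_nonneg_right ?_ hν.le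
    rw [← hE]
    have h3 : |(u₁ r - l₁) * sin (ν * r) - (u₂ r - l₂) * cos (ν * r)| ≤
        2 * (c * exp (-(K / 2 * r))) := by
      refine (abs_sub _ _).trans ?_
      rw [abs_mul, abs_mul]
      have := (mul_le_of_le_one_right (abs_nonneg (u₁ r - l₁)) (abs_sin_le_one (ν * r)))
      have := (mul_le_of_le_one_right (abs_nonneg (u₂ r - l₂)) (abs_cos_le_one (ν * r)))
      linarith
    calc _ ≤ exp (-(K / 2 * r)) * (2 * (c * exp (-(K / 2 * r)))) := by gcongr
      _ = _ := by ring
  · refine isBigO_exp_of_le (c := M * c₁) (r₀ := r₁) fun r hr => ?_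
    rw [abs_of_pos (h.ne_zero r), mul_assoc]
    exact (hquad r).trans (by gcongr; exact hup r hr)

end PerturbedOsc
end PerturbedOscillator
end WarpedVacuum
end

/-! ### The perturbed oscillator: critically damped and overdamped cases. -/

noncomputable section
namespace WarpedVacuum
section PerturbedOscillatorReal
open Real

variable {K : ℝ} {w y N : ℝ → ℝ}

namespace PerturbedOsc

lemma two_mul_add_mul_le {x₁ x₂ n q C M B : ℝ} (hC : 0 ≤ C) (hB : B = x₁ ^ 2 + x₂ ^ 2)
    (hn : |n| ≤ C * q) (hq : q ≤ M * B) :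
    |2 * (x₁ + x₂) * n| ≤ 4 * C * M * (B * √B) ∧ |2 * x₁ * n| ≤ 4 * C * M * (B * √B) := by
  have hx₁ : |x₁| ≤ √B := abs_le_sqrt (by rw [hB]; linarith [sq_nonneg x₂])
  have hx₂ : |x₂| ≤ √B := abs_le_sqrt (by rw [hB]; linarith [sq_nonneg x₁])
  have h2 : |n| ≤ C * (M * B) := hn.trans (mul_le_mul_of_nonneg_left hq hC)
  have hB0 : 0 ≤ B := by rw [hB]; positivity
  have h3 : |x₁ + x₂| ≤ 2 * √B := (abs_add_le _ _).trans (by linarith)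
  constructor
  · rw [abs_mul, abs_mul, abs_two]
    calc 2 * |x₁ + x₂| * |n| ≤ 2 * (2 * √B) * (C * (M * B)) := by gcongr
      _ = _ := by ring
  · rw [abs_mul, abs_mul, abs_two]
    calc 2 * |x₁| * |n| ≤ 2 * (2 * √B) * (C * (M * B)) := by
          gcongr; linarith [sqrt_nonneg B]
      _ = _ := by ring

/-- The critically damped case. -/
lemma degenerate (h : PerturbedOsc 8 w y N) :
    (∃ α β : ℝ, (α ≠ 0 ∨ β ≠ 0) ∧
      (fun r => w r - exp (-(4 * r)) * (α + β * r)) =O[atTop] fun r => r ^ 2 * exp (-(8 * r))) ∧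
    (fun r => w r ^ 2 + y r ^ 2) =O[atTop] fun r => r ^ 2 * exp (-(8 * r)) := by
  obtain ⟨C, hC, hN⟩ := h.N_le
  -- The linear part is a Jordan block with rate 4 in the variables `z`, `w`.
  let z : ℝ → ℝ := fun r => y r + 4 * w r
  let B : ℝ → ℝ := fun r => z r ^ 2 + w r ^ 2
  have hz : ∀ r, HasDerivAt z (-(4 * z r) + N r) r := h.mode (by norm_num) (by norm_num)
  have hw : ∀ r, HasDerivAt w (-(4 * w r) + z r) r := fun r =>
    (h.dw r).congr_deriv (by simp only [z]; ring)
  have hB : ∀ r, HasDerivAt B (-8 * B r + 2 * (z r * w r) + 2 * z r * N r) r := fun r =>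
    (((hz r).fun_pow 2).fun_add ((hw r).fun_pow 2)).congr_deriv (by
      simp only [B]; push_cast; ring)
  have hquad : ∀ r, w r ^ 2 + y r ^ 2 ≤ 33 * B r := by
    intro r
    have e : y r = z r - 4 * w r := by simp only [z]; ring
    rw [e]
    simp only [B]
    nlinarith [sq_nonneg (z r + 4 * w r), sq_nonneg (z r)]
  have hBpos : ∀ r, 0 < B r := fun r => by
    have := (h.ne_zero r).trans_le (hquad r)
    linarith
  have hBt : Tendsto B atTop (𝓝 0) := by
    simpa using ((h.y_tendsto.add (h.w_tendsto.const_mul 4)).pow 2).add (h.w_tendsto.pow 2)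
  have hzN : ∀ r, |2 * z r * N r| ≤ 4 * C * 33 * (B r * √(B r)) := fun r =>
    (two_mul_add_mul_le hC rfl (hN r) (hquad r)).2
  have hzw : ∀ r, |2 * (z r * w r)| ≤ B r := by
    intro r
    rw [abs_le]
    constructor <;> simp only [B] <;> nlinarith [sq_nonneg (z r + w r), sq_nonneg (z r - w r)]
  -- The coupling `2 z w` is at most `B`, so the rate 8 is known only up to 1. The bounds with 7 and
  -- 9 suffice: the first starts the bootstrap, the second excludes a vanishing leading term.
  obtain ⟨c₁, hc₁, r₁, hr₁, hup⟩ := decay_upper (μ := 7 / 2) (r₀ := 1) (C := 4 * C * 33)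
    (by norm_num) hBpos hB hBt
    (fun r _ => by linarith [le_abs_self (2 * z r * N r), hzN r, le_abs_self (2 * (z r * w r)), hzw r])
  obtain ⟨c₂, hc₂, hlow⟩ := decay_lower (μ := 9 / 2) (r₀ := 0) (C := 4 * C * 33) (by norm_num)
    (by positivity) hBpos hB
    (fun r _ => by linarith [neg_abs_le (2 * z r * N r), hzN r, neg_abs_le (2 * (z r * w r)), hzw r])
  have hNB : ∀ r, |N r| ≤ C * 33 * B r := fun r =>
    (hN r).trans ((mul_le_mul_of_nonneg_left (hquad r) hC).trans_eq (by ring))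
  have hu : ∀ r, HasDerivAt (fun r => exp (4 * r) * z r) (exp (4 * r) * N r) r :=
    hasDerivAt_exp_mul_mode hz
  have hu' : ∀ β r, HasDerivAt (fun r => exp (4 * r) * w r - β * r) (exp (4 * r) * z r - β) r :=
    fun β r => ((hasDerivAt_exp_mul_mode hw r).fun_sub
      ((hasDerivAt_id r).const_mul β)).congr_deriv (by simp)
  have hinv : ∀ r, exp (-(4 * r)) * exp (4 * r) = 1 := fun r => by rw [← exp_add]; simp
  have key : ∀ f : ℝ → ℝ, ∀ c r ℓ : ℝ, |exp (4 * r) * f r - ℓ| ≤ c →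
      |f r - exp (-(4 * r)) * ℓ| ≤ exp (-(4 * r)) * c := by
    intro f c r ℓ hf
    have : f r - exp (-(4 * r)) * ℓ = exp (-(4 * r)) * (exp (4 * r) * f r - ℓ) := by
      linear_combination (-f r) * hinv r
    rw [this, abs_mul, abs_of_pos (exp_pos _)]
    gcongr
  -- first approximation
  obtain ⟨β₀, hβ₀⟩ := exists_limit_of_exp_decay (μ := 3) (C := C * 33 * c₁) (by norm_num)
    (fun r (_ : r ≥ r₁) => hu r) (fun r hr => by
      rw [norm_eq_abs, abs_mul, abs_of_pos (exp_pos _)]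
      have h1 := hup r hr
      calc exp (4 * r) * |N r| ≤ exp (4 * r) * (C * 33 * (c₁ * exp (-(2 * (7 / 2) * r)))) := by
            gcongr; exact (hNB r).trans (by gcongr)
        _ = C * 33 * c₁ * (exp (4 * r) * exp (-(2 * (7 / 2) * r))) := by ring
        _ = _ := by rw [← exp_add]; ring_nf)
  simp only [norm_eq_abs] at hβ₀
  obtain ⟨α₀, hα₀⟩ := exists_limit_of_exp_decay (μ := 3) (C := C * 33 * c₁ / 3) (by norm_num)
    (fun r (_ : r ≥ r₁) => hu' β₀ r) (fun r hr => by
      rw [norm_eq_abs]; exact hβ₀ r hr)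
  simp only [norm_eq_abs] at hα₀
  have hr₁0 : 0 ≤ r₁ := zero_le_one.trans hr₁
  obtain ⟨D, hD0, hD⟩ : ∃ D ≥ 0, ∀ r ≥ r₁, B r ≤ D * (r ^ 2 * exp (-(8 * r))) := by
    set c := C * 33 * c₁ / 3 with hc
    have hc0 : 0 ≤ c := by positivity
    refine ⟨(c + |β₀|) ^ 2 + (c / 3 + |α₀| + |β₀|) ^ 2, by positivity, fun r hr => ?_⟩
    have hr1 : 1 ≤ r := hr₁.trans hr
    have he : exp (-(3 * r)) ≤ 1 := exp_le_one_iff.2 (by linarith)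
    have h1 : |exp (4 * r) * z r| ≤ (c + |β₀|) * r := by
      have := (abs_sub_abs_le_abs_sub _ _).trans (hβ₀ r hr)
      have h3 : c * exp (-(3 * r)) ≤ c := mul_le_of_le_one_right hc0 he
      have h4 : c + |β₀| ≤ (c + |β₀|) * r := le_mul_of_one_le_right (by positivity) hr1
      linarith
    have h2 : |exp (4 * r) * w r| ≤ (c / 3 + |α₀| + |β₀|) * r := by
      have h5 := (abs_sub_abs_le_abs_sub _ _).trans (hα₀ r hr)
      have h6 := abs_sub_abs_le_abs_sub (exp (4 * r) * w r) (β₀ * r)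
      rw [abs_mul β₀, abs_of_nonneg (zero_le_one.trans hr1)] at h6
      have h3 : c / 3 * exp (-(3 * r)) ≤ c / 3 := mul_le_of_le_one_right (by positivity) he
      have h4 : c / 3 + |α₀| ≤ (c / 3 + |α₀|) * r := le_mul_of_one_le_right (by positivity) hr1
      linarith
    have h7 := pow_le_pow_left₀ (abs_nonneg _) h1 2
    have h8 := pow_le_pow_left₀ (abs_nonneg _) h2 2
    rw [sq_abs] at h7 h8
    have h9 : B r = (exp (-(4 * r)) * exp (-(4 * r))) *
        ((exp (4 * r) * z r) ^ 2 + (exp (4 * r) * w r) ^ 2) := by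
      have e : exp (-(4 * r)) * exp (-(4 * r)) * (exp (4 * r) * exp (4 * r)) = 1 := by
        rw [mul_mul_mul_comm, hinv, one_mul]
      simp only [B]
      linear_combination (-(z r ^ 2 + w r ^ 2)) * e
    have e8 : exp (-(4 * r)) * exp (-(4 * r)) = exp (-(8 * r)) := by rw [← exp_add]; ring_nf
    rw [h9, e8]
    calc _ ≤ exp (-(8 * r)) * (((c + |β₀|) * r) ^ 2 + ((c / 3 + |α₀| + |β₀|) * r) ^ 2) := by
          gcongr exp (-(8 * r)) * ?_
          linarith
      _ = _ := by ring
  -- second approximation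
  obtain ⟨β, hβ⟩ := exists_limit_of_sq_exp_decay (C := C * 33 * D) hr₁
    (fun r (_ : r ≥ r₁) => hu r) (by positivity) (fun r hr => by
      rw [abs_mul, abs_of_pos (exp_pos _)]
      have h1 := hD r hr
      calc exp (4 * r) * |N r| ≤ exp (4 * r) * (C * 33 * (D * (r ^ 2 * exp (-(8 * r))))) := by
            gcongr; exact (hNB r).trans (by gcongr)
        _ = C * 33 * D * (r ^ 2 * (exp (4 * r) * exp (-(8 * r)))) := by ring
        _ = _ := by rw [← exp_add]; ring_nf)
  obtain ⟨α, hα⟩ := exists_limit_of_sq_exp_decay (C := C * 33 * D) hr₁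
    (fun r (_ : r ≥ r₁) => hu' β r) (by positivity) hβ
  set c := C * 33 * D with hc
  have hc0 : 0 ≤ c := by positivity
  have e8 : ∀ r, exp (-(4 * r)) * exp (-(4 * r)) = exp (-(8 * r)) := fun r => by
    rw [← exp_add]; ring_nf
  have hwb : ∀ r ≥ r₁, |w r - exp (-(4 * r)) * (α + β * r)| ≤ c * (r ^ 2 * exp (-(8 * r))) := by
    intro r hr
    refine (key w _ r (α + β * r) ?_).trans_eq (b := exp (-(4 * r)) * (c * (r ^ 2 * exp (-(4 * r))))) ?_
    · have := hα r hr
      rwa [sub_sub, add_comm (β * r)] at this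
    · rw [← e8]; ring
  refine ⟨⟨α, β, ?_, ?_⟩, ?_⟩
  -- For `α = β = 0` the bounds give `B = O(r⁴ exp (-16 r))`, which is incompatible with the lower
  -- bound of rate 9.
  · by_contra hcon
    push Not at hcon
    obtain ⟨rfl, rfl⟩ := hcon
    have hzb : ∀ r ≥ r₁, |z r| ≤ c * (r ^ 2 * exp (-(8 * r))) := by
      intro r hr
      have := key z _ r 0 (hβ r hr)
      rw [mul_zero, sub_zero] at this
      refine this.trans_eq ?_
      rw [← e8]; ring
    have hlim : Tendsto (fun r => 2 * c ^ 2 * (r ^ 4 * exp (-r) * exp (-(6 * r)))) atTop (𝓝 0) := by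
      have h1 := tendsto_pow_mul_exp_neg_atTop_nhds_zero 4
      simpa using (h1.mul (tendsto_exp_neg_mul (by norm_num : (0 : ℝ) < 6))).const_mul (2 * c ^ 2)
    obtain ⟨r, hr, hrr⟩ := ((hlim.eventually_lt_const hc₂).and (eventually_ge_atTop r₁)).exists
    have h1 := hwb r hrr
    have h2 := hzb r hrr
    simp only [zero_mul, add_zero, mul_zero, sub_zero] at h1
    have h3 := hlow r (hr₁0.trans hrr)
    have h4 := pow_le_pow_left₀ (abs_nonneg _) h1 2
    have h5 := pow_le_pow_left₀ (abs_nonneg _) h2 2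
    rw [sq_abs] at h4 h5
    have h6 : c₂ * exp (-(2 * (9 / 2) * r)) ≤ 2 * (c * (r ^ 2 * exp (-(8 * r)))) ^ 2 := by
      simp only [B] at h3
      linarith
    have h7 : 2 * (c * (r ^ 2 * exp (-(8 * r)))) ^ 2 =
        2 * c ^ 2 * (r ^ 4 * exp (-r) * exp (-(6 * r))) * exp (-(2 * (9 / 2) * r)) := by
      have : exp (-(8 * r)) ^ 2 = exp (-r) * exp (-(6 * r)) * exp (-(2 * (9 / 2) * r)) := by
        rw [← exp_add, ← exp_add, ← exp_nat_mul]; push_cast; ring_nf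
      linear_combination 2 * c ^ 2 * r ^ 4 * this
    rw [h7] at h6
    exact absurd (le_of_mul_le_mul_right h6 (exp_pos _)) (not_le.2 hr)
  · refine IsBigO.of_bound c ?_
    filter_upwards [eventually_ge_atTop r₁] with r hr
    rw [norm_eq_abs, norm_eq_abs, abs_of_nonneg (by positivity : 0 ≤ r ^ 2 * exp (-(8 * r)))]
    exact hwb r hr
  · refine IsBigO.of_bound (33 * D) ?_
    filter_upwards [eventually_ge_atTop r₁] with r hr
    rw [norm_eq_abs, norm_eq_abs, abs_of_nonneg (by positivity : 0 ≤ r ^ 2 * exp (-(8 * r))),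
      abs_of_pos (h.ne_zero r)]
    linarith [hquad r, hD r hr]

/-- The overdamped case. -/
lemma node (h : PerturbedOsc K w y N) {l l' : ℝ} (hl : 0 < l) (hl' : 2 * l ≤ l')
    (h1 : l + l' = K) (h2 : l * l' = 2 * K) {e : ℝ → ℝ} (he : (∀ r, e r = r) ∨
      (∀ r, e r = 1) ∧ (2 * l < l' ∨ ∃ C, ∀ r, |N r| ≤ C * √(w r ^ 2 + y r ^ 2) ^ 3)) :
    (∃ c₀ : ℝ, (fun r => w r - c₀ * exp (-(l * r))) =O[atTop] (fun r => e r * exp (-(2 * l * r))) ∧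
        (c₀ = 0 → ∃ C, ∀ᶠ r in atTop, |y r| ≤ C * |w r|)) ∧
    (fun r => w r ^ 2 + y r ^ 2) =O[atTop] fun r => exp (-(2 * l * r)) := by
  obtain ⟨C, hC, hN⟩ := h.N_le
  have hll : 0 < l' - l := by linarith
  -- `z` is the slow mode, of rate `l`, and `x` the fast one, of rate `l'`; `w` is a multiple of `z
  -- - x`.
  let z : ℝ → ℝ := fun r => y r + l' * w r
  let x : ℝ → ℝ := fun r => y r + l * w r
  let B : ℝ → ℝ := fun r => z r ^ 2 + x r ^ 2
  have hz : ∀ r, HasDerivAt z (-(l * z r) + N r) r := h.mode h1 h2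
  have hx : ∀ r, HasDerivAt x (-(l' * x r) + N r) r := h.mode (by linarith) (by linarith)
  have hw : ∀ r, w r = (z r - x r) / (l' - l) := fun r => by
    simp only [z, x]; field_simp; ring
  have hB : ∀ r, HasDerivAt B (-(2 * l) * B r - 2 * (l' - l) * x r ^ 2 + 2 * (z r + x r) * N r) r :=
    fun r => (((hz r).fun_pow 2).fun_add ((hx r).fun_pow 2)).congr_deriv (by
      simp only [B]; push_cast; ring)
  set M : ℝ := 2 + (2 + 2 * l ^ 2) * (2 / (l' - l) ^ 2) with hM
  have hM0 : 0 < M := by positivity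
  have hquad : ∀ r, w r ^ 2 + y r ^ 2 ≤ M * B r := by
    intro r
    have ey : y r = x r - l * w r := by simp only [x]; ring
    have e1 : w r ^ 2 ≤ 2 / (l' - l) ^ 2 * B r := by
      rw [hw r, div_pow, div_mul_eq_mul_div]
      gcongr
      simp only [B]
      nlinarith [sq_nonneg (z r + x r)]
    have e2 : x r ^ 2 ≤ B r := by simp only [B]; nlinarith [sq_nonneg (z r)]
    have e3 : y r ^ 2 ≤ 2 * x r ^ 2 + 2 * l ^ 2 * w r ^ 2 := by
      rw [ey]; nlinarith [sq_nonneg (x r + l * w r)]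
    have e4 := mul_le_mul_of_nonneg_left e1 (by positivity : 0 ≤ 1 + 2 * l ^ 2)
    have e5 : 0 ≤ 2 / (l' - l) ^ 2 * B r := (sq_nonneg _).trans e1
    rw [hM]
    nlinarith
  have hBpos : ∀ r, 0 < B r := fun r =>
    (mul_pos_iff_of_pos_left hM0).1 ((h.ne_zero r).trans_le (hquad r))
  have hBt : Tendsto B atTop (𝓝 0) := by
    simpa using ((h.y_tendsto.add (h.w_tendsto.const_mul l')).pow 2).add
      ((h.y_tendsto.add (h.w_tendsto.const_mul l)).pow 2)
  have hBN : ∀ r, |2 * (z r + x r) * N r| ≤ 4 * C * M * (B r * √(B r)) := fun r =>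
    (two_mul_add_mul_le hC rfl (hN r) (hquad r)).1
  obtain ⟨c₁, hc₁, r₁, hr₁, hup⟩ := decay_upper (r₀ := 1) (C := 4 * C * M) hl hBpos hB hBt
    (fun r _ => by
      have : 0 ≤ 2 * (l' - l) * x r ^ 2 := by positivity
      linarith [le_abs_self (2 * (z r + x r) * N r), hBN r])
  have hNB : ∀ r, |N r| ≤ C * M * B r := fun r =>
    (hN r).trans ((mul_le_mul_of_nonneg_left (hquad r) hC).trans_eq (by ring))
  have hNe : ∀ r ≥ r₁, |N r| ≤ C * M * c₁ * exp (-(2 * l * r)) := fun r hr => by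
    rw [mul_assoc (C * M)]
    exact (hNB r).trans (by gcongr; exact hup r hr)
  have hinv : ∀ μ r, exp (-(μ * r)) * exp (μ * r) = 1 := fun μ r => by rw [← exp_add]; simp
  have key : ∀ f : ℝ → ℝ, ∀ μ c r ℓ : ℝ, |exp (μ * r) * f r - ℓ| ≤ c →
      |f r - exp (-(μ * r)) * ℓ| ≤ exp (-(μ * r)) * c := by
    intro f μ c r ℓ hf
    have : f r - exp (-(μ * r)) * ℓ = exp (-(μ * r)) * (exp (μ * r) * f r - ℓ) := by
      linear_combination (-f r) * hinv μ r
    rw [this, abs_mul, abs_of_pos (exp_pos _)]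
    gcongr
  obtain ⟨z₀, hz₀⟩ := exists_limit_of_exp_decay (μ := l) (C := C * M * c₁) hl
    (fun r (_ : r ≥ r₁) => hasDerivAt_exp_mul_mode hz r) (fun r hr => by
      rw [norm_eq_abs, abs_mul, abs_of_pos (exp_pos _)]
      calc exp (l * r) * |N r| ≤ exp (l * r) * (C * M * c₁ * exp (-(2 * l * r))) := by
            gcongr; exact hNe r hr
        _ = C * M * c₁ * (exp (l * r) * exp (-(2 * l * r))) := by ring
        _ = _ := by rw [← exp_add]; ring_nf)
  simp only [norm_eq_abs] at hz₀
  have hzO : ∀ r ≥ r₁, |z r - exp (-(l * r)) * z₀| ≤ C * M * c₁ / l * exp (-(2 * l * r)) := by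
    intro r hr
    refine (key z l _ r z₀ (hz₀ r hr)).trans_eq ?_
    rw [mul_left_comm, ← exp_add]; ring_nf
  -- the fast mode
  have hfast : ∀ G g : ℝ → ℝ, (∀ r, HasDerivAt G (g r) r) →
      (∀ r ≥ r₁, exp (l' * r) * |N r| ≤ g r) →
      ∀ r ≥ r₁, |x r| ≤ exp (-(l' * r)) * (|exp (l' * r₁) * x r₁| + (G r - G r₁)) := by
    intro G g hG hg r hr
    have h3 := norm_sub_le_of_norm_deriv_le (r₀ := r₁) (fun r _ => hasDerivAt_exp_mul_mode hx r)
      (fun r _ => hG r) (fun r hr => by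
        rw [norm_eq_abs, abs_mul, abs_of_pos (exp_pos _)]; exact hg r hr) le_rfl hr
    rw [norm_eq_abs] at h3
    have h4 := key x l' (|exp (l' * r₁) * x r₁| + (G r - G r₁)) r 0 (by
      rw [sub_zero]
      linarith [abs_sub_abs_le_abs_sub (exp (l' * r) * x r) (exp (l' * r₁) * x r₁)])
    rwa [mul_zero, sub_zero] at h4
  set c₂ := C * M * c₁ with hc₂
  have hc₂0 : 0 ≤ c₂ := by positivity
  have hexp' : ∀ r ≥ r₁, exp (-(l' * r)) ≤ exp (-(2 * l * r)) := fun r hr =>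
    exp_le_exp.2 (by nlinarith)
  set a := |exp (l' * r₁) * x r₁| with ha
  have ha0 : 0 ≤ a := abs_nonneg _
  have hslow : l' = 2 * l ∨ 2 * l < l' := hl'.eq_or_lt.imp_left Eq.symm
  have hlt : 2 * l < l' → ∀ r ≥ r₁, |x r| ≤ (a + c₂ / (l' - 2 * l)) * exp (-(2 * l * r)) := by
    intro hlt r hr
    have hpos : 0 < l' - 2 * l := by linarith
    have h3 := hfast (fun r => c₂ / (l' - 2 * l) * exp ((l' - 2 * l) * r))
      (fun r => c₂ * exp ((l' - 2 * l) * r))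
      (fun r => ((hasDerivAt_exp_mul (l' - 2 * l) r).const_mul _).congr_deriv
        (by field_simp)) (fun r hr => by
        calc exp (l' * r) * |N r| ≤ exp (l' * r) * (c₂ * exp (-(2 * l * r))) := by
              gcongr; exact hNe r hr
          _ = c₂ * (exp (l' * r) * exp (-(2 * l * r))) := by ring
          _ = _ := by rw [← exp_add]; ring_nf) r hr
    have e1 : exp (-(l' * r)) * exp ((l' - 2 * l) * r) = exp (-(2 * l * r)) := by
      rw [← exp_add]; ring_nf
    have e2 := mul_le_mul_of_nonneg_left (hexp' r hr) ha0
    have e3 : 0 ≤ exp (-(l' * r)) * (c₂ / (l' - 2 * l) * exp ((l' - 2 * l) * r₁)) := by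
      positivity
    calc |x r| ≤ _ := h3
      _ = a * exp (-(l' * r)) + c₂ / (l' - 2 * l) * (exp (-(l' * r)) * exp ((l' - 2 * l) * r))
          - exp (-(l' * r)) * (c₂ / (l' - 2 * l) * exp ((l' - 2 * l) * r₁)) := by ring
      _ ≤ _ := by rw [e1]; linarith
  have he1 : ∀ r ≥ r₁, 1 ≤ e r := fun r hr => by
    rcases he with he | he
    · rw [he]; exact hr₁.trans hr
    · rw [he.1]
  -- For `l' = 2 l` the quadratic forcing resonates with the fast mode: `exp (l' r) N` is merely
  -- bounded and its integral grows like `r`. A cubic `N` decays like `exp (-3 l r)`, which removes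
  -- this factor.
  have hxO : ∃ c ≥ 0, ∀ r ≥ r₁, |x r| ≤ c * (e r * exp (-(2 * l * r))) := by
    rcases hslow with heq | h5
    · rcases he with he | ⟨he, h5 | ⟨C', hC'⟩⟩
      · refine ⟨a + c₂, by positivity, fun r hr => ?_⟩
        have hr1 : 1 ≤ r := hr₁.trans hr
        have h3 := hfast (fun r => c₂ * r) (fun _ => c₂)
          (fun r => ((hasDerivAt_id r).const_mul c₂).congr_deriv (by simp)) (fun r hr => by
            calc exp (l' * r) * |N r| ≤ exp (l' * r) * (c₂ * exp (-(2 * l * r))) := by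
                  gcongr; exact hNe r hr
              _ = c₂ * (exp (-(2 * l * r)) * exp (2 * l * r)) := by rw [heq]; ring
              _ = c₂ := by rw [hinv, mul_one]) r hr
        refine h3.trans ?_
        rw [heq, ← mul_assoc, mul_comm (exp _), he]
        gcongr
        have : 0 ≤ c₂ * r₁ := by positivity
        have : a ≤ a * r := le_mul_of_one_le_right ha0 hr1
        linarith
      · exact absurd heq h5.ne'
      · have hC'' : ∃ c₃ ≥ 0, ∀ r ≥ r₁, |N r| ≤ c₃ * exp (-(3 * l * r)) := by
          refine ⟨|C'| * √(M * c₁) ^ 3, by positivity, fun r hr => (hC' r).trans ?_⟩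
          have e1 : √(w r ^ 2 + y r ^ 2) ≤ √(M * c₁) * exp (-(l * r)) := by
            have e2 : exp (-(l * r)) = √(exp (-(2 * l * r))) := by
              rw [show exp (-(2 * l * r)) = exp (-(l * r)) ^ 2 by
                rw [← exp_nat_mul]; push_cast; ring_nf, sqrt_sq (exp_pos _).le]
            rw [e2, ← sqrt_mul (by positivity)]
            apply sqrt_le_sqrt
            rw [mul_assoc]
            exact (hquad r).trans (by gcongr; exact hup r hr)
          calc C' * √(w r ^ 2 + y r ^ 2) ^ 3 ≤ |C'| * (√(M * c₁) * exp (-(l * r))) ^ 3 := by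
                gcongr; exact le_abs_self _
            _ = |C'| * √(M * c₁) ^ 3 * exp (-(l * r)) ^ 3 := by ring
            _ = _ := by rw [← exp_nat_mul]; push_cast; ring_nf
        obtain ⟨c₃, hc₃, hN3⟩ := hC''
        refine ⟨a + c₃ / l * exp (-l * r₁), by positivity, fun r hr => ?_⟩
        have h3 := hfast (fun r => -(c₃ / l * exp (-l * r)))
          (fun r => c₃ * exp (-l * r))
          (fun r => ((hasDerivAt_exp_mul (-l) r).const_mul (c₃ / l)).fun_neg.congr_deriv
            (by field_simp)) (fun r hr => by
            calc exp (l' * r) * |N r| ≤ exp (l' * r) * (c₃ * exp (-(3 * l * r))) := by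
                  gcongr; exact hN3 r hr
              _ = c₃ * (exp (l' * r) * exp (-(3 * l * r))) := by ring
              _ = _ := by rw [heq, ← exp_add]; ring_nf) r hr
        rw [heq] at h3
        rw [he, one_mul, mul_comm _ (exp (-(2 * l * r)))]
        refine h3.trans (by
          gcongr exp (-(2 * l * r)) * ?_
          have : 0 ≤ c₃ / l * exp (-l * r) := by positivity
          linarith)
    · have : 0 < l' - 2 * l := by linarith
      refine ⟨a + c₂ / (l' - 2 * l), by positivity, fun r hr => (hlt h5 r hr).trans ?_⟩
      gcongr
      exact le_mul_of_one_le_left (exp_pos _).le (he1 r hr)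
  obtain ⟨c₄, hc₄, hxO⟩ := hxO
  refine ⟨⟨z₀ / (l' - l), ?_, fun hz00 => ?_⟩, ?_⟩
  · refine IsBigO.of_bound ((c₂ / l + c₄) / (l' - l)) ?_
    filter_upwards [eventually_ge_atTop r₁] with r hr
    have h3 := hzO r hr
    have h4 := hxO r hr
    have h5 : 0 ≤ e r := zero_le_one.trans (he1 r hr)
    have e1 : w r - z₀ / (l' - l) * exp (-(l * r)) =
        ((z r - exp (-(l * r)) * z₀) - x r) / (l' - l) := by rw [hw r]; ring
    rw [e1, norm_eq_abs, norm_eq_abs, abs_of_nonneg (by positivity : 0 ≤ e r * exp (-(2 * l * r))),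
      abs_div, abs_of_pos hll, div_mul_eq_mul_div (c₂ / l + c₄)]
    gcongr
    have h6 : c₂ / l * exp (-(2 * l * r)) ≤ c₂ / l * (e r * exp (-(2 * l * r))) := by
      gcongr
      exact le_mul_of_one_le_left (exp_pos _).le (he1 r hr)
    have := abs_sub (z r - exp (-(l * r)) * z₀) (x r)
    linarith
  · have hz00 : z₀ = 0 := by simpa [hll.ne'] using hz00
    rw [hz00] at hzO
    simp only [mul_zero, sub_zero] at hzO
    -- A cone argument for a vanishing slow coefficient. Eventually `exp (3 l r) D` is
    -- nondecreasing, so if `D` were positive once, `exp (3 l r) z²` would stay away from zero; but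
    -- `z = O(exp (-2 l r))`. Hence `|z| ≤ |x| / 2`, and `w` controls `x` and `y`.
    let D : ℝ → ℝ := fun r => z r ^ 2 - x r ^ 2 / 4
    have hD : ∀ r, HasDerivAt D (-(2 * l * z r ^ 2) + l' / 2 * x r ^ 2 + (2 * z r - x r / 2) * N r) r :=
      fun r => (((hz r).fun_pow 2).fun_sub (((hx r).fun_pow 2).div_const 4)).congr_deriv (by
        push_cast; ring)
    have hsm : ∀ᶠ r in atTop, 3 * (C * M) * √(B r) < l / 4 := by
      have : Tendsto (fun r => 3 * (C * M) * √(B r)) atTop (𝓝 0) := by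
        simpa using hBt.sqrt.const_mul (3 * (C * M))
      exact this.eventually_lt_const (by positivity)
    obtain ⟨R, hR⟩ := eventually_atTop.1 hsm
    have hF : ∀ r ≥ R, 0 ≤ 3 * l * exp (3 * l * r) * D r + exp (3 * l * r) *
        (-(2 * l * z r ^ 2) + l' / 2 * x r ^ 2 + (2 * z r - x r / 2) * N r) := by
      intro r hr
      have h3 : |z r| ≤ √(B r) := abs_le_sqrt (by simp only [B]; linarith [sq_nonneg (x r)])
      have h4 : |x r| ≤ √(B r) := abs_le_sqrt (by simp only [B]; linarith [sq_nonneg (z r)])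
      have h5 : |2 * z r - x r / 2| ≤ 3 * √(B r) := by
        refine (abs_sub _ _).trans ?_
        rw [abs_mul, abs_two, abs_div, abs_two]
        linarith [sqrt_nonneg (B r)]
      have h6 : |(2 * z r - x r / 2) * N r| ≤ l / 4 * B r := by
        rw [abs_mul]
        calc _ ≤ 3 * √(B r) * (C * M * B r) := by gcongr; exact hNB r
          _ = 3 * (C * M) * √(B r) * B r := by ring
          _ ≤ _ := by
            have := (hBpos r).le
            gcongr
            exact (hR r hr).le
      have h7 := neg_abs_le ((2 * z r - x r / 2) * N r)
      have h8 : 0 ≤ (l' / 2 - l) * x r ^ 2 := mul_nonneg (by linarith) (sq_nonneg _)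
      have h9 : 0 ≤ l * z r ^ 2 := by positivity
      have : 3 * l * exp (3 * l * r) * D r + exp (3 * l * r) *
        (-(2 * l * z r ^ 2) + l' / 2 * x r ^ 2 + (2 * z r - x r / 2) * N r) = exp (3 * l * r) *
        (l * z r ^ 2 + (l' / 2 - 3 / 4 * l) * x r ^ 2 + (2 * z r - x r / 2) * N r) := by
        simp only [D]; ring
      rw [this]
      refine mul_nonneg (exp_pos _).le ?_
      simp only [B] at h6
      nlinarith
    have hDle : ∀ r ≥ R, D r ≤ 0 := by
      intro r₂ hr₂
      by_contra hcon
      push Not at hcon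
      have hmono := le_of_hasDerivAt_nonneg (t₀ := r₂)
        (fun r _ => (hasDerivAt_exp_mul (3 * l) r).fun_mul (hD r)) (fun r hr => hF r (hr₂.trans hr))
      set d := exp (3 * l * r₂) * D r₂
      have hd : 0 < d := mul_pos (exp_pos _) hcon
      have hlim : Tendsto (fun r => (c₂ / l) ^ 2 * exp (-(l * r))) atTop (𝓝 0) := by
        simpa using (tendsto_exp_neg_mul hl).const_mul ((c₂ / l) ^ 2)
      obtain ⟨r, hr, hrr⟩ := ((hlim.eventually_lt_const hd).and
        (eventually_ge_atTop (max r₁ r₂))).exists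
      have h3 := hmono r ((le_max_right _ _).trans hrr)
      have h4 := pow_le_pow_left₀ (abs_nonneg _) (hzO r ((le_max_left _ _).trans hrr)) 2
      rw [sq_abs] at h4
      have h5 : D r ≤ (c₂ / l * exp (-(2 * l * r))) ^ 2 := by
        simp only [D]; linarith [sq_nonneg (x r)]
      have h6 := mul_le_mul_of_nonneg_left h5 (exp_pos (3 * l * r)).le
      have h7 : exp (3 * l * r) * (c₂ / l * exp (-(2 * l * r))) ^ 2 =
          (c₂ / l) ^ 2 * exp (-(l * r)) := by
        have : exp (3 * l * r) * exp (-(2 * l * r)) ^ 2 = exp (-(l * r)) := by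
          rw [← exp_nat_mul, ← exp_add]; push_cast; ring_nf
        rw [← this]; ring
      linarith
    refine ⟨2 * (l' - l) + l, ?_⟩
    filter_upwards [eventually_ge_atTop R] with r hr
    have h3 : |z r| ≤ |x r| / 2 := by
      have := hDle r hr
      simp only [D] at this
      refine abs_le_of_sq_le_sq' ?_ (by positivity) |> abs_le.2
      rw [div_pow, sq_abs]
      linarith
    have h4 : |x r| / 2 ≤ (l' - l) * |w r| := by
      have e1 : (l' - l) * |w r| = |z r - x r| := by
        rw [hw r, abs_div, abs_of_pos hll]; field_simp
      rw [e1]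
      have := abs_sub_abs_le_abs_sub (x r) (z r)
      rw [abs_sub_comm] at this
      linarith
    have e2 : y r = x r - l * w r := by simp only [x]; ring
    have h5 := abs_sub (x r) (l * w r)
    rw [abs_mul, abs_of_pos hl] at h5
    rw [e2]
    linarith
  · refine isBigO_exp_of_le (c := M * c₁) (r₀ := r₁) fun r hr => ?_
    rw [abs_of_pos (h.ne_zero r), mul_assoc]
    exact (hquad r).trans (by gcongr; exact hup r hr)

end PerturbedOsc
end PerturbedOscillatorReal
end WarpedVacuum
end

/-! ### The state space as a plane. -/

noncomputable section
namespace WarpedVacuum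
section StateSpaceCoordinates
open Real

/-- The slope function of the reduced system, in terms of `w = log (A / B)`. -/
def slope (m n : ℕ) (w : ℝ) : ℝ := (exp (2 * w) - 1) / (m * exp (2 * w) + n)

/-- The extremal value of `P - Q` on the state space. -/
def maxShear (m n : ℕ) : ℝ := √(((m : ℝ) + n - 1) / (m * n))

variable {m n : ℕ}

lemma denom_pos (hm : 1 < m) (w : ℝ) : 0 < m * exp (2 * w) + (n : ℝ) := by
  have : (0 : ℝ) < m := by exact_mod_cast (zero_lt_one.trans hm)
  positivity

lemma maxShear_sq (hm : 1 < m) : maxShear m n ^ 2 = ((m : ℝ) + n - 1) / (m * n) := by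
  have : (1 : ℝ) < m := by exact_mod_cast hm
  refine sq_sqrt (div_nonneg ?_ (by positivity))
  linarith [(Nat.cast_nonneg n : (0 : ℝ) ≤ n)]

lemma maxShear_pos (hm : 1 < m) (hn : 1 < n) : 0 < maxShear m n := by
  have h1 : (1 : ℝ) < m := by exact_mod_cast hm
  have h2 : (1 : ℝ) < n := by exact_mod_cast hn
  exact sqrt_pos.2 (div_pos (by linarith) (by positivity))

/-- This puts the saddle values of `tanh θ` strictly inside (-1, 1). Here dimension at least two is
essential: for `m = 1` the product equals 1. -/
lemma one_lt_mul_maxShear (hm : 1 < m) (hn : 1 < n) : 1 < m * maxShear m n := by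
  have h1 : (2 : ℝ) ≤ m := by exact_mod_cast hm
  have h2 : (2 : ℝ) ≤ n := by exact_mod_cast hn
  refine lt_of_pow_lt_pow_left₀ 2 (by have := maxShear_pos hm hn; positivity) ?_
  rw [mul_pow, maxShear_sq hm, one_pow, ← mul_div_assoc, lt_div_iff₀ (by positivity)]
  nlinarith [mul_le_mul_of_nonneg_left h1 (by linarith : (0 : ℝ) ≤ m)]

lemma maxShear_comm : maxShear m n = maxShear n m := by
  simp only [maxShear]; congr 1; ring

lemma hasDerivAt_exp_two_mul (w : ℝ) : HasDerivAt (fun w => exp (2 * w)) (2 * exp (2 * w)) w :=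
  hasDerivAt_exp_mul 2 w

lemma hasDerivAt_slope (hm : 1 < m) (w : ℝ) : HasDerivAt (slope m n)
    (2 * ((m : ℝ) + n) * exp (2 * w) / (m * exp (2 * w) + n) ^ 2) w := by
  have h := denom_pos (n := n) hm w
  refine (((hasDerivAt_exp_two_mul w).sub_const 1).fun_div
    (((hasDerivAt_exp_two_mul w).const_mul (m : ℝ)).add_const (n : ℝ)) h.ne').congr_deriv ?_
  field_simp
  ring

lemma tendsto_exp_two_mul_atBot : Tendsto (fun w => exp (2 * w)) atBot (𝓝 0) :=
  tendsto_exp_atBot.comp (tendsto_id.const_mul_atBot (by norm_num))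

lemma tendsto_exp_neg_two_mul_atTop : Tendsto (fun w : ℝ => exp (-(2 * w))) atTop (𝓝 0) :=
  tendsto_exp_neg_mul (by norm_num)

lemma slope_eq (hm : 1 < m) (w : ℝ) :
    slope m n w = (1 - exp (-(2 * w))) / (m + n * exp (-(2 * w))) := by
  have h := denom_pos (n := n) hm w
  have e := exp_pos (2 * w)
  rw [slope, exp_neg]
  field_simp

lemma slope_tendsto_atBot (hn : 1 < n) : Tendsto (slope m n) atBot (𝓝 (-(1 / n))) := by
  have h2 : (n : ℝ) ≠ 0 := by positivity
  have := (tendsto_exp_two_mul_atBot.sub_const 1).div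
    ((tendsto_exp_two_mul_atBot.const_mul (m : ℝ)).add_const (n : ℝ)) (by simpa using h2)
  simp only [zero_sub, mul_zero, zero_add, neg_div] at this
  exact this

lemma slope_tendsto_atTop (hm : 1 < m) : Tendsto (slope m n) atTop (𝓝 (1 / m)) := by
  have h2 : (m : ℝ) ≠ 0 := by positivity
  have := (tendsto_exp_neg_two_mul_atTop.const_sub 1).div
    ((tendsto_exp_neg_two_mul_atTop.const_mul (n : ℝ)).const_add (m : ℝ)) (by simpa using h2)
  simp only [sub_zero, mul_zero, add_zero] at this
  exact this.congr fun w => (slope_eq hm w).symm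

lemma slope_deriv_le (hm : 1 < m) (hn : 1 < n) (w : ℝ) :
    2 * ((m : ℝ) + n) * exp (2 * w) / (m * exp (2 * w) + n) ^ 2 ≤ 2 * (m + n) := by
  have h := denom_pos (n := n) hm w
  have h1 : (1 : ℝ) < m := by exact_mod_cast hm
  have h2 : (1 : ℝ) < n := by exact_mod_cast hn
  have e := exp_pos (2 * w)
  rw [div_le_iff₀ (by positivity)]
  gcongr
  have h3 : exp (2 * w) ≤ m * exp (2 * w) + n := by nlinarith
  have h4 : 1 ≤ m * exp (2 * w) + n := by nlinarith
  nlinarith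

/-- The reduced system on the state space, as a planar system. -/
def osc (m n : ℕ) (hm : 1 < m) (hn : 1 < n) : Osc where
  V := maxShear m n
  κ := ((m : ℝ) + n - 1) / (m + n)
  γ₁ := 1 / (n * maxShear m n)
  γ₂ := 1 / (m * maxShear m n)
  g w := slope m n w / maxShear m n
  g' w := 2 * ((m : ℝ) + n) * exp (2 * w) / (m * exp (2 * w) + n) ^ 2 / maxShear m n
  -- The primitive of `2 κ / V² * slope`, where `κ / V² = m n / (m + n)`; the last constant
  -- normalizes it at the origin.
  U w := log (m * exp (2 * w) + n) - 2 * m / (m + n) * w - log (m + n)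
  V_pos := maxShear_pos hm hn
  κ_pos := by
    have h1 : (1 : ℝ) < m := by exact_mod_cast hm
    exact div_pos (by linarith [(Nat.cast_nonneg n : (0 : ℝ) ≤ n)]) (by positivity)
  γ₁_pos := by have := maxShear_pos hm hn; positivity
  γ₂_pos := by have := maxShear_pos hm hn; positivity
  γ₁_lt := by
    have := one_lt_mul_maxShear hn hm
    rw [maxShear_comm] at this
    rw [div_lt_one (by linarith)]
    exact this
  γ₂_lt := by
    have := one_lt_mul_maxShear hm hn
    rw [div_lt_one (by linarith)]
    exact this
  g_deriv w := (hasDerivAt_slope hm w).div_const _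
  g'_pos w := by
    have := maxShear_pos hm hn
    have := denom_pos (n := n) hm w
    positivity
  g'_bdd := by
    refine ⟨2 * (m + n) / maxShear m n, fun w => ?_⟩
    have := maxShear_pos hm hn
    gcongr
    exact slope_deriv_le hm hn w
  g'_cont := by
    have : ∀ w, m * exp (2 * w) + (n : ℝ) ≠ 0 := fun w => (denom_pos hm w).ne'
    fun_prop (disch := simp [this])
  g_zero := by simp [slope]
  g_bot := by
    have := (slope_tendsto_atBot (m := m) hn).div_const (maxShear m n)
    rwa [neg_div, div_div] at this
  g_top := by
    have := (slope_tendsto_atTop (n := n) hm).div_const (maxShear m n)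
    rwa [div_div] at this
  g'_bot := by
    have h2 : (n : ℝ) ≠ 0 := by positivity
    have := ((tendsto_exp_two_mul_atBot.const_mul (2 * ((m : ℝ) + n))).div
      (((tendsto_exp_two_mul_atBot.const_mul (m : ℝ)).add_const (n : ℝ)).pow 2)
      (by simpa using h2)).div_const (maxShear m n)
    simpa using this
  g'_top := by
    have h2 : (m : ℝ) ≠ 0 := by positivity
    have := ((tendsto_exp_neg_two_mul_atTop.const_mul (2 * ((m : ℝ) + n))).div
      (((tendsto_exp_neg_two_mul_atTop.const_mul (n : ℝ)).const_add (m : ℝ)).pow 2)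
      (by simpa using h2)).div_const (maxShear m n)
    simp only [mul_zero, zero_div] at this
    refine this.congr fun w => ?_
    congr 1
    have h := denom_pos (n := n) hm w
    have e := exp_pos (2 * w)
    simp only [Pi.div_apply]
    rw [exp_neg]
    field_simp
  U_deriv w := by
    have h := denom_pos (n := n) hm w
    have hV := maxShear_pos hm hn
    have hV2 := maxShear_sq (n := n) hm
    have h1 : (1 : ℝ) < m := by exact_mod_cast hm
    have h2 : (1 : ℝ) < n := by exact_mod_cast hn
    refine (((((hasDerivAt_exp_two_mul w).const_mul (m : ℝ)).add_const (n : ℝ)).log h.ne').fun_sub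
      ((hasDerivAt_id w).const_mul _) |>.sub_const _).congr_deriv ?_
    have e : 2 * (((m : ℝ) + n - 1) / (m + n)) / maxShear m n * (slope m n w / maxShear m n) =
      2 * (((m : ℝ) + n - 1) / (m + n)) * slope m n w / maxShear m n ^ 2 := by field_simp
    have h3 : (m : ℝ) + n - 1 ≠ 0 := by linarith
    rw [e, hV2, slope]
    field_simp
    ring
  U_zero := by simp
  U_bot := by
    have h1 : (1 : ℝ) < m := by exact_mod_cast hm
    have h2 : (1 : ℝ) < n := by exact_mod_cast hn
    have h3 : Tendsto (fun w : ℝ => -(2 * m / ((m : ℝ) + n)) * w) atBot atTop :=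
      tendsto_id.const_mul_atBot_of_neg (by rw [neg_lt_zero]; positivity)
    refine tendsto_atTop_mono (fun w => ?_) (tendsto_atTop_add_const_left _ (log n - log (m + n)) h3)
    have : log n ≤ log (m * exp (2 * w) + n) :=
      log_le_log (by linarith) (by have := exp_pos (2 * w); nlinarith)
    linarith
  U_top := by
    have h1 : (1 : ℝ) < m := by exact_mod_cast hm
    have h2 : (1 : ℝ) < n := by exact_mod_cast hn
    have h3 : Tendsto (fun w : ℝ => (2 * n / ((m : ℝ) + n)) * w) atTop atTop :=
      tendsto_id.const_mul_atTop (by positivity)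
    refine tendsto_atTop_mono (fun w => ?_) (tendsto_atTop_add_const_left _ (log m - log (m + n)) h3)
    have : log (m * exp (2 * w)) ≤ log (m * exp (2 * w) + n) :=
      log_le_log (by positivity) (by linarith)
    rw [log_mul (by positivity) (exp_pos _).ne', log_exp] at this
    have e : 2 * w - 2 * m / ((m : ℝ) + n) * w = 2 * n / (m + n) * w := by field_simp; ring
    linarith

/-- The parametrization of the state space by the plane. -/
def stateOf (m n : ℕ) (x : ℝ × ℝ) : Vars :=
  (exp x.1 / (cosh x.2 * √(((m : ℝ) + n) * (m * exp (2 * x.1) + n))),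
   1 / (cosh x.2 * √(((m : ℝ) + n) * (m * exp (2 * x.1) + n))),
   1 / ((m : ℝ) + n) + n / (m + n) * (maxShear m n * tanh x.2),
   1 / ((m : ℝ) + n) - m / (m + n) * (maxShear m n * tanh x.2))

lemma one_sub_tanh_sq (x : ℝ) : 1 - tanh x ^ 2 = 1 / cosh x ^ 2 := by
  have := (cosh_pos x).ne'
  rw [tanh_eq_sinh_div_cosh, div_pow]
  field_simp
  linarith [cosh_sq x]

/-- With `P = 1/k + (n/k) v` and `Q = 1/k - (m/k) v` the cross terms cancel, and `V` is chosen so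
that the sum would be 1 exactly at `tanh² = 1`. -/
lemma shear_sum_stateOf (hm : 1 < m) (hn : 1 < n) (x : ℝ × ℝ) :
    m * (stateOf m n x).2.2.1 ^ 2 + n * (stateOf m n x).2.2.2 ^ 2 =
      1 / ((m : ℝ) + n) + ((m : ℝ) + n - 1) / (m + n) * tanh x.2 ^ 2 := by
  have hV2 := maxShear_sq (n := n) hm
  have h1 : (1 : ℝ) < m := by exact_mod_cast hm
  have h2 : (1 : ℝ) < n := by exact_mod_cast hn
  have e : m * (stateOf m n x).2.2.1 ^ 2 + n * (stateOf m n x).2.2.2 ^ 2 =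
      1 / ((m : ℝ) + n) + m * n / (m + n) * (maxShear m n ^ 2 * tanh x.2 ^ 2) := by
    simp only [stateOf]; field_simp; ring
  rw [e, hV2]
  field_simp

lemma stateOf_mem (hm : 1 < m) (hn : 1 < n) (x : ℝ × ℝ) : stateOf m n x ∈ stateSpace m n := by
  have h1 : (1 : ℝ) < m := by exact_mod_cast hm
  have h2 : (1 : ℝ) < n := by exact_mod_cast hn
  have hd := denom_pos (n := n) hm x.1
  have hs : 0 < √(((m : ℝ) + n) * (m * exp (2 * x.1) + n)) := sqrt_pos.2 (by positivity)
  have hc := cosh_pos x.2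
  have hsum := shear_sum_stateOf hm hn x
  refine ⟨?_, ?_, ?_⟩
  · have e2 : ((m : ℝ) + n - 1) * (m * (stateOf m n x).1 ^ 2 + n * (stateOf m n x).2.1 ^ 2) =
        ((m : ℝ) + n - 1) / (m + n) * (1 / cosh x.2 ^ 2) := by
      simp only [stateOf]
      rw [div_pow, div_pow, mul_pow, sq_sqrt (by positivity), ← exp_nat_mul]
      push_cast
      field_simp
    refine Prod.ext ?_ ?_
    · simp only [constraints, stateOf, Prod.fst_zero]
      field_simp
      ring
    · change (m * (stateOf m n x).2.2.1 ^ 2 + n * (stateOf m n x).2.2.2 ^ 2) + ((m : ℝ) + n - 1) * (m * (stateOf m n x).1 ^ 2 + n * (stateOf m n x).2.1 ^ 2) - 1 = 0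
      rw [hsum, e2, ← one_sub_tanh_sq]
      field_simp
      ring
  · exact div_pos (exp_pos _) (mul_pos hc hs)
  · exact div_pos one_pos (mul_pos hc hs)

/-- On the state space `1 - Σ = κ (1 - tanh² θ)`, the same factor as in the derivative of `tanh θ`.
This is why `θ` is the right variable: its equation loses the degenerate factor. -/
lemma hasDerivAt_stateOf (hm : 1 < m) (hn : 1 < n) {w θ : ℝ → ℝ}
    (h : (osc m n hm hn).IsOrbit w θ) (τ : ℝ) :
    HasDerivAt (fun τ => stateOf m n (w τ, θ τ)) (field m n (stateOf m n (w τ, θ τ))) τ := by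
  have h1 : (1 : ℝ) < m := by exact_mod_cast hm
  have h2 : (1 : ℝ) < n := by exact_mod_cast hn
  have hd := denom_pos (n := n) hm (w τ)
  have hV2 := maxShear_sq (n := n) hm
  have hV := maxShear_pos hm hn
  have hc := cosh_pos (θ τ)
  have hw : HasDerivAt w (maxShear m n * tanh (θ τ)) τ := h.dw τ
  have hθ : HasDerivAt θ (((m : ℝ) + n - 1) / (m + n) * (tanh (θ τ) - slope m n (w τ) / maxShear m n)) τ :=
    h.dθ τ
  have hsum := shear_sum_stateOf hm hn (w τ, θ τ)
  have hmem := stateOf_mem hm hn (w τ, θ τ)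
  have hv : HasDerivAt (fun τ => maxShear m n * tanh (θ τ)) (maxShear m n * ((1 - tanh (θ τ) ^ 2) *
      (((m : ℝ) + n - 1) / (m + n) * (tanh (θ τ) - slope m n (w τ) / maxShear m n)))) τ :=
    ((hasDerivAt_tanh _).comp τ hθ).const_mul _
  have hs : 0 < √(((m : ℝ) + n) * (m * exp (2 * w τ) + n)) := sqrt_pos.2 (by positivity)
  set T := tanh (θ τ) with hT
  set κ := ((m : ℝ) + n - 1) / (m + n) with hκ
  have hTs : m * n / ((m : ℝ) + n) * maxShear m n ^ 2 = κ := by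
    rw [hV2, hκ]; field_simp
  -- Only the logarithmic derivative of `B` needs a computation; that of `A` follows from `A = exp w
  -- * B`.
  have hBd : HasDerivAt (fun τ => (stateOf m n (w τ, θ τ)).2.1)
      ((stateOf m n (w τ, θ τ)).2.1 * (-(m / ((m : ℝ) + n)) * (maxShear m n * T) - κ * T ^ 2)) τ := by
    have h3 : HasDerivAt (fun τ => exp (2 * w τ)) (exp (2 * w τ) * (2 * (maxShear m n * T))) τ :=
      (hw.const_mul 2).exp
    have h4 := ((((h3.const_mul (m : ℝ)).add_const (n : ℝ)).const_mul ((m : ℝ) + n)).sqrt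
      (by positivity))
    have h5 := (((hasDerivAt_cosh (θ τ)).comp τ hθ).fun_mul h4)
    refine ((hasDerivAt_const τ (1 : ℝ)).fun_div h5 (by simp only [Function.comp]; positivity)).congr_deriv ?_
    have e1 : sinh (θ τ) = cosh (θ τ) * T := by rw [hT, tanh_eq_sinh_div_cosh]; field_simp
    simp only [stateOf, Function.comp]
    rw [e1]
    set S := √(((m : ℝ) + n) * (m * exp (2 * w τ) + n)) with hS
    have hS2 : S ^ 2 = ((m : ℝ) + n) * (m * exp (2 * w τ) + n) := sq_sqrt (by positivity)
    have e2 : κ * (T - slope m n (w τ) / maxShear m n) * T =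
        κ * T ^ 2 - m * n / ((m : ℝ) + n) * (slope m n (w τ) * (maxShear m n * T)) := by
      rw [← hTs]; field_simp
    have e3 : m * n / ((m : ℝ) + n) * slope m n (w τ) = m * exp (2 * w τ) / (m * exp (2 * w τ) + n)
        - m / (m + n) := by
      rw [slope]; field_simp; ring
    have e4 : (((m : ℝ) + n) * (m * (exp (2 * w τ) * (2 * (maxShear m n * T))))) / (2 * S) =
        S * (m * exp (2 * w τ) / (m * exp (2 * w τ) + n) * (maxShear m n * T)) := by
      rw [div_eq_iff (by positivity)]
      have : S * (m * exp (2 * w τ) / (m * exp (2 * w τ) + n) * (maxShear m n * T)) * (2 * S) =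
        S ^ 2 * (m * exp (2 * w τ) / (m * exp (2 * w τ) + n) * (maxShear m n * T)) * 2 := by ring
      rw [this, hS2]
      field_simp
    rw [e4]
    have e5 : cosh (θ τ) * T * (κ * (T - slope m n (w τ) / maxShear m n)) =
       cosh (θ τ) * (κ * T ^ 2 - (m * exp (2 * w τ) / (m * exp (2 * w τ) + n)
        - m / (m + n)) * (maxShear m n * T)) := by
      rw [← e3]; linear_combination cosh (θ τ) * e2
    rw [e5]
    field_simp
    ring
  have hPQ : ∀ X : Vars, X = (X.1, X.2.1, X.2.2.1, X.2.2.2) := fun X => rfl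
  have hA : (fun τ => (stateOf m n (w τ, θ τ)).1) = fun τ => exp (w τ) * (stateOf m n (w τ, θ τ)).2.1 := by
    funext τ; simp only [stateOf]; ring
  have hAd := (hw.exp).fun_mul hBd
  rw [← hA] at hAd
  have hA0 : (stateOf m n (w τ, θ τ)).1 = exp (w τ) * (stateOf m n (w τ, θ τ)).2.1 := congrFun hA τ
  have hPd : HasDerivAt (fun τ => (stateOf m n (w τ, θ τ)).2.2.1) _ τ :=
    (hv.const_mul ((n : ℝ) / (m + n))).const_add (1 / ((m : ℝ) + n))
  have hQd : HasDerivAt (fun τ => (stateOf m n (w τ, θ τ)).2.2.2) _ τ :=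
    (hv.const_mul ((m : ℝ) / (m + n))).const_sub (1 / ((m : ℝ) + n))
  refine (hAd.prodMk (hBd.prodMk (hPd.prodMk hQd))).congr_deriv ?_
  have hP : (stateOf m n (w τ, θ τ)).2.2.1 = 1 / ((m : ℝ) + n) + n / (m + n) * (maxShear m n * T) := rfl
  have hQ : (stateOf m n (w τ, θ τ)).2.2.2 = 1 / ((m : ℝ) + n) - m / (m + n) * (maxShear m n * T) := rfl
  have hB2 : ((m : ℝ) + n - 1) * (stateOf m n (w τ, θ τ)).2.1 ^ 2 =
      κ * (1 - T ^ 2) / (m * exp (2 * w τ) + n) := by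
    rw [hT, one_sub_tanh_sq]
    simp only [stateOf]
    rw [div_pow, mul_pow, sq_sqrt (by positivity), hκ]
    field_simp
  have hA2 : ((m : ℝ) + n - 1) * (stateOf m n (w τ, θ τ)).1 ^ 2 =
      κ * (1 - T ^ 2) * exp (2 * w τ) / (m * exp (2 * w τ) + n) := by
    have : exp (2 * w τ) = exp (w τ) ^ 2 := by rw [← exp_nat_mul]; push_cast; rfl
    rw [hA0, mul_pow, mul_left_comm, hB2, this]; ring
  have hκ1 : 1 / ((m : ℝ) + n) = 1 - κ := by rw [hκ]; field_simp; ring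
  have hsl : maxShear m n * ((1 - T ^ 2) * (κ * (T - slope m n (w τ) / maxShear m n))) =
      κ * (1 - T ^ 2) * (maxShear m n * T - slope m n (w τ)) := by field_simp
  conv_rhs => rw [hPQ (stateOf m n (w τ, θ τ))]
  simp only [field]
  rw [hsum]
  refine Prod.ext ?_ (Prod.ext ?_ (Prod.ext ?_ ?_)) <;> dsimp only
  · rw [hA0, hP]
    have : (n : ℝ) / (m + n) = 1 - m / (m + n) := by field_simp; ring
    rw [this]; ring
  · rw [hQ]; ring
  · rw [hsl, hA2, hP, slope, hκ]
    field_simp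
    ring
  · rw [hsl, hB2, hQ, slope, hκ]
    field_simp
    ring

end StateSpaceCoordinates
end WarpedVacuum
end

/-! ### Topology of the state space and the exceptional orbits. -/

noncomputable section
namespace WarpedVacuum
section StateSpaceTopology
open Real

/-- Near a point other than the origin and off the curve, both ends of the curve are absent, so only
a compact arc has to be avoided. -/
lemma isClosed_insert_range {γ : ℝ → ℝ × ℝ} (hc : Continuous γ) (h0 : Tendsto γ atBot (𝓝 0))
    (h1 : ∀ x : ℝ × ℝ, ∃ U ∈ 𝓝 x, ∀ᶠ τ in atTop, γ τ ∉ U) :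
    IsClosed (insert 0 (Set.range γ)) := by
  rw [← isOpen_compl_iff, isOpen_iff_mem_nhds]
  intro x hx
  rw [Set.mem_compl_iff, Set.mem_insert_iff, not_or] at hx
  obtain ⟨U, V, hU, hV, hxU, h0V, hUV⟩ := t2_separation hx.1
  obtain ⟨a, ha⟩ := eventually_atBot.1 (h0.eventually (hV.mem_nhds h0V))
  obtain ⟨W, hW, hWt⟩ := h1 x
  obtain ⟨b, hb⟩ := eventually_atTop.1 hWt
  have hK : IsClosed (γ '' Set.Icc a b) := (isCompact_Icc.image hc).isClosed
  have hxK : x ∈ (γ '' Set.Icc a b)ᶜ := fun h => hx.2 (Set.image_subset_range _ _ h)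
  filter_upwards [hU.mem_nhds hxU, hW, hK.isOpen_compl.mem_nhds hxK] with y hyU hyW hyK
  rintro (rfl | ⟨τ, rfl⟩)
  · exact hUV.le_bot ⟨hyU, h0V⟩
  · rcases le_or_gt τ a with h | h
    · exact hUV.le_bot ⟨hyU, ha τ h⟩
    rcases le_or_gt b τ with h' | h'
    · exact hb τ h' hyW
    · exact hyK ⟨τ, ⟨h.le, h'.le⟩, rfl⟩

lemma Osc.IsOrbit.contDiff {O : Osc} {w θ : ℝ → ℝ} (h : O.IsOrbit w θ) :
    ContDiff ℝ 1 fun τ => (w τ, θ τ) := by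
  have h1 := Osc.isOrbit_iff.1 h
  rw [contDiff_one_iff_deriv]
  refine ⟨fun τ => (h1 τ).differentiableAt, ?_⟩
  have : deriv (fun τ => (w τ, θ τ)) = fun τ => O.vf (w τ, θ τ) := funext fun τ => (h1 τ).deriv
  rw [this]
  exact O.contDiff_vf.continuous.comp (h.continuous_w.prodMk h.continuous_θ)

/-- The complement of the image of a C¹ curve in the plane is dense for reasons of dimension. -/
lemma Osc.IsOrbit.dense_compl {O : Osc} {w θ : ℝ → ℝ} (h : O.IsOrbit w θ) :
    Dense (insert 0 (Set.range fun τ => (w τ, θ τ)))ᶜ := by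
  have h1 : Dense (Set.range fun τ => (w τ, θ τ))ᶜ :=
    h.contDiff.dense_compl_range_of_finrank_lt_finrank (by simp)
  have h2 : Dense ({0}ᶜ : Set (ℝ × ℝ)) := dense_compl_singleton 0
  have := h2.inter_of_isOpen_left h1 isOpen_compl_singleton
  rwa [← Set.compl_union, Set.singleton_union] at this

lemma Osc.IsOrbit.isClosed_insert_range {O : Osc} {w θ : ℝ → ℝ} (h : O.IsOrbit w θ)
    (ht : Tendsto w atTop atBot ∨ Tendsto w atTop atTop) :
    IsClosed (insert 0 (Set.range fun τ => (w τ, θ τ))) := by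
  refine WarpedVacuum.isClosed_insert_range (h.continuous_w.prodMk h.continuous_θ)
    (h.tendsto_atBot.1.prodMk_nhds h.tendsto_atBot.2) fun x => ?_
  rcases ht with ht | ht
  · refine ⟨{y | x.1 - 1 < y.1}, (isOpen_lt continuous_const continuous_fst).mem_nhds
      (by simp), ?_⟩
    filter_upwards [ht.eventually_le_atBot (x.1 - 1)] with τ hτ
    simpa using hτ
  · refine ⟨{y | y.1 < x.1 + 1}, (isOpen_lt continuous_fst continuous_const).mem_nhds
      (by simp), ?_⟩
    filter_upwards [ht.eventually_ge_atTop (x.1 + 1)] with τ hτ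
    simpa using hτ

variable {m n : ℕ}

lemma continuous_stateOf (hm : 1 < m) : Continuous (stateOf m n) := by
  have h1 : (1 : ℝ) < m := by exact_mod_cast hm
  have hs : ∀ x : ℝ × ℝ, cosh x.2 * √(((m : ℝ) + n) * (m * exp (2 * x.1) + n)) ≠ 0 := fun x => by
    have := denom_pos (n := n) hm x.1
    exact (mul_pos (cosh_pos _) (sqrt_pos.2 (by positivity))).ne'
  have ht : Continuous fun x : ℝ × ℝ => tanh x.2 := continuous_tanh.comp continuous_snd
  have hc : Continuous fun x : ℝ × ℝ => cosh x.2 := continuous_cosh.comp continuous_snd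
  unfold stateOf
  refine Continuous.prodMk ?_ (Continuous.prodMk ?_ (Continuous.prodMk ?_ ?_))
  · exact Continuous.div (by fun_prop) (by fun_prop) hs
  · exact Continuous.div (by fun_prop) (by fun_prop) hs
  · fun_prop
  · fun_prop

/-- The inverse of `stateOf` on the state space. -/
def coordOf (m n : ℕ) (X : Vars) : ℝ × ℝ :=
  (log (X.1 / X.2.1), artanh ((X.2.2.1 - X.2.2.2) / maxShear m n))

lemma coordOf_stateOf (hm : 1 < m) (hn : 1 < n) (x : ℝ × ℝ) : coordOf m n (stateOf m n x) = x := by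
  have h1 : (1 : ℝ) < m := by exact_mod_cast hm
  have hV := maxShear_pos hm hn
  obtain ⟨-, hA, hB⟩ := stateOf_mem hm hn x
  refine Prod.ext ?_ ?_
  · have : (stateOf m n x).1 = exp x.1 * (stateOf m n x).2.1 := by simp only [stateOf]; ring
    simp only [coordOf]
    rw [this, mul_div_cancel_right₀ _ hB.ne', log_exp]
  · simp only [coordOf, stateOf]
    have : (1 / ((m : ℝ) + n) + n / (m + n) * (maxShear m n * tanh x.2) -
        (1 / (m + n) - m / (m + n) * (maxShear m n * tanh x.2))) / maxShear m n = tanh x.2 := by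
      field_simp; ring
    rw [this, artanh_tanh]

/-- On `m P + n Q = 1` one has `m n (P - Q)² = (m + n) Σ - 1`, and `Σ < 1` because `A` and `B` are
positive. -/
lemma shear_mem_Ioo (hm : 1 < m) (hn : 1 < n) {X : Vars} (hX : X ∈ stateSpace m n) :
    (X.2.2.1 - X.2.2.2) / maxShear m n ∈ Set.Ioo (-1) 1 := by
  have h1 : (1 : ℝ) < m := by exact_mod_cast hm
  have h2 : (1 : ℝ) < n := by exact_mod_cast hn
  obtain ⟨A, B, P, Q⟩ := X
  obtain ⟨hc, hA, hB⟩ := hX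
  obtain ⟨c1, c2⟩ := Prod.mk_eq_zero.1 hc
  dsimp only at c1 c2 hA hB ⊢
  have hV := maxShear_pos hm hn
  rw [Set.mem_Ioo, ← abs_lt, abs_div, abs_of_pos hV, div_lt_one hV]
  refine abs_lt_of_sq_lt_sq ?_ hV.le
  rw [maxShear_sq hm, lt_div_iff₀ (by positivity)]
  have h3 : (m : ℝ) * P ^ 2 + n * Q ^ 2 < 1 := by
    have : 0 < ((m : ℝ) + n - 1) * (m * A ^ 2 + n * B ^ 2) :=
      mul_pos (by linarith) (by positivity)
    linarith
  have e : (P - Q) ^ 2 * (m * n) = (m + n) * ((m : ℝ) * P ^ 2 + n * Q ^ 2) - (m * P + n * Q) ^ 2 := by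
    ring
  rw [e, show (m : ℝ) * P + n * Q = 1 by linarith]
  nlinarith

/-- `P` and `Q` are determined by `P - Q` and the linear constraint; `B` is then determined by `A /
B` and the quadratic constraint, since it is positive. -/
lemma stateOf_coordOf (hm : 1 < m) (hn : 1 < n) {X : Vars} (hX : X ∈ stateSpace m n) :
    stateOf m n (coordOf m n X) = X := by
  have h1 : (1 : ℝ) < m := by exact_mod_cast hm
  have h2 : (1 : ℝ) < n := by exact_mod_cast hn
  have hv := tanh_artanh (shear_mem_Ioo hm hn hX)
  obtain ⟨A, B, P, Q⟩ := X
  obtain ⟨hc, hA, hB⟩ := hX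
  obtain ⟨c1, c2⟩ := Prod.mk_eq_zero.1 hc
  dsimp only at c1 c2 hA hB hv
  have hV := maxShear_pos hm hn
  set x := coordOf m n (A, B, P, Q) with hx
  have hx1 : exp x.1 = A / B := exp_log (div_pos hA hB)
  have hx2 : maxShear m n * tanh x.2 = P - Q := by
    have : tanh x.2 = (P - Q) / maxShear m n := hv
    rw [this]; field_simp
  have hsum := shear_sum_stateOf hm hn x
  have hP : (stateOf m n x).2.2.1 = P := by
    simp only [stateOf, hx2]
    field_simp
    linarith
  have hQ : (stateOf m n x).2.2.2 = Q := by
    simp only [stateOf, hx2]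
    field_simp
    linarith
  have hcx := cosh_pos x.2
  have hd := denom_pos (n := n) hm x.1
  rw [hP, hQ] at hsum
  have hBsq : (stateOf m n x).2.1 ^ 2 = B ^ 2 := by
    have e1 : (stateOf m n x).2.1 ^ 2 = 1 / cosh x.2 ^ 2 / ((m + n) * (m * exp (2 * x.1) + n)) := by
      simp only [stateOf]
      rw [div_pow, mul_pow, sq_sqrt (by positivity), one_pow, div_div]
    have e2 : exp (2 * x.1) = (A / B) ^ 2 := by rw [← hx1, ← exp_nat_mul]; push_cast; rfl
    rw [e1, ← one_sub_tanh_sq, div_eq_iff (by positivity), e2]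
    have e3 : ((m : ℝ) + n - 1) / (m + n) * (1 - tanh x.2 ^ 2) =
        (m + n - 1) * (m * A ^ 2 + n * B ^ 2) := by
      have : 1 / ((m : ℝ) + n) = 1 - ((m : ℝ) + n - 1) / (m + n) := by field_simp; ring
      rw [this] at hsum
      linarith
    have h3 : (m : ℝ) + n - 1 ≠ 0 := by linarith
    field_simp at e3 ⊢
    linarith
  have hB' : (stateOf m n x).2.1 = B := by
    have h0 := (stateOf_mem hm hn x).2.2
    exact (sq_eq_sq₀ h0.le hB.le).1 hBsq
  have hA' : (stateOf m n x).1 = A := by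
    have : (stateOf m n x).1 = exp x.1 * (stateOf m n x).2.1 := by simp only [stateOf]; ring
    rw [this, hx1, hB']
    field_simp
  exact Prod.ext hA' (Prod.ext hB' (Prod.ext hP hQ))

lemma continuousOn_coordOf (hm : 1 < m) (hn : 1 < n) :
    ContinuousOn (coordOf m n) (stateSpace m n) := by
  refine ContinuousOn.prodMk ?_ ?_
  · refine ContinuousOn.log (ContinuousOn.div (by fun_prop) (by fun_prop) fun X hX => hX.2.2.ne')
      fun X hX => (div_pos hX.2.1 hX.2.2).ne'
  · unfold artanh
    refine ContinuousOn.log (ContinuousOn.sqrt (ContinuousOn.div (by fun_prop) (by fun_prop)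
      fun X hX => ?_)) fun X hX => ?_
    · have := (shear_mem_Ioo hm hn hX).2
      linarith
    · have h3 := shear_mem_Ioo hm hn hX
      exact (sqrt_pos.2 (div_pos (by linarith [h3.1]) (by linarith [h3.2]))).ne'

lemma stateOf_zero (hm : 1 < m) : stateOf m n 0 = fixedStar m n := by
  have h1 : (1 : ℝ) < m := by exact_mod_cast hm
  have : √(((m : ℝ) + n) * (m + n)) = m + n := sqrt_mul_self (by positivity)
  simp [stateOf, fixedStar, this]

/-- In this form the limit for `w → -∞` depends on `tanh θ` only. -/
lemma stateOf_snd_eq_sqrt (hm : 1 < m) (hn : 1 < n) (x : ℝ × ℝ) : (stateOf m n x).2.1 =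
    √((1 - tanh x.2 ^ 2) / ((m + n) * (m * exp (2 * x.1) + n))) := by
  have h1 : (1 : ℝ) < m := by exact_mod_cast hm
  have hd := denom_pos (n := n) hm x.1
  rw [← sqrt_sq (stateOf_mem hm hn x).2.2.le, one_sub_tanh_sq]
  congr 1
  simp only [stateOf]
  rw [div_pow, mul_pow, sq_sqrt (by positivity), one_pow, div_div]

lemma stateOf_fst_eq_sqrt (hm : 1 < m) (hn : 1 < n) (x : ℝ × ℝ) : (stateOf m n x).1 =
    √((1 - tanh x.2 ^ 2) / ((m + n) * (m + n * exp (-(2 * x.1))))) := by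
  have h1 : (1 : ℝ) < m := by exact_mod_cast hm
  have hd := denom_pos (n := n) hm x.1
  rw [← sqrt_sq (stateOf_mem hm hn x).2.1.le, one_sub_tanh_sq]
  congr 1
  have e : exp (2 * x.1) = exp x.1 ^ 2 := by rw [← exp_nat_mul]; push_cast; rfl
  simp only [stateOf]
  rw [div_pow, mul_pow, sq_sqrt (by positivity), exp_neg, e]
  rw [e] at hd
  have := exp_pos x.1
  field_simp

lemma stateOf_tendsto_fixedA (hm : 1 < m) (hn : 1 < n) {w θ : ℝ → ℝ}
    (hw : Tendsto w atTop atBot)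
    (hθ : Tendsto (fun τ => tanh (θ τ)) atTop (𝓝 (-(1 / (n * maxShear m n))))) :
    Tendsto (fun τ => stateOf m n (w τ, θ τ)) atTop (𝓝 (fixedA m n)) := by
  have h1 : (1 : ℝ) < m := by exact_mod_cast hm
  have h2 : (1 : ℝ) < n := by exact_mod_cast hn
  have hV := maxShear_pos hm hn
  have hB : Tendsto (fun τ => (stateOf m n (w τ, θ τ)).2.1) atTop
      (𝓝 (√(((n : ℝ) - 1) / n ^ 2 * (1 / ((m : ℝ) + n - 1))))) := by
    simp only [stateOf_snd_eq_sqrt hm hn]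
    have := ((hθ.pow 2).const_sub 1).div ((((tendsto_exp_two_mul_atBot.comp hw).const_mul
      (m : ℝ)).add_const (n : ℝ)).const_mul ((m : ℝ) + n)) (by simp; constructor <;> positivity)
    convert this.sqrt using 3
    · rfl
    rw [neg_sq, div_pow, mul_pow, maxShear_sq hm]
    have h3 : (m : ℝ) + n - 1 ≠ 0 := by linarith
    field_simp
    ring
  have hA : Tendsto (fun τ => (stateOf m n (w τ, θ τ)).1) atTop (𝓝 0) := by
    have := (tendsto_exp_atBot.comp hw).mul hB
    rw [zero_mul] at this
    refine this.congr fun τ => ?_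
    simp only [stateOf, Function.comp]; ring
  have hv := hθ.const_mul (maxShear m n)
  refine hA.prodMk_nhds (hB.prodMk_nhds (Tendsto.prodMk_nhds ?_ ?_))
  · convert (hv.const_mul ((n : ℝ) / (m + n))).const_add (1 / ((m : ℝ) + n)) using 2
    field_simp; ring
  · convert (hv.const_mul ((m : ℝ) / (m + n))).const_sub (1 / ((m : ℝ) + n)) using 2
    field_simp; ring

lemma stateOf_tendsto_fixedB (hm : 1 < m) (hn : 1 < n) {w θ : ℝ → ℝ}
    (hw : Tendsto w atTop atTop)
    (hθ : Tendsto (fun τ => tanh (θ τ)) atTop (𝓝 (1 / (m * maxShear m n)))) :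
    Tendsto (fun τ => stateOf m n (w τ, θ τ)) atTop (𝓝 (fixedB m n)) := by
  have h1 : (1 : ℝ) < m := by exact_mod_cast hm
  have h2 : (1 : ℝ) < n := by exact_mod_cast hn
  have hV := maxShear_pos hm hn
  have hA : Tendsto (fun τ => (stateOf m n (w τ, θ τ)).1) atTop
      (𝓝 (√(((m : ℝ) - 1) / m ^ 2 * (1 / ((m : ℝ) + n - 1))))) := by
    simp only [stateOf_fst_eq_sqrt hm hn]
    have := ((hθ.pow 2).const_sub 1).div ((((tendsto_exp_neg_two_mul_atTop.comp hw).const_mul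
      (n : ℝ)).const_add (m : ℝ)).const_mul ((m : ℝ) + n)) (by simp; constructor <;> positivity)
    convert this.sqrt using 3
    · rfl
    rw [div_pow, mul_pow, maxShear_sq hm]
    have h3 : (m : ℝ) + n - 1 ≠ 0 := by linarith
    field_simp
    ring
  have hB : Tendsto (fun τ => (stateOf m n (w τ, θ τ)).2.1) atTop (𝓝 0) := by
    have := (tendsto_exp_neg_atTop_nhds_zero.comp hw).mul hA
    rw [zero_mul] at this
    refine this.congr fun τ => ?_
    simp only [stateOf, Function.comp]
    rw [← mul_div_assoc, ← exp_add]
    simp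
  have hv := hθ.const_mul (maxShear m n)
  refine hA.prodMk_nhds (hB.prodMk_nhds (Tendsto.prodMk_nhds ?_ ?_))
  · convert (hv.const_mul ((n : ℝ) / (m + n))).const_add (1 / ((m : ℝ) + n)) using 2
    field_simp
  · convert (hv.const_mul ((m : ℝ) / (m + n))).const_sub (1 / ((m : ℝ) + n)) using 2
    field_simp; ring

/-- The two exceptional orbits, and the fate of the orbits in their complement. -/
theorem exists_exceptional_orbits (hm : 1 < m) (hn : 1 < n) : ∃ EA EB : Set Vars,
    IsOrbitTendingTo m n (fixedA m n) EA ∧ IsOrbitTendingTo m n (fixedB m n) EB ∧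
    (∃ O : Set Vars, IsOpen O ∧
      stateSpace m n \ ({fixedStar m n} ∪ EA ∪ EB) = stateSpace m n ∩ O) ∧
    stateSpace m n ⊆ closure (stateSpace m n \ ({fixedStar m n} ∪ EA ∪ EB)) ∧
    ∀ w θ : ℝ → ℝ, (osc m n hm hn).IsOrbit w θ →
      (∃ τ, stateOf m n (w τ, θ τ) ∉ {fixedStar m n} ∪ EA ∪ EB) →
      (w 0, θ 0) ≠ 0 ∧ ((∃ δ > 0, ∃ t₀, ∀ t ≥ t₀, δ * (t - t₀) ≤ θ t) ∨
        (∃ δ > 0, ∃ t₀, ∀ t ≥ t₀, θ t ≤ -(δ * (t - t₀)))) := by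
  obtain ⟨wA, θA, hA, hAs⟩ := Osc.exists_isOrbit_tendsToSaddle (osc m n hm hn)
  obtain ⟨wR, θR, hR, hRs⟩ := Osc.exists_isOrbit_tendsToSaddle (osc m n hm hn).reflect
  -- The separatrix of F_B is the mirror image of the one that tends to the saddle at `w = -∞` of
  -- the reflected system.
  have hrr : (osc m n hm hn).reflect.reflect = osc m n hm hn := by
    simp [Osc.reflect]
  have hB : (osc m n hm hn).IsOrbit (fun τ => -wR τ) (fun τ => -θR τ) := hrr ▸ hR.reflect
  have hBw : Tendsto (fun τ => -wR τ) atTop atTop := tendsto_neg_atBot_atTop.comp hRs.1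
  have hBθ : Tendsto (fun τ => tanh (-θR τ)) atTop (𝓝 (osc m n hm hn).γ₂) := by
    have := hRs.2.neg
    simpa [Osc.reflect] using this
  set CA := Set.range fun τ => (wA τ, θA τ) with hCA
  set CB := Set.range fun τ => (-wR τ, -θR τ) with hCB
  set C : Set (ℝ × ℝ) := insert 0 CA ∪ insert 0 CB with hC
  have hinj : Function.Injective (stateOf m n) := fun x y hxy => by
    rw [← coordOf_stateOf hm hn x, hxy, coordOf_stateOf hm hn y]
  have hE : {fixedStar m n} ∪ (Set.range fun τ => stateOf m n (wA τ, θA τ)) ∪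
      (Set.range fun τ => stateOf m n (-wR τ, -θR τ)) = stateOf m n '' C := by
    rw [hC, Set.image_union, Set.image_insert_eq, Set.image_insert_eq, stateOf_zero hm, hCA, hCB,
      ← Set.range_comp, ← Set.range_comp]
    ext x
    simp only [Set.mem_union, Set.mem_insert_iff, Set.mem_singleton_iff, Function.comp_def]
    tauto
  -- Both curves emanate from the origin, so adjoining the Friedmann point makes each of them
  -- closed.
  have hCcl : IsClosed C := (hA.isClosed_insert_range (Or.inl hAs.1)).union
    (hB.isClosed_insert_range (Or.inr hBw))
  have hCd : Dense Cᶜ := by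
    rw [hC, Set.compl_union]
    exact hA.dense_compl.inter_of_isOpen_left hB.dense_compl
      (hA.isClosed_insert_range (Or.inl hAs.1)).isOpen_compl
  have hmemE : ∀ X ∈ stateSpace m n, X ∈ stateOf m n '' C ↔ coordOf m n X ∈ C := by
    intro X hX
    constructor
    · rintro ⟨x, hx, rfl⟩
      rwa [coordOf_stateOf hm hn]
    · exact fun h => ⟨_, h, stateOf_coordOf hm hn hX⟩
  refine ⟨Set.range fun τ => stateOf m n (wA τ, θA τ), Set.range fun τ => stateOf m n (-wR τ, -θR τ),
    ⟨_, fun τ => hasDerivAt_stateOf hm hn hA τ, fun τ => stateOf_mem hm hn _, rfl,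
      stateOf_tendsto_fixedA hm hn hAs.1 hAs.2⟩,
    ⟨_, fun τ => hasDerivAt_stateOf hm hn hB τ, fun τ => stateOf_mem hm hn _, rfl,
      stateOf_tendsto_fixedB hm hn hBw hBθ⟩, ?_, ?_, ?_⟩
  · rw [hE]
    obtain ⟨O, hO, hO'⟩ := continuousOn_iff'.1 (continuousOn_coordOf hm hn) Cᶜ hCcl.isOpen_compl
    refine ⟨O, hO, ?_⟩
    rw [Set.inter_comm, ← hO']
    ext X
    simp only [Set.mem_sdiff, Set.mem_inter_iff, Set.mem_preimage, Set.mem_compl_iff]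
    constructor
    · exact fun h => ⟨fun h' => h.2 ((hmemE X h.1).2 h'), h.1⟩
    · exact fun h => ⟨h.2, fun h' => h.1 ((hmemE X h.2).1 h')⟩
  · rw [hE]
    intro X hX
    rw [← stateOf_coordOf hm hn hX]
    refine closure_mono ?_ (image_closure_subset_closure_image (continuous_stateOf hm)
      ⟨_, hCd (coordOf m n X), rfl⟩)
    rintro _ ⟨x, hx, rfl⟩
    refine ⟨stateOf_mem hm hn x, ?_⟩
    rintro ⟨y, hy, hxy⟩
    exact hx (hinj hxy ▸ hy)
  · rw [hE]
    rintro w θ h ⟨τ, hτ⟩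
    have hτ' : (w τ, θ τ) ∉ C := fun h' => hτ ⟨_, h', rfl⟩
    simp only [hC, Set.mem_union, Set.mem_insert_iff, not_or] at hτ'
    have h0 := h.ne_zero hτ'.1.1 0
    refine ⟨h0, ?_⟩
    -- The last two fates are excluded: by uniqueness up to translation such an orbit would run
    -- along one of the exceptional curves.
    rcases h.fate h0 with h1 | h1 | h1 | h1
    · exact Or.inl h1
    · exact Or.inr h1
    · obtain ⟨c, hc⟩ := hA.eq_shift_of_saddle h hAs h1
      exact absurd ⟨τ + c, by simp [hc τ]⟩ hτ'.1.2
    · have h2 : (osc m n hm hn).reflect.TendsToSaddle (fun t => -w t) (fun t => -θ t) := by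
        refine ⟨tendsto_neg_atTop_atBot.comp h1.1, ?_⟩
        have := h1.2.neg
        simpa [Osc.reflect] using this
      obtain ⟨c, hc⟩ := hR.eq_shift_of_saddle h.reflect hRs h2
      exact absurd ⟨τ + c, by simp [← hc τ]⟩ hτ'.2.2

end StateSpaceTopology
end WarpedVacuum
end

/-! ### Linearization at the Friedmann point. -/

noncomputable section
namespace WarpedVacuum
section Linearization
open Real

variable {m n : ℕ}

lemma hasDerivAt_add_smul_coord (x y : ℝ) : HasDerivAt (fun t : ℝ => x + t * y) y 0 :=
  (((hasDerivAt_id (0 : ℝ)).mul_const y).const_add x).congr_deriv (by simp)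

lemma fderiv_field (X u : Vars) : fderiv ℝ (field m n) X u =
    (u.1 * (X.2.2.1 - (m * X.2.2.1 ^ 2 + n * X.2.2.2 ^ 2)) +
        X.1 * (u.2.2.1 - (2 * m * X.2.2.1 * u.2.2.1 + 2 * n * X.2.2.2 * u.2.2.2)),
      u.2.1 * (X.2.2.2 - (m * X.2.2.1 ^ 2 + n * X.2.2.2 ^ 2)) +
        X.2.1 * (u.2.2.2 - (2 * m * X.2.2.1 * u.2.2.1 + 2 * n * X.2.2.2 * u.2.2.2)),
      u.2.2.1 * (1 - (m * X.2.2.1 ^ 2 + n * X.2.2.2 ^ 2)) -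
        X.2.2.1 * (2 * m * X.2.2.1 * u.2.2.1 + 2 * n * X.2.2.2 * u.2.2.2) -
        ((m : ℝ) + n - 1) * (2 * X.1 * u.1),
      u.2.2.2 * (1 - (m * X.2.2.1 ^ 2 + n * X.2.2.2 ^ 2)) -
        X.2.2.2 * (2 * m * X.2.2.1 * u.2.2.1 + 2 * n * X.2.2.2 * u.2.2.2) -
        ((m : ℝ) + n - 1) * (2 * X.2.1 * u.2.1)) := by
  have hd : Differentiable ℝ (field m n) := by
    change Differentiable ℝ fun X : Vars =>
      (X.1 * (X.2.2.1 - (m * X.2.2.1 ^ 2 + n * X.2.2.2 ^ 2)),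
        X.2.1 * (X.2.2.2 - (m * X.2.2.1 ^ 2 + n * X.2.2.2 ^ 2)),
        X.2.2.1 * (1 - (m * X.2.2.1 ^ 2 + n * X.2.2.2 ^ 2)) - ((m : ℝ) + n - 1) * X.1 ^ 2,
        X.2.2.2 * (1 - (m * X.2.2.1 ^ 2 + n * X.2.2.2 ^ 2)) - ((m : ℝ) + n - 1) * X.2.1 ^ 2)
    fun_prop
  rw [← (hd X).lineDeriv_eq_fderiv]
  refine HasLineDerivAt.lineDeriv ?_
  have hA := hasDerivAt_add_smul_coord X.1 u.1
  have hB := hasDerivAt_add_smul_coord X.2.1 u.2.1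
  have hP := hasDerivAt_add_smul_coord X.2.2.1 u.2.2.1
  have hQ := hasDerivAt_add_smul_coord X.2.2.2 u.2.2.2
  have hS := ((hP.fun_pow 2).const_mul (m : ℝ)).fun_add ((hQ.fun_pow 2).const_mul (n : ℝ))
  refine HasDerivAt.congr_deriv ((hA.fun_mul (hP.fun_sub hS)).prodMk ((hB.fun_mul (hQ.fun_sub hS)).prodMk
    (((hP.fun_mul (hS.const_sub 1)).fun_sub ((hA.fun_pow 2).const_mul ((m : ℝ) + n - 1))).prodMk
    ((hQ.fun_mul (hS.const_sub 1)).fun_sub ((hB.fun_pow 2).const_mul ((m : ℝ) + n - 1)))))) ?_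
  refine Prod.ext ?_ (Prod.ext ?_ (Prod.ext ?_ ?_)) <;> dsimp only <;> push_cast <;> ring

lemma fderiv_constraints (X u : Vars) : fderiv ℝ (constraints m n) X u =
    (m * u.2.2.1 + n * u.2.2.2,
      (2 * m * X.2.2.1 * u.2.2.1 + 2 * n * X.2.2.2 * u.2.2.2) +
        ((m : ℝ) + n - 1) * (2 * m * X.1 * u.1 + 2 * n * X.2.1 * u.2.1)) := by
  have hd : Differentiable ℝ (constraints m n) := by
    change Differentiable ℝ fun X : Vars => (m * X.2.2.1 + n * X.2.2.2 - 1,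
      (m * X.2.2.1 ^ 2 + n * X.2.2.2 ^ 2) +
        ((m : ℝ) + n - 1) * (m * X.1 ^ 2 + n * X.2.1 ^ 2) - 1)
    fun_prop
  rw [← (hd X).lineDeriv_eq_fderiv]
  refine HasLineDerivAt.lineDeriv ?_
  have hA := hasDerivAt_add_smul_coord X.1 u.1
  have hB := hasDerivAt_add_smul_coord X.2.1 u.2.1
  have hP := hasDerivAt_add_smul_coord X.2.2.1 u.2.2.1
  have hQ := hasDerivAt_add_smul_coord X.2.2.2 u.2.2.2
  refine HasDerivAt.congr_deriv
    ((((hP.const_mul (m : ℝ)).fun_add (hQ.const_mul (n : ℝ))).sub_const 1).prodMk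
    (((((hP.fun_pow 2).const_mul (m : ℝ)).fun_add ((hQ.fun_pow 2).const_mul (n : ℝ))).fun_add
      ((((hA.fun_pow 2).const_mul (m : ℝ)).fun_add ((hB.fun_pow 2).const_mul (n : ℝ))).const_mul
        ((m : ℝ) + n - 1))).sub_const 1)) ?_
  refine Prod.ext ?_ ?_ <;> dsimp only <;> push_cast <;> ring

lemma fderiv_constraints_fixedStar_eq_zero (hm : 1 < m) {u : Vars} :
    fderiv ℝ (constraints m n) (fixedStar m n) u = 0 ↔
      m * u.1 + n * u.2.1 = 0 ∧ m * u.2.2.1 + n * u.2.2.2 = 0 := by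
  have h1 : (1 : ℝ) < m := by exact_mod_cast hm
  have hn : (0 : ℝ) ≤ n := Nat.cast_nonneg n
  have hk : (m : ℝ) + n ≠ 0 := by positivity
  have hK : (m : ℝ) + n - 1 ≠ 0 := by linarith
  rw [fderiv_constraints, Prod.mk_eq_zero]
  simp only [fixedStar]
  constructor
  · rintro ⟨e1, e2⟩
    have e3 : ((m : ℝ) + n - 1) * (2 / (m + n)) * (m * u.1 + n * u.2.1) = 0 := by
      linear_combination e2 - 2 * (1 / ((m : ℝ) + n)) * e1
    exact ⟨(mul_eq_zero.1 e3).resolve_left (mul_ne_zero hK (div_ne_zero two_ne_zero hk)), e1⟩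
  · rintro ⟨e1, e2⟩
    refine ⟨e2, ?_⟩
    linear_combination 2 * (1 / ((m : ℝ) + n)) * e2 + ((m : ℝ) + n - 1) * (2 / (m + n)) * e1

lemma fderiv_field_fixedStar (hm : 1 < m) {u : Vars} (hu : m * u.2.2.1 + n * u.2.2.2 = 0) :
    fderiv ℝ (field m n) (fixedStar m n) u = (u.2.2.1 / (m + n), u.2.2.2 / (m + n),
      ((m : ℝ) + n - 1) / (m + n) * (u.2.2.1 - 2 * u.1),
      ((m : ℝ) + n - 1) / (m + n) * (u.2.2.2 - 2 * u.2.1)) := by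
  have h1 : (1 : ℝ) < m := by exact_mod_cast hm
  have hn : (0 : ℝ) ≤ n := Nat.cast_nonneg n
  have hk : (m : ℝ) + n ≠ 0 := by positivity
  have e1 : 2 * (m : ℝ) * (1 / (m + n)) * u.2.2.1 + 2 * n * (1 / (m + n)) * u.2.2.2 = 0 := by
    linear_combination 2 * (1 / ((m : ℝ) + n)) * hu
  have e2 : (m : ℝ) * (1 / (m + n)) ^ 2 + n * (1 / (m + n)) ^ 2 = 1 / (m + n) := by
    field_simp
  rw [fderiv_field]
  simp only [fixedStar]
  rw [e1, e2]
  refine Prod.ext ?_ (Prod.ext ?_ (Prod.ext ?_ ?_)) <;> dsimp only <;> field_simp <;> ring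

/-- The eigenvalues `x + i y` of the linearization at the Friedmann point. -/
lemma mem_linEigenvalues_iff (hm : 1 < m) (hn : 1 < n) {c : ℂ} :
    c ∈ linEigenvalues m n (fixedStar m n) ↔
      ((m + n) * c.re) ^ 2 - ((m + n) * c.im) ^ 2 - ((m : ℝ) + n - 1) * ((m + n) * c.re) +
        2 * ((m : ℝ) + n - 1) = 0 ∧
      2 * ((m + n) * c.re) * ((m + n) * c.im) - ((m : ℝ) + n - 1) * ((m + n) * c.im) = 0 := by
  have h1 : (1 : ℝ) < m := by exact_mod_cast hm
  have h2 : (1 : ℝ) < n := by exact_mod_cast hn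
  have hk : (m : ℝ) + n ≠ 0 := by positivity
  constructor
  · rintro ⟨u, v, hu, hv, huv, e1, e2⟩
    rw [fderiv_constraints_fixedStar_eq_zero hm] at hu hv
    rw [fderiv_field_fixedStar hm hu.2] at e1
    rw [fderiv_field_fixedStar hm hv.2] at e2
    obtain ⟨u₁, u₂, u₃, u₄⟩ := u
    obtain ⟨v₁, v₂, v₃, v₄⟩ := v
    simp only [Prod.smul_mk, smul_eq_mul, Prod.mk_sub_mk, Prod.mk_add_mk, Prod.mk.injEq] at e1 e2
    dsimp only at hu hv
    obtain ⟨a1, -, a3, -⟩ := e1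
    obtain ⟨b1, -, b3, -⟩ := e2
    set k : ℝ := (m : ℝ) + n
    set x := c.re
    set y := c.im
    have a1' : u₃ = k * x * u₁ - k * y * v₁ := by field_simp at a1; linarith
    have b1' : v₃ = k * y * u₁ + k * x * v₁ := by field_simp at b1; linarith
    have a3' : (k - 1) * (u₃ - 2 * u₁) = k * (x * u₃ - y * v₃) := by field_simp at a3; linarith
    have b3' : (k - 1) * (v₃ - 2 * v₁) = k * (y * u₃ + x * v₃) := by field_simp at b3; linarith
    -- By tangency and the first eigenvalue equation the whole eigenvector is determined by its
    -- first component `u₁ + i v₁`. The characteristic equation is then obtained by multiplying with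
    -- the conjugate of this component and taking real and imaginary parts.
    have hne : 0 < u₁ ^ 2 + v₁ ^ 2 := by
      by_contra hcon
      have z1 : u₁ = 0 := by nlinarith [sq_nonneg u₁, sq_nonneg v₁]
      have z2 : v₁ = 0 := by nlinarith [sq_nonneg u₁, sq_nonneg v₁]
      have z3 : u₃ = 0 := by rw [a1', z1, z2]; ring
      have z4 : v₃ = 0 := by rw [b1', z1, z2]; ring
      have hn0 : (n : ℝ) ≠ 0 := by positivity
      have z5 : u₂ = 0 := by simpa [z1, hn0] using hu.1
      have z6 : v₂ = 0 := by simpa [z2, hn0] using hv.1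
      have z7 : u₄ = 0 := by simpa [z3, hn0] using hu.2
      have z8 : v₄ = 0 := by simpa [z4, hn0] using hv.2
      exact huv (by simp [z1, z2, z3, z4, z5, z6, z7, z8])
    rw [a1', b1'] at a3' b3'
    constructor
    · refine (mul_eq_zero.1 (?_ : (u₁ ^ 2 + v₁ ^ 2) * _ = 0)).resolve_left hne.ne'
      linear_combination (-u₁) * a3' - v₁ * b3'
    · refine (mul_eq_zero.1 (?_ : (u₁ ^ 2 + v₁ ^ 2) * _ = 0)).resolve_left hne.ne'
      linear_combination v₁ * a3' - u₁ * b3'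
  · rintro ⟨e1, e2⟩
    set k : ℝ := (m : ℝ) + n
    set x := c.re
    set y := c.im
    have h3 : (m : ℝ) * (n * (k * x)) + n * (-(m * (k * x))) = 0 := by ring
    have h4 : (m : ℝ) * (n * (k * y)) + n * (-(m * (k * y))) = 0 := by ring
    -- The tangent plane is spanned by `(n, -m, 0, 0)` and `(0, 0, n, -m)`; the first line of the
    -- system makes the second coefficient `k` times the eigenvalue.
    refine ⟨((n : ℝ), -(m : ℝ), n * (k * x), -(m * (k * x))),
      (0, 0, n * (k * y), -(m * (k * y))), ?_, ?_, ?_, ?_, ?_⟩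
    · rw [fderiv_constraints_fixedStar_eq_zero hm]
      exact ⟨by dsimp only; ring, h3⟩
    · rw [fderiv_constraints_fixedStar_eq_zero hm]
      exact ⟨by dsimp only; ring, h4⟩
    · simp only [ne_eq, Prod.mk_eq_zero, not_and]
      intro h; linarith [h.1]
    · rw [fderiv_field_fixedStar hm h3]
      have q : (k - 1) / k * (k * x - 2) = k * x ^ 2 - k * y ^ 2 := by
        field_simp; linear_combination -e1
      refine Prod.ext ?_ (Prod.ext ?_ (Prod.ext ?_ ?_)) <;>
        simp only [Prod.fst_sub, Prod.snd_sub, Prod.smul_fst, Prod.smul_snd, smul_eq_mul]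
      · field_simp; ring
      · field_simp; ring
      · linear_combination n * q
      · linear_combination -m * q
    · rw [fderiv_field_fixedStar hm h4]
      have q : (k - 1) / k * (k * y) = 2 * k * x * y := by
        refine mul_left_cancel₀ hk ?_
        rw [← mul_assoc, mul_div_cancel₀ _ hk]
        linear_combination -e2
      refine Prod.ext ?_ (Prod.ext ?_ (Prod.ext ?_ ?_)) <;>
        simp only [Prod.fst_add, Prod.snd_add, Prod.smul_fst, Prod.smul_snd, smul_eq_mul]
      · field_simp; ring
      · field_simp; ring
      · linear_combination n * q
      · linear_combination -m * q

/-- The scaled eigenvalue `k c` is a root of `X² - K X + 2 K`, whose roots have positive sum and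
positive product. -/
lemma re_pos_of_mem_linEigenvalues (hm : 1 < m) (hn : 1 < n) {c : ℂ}
    (hc : c ∈ linEigenvalues m n (fixedStar m n)) : 0 < c.re := by
  obtain ⟨e1, e2⟩ := (mem_linEigenvalues_iff hm hn).1 hc
  have h1 : (1 : ℝ) < m := by exact_mod_cast hm
  have h2 : (1 : ℝ) < n := by exact_mod_cast hn
  have hk : 0 < (m : ℝ) + n := by positivity
  refine (mul_pos_iff_of_pos_left hk).1 ?_
  generalize ((m : ℝ) + n) * c.re = x at *
  generalize ((m : ℝ) + n) * c.im = y at *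
  have e3 : (2 * x - ((m : ℝ) + n - 1)) * y = 0 := by linear_combination e2
  rcases mul_eq_zero.1 e3 with h | rfl
  · linarith
  · nlinarith [sq_nonneg x]

lemma im_eq_zero_iff_of_mem_linEigenvalues (hm : 1 < m) (hn : 1 < n) {c : ℂ}
    (hc : c ∈ linEigenvalues m n (fixedStar m n)) : c.im = 0 ↔ 9 ≤ m + n := by
  obtain ⟨e1, e2⟩ := (mem_linEigenvalues_iff hm hn).1 hc
  have h1 : (1 : ℝ) < m := by exact_mod_cast hm
  have h2 : (1 : ℝ) < n := by exact_mod_cast hn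
  have hk : 0 < (m : ℝ) + n := by positivity
  have h9 : 9 ≤ m + n ↔ (8 : ℝ) ≤ (m : ℝ) + n - 1 := by
    rw [le_sub_iff_add_le]; norm_num; exact_mod_cast Iff.rfl
  have hy : c.im = 0 ↔ ((m : ℝ) + n) * c.im = 0 := by simp [hk.ne']
  rw [h9, hy]
  generalize ((m : ℝ) + n) * c.re = x at *
  generalize ((m : ℝ) + n) * c.im = y at *
  have hK : 0 < (m : ℝ) + n - 1 := by linarith
  generalize (m : ℝ) + n - 1 = K at *
  have e3 : (2 * x - K) * y = 0 := by linear_combination e2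
  constructor
  · rintro rfl
    by_contra hcon
    nlinarith [sq_nonneg (2 * x - K)]
  · intro h8
    rcases mul_eq_zero.1 e3 with h | h
    · have hx : x = K / 2 := by linarith
      rw [hx] at e1
      nlinarith [sq_nonneg y]
    · exact h

/-- `IsSpiral` and `IsNode` quantify over all eigenvalues; without an actual one they could hold
vacuously and say nothing about the dimension. -/
lemma linEigenvalues_nonempty (hm : 1 < m) (hn : 1 < n) :
    (linEigenvalues m n (fixedStar m n)).Nonempty := by
  have h1 : (1 : ℝ) < m := by exact_mod_cast hm
  have h2 : (1 : ℝ) < n := by exact_mod_cast hn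
  have hk : (m : ℝ) + n ≠ 0 := by positivity
  rcases le_total 8 ((m : ℝ) + n - 1) with h | h
  · have hs : √(((m : ℝ) + n - 1) * ((m : ℝ) + n - 1 - 8)) ^ 2 = _ :=
      sq_sqrt (mul_nonneg (by linarith) (by linarith))
    refine ⟨⟨(((m : ℝ) + n - 1) + √(((m : ℝ) + n - 1) * ((m : ℝ) + n - 1 - 8))) / 2 / (m + n), 0⟩,
      (mem_linEigenvalues_iff hm hn).2 ⟨?_, by simp⟩⟩
    simp only
    rw [mul_div_cancel₀ _ hk]
    linear_combination hs / 4
  · have hs : √(((m : ℝ) + n - 1) * (8 - ((m : ℝ) + n - 1))) ^ 2 = _ :=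
      sq_sqrt (mul_nonneg (by linarith) (by linarith))
    refine ⟨⟨((m : ℝ) + n - 1) / 2 / (m + n),
      √(((m : ℝ) + n - 1) * (8 - ((m : ℝ) + n - 1))) / 2 / (m + n)⟩,
      (mem_linEigenvalues_iff hm hn).2 ⟨?_, ?_⟩⟩
    · simp only
      rw [mul_div_cancel₀ _ hk, mul_div_cancel₀ _ hk]
      linear_combination -hs / 4
    · simp only
      rw [mul_div_cancel₀ _ hk, mul_div_cancel₀ _ hk]
      ring

theorem isSpiral_fixedStar_iff (hm : 1 < m) (hn : 1 < n) :
    IsSpiral m n (fixedStar m n) ↔ m + n < 9 := by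
  constructor
  · intro h
    obtain ⟨c, hc⟩ := linEigenvalues_nonempty hm hn
    rw [← not_le, ← im_eq_zero_iff_of_mem_linEigenvalues hm hn hc]
    exact (h c hc).2
  · intro h c hc
    refine ⟨re_pos_of_mem_linEigenvalues hm hn hc, ?_⟩
    rwa [Ne, im_eq_zero_iff_of_mem_linEigenvalues hm hn hc, not_le]

theorem isNode_fixedStar_iff (hm : 1 < m) (hn : 1 < n) :
    IsNode m n (fixedStar m n) ↔ 9 ≤ m + n := by
  constructor
  · intro h
    obtain ⟨c, hc⟩ := linEigenvalues_nonempty hm hn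
    exact (im_eq_zero_iff_of_mem_linEigenvalues hm hn hc).1 (h c hc).2
  · exact fun h c hc => ⟨re_pos_of_mem_linEigenvalues hm hn hc,
      (im_eq_zero_iff_of_mem_linEigenvalues hm hn hc).2 h⟩

end Linearization
end WarpedVacuum
end

/-! ### Proper time and the solution belonging to an orbit. -/

noncomputable section
namespace WarpedVacuum
section Reconstruction
open Real

/-- `T` is a decreasing reparametrization of `(T₀, ∞)` by `ℝ`, with `T' = -f` and inverse `σ`. -/
structure Clock (f : ℝ → ℝ) (T₀ : ℝ) (T σ : ℝ → ℝ) : Prop where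
  rate_pos : ∀ τ, 0 < f τ
  deriv : ∀ τ, HasDerivAt T (-f τ) τ
  tendsto_atTop : Tendsto T atTop (𝓝 T₀)
  tendsto_atBot : Tendsto T atBot atTop
  lt : ∀ τ, T₀ < T τ
  left_inv : ∀ τ, σ (T τ) = τ
  right_inv : ∀ t, T₀ < t → T (σ t) = t

namespace Clock

variable {f : ℝ → ℝ} {T₀ : ℝ} {T σ : ℝ → ℝ}

lemma strictAnti (h : Clock f T₀ T σ) : StrictAnti T :=
  strictAnti_of_hasDerivAt_neg h.deriv fun τ => by linarith [h.rate_pos τ]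

lemma lt_iff (h : Clock f T₀ T σ) {t τ : ℝ} (ht : T₀ < t) : σ t < τ ↔ T τ < t := by
  rw [← h.strictAnti.lt_iff_gt, h.right_inv t ht]

lemma lt_iff' (h : Clock f T₀ T σ) {t τ : ℝ} (ht : T₀ < t) : τ < σ t ↔ t < T τ := by
  rw [← h.strictAnti.lt_iff_gt, h.right_inv t ht]

lemma continuousAt_inv (h : Clock f T₀ T σ) {t : ℝ} (ht : T₀ < t) : ContinuousAt σ t := by
  rw [ContinuousAt, tendsto_order]
  refine ⟨fun τ hτ => ?_, fun τ hτ => ?_⟩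
  · filter_upwards [eventually_lt_nhds ((h.lt_iff' ht).1 hτ), eventually_gt_nhds ht] with s h1 h2
    exact (h.lt_iff' h2).2 h1
  · filter_upwards [eventually_gt_nhds ((h.lt_iff ht).1 hτ), eventually_gt_nhds ht] with s h1 h2
    exact (h.lt_iff h2).2 h1

lemma hasDerivAt_inv (h : Clock f T₀ T σ) {t : ℝ} (ht : T₀ < t) :
    HasDerivAt σ (-(1 / f (σ t))) t := by
  have := HasDerivAt.of_local_left_inverse (h.continuousAt_inv ht) (h.deriv (σ t))
    (by linarith [h.rate_pos (σ t)]) (by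
      filter_upwards [eventually_gt_nhds ht] with s hs using h.right_inv s hs)
  refine this.congr_deriv ?_
  rw [inv_neg, one_div]

lemma inv_tendsto_nhdsGT (h : Clock f T₀ T σ) : Tendsto σ (𝓝[>] T₀) atTop := by
  rw [Filter.tendsto_atTop]
  intro τ
  have h1 : ∀ᶠ t in 𝓝[>] T₀, t < T τ := (eventually_lt_nhds (h.lt τ)).filter_mono nhdsWithin_le_nhds
  filter_upwards [h1, self_mem_nhdsWithin] with t h2 h3
  exact ((h.lt_iff' h3).2 h2).le

lemma inv_tendsto_atTop (h : Clock f T₀ T σ) : Tendsto σ atTop atBot := by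
  rw [Filter.tendsto_atBot]
  intro τ
  filter_upwards [eventually_gt_atTop (T τ)] with t ht
  exact ((h.lt_iff ((h.lt τ).trans ht)).2 ht).le

end Clock

/-- `T` is `t₀` minus a primitive of `f`. The exponential bound makes the singularity a finite time
away, and the lower bound makes the expanding direction complete. -/
lemma exists_clock {f : ℝ → ℝ} (hf : Continuous f) (hpos : ∀ τ, 0 < f τ) {δ C μ : ℝ} (hδ : 0 < δ)
    (hμ : 0 < μ) (hlow : ∀ τ ≤ 0, δ ≤ f τ) (hup : ∀ τ ≥ 0, f τ ≤ C * exp (-(μ * τ))) (t₀ : ℝ) :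
    ∃ T₀ T σ, Clock f T₀ T σ ∧ T 0 = t₀ := by
  let T : ℝ → ℝ := fun τ => t₀ - ∫ s in (0)..τ, f s
  have hd : ∀ τ, HasDerivAt T (-f τ) τ := fun τ =>
    (intervalIntegral.integral_hasDerivAt_right (hf.intervalIntegrable 0 τ)
      (hf.stronglyMeasurableAtFilter _ _) hf.continuousAt).const_sub t₀
  have hT : Continuous T := continuous_iff_continuousAt.2 fun τ => (hd τ).continuousAt
  have hanti : StrictAnti T := strictAnti_of_hasDerivAt_neg hd fun τ => by linarith [hpos τ]
  obtain ⟨T₀, hT₀⟩ := exists_limit_of_exp_decay hμ (fun τ (_ : τ ≥ 0) => hd τ) (fun τ hτ => by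
    rw [norm_neg, norm_eq_abs, abs_of_pos (hpos τ)]; exact hup τ hτ)
  have hlim : Tendsto T atTop (𝓝 T₀) := by
    rw [tendsto_iff_norm_sub_tendsto_zero]
    refine squeeze_zero' (Eventually.of_forall fun _ => norm_nonneg _)
      ((eventually_ge_atTop 0).mono hT₀) ?_
    simpa using (tendsto_exp_neg_mul hμ).const_mul (C / μ)
  have hbot : Tendsto T atBot atTop := by
    have h1 : ∀ τ ≤ 0, t₀ + δ * (-τ) ≤ T τ := by
      intro τ hτ
      have := add_mul_le_of_le_hasDerivAt (t₀ := 0) (f := fun s => T (-s)) (f' := fun s => f (-s))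
        (δ := δ) (fun s _ => ((hd (-s)).scomp s (hasDerivAt_neg s)).congr_deriv (by simp))
        (fun s hs => hlow _ (by linarith)) (-τ) (by linarith)
      simpa [T] using this
    refine tendsto_atTop_mono' _ ((eventually_le_atBot 0).mono h1) ?_
    exact tendsto_atTop_add_const_left _ _ (tendsto_neg_atBot_atTop.const_mul_atTop hδ)
  have hlt : ∀ τ, T₀ < T τ := fun τ =>
    (hanti.antitone.le_of_tendsto hlim (τ + 1)).trans_lt (hanti (by linarith))
  have hsurj : ∀ t, T₀ < t → ∃ τ, T τ = t := by
    intro t ht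
    obtain ⟨x, hx⟩ := (hlim.eventually_lt_const ht).exists
    obtain ⟨y, hy⟩ := (hbot.eventually_gt_atTop t).exists
    exact mem_range_of_exists_le_of_exists_ge hT ⟨x, hx.le⟩ ⟨y, hy.le⟩
  refine ⟨T₀, T, Function.invFun T, ⟨hpos, hd, hlim, hbot, hlt,
    Function.leftInverse_invFun hanti.injective, fun t ht => Function.invFun_eq (hsurj t ht)⟩, ?_⟩
  simp [T]

variable {m n : ℕ}

/-- The solutions of the scale factor equations are determined by their values at one time. -/
lemma ScaleODE.eqOn {I J : Set ℝ} {a b p q a' b' p' q' : ℝ → ℝ} (h : ScaleODE m n I a b p q)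
    (h' : ScaleODE m n J a' b' p' q') {t₀ : ℝ} (hI : t₀ ∈ I) (hJ : t₀ ∈ J) (ha : a t₀ = a' t₀)
    (hb : b t₀ = b' t₀) (hp : p t₀ = p' t₀) (hq : q t₀ = q' t₀) {t : ℝ} (ht : t ∈ I) (ht' : t ∈ J) :
    a t = a' t ∧ b t = b' t ∧ p t = p' t ∧ q t = q' t := by
  have hsub : ∀ {I : Set ℝ} {a b p q : ℝ → ℝ}, ScaleODE m n I a b p q → t₀ ∈ I → t ∈ I →
      ∃ ε > 0, Set.Ioo (min t t₀ - ε) (max t t₀ + ε) ⊆ I := by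
    intro I a b p q h h0 h1
    have hc : Set.Icc (min t t₀) (max t t₀) ⊆ I := h.ordConnected.uIcc_subset h1 h0
    have hmin : min t t₀ ∈ I := hc (Set.left_mem_Icc.2 min_le_max)
    have hmax : max t t₀ ∈ I := hc (Set.right_mem_Icc.2 min_le_max)
    obtain ⟨ε₁, hε₁, h2⟩ := Metric.isOpen_iff.1 h.isOpen _ hmin
    obtain ⟨ε₂, hε₂, h3⟩ := Metric.isOpen_iff.1 h.isOpen _ hmax
    refine ⟨min ε₁ ε₂, lt_min hε₁ hε₂, fun s hs => ?_⟩
    have e1 := min_le_left ε₁ ε₂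
    have e2 := min_le_right ε₁ ε₂
    rcases lt_or_ge s (min t t₀) with h4 | h4
    · exact h2 (by rw [Real.ball_eq_Ioo]; exact ⟨by linarith [hs.1], by linarith⟩)
    rcases le_or_gt s (max t t₀) with h5 | h5
    · exact hc ⟨h4, h5⟩
    · exact h3 (by rw [Real.ball_eq_Ioo]; exact ⟨by linarith, by linarith [hs.2]⟩)
  obtain ⟨ε₁, hε₁, h1⟩ := hsub h hI ht
  obtain ⟨ε₂, hε₂, h2⟩ := hsub h' hJ ht'
  set ε := min ε₁ ε₂
  have hε : 0 < ε := lt_min hε₁ hε₂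
  have e1 : ε ≤ ε₁ := min_le_left ε₁ ε₂
  have e2 : ε ≤ ε₂ := min_le_right ε₁ ε₂
  -- In terms of log a and log b the field is smooth on all of ℝ⁴, so the standard uniqueness
  -- theorem applies without regard to positivity.
  let v : ℝ × ℝ × ℝ × ℝ → ℝ × ℝ × ℝ × ℝ := fun X => (-X.2.2.1, -X.2.2.2,
    X.2.2.1 * (m * X.2.2.1 + n * X.2.2.2) - (m + n - 1) * exp (-(2 * X.1)),
    X.2.2.2 * (m * X.2.2.1 + n * X.2.2.2) - (m + n - 1) * exp (-(2 * X.2.1)))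
  have hv : ContMDiff 𝓘(ℝ, ℝ × ℝ × ℝ × ℝ) (𝓘(ℝ, ℝ × ℝ × ℝ × ℝ).prod 𝓘(ℝ, ℝ × ℝ × ℝ × ℝ)) 1
      (fun X : ℝ × ℝ × ℝ × ℝ => (⟨X, v X⟩ : TangentBundle 𝓘(ℝ, ℝ × ℝ × ℝ × ℝ) (ℝ × ℝ × ℝ × ℝ))) := by
    refine contMDiff_vectorSpace_iff_contDiff.2 ?_
    simp only [v]
    fun_prop
  have key : ∀ {I : Set ℝ} {a b p q : ℝ → ℝ}, ScaleODE m n I a b p q → ∀ {s}, s ∈ I →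
      HasDerivAt (fun t => (log (a t), log (b t), p t, q t)) (v (log (a s), log (b s), p s, q s)) s := by
    intro I a b p q h s hs
    have ha := h.a_pos s hs
    have hb := h.b_pos s hs
    refine (((h.a_deriv s hs).log ha.ne').prodMk (((h.b_deriv s hs).log hb.ne').prodMk
      ((h.p_deriv s hs).prodMk (h.q_deriv s hs)))).congr_deriv ?_
    have ea : exp (-(2 * log (a s))) = 1 / a s ^ 2 := by
      rw [exp_neg, two_mul, exp_add, exp_log ha, one_div, sq]
    have eb : exp (-(2 * log (b s))) = 1 / b s ^ 2 := by
      rw [exp_neg, two_mul, exp_add, exp_log hb, one_div, sq]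
    simp only [v, ea, eb]
    refine Prod.ext ?_ (Prod.ext ?_ (Prod.ext ?_ ?_)) <;> dsimp only
    · field_simp
    · field_simp
    · ring
    · ring
  have hcurve : ∀ {I : Set ℝ} {a b p q : ℝ → ℝ}, ScaleODE m n I a b p q →
      Set.Ioo (min t t₀ - ε) (max t t₀ + ε) ⊆ I →
      IsMIntegralCurveOn (I := 𝓘(ℝ, ℝ × ℝ × ℝ × ℝ)) (fun t => (log (a t), log (b t), p t, q t)) v
        (Set.Ioo (min t t₀ - ε) (max t t₀ + ε)) := by
    intro I a b p q h hI s hs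
    exact (key h (hI hs)).hasFDerivAt.hasFDerivWithinAt.hasMFDerivWithinAt
  have s1 : Set.Ioo (min t t₀ - ε) (max t t₀ + ε) ⊆ I := fun s hs =>
    h1 ⟨by linarith [hs.1], by linarith [hs.2]⟩
  have s2 : Set.Ioo (min t t₀ - ε) (max t t₀ + ε) ⊆ J := fun s hs =>
    h2 ⟨by linarith [hs.1], by linarith [hs.2]⟩
  have htm : t ∈ Set.Ioo (min t t₀ - ε) (max t t₀ + ε) :=
    ⟨by linarith [min_le_left t t₀], by linarith [le_max_left t t₀]⟩
  have := isMIntegralCurveOn_Ioo_eqOn_of_contMDiff_boundaryless (t₀ := t₀)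
    ⟨by linarith [min_le_right t t₀], by linarith [le_max_right t t₀]⟩ hv
    (hcurve h s1) (hcurve h' s2) (by simp [ha, hb, hp, hq]) htm
  simp only [Prod.mk.injEq] at this
  exact ⟨log_injOn_pos (h.a_pos t ht) (h'.a_pos t ht') this.1,
    log_injOn_pos (h.b_pos t ht) (h'.b_pos t ht') this.2.1, this.2.2.1, this.2.2.2⟩

/-- Minus the derivative of proper time with respect to `τ`, that is `-1 / H`. -/
def tick (m n : ℕ) (hm : 1 < m) (hn : 1 < n) (c : ℝ) (w θ : ℝ → ℝ) (τ : ℝ) : ℝ :=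
  c / (m + n) * exp (-(τ / (m + n)) - (osc m n hm hn).energy (w τ) (θ τ) / 2)

/-- The scale factor of the first factor in terms of `τ`. -/
def scaleA (m n : ℕ) (c : ℝ) (w : ℝ → ℝ) (τ : ℝ) : ℝ := c * exp (-(τ / (m + n)) - n / (m + n) * w τ)

/-- The scale factor of the second factor in terms of `τ`. -/
def scaleB (m n : ℕ) (c : ℝ) (w : ℝ → ℝ) (τ : ℝ) : ℝ := c * exp (-(τ / (m + n)) + m / (m + n) * w τ)

variable {hm : 1 < m} {hn : 1 < n} {c : ℝ} {w θ : ℝ → ℝ}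

lemma tick_pos (hc : 0 < c) (τ : ℝ) : 0 < tick m n hm hn c w θ τ := by
  have h1 : (1 : ℝ) < m := by exact_mod_cast hm
  exact mul_pos (by positivity) (exp_pos _)

/-- The energy is, up to elementary factors, the logarithm of the denominators of `A` and `B`; this
is what makes `A a = B b = -1/H` an identity. -/
lemma exp_energy (x : ℝ × ℝ) : exp ((osc m n hm hn).energy x.1 x.2 / 2) =
    cosh x.2 * √(((m : ℝ) + n) * (m * exp (2 * x.1) + n)) * exp (-(m / (m + n) * x.1)) / (m + n) := by
  have h1 : (1 : ℝ) < m := by exact_mod_cast hm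
  have hk : 0 < (m : ℝ) + n := by positivity
  have hd := denom_pos (n := n) hm x.1
  have e : (osc m n hm hn).energy x.1 x.2 / 2 = log (cosh x.2) + log (√(((m : ℝ) + n) * (m * exp (2 * x.1) + n)))
      + (-(m / (m + n) * x.1)) - log (m + n) := by
    rw [log_sqrt (by positivity), log_mul hk.ne' hd.ne']
    simp only [Osc.energy, osc]
    ring
  rw [e, exp_sub, exp_add, exp_add, exp_log (cosh_pos _), exp_log (sqrt_pos.2 (by positivity)),
    exp_log hk]

lemma scaleA_mul (hc : 0 < c) (τ : ℝ) :
    (stateOf m n (w τ, θ τ)).1 * scaleA m n c w τ = tick m n hm hn c w θ τ := by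
  have h1 : (1 : ℝ) < m := by exact_mod_cast hm
  have hk : 0 < (m : ℝ) + n := by positivity
  have hd := denom_pos (n := n) hm (w τ)
  have hs : 0 < √(((m : ℝ) + n) * (m * exp (2 * w τ) + n)) := sqrt_pos.2 (by positivity)
  have hcosh := cosh_pos (θ τ)
  have he := exp_energy (hm := hm) (hn := hn) (w τ, θ τ)
  simp only at he
  rw [tick, exp_sub (-(τ / _)), he, scaleA, exp_sub, stateOf]
  have e2 : exp (w τ) = exp (n / (m + n) * w τ) * exp (m / (m + n) * w τ) := by
    rw [← exp_add]; congr 1; field_simp; ring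
  simp only
  rw [e2, exp_neg (m / (m + n) * w τ)]
  field_simp

lemma scaleB_mul (hc : 0 < c) (τ : ℝ) :
    (stateOf m n (w τ, θ τ)).2.1 * scaleB m n c w τ = tick m n hm hn c w θ τ := by
  have h1 : (1 : ℝ) < m := by exact_mod_cast hm
  have hk : 0 < (m : ℝ) + n := by positivity
  rw [← scaleA_mul hc]
  have e2 : exp (w τ) = exp (n / (m + n) * w τ) * exp (m / (m + n) * w τ) := by
    rw [← exp_add]; congr 1; field_simp; ring
  simp only [stateOf, scaleA, scaleB]
  rw [exp_sub, exp_add, e2]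
  field_simp

/-- The logarithmic derivative of `-1/H` must be `-Σ`, and `Σ = 1/k + E'/2`; hence the closed
formula in terms of the energy. -/
lemma hasDerivAt_tick (h : (osc m n hm hn).IsOrbit w θ) (τ : ℝ) :
    HasDerivAt (tick m n hm hn c w θ) (-(tick m n hm hn c w θ τ *
      (m * (stateOf m n (w τ, θ τ)).2.2.1 ^ 2 + n * (stateOf m n (w τ, θ τ)).2.2.2 ^ 2))) τ := by
  have := ((((hasDerivAt_id τ).div_const ((m : ℝ) + n)).fun_neg.fun_sub
    ((h.energy_deriv τ).div_const 2)).exp).const_mul (c / ((m : ℝ) + n))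
  refine this.congr_deriv ?_
  rw [shear_sum_stateOf hm hn, tick]
  simp only [osc, id]
  ring

lemma hasDerivAt_scaleA (h : (osc m n hm hn).IsOrbit w θ) (τ : ℝ) :
    HasDerivAt (scaleA m n c w) (-(scaleA m n c w τ * (stateOf m n (w τ, θ τ)).2.2.1)) τ := by
  have := ((((hasDerivAt_id τ).div_const ((m : ℝ) + n)).fun_neg.fun_sub
    ((h.dw τ).const_mul ((n : ℝ) / (m + n)))).exp).const_mul c
  refine this.congr_deriv ?_
  simp only [osc, id, scaleA, stateOf]
  ring

lemma hasDerivAt_scaleB (h : (osc m n hm hn).IsOrbit w θ) (τ : ℝ) :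
    HasDerivAt (scaleB m n c w) (-(scaleB m n c w τ * (stateOf m n (w τ, θ τ)).2.2.2)) τ := by
  have := ((((hasDerivAt_id τ).div_const ((m : ℝ) + n)).fun_neg.fun_add
    ((h.dw τ).const_mul ((m : ℝ) / (m + n)))).exp).const_mul c
  refine this.congr_deriv ?_
  simp only [osc, id, scaleB, stateOf]
  ring

/-- Monotonicity of the energy bounds the rate below for `τ ≤ 0`; its nonnegativity bounds it above
by a decaying exponential. -/
lemma exists_clock_tick (h : (osc m n hm hn).IsOrbit w θ) (hc : 0 < c) (t₀ : ℝ) :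
    ∃ T₀ T σ, Clock (tick m n hm hn c w θ) T₀ T σ ∧ T 0 = t₀ := by
  have h1 : (1 : ℝ) < m := by exact_mod_cast hm
  have hk : 0 < (m : ℝ) + n := by positivity
  refine exists_clock (δ := c / (m + n) * exp (-((osc m n hm hn).energy (w 0) (θ 0) / 2)))
    (C := c / (m + n)) (μ := 1 / (m + n))
    (continuous_iff_continuousAt.2 fun τ => (hasDerivAt_tick h τ).continuousAt)
    (fun τ => tick_pos hc τ) (by positivity) (by positivity) (fun τ hτ => ?_) (fun τ hτ => ?_) t₀
  · have h2 := h.energy_monotone hτ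
    have h3 : τ / ((m : ℝ) + n) ≤ 0 := div_nonpos_of_nonpos_of_nonneg hτ hk.le
    rw [tick]
    gcongr
    simp only at h2
    linarith
  · have h2 := (osc m n hm hn).energy_nonneg (w τ) (θ τ)
    rw [tick]
    gcongr
    rw [one_div_mul_eq_div]
    linarith

lemma mem_stateSpace_iff {X : Vars} : X ∈ stateSpace m n ↔ m * X.2.2.1 + n * X.2.2.2 = 1 ∧
    (m * X.2.2.1 ^ 2 + n * X.2.2.2 ^ 2) + ((m : ℝ) + n - 1) * (m * X.1 ^ 2 + n * X.2.1 ^ 2) = 1 ∧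
    0 < X.1 ∧ 0 < X.2.1 := by
  obtain ⟨A, B, P, Q⟩ := X
  simp only [stateSpace, constraints, Set.mem_ofPred_eq, Prod.mk_eq_zero, sub_eq_zero, and_assoc]

/-- The vacuum solution belonging to an orbit of the reduced system. -/
lemma Clock.scaleODE (h : (osc m n hm hn).IsOrbit w θ) (hc : 0 < c) {T₀ : ℝ} {T σ : ℝ → ℝ}
    (hT : Clock (tick m n hm hn c w θ) T₀ T σ) :
    ScaleODE m n (Set.Ioi T₀) (fun t => scaleA m n c w (σ t)) (fun t => scaleB m n c w (σ t))
      (fun t => -((stateOf m n (w (σ t), θ (σ t))).2.2.1 / tick m n hm hn c w θ (σ t)))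
      (fun t => -((stateOf m n (w (σ t), θ (σ t))).2.2.2 / tick m n hm hn c w θ (σ t))) := by
  have hst := fun τ => (hasDerivAt_stateOf hm hn h τ).hasFDerivAt
  have hP : ∀ τ, HasDerivAt (fun τ => (stateOf m n (w τ, θ τ)).2.2.1)
      (field m n (stateOf m n (w τ, θ τ))).2.2.1 τ := fun τ =>
    (hst τ).snd.snd.fst.hasDerivAt.congr_deriv (by simp)
  have hQ : ∀ τ, HasDerivAt (fun τ => (stateOf m n (w τ, θ τ)).2.2.2)
      (field m n (stateOf m n (w τ, θ τ))).2.2.2 τ := fun τ =>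
    (hst τ).snd.snd.snd.hasDerivAt.congr_deriv (by simp)
  have hmul := fun τ => (mem_stateSpace_iff.1 (stateOf_mem hm hn (w τ, θ τ))).1
  have hcon := fun τ => (mem_stateSpace_iff.1 (stateOf_mem hm hn (w τ, θ τ))).2.1
  have hApos : ∀ τ, 0 < scaleA m n c w τ := fun τ => mul_pos hc (exp_pos _)
  have hBpos : ∀ τ, 0 < scaleB m n c w τ := fun τ => mul_pos hc (exp_pos _)
  refine ⟨isOpen_Ioi, Set.ordConnected_Ioi, Set.nonempty_Ioi, fun t _ => hApos _, fun t _ => hBpos _,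
    fun t ht => ?_, fun t ht => ?_, fun t ht => ?_, fun t ht => ?_, fun t ht => ?_⟩ <;>
  have hσ := hT.hasDerivAt_inv ht <;>
  have hf := hT.rate_pos (σ t) <;>
  have hA := scaleA_mul (θ := θ) (hn := hn) (hm := hm) (w := w) hc (σ t) <;>
  have hB := scaleB_mul (θ := θ) (hn := hn) (hm := hm) (w := w) hc (σ t) <;>
  have h1 := hmul (σ t) <;>
  have h2 := hcon (σ t) <;>
  have hP' := hP (σ t) <;>
  have hQ' := hQ (σ t) <;>
  have hA' := hasDerivAt_scaleA (c := c) h (σ t) <;>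
  have hB' := hasDerivAt_scaleB (c := c) h (σ t) <;>
  have hf' := hasDerivAt_tick (c := c) h (σ t) <;>
  have hAp := hApos (σ t) <;>
  have hBp := hBpos (σ t)
  · refine (hA'.comp t hσ).congr_deriv ?_
    field_simp
  · refine (hB'.comp t hσ).congr_deriv ?_
    field_simp
  · refine (((hP'.comp t hσ).fun_div (hf'.comp t hσ) hf.ne').fun_neg).congr_deriv ?_
    simp only [field, Function.comp]
    set f := tick m n hm hn c w θ (σ t)
    set A := (stateOf m n (w (σ t), θ (σ t))).1
    set P := (stateOf m n (w (σ t), θ (σ t))).2.2.1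
    set Q := (stateOf m n (w (σ t), θ (σ t))).2.2.2
    -- The mean curvature is `-1 / f` by the linear constraint, and `A a = f` turns `1 / a²` into
    -- `A² / f²`; the field equations then become those of the reduced system.
    have e1 : (m : ℝ) * -(P / f) + n * -(Q / f) = -(1 / f) := by rw [← h1]; ring
    have e2 : 1 / scaleA m n c w (σ t) ^ 2 = A ^ 2 / f ^ 2 := by
      rw [← hA, mul_pow] ; rw [← hA] at hf
      have : A ≠ 0 := left_ne_zero_of_mul hf.ne'
      field_simp
    rw [e1, div_eq_mul_one_div _ (scaleA m n c w (σ t) ^ 2), e2]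
    field_simp
    ring
  · refine (((hQ'.comp t hσ).fun_div (hf'.comp t hσ) hf.ne').fun_neg).congr_deriv ?_
    simp only [field, Function.comp]
    set f := tick m n hm hn c w θ (σ t)
    set B := (stateOf m n (w (σ t), θ (σ t))).2.1
    set P := (stateOf m n (w (σ t), θ (σ t))).2.2.1
    set Q := (stateOf m n (w (σ t), θ (σ t))).2.2.2
    have e1 : (m : ℝ) * -(P / f) + n * -(Q / f) = -(1 / f) := by rw [← h1]; ring
    have e2 : 1 / scaleB m n c w (σ t) ^ 2 = B ^ 2 / f ^ 2 := by
      rw [← hB, mul_pow] ; rw [← hB] at hf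
      have : B ≠ 0 := left_ne_zero_of_mul hf.ne'
      field_simp
    rw [e1, div_eq_mul_one_div _ (scaleB m n c w (σ t) ^ 2), e2]
    field_simp
    ring
  · set f := tick m n hm hn c w θ (σ t)
    set A := (stateOf m n (w (σ t), θ (σ t))).1
    set B := (stateOf m n (w (σ t), θ (σ t))).2.1
    set P := (stateOf m n (w (σ t), θ (σ t))).2.2.1
    set Q := (stateOf m n (w (σ t), θ (σ t))).2.2.2
    have e1 : (m : ℝ) * -(P / f) + n * -(Q / f) = -(1 / f) := by rw [← h1]; ring
    have ea : m / scaleA m n c w (σ t) ^ 2 = m * A ^ 2 / f ^ 2 := by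
      rw [← hA, mul_pow] ; rw [← hA] at hf
      have : A ≠ 0 := left_ne_zero_of_mul hf.ne'
      field_simp
    have eb : n / scaleB m n c w (σ t) ^ 2 = n * B ^ 2 / f ^ 2 := by
      rw [← hB, mul_pow] ; rw [← hB] at hf
      have : B ≠ 0 := left_ne_zero_of_mul hf.ne'
      field_simp
    rw [e1, ea, eb]
    field_simp
    linarith

end Reconstruction
end WarpedVacuum
end

/-! ### Maximal solutions are reconstructed from orbits. -/

noncomputable section
namespace WarpedVacuum
section MaximalSolutions
open Real

variable {m n : ℕ} {hm : 1 < m} {hn : 1 < n} {c : ℝ} {w θ : ℝ → ℝ}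

lemma tick_tendsto_zero (hc : 0 < c) : Tendsto (tick m n hm hn c w θ) atTop (𝓝 0) := by
  have h1 : (1 : ℝ) < m := by exact_mod_cast hm
  have hk : 0 < (m : ℝ) + n := by positivity
  have hlim : Tendsto (fun τ => c / ((m : ℝ) + n) * exp (-(1 / (m + n) * τ))) atTop (𝓝 0) := by
    simpa using (tendsto_exp_neg_mul (one_div_pos.2 hk)).const_mul (c / ((m : ℝ) + n))
  refine squeeze_zero (fun τ => (tick_pos hc τ).le) (fun τ => ?_) hlim
  have h2 := (osc m n hm hn).energy_nonneg (w τ) (θ τ)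
  rw [tick]
  gcongr
  rw [one_div_mul_eq_div]
  linarith

/-- The initial data at one time are those of a solution reconstructed from an orbit. -/
lemma ScaleODE.exists_orbit (hm : 1 < m) (hn : 1 < n) {I : Set ℝ} {a b p q : ℝ → ℝ}
    (h : ScaleODE m n I a b p q) {t₀ : ℝ} (ht : t₀ ∈ I) (hH : m * p t₀ + n * q t₀ < 0) :
    ∃ w θ c T₀ T σ, (osc m n hm hn).IsOrbit w θ ∧ 0 < c ∧ Clock (tick m n hm hn c w θ) T₀ T σ ∧
      T 0 = t₀ ∧ scaleA m n c w 0 = a t₀ ∧ scaleB m n c w 0 = b t₀ ∧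
      -((stateOf m n (w 0, θ 0)).2.2.1 / tick m n hm hn c w θ 0) = p t₀ ∧
      -((stateOf m n (w 0, θ 0)).2.2.2 / tick m n hm hn c w θ 0) = q t₀ := by
  have h1 : (1 : ℝ) < m := by exact_mod_cast hm
  have hk : 0 < (m : ℝ) + n := by positivity
  have ha := h.a_pos t₀ ht
  have hb := h.b_pos t₀ ht
  have hcon := h.constraint t₀ ht
  set H := m * p t₀ + n * q t₀ with hHdef
  have hH' : 0 < -H := by linarith
  have hHne : H ≠ 0 := hH.ne
  have hX : ((-(1 / (a t₀ * H)), -(1 / (b t₀ * H)), p t₀ / H, q t₀ / H) : Vars) ∈ stateSpace m n := by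
    rw [mem_stateSpace_iff]
    refine ⟨?_, ?_, ?_, ?_⟩ <;> dsimp only
    · rw [← mul_div_assoc, ← mul_div_assoc, ← add_div, ← hHdef, div_self hHne]
    · have : m * (p t₀ / H) ^ 2 + n * (q t₀ / H) ^ 2 + ((m : ℝ) + n - 1) *
          (m * (-(1 / (a t₀ * H))) ^ 2 + n * (-(1 / (b t₀ * H))) ^ 2) =
          (m * p t₀ ^ 2 + n * q t₀ ^ 2 + (m + n - 1) * (m / a t₀ ^ 2 + n / b t₀ ^ 2)) / H ^ 2 := by
        field_simp
      rw [this, ← hcon, div_self (pow_ne_zero 2 hHne)]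
    · rw [← one_div_neg_eq_neg_one_div, ← mul_neg]; positivity
    · rw [← one_div_neg_eq_neg_one_div, ← mul_neg]; positivity
  obtain ⟨w, θ, ho, hw, hθ⟩ := (osc m n hm hn).exists_isOrbit
    (coordOf m n (-(1 / (a t₀ * H)), -(1 / (b t₀ * H)), p t₀ / H, q t₀ / H)).1
    (coordOf m n (-(1 / (a t₀ * H)), -(1 / (b t₀ * H)), p t₀ / H, q t₀ / H)).2
  have hst : stateOf m n (w 0, θ 0) = (-(1 / (a t₀ * H)), -(1 / (b t₀ * H)), p t₀ / H, q t₀ / H) := by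
    rw [hw, hθ]
    exact stateOf_coordOf hm hn hX
  -- The overall scale is fixed by requiring `-1/H` to be right at `t₀`; both scale factors are then
  -- right because of `A a = B b = -1/H`.
  set c := (m + n) * exp ((osc m n hm hn).energy (w 0) (θ 0) / 2) / -H with hcdef
  have hc : 0 < c := by positivity
  have htick : tick m n hm hn c w θ 0 = 1 / -H := by
    rw [tick, hcdef, zero_div, neg_zero, zero_sub, exp_neg]
    field_simp
  obtain ⟨T₀, T, σ, hT, hT0⟩ := exists_clock_tick ho hc t₀
  have hA := scaleA_mul (θ := θ) (hn := hn) (hm := hm) (w := w) hc 0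
  have hB := scaleB_mul (θ := θ) (hn := hn) (hm := hm) (w := w) hc 0
  rw [hst, htick] at hA hB
  refine ⟨w, θ, c, T₀, T, σ, ho, hc, hT, hT0, ?_, ?_, ?_, ?_⟩
  · simp only at hA
    field_simp at hA
    linarith
  · simp only at hB
    field_simp at hB
    linarith
  · rw [hst, htick]; field_simp
  · rw [hst, htick]; field_simp

variable {M : Type*} [TopologicalSpace M] [ChartedSpace (Fin m → ℝ) M]
  [IsManifold 𝓘(ℝ, Fin m → ℝ) ∞ M]
  {N : Type*} [TopologicalSpace N] [ChartedSpace (Fin n → ℝ) N]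
  [IsManifold 𝓘(ℝ, Fin n → ℝ) ∞ N] {g : RMetric m M} {h : RMetric n N} {I : Set ℝ} {a b : ℝ → ℝ}

/-- A maximal vacuum solution which is expanding at some time comes from an orbit of the reduced
system. -/
theorem IsMaximalVacuum.exists_orbit [Nonempty M] [Nonempty N] (hm : 1 < m) (hn : 1 < n)
    (hg : IsEinstein (-((m : ℝ) + n - 1)) g) (hh : IsEinstein (-((m : ℝ) + n - 1)) h)
    (hv : IsMaximalVacuum g h I a b) (hH : ∃ t ∈ I, meanCurv m n a b t < 0) :
    ∃ w θ c T₀ T σ, (osc m n hm hn).IsOrbit w θ ∧ 0 < c ∧ Clock (tick m n hm hn c w θ) T₀ T σ ∧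
      I = Set.Ioi T₀ ∧ ∀ t, T₀ < t → a t = scaleA m n c w (σ t) ∧ b t = scaleB m n c w (σ t) ∧
        meanCurv m n a b t < 0 ∧ varsAt m n a b t = stateOf m n (w (σ t), θ (σ t)) := by
  obtain ⟨t₀, ht₀, hH⟩ := hH
  have hs := hv.1.scaleODE (by omega) (by omega) hg hh
  obtain ⟨w, θ, c, T₀, T, σ, ho, hc, hT, hT0, ha0, hb0, hp0, hq0⟩ := hs.exists_orbit hm hn ht₀ hH
  have hs' := hT.scaleODE ho hc
  have hσ0 : σ t₀ = 0 := by rw [← hT0, hT.left_inv]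
  have htT : T₀ < t₀ := hT0 ▸ hT.lt 0
  have hmul := fun τ => (mem_stateSpace_iff.1 (stateOf_mem hm hn (w τ, θ τ))).1
  have heq : ∀ t ∈ I, T₀ < t → _ := fun t ht ht' =>
    hs.eqOn hs' ht₀ htT (by rw [hσ0, ha0]) (by rw [hσ0, hb0]) (by rw [hσ0, hp0])
      (by rw [hσ0, hq0]) ht ht'
  have hHt : ∀ t ∈ I, T₀ < t → meanCurv m n a b t = -(1 / tick m n hm hn c w θ (σ t)) := by
    intro t ht ht'
    obtain ⟨-, -, e1, e2⟩ := heq t ht ht'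
    rw [meanCurv, e1, e2, ← hmul (σ t)]
    ring
  -- If `I` reached `T₀`, the mean curvature would be continuous there; but it is `-1 / tick` to the
  -- right of `T₀` and tends to `-∞`.
  have hsub : I ⊆ Set.Ioi T₀ := by
    intro t₁ ht₁
    by_contra hcon
    rw [Set.mem_Ioi, not_lt] at hcon
    have hTI : T₀ ∈ I := hs.ordConnected.out ht₁ ht₀ ⟨hcon, htT.le⟩
    have hcont : Tendsto (meanCurv m n a b) (𝓝[>] T₀) (𝓝 (meanCurv m n a b T₀)) :=
      (((hs.p_deriv T₀ hTI).continuousAt.const_mul (m : ℝ)).add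
        ((hs.q_deriv T₀ hTI).continuousAt.const_mul (n : ℝ))).mono_left nhdsWithin_le_nhds
    have h0 : Tendsto (fun t => tick m n hm hn c w θ (σ t)) (𝓝[>] T₀) (𝓝[>] 0) :=
      tendsto_nhdsWithin_iff.2 ⟨(tick_tendsto_zero hc).comp hT.inv_tendsto_nhdsGT,
        Eventually.of_forall fun t => tick_pos hc _⟩
    have h1 : Tendsto (fun t => -(1 / tick m n hm hn c w θ (σ t))) (𝓝[>] T₀) atBot := by
      simp only [one_div]
      exact tendsto_neg_atTop_atBot.comp (tendsto_inv_nhdsGT_zero.comp h0)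
    refine not_tendsto_nhds_of_tendsto_atBot (h1.congr' ?_) _ hcont
    filter_upwards [self_mem_nhdsWithin,
      nhdsWithin_le_nhds (hs.isOpen.mem_nhds hTI)] with t h2 h3 using (hHt t h3 h2).symm
  -- The reconstructed solution extends the given one to `(T₀, ∞)`, so maximality forces equality.
  have hI : Set.Ioi T₀ = I := hv.2 _ _ _ (hs'.isVacuum hg hh) hsub
    (fun t ht => (heq t ht (hsub ht)).1.symm) (fun t ht => (heq t ht (hsub ht)).2.1.symm)
  refine ⟨w, θ, c, T₀, T, σ, ho, hc, hT, hI.symm, fun t ht => ?_⟩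
  have ht' : t ∈ I := hI ▸ ht
  obtain ⟨e1, e2, e3, e4⟩ := heq t ht' ht
  have hf := tick_pos (hm := hm) (hn := hn) (w := w) (θ := θ) hc (σ t)
  have hA := scaleA_mul (θ := θ) (hn := hn) (hm := hm) (w := w) hc (σ t)
  have hB := scaleB_mul (θ := θ) (hn := hn) (hm := hm) (w := w) hc (σ t)
  have ha : 0 < scaleA m n c w (σ t) := mul_pos hc (exp_pos _)
  have hb : 0 < scaleB m n c w (σ t) := mul_pos hc (exp_pos _)
  refine ⟨e1, e2, ?_, ?_⟩
  · rw [hHt t ht' ht, neg_lt_zero]; positivity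
  · have hHs := hHt t ht' ht
    generalize stateOf m n (w (σ t), θ (σ t)) = X at *
    generalize tick m n hm hn c w θ (σ t) = f at *
    refine Prod.ext ?_ (Prod.ext ?_ (Prod.ext ?_ ?_)) <;>
      simp only [varsAt, hHs]
    · rw [e1, ← hA]
      have : X.1 ≠ 0 := left_ne_zero_of_mul (hA.trans_ne hf.ne')
      field_simp
    · rw [e2, ← hB]
      have : X.2.1 ≠ 0 := left_ne_zero_of_mul (hB.trans_ne hf.ne')
      field_simp
    · rw [e3]; field_simp
    · rw [e4]; field_simp

end MaximalSolutions
end WarpedVacuum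
end

/-! ### Kasner behavior at the singularity. -/

noncomputable section
namespace WarpedVacuum
section Kasner
open Real

lemma one_sub_tanh_le (x : ℝ) : |1 - tanh x| ≤ 2 * exp (-(2 * x)) := by
  have h1 := tanh_lt_one x
  rw [abs_of_pos (by linarith), tanh_eq_sinh_div_cosh, sinh_eq, cosh_eq]
  have e1 := exp_pos x
  have e2 := exp_pos (-x)
  have e : exp (-(2 * x)) = exp (-x) * exp (-x) := by rw [← exp_add]; ring_nf
  have e3 : exp x * exp (-x) = 1 := by rw [← exp_add]; simp
  have : 1 - (exp x - exp (-x)) / 2 / ((exp x + exp (-x)) / 2) = 2 * exp (-x) / (exp x + exp (-x)) := by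
    field_simp; ring
  rw [this, div_le_iff₀ (by positivity), e]
  have : 2 * (exp (-x) * exp (-x)) * (exp x + exp (-x)) =
      2 * exp (-x) * (exp x * exp (-x)) + 2 * exp (-x) ^ 3 := by ring
  rw [this, e3]
  have : 0 < exp (-x) ^ 3 := by positivity
  linarith

variable {m n : ℕ} {hm : 1 < m} {hn : 1 < n} {c : ℝ} {w θ : ℝ → ℝ}

lemma exists_tendsto_of_exp_decay {u u' : ℝ → ℝ} {C μ r₀ : ℝ} (hμ : 0 < μ)
    (hu : ∀ r, HasDerivAt u (u' r) r) (hb : ∀ r ≥ r₀, |u' r| ≤ C * exp (-(μ * r))) :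
    ∃ l, Tendsto u atTop (𝓝 l) := by
  obtain ⟨l, hl⟩ := exists_limit_of_exp_decay hμ (fun r (_ : r ≥ r₀) => hu r) hb
  refine ⟨l, tendsto_iff_norm_sub_tendsto_zero.2 ?_⟩
  refine squeeze_zero' (Eventually.of_forall fun _ => norm_nonneg _)
    ((eventually_ge_atTop r₀).mono hl) ?_
  simpa using (tendsto_exp_neg_mul hμ).const_mul (C / μ)

/-- Since `tanh θ → s` exponentially, `w - s V τ` and `E - 2 κ τ` converge. As `1/k + κ = 1`, the
rate of the clock is asymptotic to a multiple of `exp (-τ)`, and l'Hôpital's rule transfers this to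
`T - T₀`. -/
lemma kasner_aux (h : (osc m n hm hn).IsOrbit w θ) (hc : 0 < c) {T₀ : ℝ} {T σ : ℝ → ℝ}
    (hT : Clock (tick m n hm hn c w θ) T₀ T σ) {s : ℝ} (hs : s ^ 2 = 1) {δ r₀ C : ℝ} (hδ : 0 < δ)
    (hC : ∀ τ ≥ r₀, |tanh (θ τ) - s| ≤ C * exp (-(δ * τ))) :
    ∃ l D, 0 < D ∧ Tendsto (fun τ => w τ - s * maxShear m n * τ) atTop (𝓝 l) ∧
      Tendsto (fun τ => (T τ - T₀) * exp τ) atTop (𝓝 D) := by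
  have h1 : (1 : ℝ) < m := by exact_mod_cast hm
  have hk : 0 < (m : ℝ) + n := by positivity
  have hV := maxShear_pos hm hn
  have hκ : 0 < ((m : ℝ) + n - 1) / (m + n) := (osc m n hm hn).κ_pos
  have hs1 : |s| = 1 := by rw [← sqrt_sq_eq_abs, hs, sqrt_one]
  obtain ⟨l, hl⟩ := exists_tendsto_of_exp_decay (u := fun τ => w τ - s * maxShear m n * τ)
    (C := maxShear m n * C) (r₀ := r₀) hδ
    (fun τ => (h.dw τ).fun_sub ((hasDerivAt_id τ).const_mul (s * maxShear m n))) (fun τ hτ => by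
      have : (osc m n hm hn).V * tanh (θ τ) - s * maxShear m n * 1 = maxShear m n * (tanh (θ τ) - s) := by
        simp only [osc]; ring
      rw [this, abs_mul, abs_of_pos hV, mul_assoc]
      gcongr
      exact hC τ hτ)
  obtain ⟨e, he⟩ := exists_tendsto_of_exp_decay (C := 4 * (((m : ℝ) + n - 1) / (m + n)) * C)
    (u := fun τ => (osc m n hm hn).energy (w τ) (θ τ) - 2 * (((m : ℝ) + n - 1) / (m + n)) * τ)
    (r₀ := r₀) hδ
    (fun τ => (h.energy_deriv τ).fun_sub ((hasDerivAt_id τ).const_mul _)) (fun τ hτ => by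
      have : 2 * (osc m n hm hn).κ * tanh (θ τ) ^ 2 - 2 * (((m : ℝ) + n - 1) / (m + n)) * 1 =
          2 * (((m : ℝ) + n - 1) / (m + n)) * ((tanh (θ τ) - s) * (tanh (θ τ) + s)) := by
        simp only [osc]; linear_combination 2 * (((m : ℝ) + n - 1) / (m + n)) * hs
      rw [this, abs_mul, abs_mul (tanh _ - s), abs_of_pos (by positivity)]
      have h2 := hC τ hτ
      have h3 : |tanh (θ τ) + s| ≤ 2 := by
        refine (abs_add_le _ _).trans ?_
        rw [hs1]
        linarith [(abs_tanh_lt_one (θ τ)).le]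
      calc 2 * (((m : ℝ) + n - 1) / (m + n)) * (|tanh (θ τ) - s| * |tanh (θ τ) + s|) ≤
          2 * (((m : ℝ) + n - 1) / (m + n)) * ((C * exp (-(δ * τ))) * 2) := by
            have := (abs_nonneg _).trans h2
            gcongr
        _ = _ := by ring)
  refine ⟨l, c / (m + n) * exp (-(e / 2)), by positivity, hl, ?_⟩
  have hlim : Tendsto (fun τ => tick m n hm hn c w θ τ * exp τ) atTop
      (𝓝 (c / (m + n) * exp (-(e / 2)))) := by
    refine ((((he.div_const 2).neg).rexp).const_mul (c / ((m : ℝ) + n))).congr fun τ => ?_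
    rw [tick, mul_assoc (c / _), ← exp_add]
    congr 2
    field_simp
    ring
  have hder := HasDerivAt.lhopital_zero_atTop (f := fun τ => T τ - T₀)
    (g := fun τ => exp (-τ)) (f' := fun τ => -tick m n hm hn c w θ τ) (g' := fun τ => -exp (-τ))
    (l := 𝓝 (c / (m + n) * exp (-(e / 2))))
    (Eventually.of_forall fun τ => (hT.deriv τ).sub_const _)
    (Eventually.of_forall fun τ => ((hasDerivAt_neg τ).exp).congr_deriv (by ring))
    (Eventually.of_forall fun τ => (neg_neg_of_pos (exp_pos _)).ne)
    (by simpa using hT.tendsto_atTop.sub_const T₀) tendsto_exp_neg_atTop_nhds_zero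
    (hlim.congr fun τ => by rw [neg_div_neg_eq, exp_neg]; field_simp)
  refine hder.congr fun τ => ?_
  rw [exp_neg]; field_simp

lemma tendsto_div_rpow {T₀ : ℝ} {f : ℝ → ℝ} {T σ : ℝ → ℝ} (hT : Clock f T₀ T σ)
    {D P l : ℝ} (hD : 0 < D) (hTD : Tendsto (fun τ => (T τ - T₀) * exp τ) atTop (𝓝 D)) {S : ℝ → ℝ}
    (hS : Tendsto (fun τ => S τ * exp (P * τ)) atTop (𝓝 l)) :
    Tendsto (fun t => S (σ t) / (t - T₀) ^ P) (𝓝[>] T₀) (𝓝 (l / D ^ P)) := by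
  have h1 := (hS.div (hTD.rpow_const (p := P) (Or.inl hD.ne')) (rpow_pos_of_pos hD P).ne').comp
    hT.inv_tendsto_nhdsGT
  refine h1.congr' ?_
  filter_upwards [self_mem_nhdsWithin] with t ht
  have ht' : 0 < t - T₀ := sub_pos.2 ht
  simp only [Function.comp, Pi.div_apply]
  rw [hT.right_inv t ht, mul_rpow ht'.le (exp_pos _).le, ← exp_mul, mul_comm (σ t) P,
    mul_div_mul_right _ _ (exp_pos _).ne']

/-- Orbits which escape in the direction of `θ` are of Kasner type. -/
theorem isKasnerType_of_fate (h : (osc m n hm hn).IsOrbit w θ) (hc : 0 < c) {T₀ : ℝ} {T σ : ℝ → ℝ}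
    (hT : Clock (tick m n hm hn c w θ) T₀ T σ)
    (hfate : (∃ δ > 0, ∃ t₀, ∀ t ≥ t₀, δ * (t - t₀) ≤ θ t) ∨
        (∃ δ > 0, ∃ t₀, ∀ t ≥ t₀, θ t ≤ -(δ * (t - t₀)))) :
    IsKasnerType m n T₀ (fun t => scaleA m n c w (σ t)) (fun t => scaleB m n c w (σ t)) := by
  have h1 : (1 : ℝ) < m := by exact_mod_cast hm
  have h2 : (1 : ℝ) < n := by exact_mod_cast hn
  have hk : 0 < (m : ℝ) + n := by positivity
  obtain ⟨s, hs, δ, hδ, r₀, C, hC⟩ : ∃ s : ℝ, s ^ 2 = 1 ∧ ∃ δ > 0, ∃ r₀ C : ℝ,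
      ∀ τ ≥ r₀, |tanh (θ τ) - s| ≤ C * exp (-(δ * τ)) := by
    rcases hfate with ⟨δ, hδ, t₀, hθ⟩ | ⟨δ, hδ, t₀, hθ⟩
    · refine ⟨1, by norm_num, 2 * δ, by positivity, t₀, 2 * exp (2 * δ * t₀), fun τ hτ => ?_⟩
      rw [abs_sub_comm, mul_assoc, ← exp_add]
      refine (one_sub_tanh_le _).trans ?_
      gcongr
      linarith [hθ τ hτ]
    · refine ⟨-1, by norm_num, 2 * δ, by positivity, t₀, 2 * exp (2 * δ * t₀), fun τ hτ => ?_⟩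
      have e : tanh (θ τ) - -1 = 1 - tanh (-θ τ) := by rw [tanh_neg]; ring
      rw [e, mul_assoc, ← exp_add]
      refine (one_sub_tanh_le _).trans ?_
      gcongr
      linarith [hθ τ hτ]
  obtain ⟨l, D, hD, hw, hTD⟩ := kasner_aux h hc hT hs hδ hC
  have hV2 := maxShear_sq (n := n) hm
  -- The Kasner exponents are the values of `P` and `Q` at `tanh θ = s`; the quadratic relation is
  -- `s² = 1`.
  refine ⟨1 / (m + n) + n / (m + n) * (s * maxShear m n), 1 / (m + n) - m / (m + n) * (s * maxShear m n),
    _, _, ?_, ?_, ?_, ?_, tendsto_div_rpow (l := c * exp (-(n / (m + n) * l))) hT hD hTD ?_,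
    tendsto_div_rpow (l := c * exp (m / (m + n) * l)) hT hD hTD ?_⟩
  · field_simp; ring
  · have : m * (1 / ((m : ℝ) + n) + n / (m + n) * (s * maxShear m n)) ^ 2 +
        n * (1 / ((m : ℝ) + n) - m / (m + n) * (s * maxShear m n)) ^ 2 =
        1 / ((m : ℝ) + n) + m * n / (m + n) * (s ^ 2 * maxShear m n ^ 2) := by
      field_simp; ring
    rw [this, hs, hV2]
    field_simp
    ring
  · exact div_pos (by positivity) (rpow_pos_of_pos hD _)
  · exact div_pos (by positivity) (rpow_pos_of_pos hD _)
  · refine (((hw.const_mul ((n : ℝ) / (m + n))).neg.rexp).const_mul c).congr fun τ => ?_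
    rw [scaleA, mul_assoc c, ← exp_add]
    congr 2
    field_simp
    ring
  · refine (((hw.const_mul ((m : ℝ) / (m + n))).rexp).const_mul c).congr fun τ => ?_
    rw [scaleB, mul_assoc c, ← exp_add]
    congr 2
    field_simp
    ring

end Kasner
end WarpedVacuum
end

/-! ### The oscillator equation at late times. -/

noncomputable section
namespace WarpedVacuum
section LateTimeOscillator
open Real

lemma abs_le_mul_of_hasDerivAt {g g' : ℝ → ℝ} (hg : ∀ x, HasDerivAt g (g' x) x) (h0 : g 0 = 0)
    {w C : ℝ} (hb : ∀ x, |x| ≤ |w| → |g' x| ≤ C) : |g w| ≤ C * |w| := by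
  have := (convex_closedBall (0 : ℝ) |w|).norm_image_sub_le_of_norm_hasDerivWithin_le
    (fun x _ => (hg x).hasDerivWithinAt) (fun x hx => by
      rw [mem_closedBall_zero_iff] at hx; exact hb x hx)
    (x := 0) (y := w) (by simp) (by simp)
  simpa [h0] using this

variable {m n : ℕ}

lemma slope_zero : slope m n 0 = 0 := by simp [slope]

lemma abs_slope_le (hm : 1 < m) (hn : 1 < n) (w : ℝ) : |slope m n w| ≤ 2 * (m + n) * |w| :=
  abs_le_mul_of_hasDerivAt (hasDerivAt_slope hm) slope_zero fun x _ => by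
    have := denom_pos (n := n) hm x
    rw [abs_of_nonneg (by positivity)]
    exact slope_deriv_le hm hn x

lemma abs_slope_lt (hm : 1 < m) (hn : 1 < n) (w : ℝ) : |slope m n w| < maxShear m n := by
  have hV := maxShear_pos hm hn
  have h1 : -(osc m n hm hn).γ₁ < slope m n w / maxShear m n := (osc m n hm hn).neg_γ₁_lt w
  have h2 : slope m n w / maxShear m n < (osc m n hm hn).γ₂ := (osc m n hm hn).lt_γ₂ w
  have h3 := (osc m n hm hn).γ₁_lt
  have h4 := (osc m n hm hn).γ₂_lt
  have : |slope m n w / maxShear m n| < 1 := abs_lt.2 ⟨by linarith, by linarith⟩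
  rwa [abs_div, abs_of_pos hV, div_lt_one hV] at this

/-- `slope` has derivative `2 / (m + n)` at 0. The mean value inequality is applied twice, to the
derivative and to the function. -/
lemma abs_mul_slope_sub_le (hm : 1 < m) (hn : 1 < n) (w : ℝ) :
    |(m + n) * slope m n w - 2 * w| ≤ 4 * ((m : ℝ) + n) ^ 2 * w ^ 2 := by
  have h1 : (1 : ℝ) < m := by exact_mod_cast hm
  have hk : 0 < (m : ℝ) + n := by positivity
  have hD : ∀ x, HasDerivAt (fun x => ((m : ℝ) + n) *
      (2 * ((m : ℝ) + n) * exp (2 * x) / (m * exp (2 * x) + n) ^ 2) - 2)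
      (4 * ((m : ℝ) + n) ^ 2 * (exp (2 * x) / (m * exp (2 * x) + n) ^ 2 *
        ((n - m * exp (2 * x)) / (m * exp (2 * x) + n)))) x := by
    intro x
    have hd := denom_pos (n := n) hm x
    have := ((((hasDerivAt_exp_two_mul x).const_mul (2 * ((m : ℝ) + n))).fun_div
      ((((hasDerivAt_exp_two_mul x).const_mul (m : ℝ)).add_const (n : ℝ)).fun_pow 2)
      (pow_ne_zero 2 hd.ne')).const_mul ((m : ℝ) + n)).sub_const 2
    refine this.congr_deriv ?_
    field_simp
    push_cast
    ring
  have hD' : ∀ x, |((m : ℝ) + n) * (2 * ((m : ℝ) + n) * exp (2 * x) / (m * exp (2 * x) + n) ^ 2) - 2| ≤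
      4 * ((m : ℝ) + n) ^ 2 * |x| := fun x =>
    abs_le_mul_of_hasDerivAt hD (by simp; field_simp; ring) fun z _ => by
      have hd := denom_pos (n := n) hm z
      have h2 := slope_deriv_le hm hn z
      have h3 : exp (2 * z) / (m * exp (2 * z) + n) ^ 2 ≤ 1 := by
        rw [mul_div_assoc] at h2
        nlinarith
      have h4 : |((n : ℝ) - m * exp (2 * z)) / (m * exp (2 * z) + n)| ≤ 1 := by
        have := exp_pos (2 * z)
        rw [abs_div, abs_of_pos hd, div_le_one hd, abs_le]
        constructor
        · nlinarith [(Nat.cast_nonneg n : (0 : ℝ) ≤ n)]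
        · nlinarith
      rw [abs_mul, abs_mul (exp _ / _), abs_of_pos (by positivity),
        abs_of_nonneg (by positivity : 0 ≤ exp (2 * z) / (m * exp (2 * z) + n) ^ 2)]
      calc _ ≤ 4 * ((m : ℝ) + n) ^ 2 * (1 * 1) := by gcongr
        _ = _ := by ring
  have := abs_le_mul_of_hasDerivAt (g := fun w => ((m : ℝ) + n) * slope m n w - 2 * w)
    (fun x => ((hasDerivAt_slope (n := n) hm x).const_mul ((m : ℝ) + n)).fun_sub
      (((hasDerivAt_id x).const_mul 2).congr_deriv (mul_one 2)))
    (by simp [slope_zero]) (w := w) (C := 4 * ((m : ℝ) + n) ^ 2 * |w|)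
    fun x hx => (hD' x).trans (by gcongr)
  rwa [mul_assoc, ← sq, sq_abs] at this

/-- For equal dimensions `slope` is odd, so the perturbation starts at third order; this is what
removes the logarithm at `m = n = 5`. -/
lemma slope_self (hm : 1 < m) (w : ℝ) : slope m m w = tanh w / m := by
  have h1 : (1 : ℝ) < m := by exact_mod_cast hm
  have e : exp (2 * w) = exp w * exp w := by rw [← exp_add]; ring_nf
  have e3 : exp (-w) = (exp w)⁻¹ := exp_neg w
  have := exp_pos w
  rw [slope, tanh_eq_sinh_div_cosh, sinh_eq, cosh_eq, e3, e]
  field_simp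

lemma abs_mul_slope_self_sub_le (hm : 1 < m) (w : ℝ) :
    |((m : ℝ) + m) * slope m m w - 2 * w| ≤ 2 * |w| ^ 3 := by
  have h1 : (1 : ℝ) < m := by exact_mod_cast hm
  have e : ((m : ℝ) + m) * slope m m w - 2 * w = 2 * (tanh w - w) := by
    rw [slope_self hm]; field_simp; ring
  have := abs_le_mul_of_hasDerivAt (g := fun w => tanh w - w)
    (fun x => (hasDerivAt_tanh x).fun_sub (hasDerivAt_id x)) (by simp) (w := w) (C := |w| ^ 2)
    (fun x hx => by
      have h2 := Osc.abs_tanh_sub_le x 0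
      simp only [tanh_zero, sub_zero] at h2
      have : 1 - tanh x ^ 2 - 1 = -(tanh x ^ 2) := by ring
      rw [this, abs_neg, abs_pow]
      exact pow_le_pow_left₀ (abs_nonneg _) (h2.trans hx) 2)
  rw [e, abs_mul, abs_two]
  linarith [show |w| ^ 2 * |w| = |w| ^ 3 by ring]

/-- The perturbation in the second order equation for `w` in the time `r = -τ / (m + n)`. -/
def perturbation (m n : ℕ) (w y : ℝ) : ℝ :=
  -(((m : ℝ) + n - 1) * ((m + n) * slope m n w - 2 * w)) +
    m * n / ((m : ℝ) + n) ^ 2 * (y ^ 2 * (y + (m + n) * slope m n w))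

lemma abs_le_sqrt_quad (w y : ℝ) : |w| ≤ √(w ^ 2 + y ^ 2) ∧ |y| ≤ √(w ^ 2 + y ^ 2) :=
  ⟨abs_le_sqrt (by nlinarith [sq_nonneg y]), abs_le_sqrt (by nlinarith [sq_nonneg w])⟩

/-- A bound on `y` is required because of the term cubic in `y`; along orbits it holds since `y` is
a multiple of `tanh θ`. -/
lemma exists_abs_perturbation_le (hm : 1 < m) (hn : 1 < n) (Y : ℝ) :
    ∃ C ≥ 0, ∀ w y, |y| ≤ Y → |perturbation m n w y| ≤ C * (w ^ 2 + y ^ 2) := by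
  have h1 : (1 : ℝ) < m := by exact_mod_cast hm
  have h2 : (1 : ℝ) < n := by exact_mod_cast hn
  have hk : 0 < (m : ℝ) + n := by positivity
  have hK : 0 < (m : ℝ) + n - 1 := by linarith
  have hV := maxShear_pos hm hn
  refine ⟨((m : ℝ) + n - 1) * (4 * ((m : ℝ) + n) ^ 2) +
    m * n / ((m : ℝ) + n) ^ 2 * (|Y| + (m + n) * maxShear m n), by positivity, fun w y hy => ?_⟩
  have e1 := abs_mul_slope_sub_le hm hn w
  have e2 : |y + (m + n) * slope m n w| ≤ |Y| + (m + n) * maxShear m n := by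
    refine (abs_add_le _ _).trans ?_
    rw [abs_mul, abs_of_pos hk]
    exact add_le_add (hy.trans (le_abs_self Y))
      (mul_le_mul_of_nonneg_left (abs_slope_lt hm hn w).le hk.le)
  rw [perturbation]
  refine (abs_add_le _ _).trans ?_
  rw [abs_neg, abs_mul, abs_mul, abs_mul, abs_of_pos hK,
    abs_of_pos (by positivity : 0 < (m : ℝ) * n / (m + n) ^ 2), abs_of_nonneg (sq_nonneg y)]
  calc _ ≤ ((m : ℝ) + n - 1) * (4 * ((m : ℝ) + n) ^ 2 * w ^ 2) +
        m * n / ((m : ℝ) + n) ^ 2 * (y ^ 2 * (|Y| + (m + n) * maxShear m n)) :=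
      add_le_add (mul_le_mul_of_nonneg_left e1 hK.le) (mul_le_mul_of_nonneg_left
        (mul_le_mul_of_nonneg_left e2 (sq_nonneg y)) (by positivity))
    _ = ((m : ℝ) + n - 1) * (4 * ((m : ℝ) + n) ^ 2) * w ^ 2 +
        m * n / ((m : ℝ) + n) ^ 2 * (|Y| + (m + n) * maxShear m n) * y ^ 2 := by ring
    _ ≤ ((m : ℝ) + n - 1) * (4 * ((m : ℝ) + n) ^ 2) * (w ^ 2 + y ^ 2) +
        m * n / ((m : ℝ) + n) ^ 2 * (|Y| + (m + n) * maxShear m n) * (w ^ 2 + y ^ 2) := by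
      gcongr <;> nlinarith [sq_nonneg w, sq_nonneg y]
    _ = _ := by ring

lemma exists_abs_perturbation_self_le (hm : 1 < m) :
    ∃ C, ∀ w y, |perturbation m m w y| ≤ C * √(w ^ 2 + y ^ 2) ^ 3 := by
  have h1 : (1 : ℝ) < m := by exact_mod_cast hm
  have hK : 0 < (m : ℝ) + m - 1 := by linarith
  refine ⟨((m : ℝ) + m - 1) * 2 +
    m * m / ((m : ℝ) + m) ^ 2 * (1 + (m + m) * (2 * (m + m))), fun w y => ?_⟩
  obtain ⟨hw, hy⟩ := abs_le_sqrt_quad w y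
  set q := √(w ^ 2 + y ^ 2)
  have e1 := abs_mul_slope_self_sub_le hm w
  have e2 : |y + (m + m) * slope m m w| ≤ (1 + (m + m) * (2 * (m + m))) * q := by
    refine (abs_add_le _ _).trans ?_
    rw [abs_mul, abs_of_pos (by positivity : 0 < (m : ℝ) + m)]
    have := (abs_slope_le hm hm w)
    calc _ ≤ q + ((m : ℝ) + m) * (2 * (m + m) * q) :=
          add_le_add hy (mul_le_mul_of_nonneg_left (this.trans (by gcongr)) (by positivity))
      _ = _ := by ring
  rw [perturbation]
  refine (abs_add_le _ _).trans ?_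
  rw [abs_neg, abs_mul, abs_mul, abs_mul, abs_of_pos hK,
    abs_of_pos (by positivity : 0 < (m : ℝ) * m / (m + m) ^ 2), ← sq_abs y, abs_of_nonneg (by positivity : 0 ≤ |y| ^ 2)]
  calc _ ≤ ((m : ℝ) + m - 1) * (2 * q ^ 3) +
        m * m / ((m : ℝ) + m) ^ 2 * (q ^ 2 * ((1 + (m + m) * (2 * (m + m))) * q)) := by
        refine add_le_add (mul_le_mul_of_nonneg_left (e1.trans (by gcongr)) hK.le)
          (mul_le_mul_of_nonneg_left ?_ (by positivity))
        exact mul_le_mul (by gcongr) e2 (abs_nonneg _) (by positivity)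
    _ = _ := by ring

variable {hm : 1 < m} {hn : 1 < n} {w θ : ℝ → ℝ}

/-- The relative logarithmic scale factor as a function of `r = -τ / (m + n)`. -/
def revW (m n : ℕ) (w : ℝ → ℝ) (r : ℝ) : ℝ := w (-((m + n) * r))

/-- The derivative of `revW`. -/
def revY (m n : ℕ) (θ : ℝ → ℝ) (r : ℝ) : ℝ :=
  -((m + n) * (maxShear m n * tanh (θ (-((m + n) * r)))))

lemma tendsto_neg_mul_atBot (hm : 1 < m) :
    Tendsto (fun r => -(((m : ℝ) + n) * r)) atTop atBot := by
  have h1 : (1 : ℝ) < m := by exact_mod_cast hm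
  exact tendsto_neg_atTop_atBot.comp (tendsto_id.const_mul_atTop (by positivity))

lemma abs_revY_le (hm : 1 < m) (hn : 1 < n) (r : ℝ) : |revY m n θ r| ≤ (m + n) * maxShear m n := by
  have hV := maxShear_pos hm hn
  rw [revY, abs_neg, abs_mul, abs_mul, abs_of_nonneg (by positivity), abs_of_pos hV]
  gcongr
  exact mul_le_of_le_one_right hV.le (abs_tanh_lt_one _).le

/-- Time is reversed so that the Friedmann point is approached as `r → ∞`. Linearizing `slope` gives
the terms `K w'` and `2 K w`; its remainder and the part of `1 - tanh²` beyond 1 make up the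
perturbation. -/
lemma perturbedOsc_of_isOrbit (h : (osc m n hm hn).IsOrbit w θ) (h0 : (w 0, θ 0) ≠ 0) :
    PerturbedOsc ((m : ℝ) + n - 1) (revW m n w) (revY m n θ)
      (fun r => perturbation m n (revW m n w r) (revY m n θ r)) := by
  have h1 : (1 : ℝ) < m := by exact_mod_cast hm
  have h2 : (1 : ℝ) < n := by exact_mod_cast hn
  have hk : 0 < (m : ℝ) + n := by positivity
  have hV := maxShear_pos hm hn
  have hV2 := maxShear_sq (n := n) hm
  have hr : ∀ r, HasDerivAt (fun r => -(((m : ℝ) + n) * r)) (-((m : ℝ) + n)) r := fun r =>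
    ((hasDerivAt_id r).const_mul ((m : ℝ) + n)).fun_neg.congr_deriv (by simp)
  refine ⟨fun r => ?_, fun r => ?_, ?_, ?_, ?_, fun r => ?_⟩
  · refine ((h.dw _).comp r (hr r)).congr_deriv ?_
    simp only [osc, revY]; ring
  · have hθ := (hasDerivAt_tanh _).comp r ((h.dθ _).comp r (hr r))
    refine ((hθ.const_mul (maxShear m n)).const_mul ((m : ℝ) + n)).fun_neg.congr_deriv ?_
    simp only [osc, revY, revW, perturbation, Function.comp]
    set x := tanh (θ (-((m + n) * r)))
    set f := slope m n (w (-((m + n) * r)))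
    have e : m * n / ((m : ℝ) + n) ^ 2 * ((-((m + n) * (maxShear m n * x))) ^ 2 *
        (-((m + n) * (maxShear m n * x)) + (m + n) * f)) =
        m * n * maxShear m n ^ 2 * x ^ 2 * ((m + n) * (f - maxShear m n * x)) := by
      field_simp; ring
    rw [e, hV2]
    field_simp
    ring
  · obtain ⟨C, hC, hC'⟩ := exists_abs_perturbation_le hm hn (((m : ℝ) + n) * maxShear m n)
    exact ⟨C, hC, fun r => hC' _ _ (abs_revY_le hm hn r)⟩
  · exact h.tendsto_atBot.1.comp (tendsto_neg_mul_atBot hm)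
  · have := (continuous_tanh.tendsto 0).comp (h.tendsto_atBot.2.comp (tendsto_neg_mul_atBot (n := n) hm))
    have h3 := ((this.const_mul (maxShear m n)).const_mul ((m : ℝ) + n)).neg
    rw [tanh_zero, mul_zero, mul_zero, neg_zero] at h3
    exact h3
  · by_contra hcon
    have hw : revW m n w r = 0 := by nlinarith [sq_nonneg (revW m n w r), sq_nonneg (revY m n θ r)]
    have hy : revY m n θ r = 0 := by nlinarith [sq_nonneg (revW m n w r), sq_nonneg (revY m n θ r)]
    have hθ : θ (-((m + n) * r)) = 0 := by
      have : tanh (θ (-((m + n) * r))) = 0 := by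
        simpa [revY, hk.ne', hV.ne'] using hy
      exact strictMono_tanh.injective (this.trans tanh_zero.symm)
    exact h.ne_zero h0 (-((m + n) * r)) (by rw [Prod.mk_eq_zero]; exact ⟨hw, hθ⟩)

end LateTimeOscillator
end WarpedVacuum
end

/-! ### From the logarithmic time to proper time. -/

noncomputable section
namespace WarpedVacuum
section LateTimeExpansion
open Real

namespace PerturbedOsc

variable {K : ℝ} {w y N : ℝ → ℝ}

/-- A clock with rate `c * exp (r - E / 2)`, where `E` is at most quadratic, agrees with
`T₁ + c * exp r` up to a relative error which is quadratic. -/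
lemma exists_clock_limit (h : PerturbedOsc K w y N) (hK : 2 ≤ K) {S E : ℝ → ℝ} {c C : ℝ}
    (hc : 0 < c) (hC : 0 ≤ C) (hE0 : ∀ r, 0 ≤ E r)
    (hE : ∀ᶠ r in atTop, E r ≤ C * (w r ^ 2 + y r ^ 2))
    (hS : ∀ r, HasDerivAt S (c * exp (r - E r / 2)) r) :
    ∃ T₁ D, ∀ᶠ r in atTop, |S r - T₁ - c * exp r| ≤ D * (exp r * (w r ^ 2 + y r ^ 2)) := by
  obtain ⟨C₁, hC₁, hN⟩ := h.N_le
  -- A Lyapunov function whose mixed terms cancel in the derivative. It decays like `exp (-3 r / 2)`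
  -- at least, which beats the factor `exp r` of the clock.
  let B : ℝ → ℝ := fun r => (y r + w r) ^ 2 + (K + 1) * w r ^ 2
  let B' : ℝ → ℝ := fun r => -(2 * (K - 1)) * (y r + w r) ^ 2 - 2 * (K + 1) * w r ^ 2 +
    2 * (y r + w r) * N r
  have hB : ∀ r, HasDerivAt B (B' r) r := fun r => by
    refine ((((h.dy r).fun_add (h.dw r)).fun_pow 2).fun_add
      (((h.dw r).fun_pow 2).const_mul (K + 1))).congr_deriv ?_
    simp only [B']; push_cast; ring
  have hBnn : ∀ r, 0 ≤ B r := fun r => by simp only [B]; positivity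
  have hqB : ∀ r, w r ^ 2 + y r ^ 2 ≤ 2 * B r := fun r => by
    simp only [B]; nlinarith [sq_nonneg (2 * w r + y r), sq_nonneg (w r), sq_nonneg (y r + 2 * w r)]
  have hBq : ∀ r, B r ≤ (K + 3) * (w r ^ 2 + y r ^ 2) := fun r => by
    simp only [B]; nlinarith [sq_nonneg (w r - y r), sq_nonneg (w r), sq_nonneg (y r)]
  have hx : Tendsto (fun r => C₁ * |y r + w r|) atTop (𝓝 0) := by
    simpa using ((h.y_tendsto.add h.w_tendsto).abs).const_mul C₁
  have hdec : ∀ᶠ r in atTop, B' r ≤ -(3 / 2) * B r := by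
    filter_upwards [hx.eventually_le_const (by norm_num : (0 : ℝ) < 1 / 8)] with r hr
    have h1 : 2 * (y r + w r) * N r ≤ 1 / 2 * B r := calc
      2 * (y r + w r) * N r ≤ 2 * (|y r + w r| * |N r|) := by
        rw [← abs_mul, mul_assoc]; gcongr; exact le_abs_self _
      _ ≤ 2 * (|y r + w r| * (C₁ * (2 * B r))) :=
        mul_le_mul_of_nonneg_left (mul_le_mul_of_nonneg_left ((hN r).trans
          (mul_le_mul_of_nonneg_left (hqB r) hC₁)) (abs_nonneg _)) zero_le_two
      _ = 4 * (C₁ * |y r + w r|) * B r := by ring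
      _ ≤ 4 * (1 / 8) * B r := by have := hBnn r; gcongr
      _ = _ := by ring
    have h2 : B r = (y r + w r) ^ 2 + (K + 1) * w r ^ 2 := rfl
    simp only [B']
    nlinarith [sq_nonneg (y r + w r), sq_nonneg (w r)]
  obtain ⟨r₀, hr₀⟩ := (hdec.and hE).exists_forall_of_atTop
  have hG : ∀ r, HasDerivAt (fun r => exp r * B r) (exp r * B r + exp r * B' r) r := fun r =>
    (Real.hasDerivAt_exp r).fun_mul (hB r)
  have hmono : AntitoneOn (fun r => exp (3 / 2 * r) * B r) (Set.Ici r₀) := by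
    have hd : ∀ r, HasDerivAt (fun r => exp (3 / 2 * r) * B r)
        (3 / 2 * exp (3 / 2 * r) * B r + exp (3 / 2 * r) * B' r) r := fun r =>
      (hasDerivAt_exp_mul (3 / 2) r).fun_mul (hB r)
    refine antitoneOn_of_deriv_nonpos (convex_Ici r₀)
      (fun r _ => (hd r).continuousAt.continuousWithinAt)
      (fun r _ => (hd r).differentiableAt.differentiableWithinAt) fun r hr => ?_
    rw [interior_Ici] at hr
    rw [(hd r).deriv]
    nlinarith [exp_pos (3 / 2 * r), (hr₀ r hr.le).1]
  have hG0 : Tendsto (fun r => exp r * B r) atTop (𝓝 0) := by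
    have h0 := (tendsto_exp_neg_mul (by norm_num : (0 : ℝ) < 1 / 2)).const_mul
      (exp (3 / 2 * r₀) * B r₀)
    rw [mul_zero] at h0
    refine squeeze_zero' (Eventually.of_forall fun r => by have := hBnn r; positivity) ?_ h0
    filter_upwards [eventually_ge_atTop r₀] with r hr
    have := mul_le_mul_of_nonneg_right (hmono (Set.self_mem_Ici) hr hr)
      (exp_pos (-(1 / 2 * r))).le
    refine le_trans (le_of_eq ?_) this
    rw [mul_right_comm, ← exp_add]
    ring_nf
  -- The time translation is the limit of `S - c exp r`. Its derivative is at most a multiple of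
  -- `exp r B`, and `B' ≤ -3/2 B` gives `exp r B ≤ -2 (exp r B)'`, so `exp r B` itself bounds the
  -- tail.
  obtain ⟨T₁, hT₁⟩ := exists_limit_of_norm_deriv_le (u := fun r => S r - c * exp r)
    (u' := fun r => c * exp (r - E r / 2) - c * exp r) (B := fun r => 2 * (c * C) * (exp r * B r))
    (b := fun r => -(2 * (c * C) * (exp r * B r + exp r * B' r))) (r₀ := r₀)
    (fun r _ => (hS r).fun_sub ((Real.hasDerivAt_exp r).const_mul c))
    (fun r _ => ((hG r).const_mul (2 * (c * C))).congr_deriv (by ring))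
    (fun r hr => by
      have h1 : c * exp (r - E r / 2) - c * exp r = -(c * exp r * (1 - exp (-(E r / 2)))) := by
        rw [sub_eq_add_neg r, exp_add]; ring
      have h2 : 0 ≤ 1 - exp (-(E r / 2)) := by
        have : exp (-(E r / 2)) ≤ 1 := exp_le_one_iff.2 (by linarith [hE0 r])
        linarith
      have h3 : 1 - exp (-(E r / 2)) ≤ E r / 2 := by
        have := add_one_le_exp (-(E r / 2)); linarith
      have h4 := (hr₀ r hr).2
      have h5 := hqB r
      rw [h1, norm_neg, Real.norm_of_nonneg (by positivity)]
      have h6 : 1 - exp (-(E r / 2)) ≤ C * B r := by nlinarith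
      calc _ ≤ c * exp r * (C * B r) := by gcongr
        _ = c * C * exp r * B r := by ring
        _ ≤ c * C * exp r * (-2 * (B r + B' r)) := by
          gcongr
          linarith [(hr₀ r hr).1]
        _ = _ := by ring)
    (by simpa using hG0.const_mul (2 * (c * C)))
  refine ⟨T₁, 2 * (c * C) * (K + 3), ?_⟩
  filter_upwards [eventually_ge_atTop r₀] with r hr
  have := hT₁ r hr
  rw [Real.norm_eq_abs, sub_right_comm] at this
  calc _ ≤ _ := this
    _ ≤ 2 * (c * C) * (exp r * ((K + 3) * (w r ^ 2 + y r ^ 2))) := by gcongr; exact hBq r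
    _ = _ := by ring

end PerturbedOsc

/-- Behavior of a scale factor `f` at late times in terms of the relative logarithmic scale
factor `W` and the square deviation `q` in the logarithmic time `ρ`. -/
structure LateTime (c κ : ℝ) (W q ρ f : ℝ → ℝ) : Prop where
  c_pos : 0 < c
  sq_le : ∀ r, W r ^ 2 ≤ q r
  q_tendsto : Tendsto q atTop (𝓝 0)
  ρ_tendsto : Tendsto ρ atTop atTop
  clock : (fun s => s - c * exp (ρ s)) =O[atTop] fun s => exp (ρ s) * q (ρ s)
  eq : ∀ᶠ s in atTop, f s = c * exp (ρ s + κ * W (ρ s))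

namespace LateTime

variable {c κ : ℝ} {W q ρ f : ℝ → ℝ}

lemma q_comp (h : LateTime c κ W q ρ f) : Tendsto (fun s => q (ρ s)) atTop (𝓝 0) :=
  h.q_tendsto.comp h.ρ_tendsto

lemma q_nonneg (h : LateTime c κ W q ρ f) (r : ℝ) : 0 ≤ q r := (sq_nonneg _).trans (h.sq_le r)

lemma exists_clock_bound (h : LateTime c κ W q ρ f) :
    ∃ C > 0, ∀ᶠ s in atTop, |s - c * exp (ρ s)| ≤ C * (s * q (ρ s)) ∧
      c * exp (ρ s) ≤ 2 * s ∧ s ≤ 2 * (c * exp (ρ s)) := by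
  obtain ⟨C, hC, hb⟩ := h.clock.exists_pos
  have hc := h.c_pos
  refine ⟨C * (2 / c), by positivity, ?_⟩
  have h0 := (h.q_comp.const_mul C).eventually_le_const (by simpa using half_pos hc : C * 0 < c / 2)
  filter_upwards [hb.bound, h0] with s h1 h2
  have hq := h.q_nonneg (ρ s)
  have he := exp_pos (ρ s)
  rw [norm_eq_abs, norm_eq_abs, abs_of_nonneg (a := exp _ * _) (by positivity)] at h1
  have h3 : |s - c * exp (ρ s)| ≤ c / 2 * exp (ρ s) := by nlinarith
  have h4 := abs_le.1 h3
  have h5 : exp (ρ s) ≤ 2 / c * s := by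
    rw [div_mul_eq_mul_div, le_div_iff₀ hc]; nlinarith
  refine ⟨h1.trans ?_, by nlinarith, by nlinarith⟩
  calc _ ≤ C * (2 / c * s * q (ρ s)) := by gcongr
    _ = _ := by ring

/-- Expand `f = c exp ρ exp (κ W)` to first order in `W`: the remainder is of order `W² ≤ q`, and `c
exp ρ = s (1 + O(q))`. -/
lemma sub_isBigO (h : LateTime c κ W q ρ f) :
    (fun s => f s - s * (1 + κ * W (ρ s))) =O[atTop] fun s => s * q (ρ s) := by
  obtain ⟨C, hC, hb⟩ := h.exists_clock_bound
  have hκ : Tendsto (fun s => κ ^ 2 * q (ρ s)) atTop (𝓝 0) := by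
    simpa using h.q_comp.const_mul (κ ^ 2)
  refine IsBigO.of_bound (2 * κ ^ 2 + C * 2) ?_
  filter_upwards [hb, h.eq, hκ.eventually_le_const one_pos, eventually_gt_atTop 0]
    with s ⟨h1, h2, _⟩ h3 h4 hs
  have hq := h.q_nonneg (ρ s)
  have hW := h.sq_le (ρ s)
  have hc := h.c_pos
  have h5 : (κ * W (ρ s)) ^ 2 ≤ κ ^ 2 * q (ρ s) := by rw [mul_pow]; gcongr
  have h6 : |κ * W (ρ s)| ≤ 1 := abs_le_one_iff_mul_self_le_one.2 (by nlinarith)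
  have h7 := Real.abs_exp_sub_one_sub_id_le h6
  have e : f s - s * (1 + κ * W (ρ s)) =
      c * exp (ρ s) * (exp (κ * W (ρ s)) - 1 - κ * W (ρ s)) -
      (s - c * exp (ρ s)) * (1 + κ * W (ρ s)) := by rw [h3, exp_add]; ring
  have h8 : |1 + κ * W (ρ s)| ≤ 2 := by
    have := abs_add_le 1 (κ * W (ρ s)); rw [abs_one] at this; linarith
  rw [e, norm_eq_abs, norm_eq_abs, abs_of_nonneg (a := s * _) (by positivity)]
  refine (abs_sub _ _).trans ?_
  rw [abs_mul (c * exp (ρ s)), abs_mul (s - _), abs_of_pos (by positivity : 0 < c * exp (ρ s))]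
  calc _ ≤ 2 * s * (κ ^ 2 * q (ρ s)) + C * (s * q (ρ s)) * 2 :=
        add_le_add (mul_le_mul h2 (h7.trans h5) (abs_nonneg _) (by positivity))
          (mul_le_mul h1 h8 (abs_nonneg _) (by positivity))
    _ = _ := by ring

lemma log_isBigO (h : LateTime c κ W q ρ f) :
    (fun s => ρ s - (log s - log c)) =O[atTop] fun s => q (ρ s) := by
  obtain ⟨C, hC, hb⟩ := h.exists_clock_bound
  refine IsBigO.of_bound (2 * C) ?_
  filter_upwards [hb, eventually_gt_atTop 0] with s ⟨h1, h2, h3⟩ hs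
  have hq := h.q_nonneg (ρ s)
  have hc := h.c_pos
  have he := exp_pos (ρ s)
  have e : ρ s - (log s - log c) = log (c * exp (ρ s) / s) := by
    rw [log_div (by positivity) hs.ne', log_mul hc.ne' he.ne', log_exp]; ring
  have hz : 1 / 2 ≤ c * exp (ρ s) / s := by rw [div_le_div_iff₀ two_pos hs]; linarith
  have hz1 : |c * exp (ρ s) / s - 1| ≤ C * q (ρ s) := by
    rw [div_sub_one hs.ne', abs_div, abs_of_pos hs, div_le_iff₀ hs, abs_sub_comm]
    linarith
  rw [e, norm_eq_abs, norm_eq_abs, abs_of_nonneg hq]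
  set z := c * exp (ρ s) / s
  have hz0 : 0 < z := by linarith
  have h4 := log_le_sub_one_of_pos hz0
  have h5 := one_sub_inv_le_log_of_pos hz0
  have h6 : z⁻¹ - 1 ≤ 2 * |z - 1| := by
    have : z⁻¹ - 1 = z⁻¹ * (1 - z) := by field_simp
    rw [this]
    calc _ ≤ z⁻¹ * |z - 1| := by
          gcongr; rw [abs_sub_comm]; exact le_abs_self _
      _ ≤ 2 * |z - 1| := by
          gcongr; rw [inv_le_comm₀ hz0 two_pos]; linarith
  rw [abs_le]
  have := le_abs_self (z - 1)
  have := abs_nonneg (z - 1)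
  constructor <;> nlinarith

lemma log_bounded (h : LateTime c κ W q ρ f) :
    Tendsto (fun s => ρ s - (log s - log c)) atTop (𝓝 0) := h.log_isBigO.trans_tendsto h.q_comp

/-- The expansion of `f` in terms of an expansion of `W`. -/
lemma expansion (h : LateTime c κ W q ρ f) {p p' e err : ℝ → ℝ} {L : ℝ}
    (hp : ∀ r, HasDerivAt p (p' r) r) (hp' : ∀ r ≥ 0, |p' r| ≤ L)
    (hW : (fun r => W r - p r) =O[atTop] e) (hq : q =O[atTop] e)
    (he : (fun s => e (ρ s)) =O[atTop] err) :
    (fun s => f s - s * (1 + κ * p (log s - log c))) =O[atTop] fun s => s * err s := by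
  -- `p` is Lipschitz on the half line, so replacing `ρ` by `log s - log c` costs no more than their
  -- difference, which is `O(q)`.
  have h1 : (fun s => p (ρ s) - p (log s - log c)) =O[atTop] fun s => q (ρ s) := by
    refine IsBigO.trans (IsBigO.of_bound L ?_) h.log_isBigO
    have hlog : Tendsto (fun s => log s - log c) atTop atTop := by
      simpa [sub_eq_add_neg] using tendsto_atTop_add_const_right _ (-log c) tendsto_log_atTop
    filter_upwards [h.ρ_tendsto.eventually_ge_atTop 0, hlog.eventually_ge_atTop 0] with s h1 h2
    exact (convex_Ici (0 : ℝ)).norm_image_sub_le_of_norm_hasDerivWithin_le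
      (fun x _ => (hp x).hasDerivWithinAt) hp' h2 h1
  have h2 : (fun s => W (ρ s) - p (ρ s)) =O[atTop] err :=
    (hW.comp_tendsto h.ρ_tendsto).trans he
  have h3 : (fun s => q (ρ s)) =O[atTop] err := (hq.comp_tendsto h.ρ_tendsto).trans he
  have h4 := (isBigO_refl (fun s : ℝ => s) atTop).mul (((h2.add (h1.trans h3))).const_mul_left κ)
  have h5 := (h.sub_isBigO.trans ((isBigO_refl (fun s : ℝ => s) atTop).mul h3)).add h4
  refine h5.congr_left fun s => by ring

lemma exp_isBigO (h : LateTime c κ W q ρ f) (μ : ℝ) :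
    (fun s => exp (-(μ * ρ s))) =O[atTop] fun s => s ^ (-μ) := by
  have h1 : Tendsto (fun s => exp (-(μ * (ρ s - (log s - log c))) + μ * log c)) atTop
      (𝓝 (exp (-(μ * 0) + μ * log c))) :=
    (Real.continuous_exp.tendsto _).comp (((h.log_bounded.const_mul μ).neg).add_const _)
  have h2 := (h1.isBigO_one ℝ).mul (isBigO_refl (fun s : ℝ => s ^ (-μ)) atTop)
  simp only [one_mul] at h2
  refine h2.congr' ?_ EventuallyEq.rfl
  filter_upwards [eventually_gt_atTop 0] with s hs
  rw [rpow_def_of_pos hs, ← exp_add]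
  ring_nf

lemma id_isBigO (h : LateTime c κ W q ρ f) : ρ =O[atTop] log := by
  have h1 : (fun s => ρ s - (log s - log c) - log c) =O[atTop] (fun _ => (1 : ℝ)) :=
    (h.log_bounded.sub_const (log c)).isBigO_one ℝ
  have h2 : (fun _ : ℝ => (1 : ℝ)) =O[atTop] log :=
    (isLittleO_const_log_atTop (c := (1 : ℝ))).isBigO
  refine ((h1.trans h2).add (isBigO_refl log atTop)).congr_left fun s => by ring

/-- As `f - s = κ s W + O(s q)`, the sign of `f - s` is that of `κ W` wherever `|W|` exceeds a large
enough multiple of `q`. -/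
lemma oscillates (h : LateTime c κ W q ρ f) (hκ : κ ≠ 0)
    (h1 : ∀ C, ∃ᶠ s in atTop, C * q (ρ s) < W (ρ s))
    (h2 : ∀ C, ∃ᶠ s in atTop, C * q (ρ s) < -W (ρ s)) : OscillatesAboutFriedmann f := by
  obtain ⟨C, hC, hb⟩ := h.sub_isBigO.exists_pos
  have hev : ∀ᶠ s in atTop, 0 < s ∧ |f s - s * (1 + κ * W (ρ s))| ≤ C * (s * q (ρ s)) := by
    filter_upwards [hb.bound, eventually_gt_atTop 0] with s h1 hs
    have := h.q_nonneg (ρ s)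
    rw [norm_eq_abs, norm_eq_abs, abs_of_nonneg (a := s * _) (by positivity)] at h1
    exact ⟨hs, h1⟩
  have key : ∀ σ : ℝ, (∃ᶠ s in atTop, C / |κ| * q (ρ s) < σ * W (ρ s)) →
      ∃ᶠ s in atTop, 0 < s ∧ |f s - s * (1 + κ * W (ρ s))| ≤ C * (s * q (ρ s)) ∧
        C * (s * q (ρ s)) < s * (|κ| * (σ * W (ρ s))) := fun σ hσ => by
    refine (hσ.and_eventually hev).mono fun s ⟨h3, hs, h4⟩ => ⟨hs, h4, ?_⟩
    have := abs_pos.2 hκ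
    rw [div_mul_eq_mul_div, div_lt_iff₀ this] at h3
    nlinarith
  have h1' := key 1 (by simpa using h1 (C / |κ|))
  have h2' := key (-1) (by simpa using h2 (C / |κ|))
  rcases lt_or_gt_of_ne hκ with hκ | hκ
  · rw [abs_of_neg hκ] at h1' h2'
    refine ⟨h2'.mono fun s ⟨_, h3, h4⟩ => ?_, h1'.mono fun s ⟨_, h3, h4⟩ => ?_⟩ <;>
      have := abs_le.1 h3 <;> nlinarith
  · rw [abs_of_pos hκ] at h1' h2'
    refine ⟨h1'.mono fun s ⟨_, h3, h4⟩ => ?_, h2'.mono fun s ⟨_, h3, h4⟩ => ?_⟩ <;>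
      have := abs_le.1 h3 <;> nlinarith

lemma not_oscillates (h : LateTime c κ W q ρ f) (hκ : κ ≠ 0) {σ : ℝ} (hσ : σ = 1 ∨ σ = -1)
    (h1 : ∀ C, ∀ᶠ r in atTop, C * q r < σ * W r) : ¬ OscillatesAboutFriedmann f := by
  obtain ⟨C, hC, hb⟩ := h.sub_isBigO.exists_pos
  have hκ' := abs_pos.2 hκ
  have h2 : ∀ᶠ s in atTop, C * (s * q (ρ s)) < s * (|κ| * (σ * W (ρ s))) ∧
      |f s - s * (1 + κ * W (ρ s))| ≤ C * (s * q (ρ s)) := by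
    filter_upwards [hb.bound, eventually_gt_atTop 0,
      h.ρ_tendsto.eventually (h1 (C / |κ|))] with s h3 hs h4
    have := h.q_nonneg (ρ s)
    rw [norm_eq_abs, norm_eq_abs, abs_of_nonneg (a := s * _) (by positivity)] at h3
    rw [div_mul_eq_mul_div, div_lt_iff₀ hκ'] at h4
    exact ⟨by nlinarith, h3⟩
  have h3 : (∀ᶠ s in atTop, s < f s) ∨ ∀ᶠ s in atTop, f s < s := by
    rcases lt_or_gt_of_ne hκ with hκ | hκ
    · rw [abs_of_neg hκ] at h2
      rcases hσ with rfl | rfl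
      · exact Or.inr (h2.mono fun s ⟨h3, h4⟩ => by have := abs_le.1 h4; nlinarith)
      · exact Or.inl (h2.mono fun s ⟨h3, h4⟩ => by have := abs_le.1 h4; nlinarith)
    · rw [abs_of_pos hκ] at h2
      rcases hσ with rfl | rfl
      · exact Or.inl (h2.mono fun s ⟨h3, h4⟩ => by have := abs_le.1 h4; nlinarith)
      · exact Or.inr (h2.mono fun s ⟨h3, h4⟩ => by have := abs_le.1 h4; nlinarith)
  rintro ⟨h4, h5⟩
  rcases h3 with h3 | h3
  · obtain ⟨s, hs, hs'⟩ := (h5.and_eventually h3).exists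
    exact lt_asymm hs hs'
  · obtain ⟨s, hs, hs'⟩ := (h4.and_eventually h3).exists
    exact lt_asymm hs hs'

end LateTime

end LateTimeExpansion
end WarpedVacuum
end

/-! ### The sign of the leading term. -/

noncomputable section
namespace WarpedVacuum
section Sign
open Real

/-- If `W` has the leading term `exp (-(μ * r)) * p r`, then it dominates `q` with the sign of `p`
wherever `p` is bounded away from zero. -/
lemma eventually_lt_of_leading {W q p g : ℝ → ℝ} {μ δ σ : ℝ} (hδ : 0 < δ)
    (hW : (fun r => W r - exp (-(μ * r)) * p r) =O[atTop] g) (hq : q =O[atTop] g)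
    (hg : g =o[atTop] fun r => exp (-(μ * r))) (C : ℝ) :
    ∀ᶠ r in atTop, δ ≤ σ * p r → C * q r < σ * W r := by
  have h1 : (fun r => C * q r - σ * (W r - exp (-(μ * r)) * p r)) =o[atTop]
      fun r => exp (-(μ * r)) := ((hq.const_mul_left C).sub (hW.const_mul_left σ)).trans_isLittleO hg
  filter_upwards [h1.bound (half_pos hδ)] with r hr hp
  rw [norm_eq_abs, norm_eq_abs, abs_of_pos (exp_pos _)] at hr
  have := (abs_le.1 hr).2
  have := mul_le_mul_of_nonneg_left hp (exp_pos (-(μ * r))).le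
  have : 0 < exp (-(μ * r)) * δ := by positivity
  nlinarith

lemma exp_isLittleO_exp {a b : ℝ} (h : b < a) :
    (fun r => exp (-(a * r))) =o[atTop] fun r => exp (-(b * r)) := by
  rw [isLittleO_exp_comp_exp_comp]
  have : (fun r => -(b * r) - -(a * r)) = fun r => (a - b) * r := by ext; ring
  rw [this]
  exact tendsto_id.const_mul_atTop (by linarith)

lemma pow_mul_exp_isLittleO_exp (k : ℕ) {a b : ℝ} (h : b < a) :
    (fun r => r ^ k * exp (-(a * r))) =o[atTop] fun r => exp (-(b * r)) := by
  have h1 := (isLittleO_pow_exp_pos_mul_atTop k (sub_pos.2 h)).mul_isBigO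
    (isBigO_refl (fun r => exp (-(a * r))) atTop)
  refine h1.congr_right fun r => ?_
  rw [← exp_add]; ring_nf

namespace PerturbedOsc
variable {K : ℝ} {w y N : ℝ → ℝ}

/-- The phase of a spiral. -/
lemma exists_amplitude_phase {α β : ℝ} (h : α ≠ 0 ∨ β ≠ 0) :
    ∃ R δ : ℝ, 0 < R ∧ ∀ x, α * cos x + β * sin x = R * cos (x - δ) := by
  have h0 : (⟨α, β⟩ : ℂ) ≠ 0 := fun h0 => by
    rw [Complex.ext_iff] at h0
    rcases h with h | h
    · exact h h0.1
    · exact h h0.2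
  refine ⟨‖(⟨α, β⟩ : ℂ)‖, Complex.arg ⟨α, β⟩, norm_pos_iff.2 h0, fun x => ?_⟩
  have h1 := Complex.norm_mul_cos_arg ⟨α, β⟩
  have h2 := Complex.norm_mul_sin_arg ⟨α, β⟩
  simp only at h1 h2
  rw [cos_sub]
  linear_combination -cos x * h1 - sin x * h2

/-- The solution of the perturbed oscillator oscillates if `K < 8`. -/
lemma frequently_of_spiral {R δ ν : ℝ} (hK : 0 < K) (hR : 0 < R) (hν : 0 < ν) {q : ℝ → ℝ}
    (hW : (fun r => w r - exp (-(K / 2 * r)) * (R * cos (ν * r - δ))) =O[atTop]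
      fun r => exp (-(K * r)))
    (hq : q =O[atTop] fun r => exp (-(K * r))) {σ : ℝ} (hσ : σ = 1 ∨ σ = -1) (C : ℝ) :
    ∃ᶠ r in atTop, C * q r < σ * w r := by
  have h1 := eventually_lt_of_leading (σ := σ) hR hW hq (exp_isLittleO_exp (by linarith)) C
  obtain ⟨x₀, hx₀⟩ : ∃ x₀, σ * cos x₀ = 1 := by
    rcases hσ with rfl | rfl
    · exact ⟨0, by simp⟩
    · exact ⟨π, by simp⟩
  -- The times at which the cosine equals `σ`; there the leading term has full amplitude.
  have h2 : Tendsto (fun j : ℕ => (j * (2 * π) + x₀ + δ) / ν) atTop atTop := by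
    refine Tendsto.atTop_div_const hν ?_
    refine tendsto_atTop_add_const_right _ _ (tendsto_atTop_add_const_right _ _ ?_)
    exact tendsto_natCast_atTop_atTop.atTop_mul_const two_pi_pos
  refine h2.frequently (((h2.eventually h1).mono fun j hj => hj ?_).frequently)
  have e : ν * ((j * (2 * π) + x₀ + δ) / ν) - δ = x₀ + j * (2 * π) := by field_simp; ring
  rw [e, cos_add_nat_mul_two_pi]
  nlinarith

lemma exists_sign_of_ne_zero {x : ℝ} (hx : x ≠ 0) : ∃ σ : ℝ, (σ = 1 ∨ σ = -1) ∧ σ * x = |x| := by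
  rcases lt_or_gt_of_ne hx with h | h
  · exact ⟨-1, Or.inr rfl, by rw [abs_of_neg h]; ring⟩
  · exact ⟨1, Or.inl rfl, by rw [abs_of_pos h]; ring⟩

/-- The solution of the perturbed oscillator has a definite sign if `K = 8`. -/
lemma exists_sign_of_degenerate {α β : ℝ} (h : α ≠ 0 ∨ β ≠ 0) {q : ℝ → ℝ}
    (hW : (fun r => w r - exp (-(4 * r)) * (α + β * r)) =O[atTop] fun r => r ^ 2 * exp (-(8 * r)))
    (hq : q =O[atTop] fun r => r ^ 2 * exp (-(8 * r))) :
    ∃ σ : ℝ, (σ = 1 ∨ σ = -1) ∧ ∀ C, ∀ᶠ r in atTop, C * q r < σ * w r := by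
  obtain ⟨σ, hσ, δ, hδ, hp⟩ : ∃ σ : ℝ, (σ = 1 ∨ σ = -1) ∧ ∃ δ > 0, ∀ᶠ r in atTop,
      δ ≤ σ * (α + β * r) := by
    by_cases hβ : β = 0
    · have hα : α ≠ 0 := by simpa [hβ] using h
      obtain ⟨σ, hσ, e⟩ := exists_sign_of_ne_zero hα
      exact ⟨σ, hσ, |α|, abs_pos.2 hα, Eventually.of_forall fun r => by rw [hβ]; linarith⟩
    · obtain ⟨σ, hσ, e⟩ := exists_sign_of_ne_zero hβ
      refine ⟨σ, hσ, 1, one_pos, ?_⟩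
      have h1 : Tendsto (fun r => σ * α + |β| * r) atTop atTop :=
        tendsto_atTop_add_const_left _ _ (tendsto_id.const_mul_atTop (abs_pos.2 hβ))
      filter_upwards [h1.eventually_ge_atTop 1] with r hr
      rw [← e] at hr
      linarith
  refine ⟨σ, hσ, fun C => ?_⟩
  filter_upwards [hp, eventually_lt_of_leading hδ hW hq
    (pow_mul_exp_isLittleO_exp 2 (by norm_num)) C] with r h1 h2 using h2 h1

/-- The solution of the perturbed oscillator has a definite sign if `K > 8`. -/
lemma exists_sign_of_node (h : PerturbedOsc K w y N) {c₀ l : ℝ} {g : ℝ → ℝ}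
    (hg : g =o[atTop] fun r => exp (-(l * r)))
    (hW : (fun r => w r - c₀ * exp (-(l * r))) =O[atTop] g)
    (h0 : c₀ = 0 → ∃ C, ∀ᶠ r in atTop, |y r| ≤ C * |w r|)
    (hq : (fun r => w r ^ 2 + y r ^ 2) =O[atTop] g) :
    ∃ σ : ℝ, (σ = 1 ∨ σ = -1) ∧ ∀ C, ∀ᶠ r in atTop, C * (w r ^ 2 + y r ^ 2) < σ * w r := by
  -- Without a leading term, `y` is controlled by `w`; a late zero of `w` would be a zero of `(w,
  -- y)`, which is excluded. So `w` keeps its sign, and `w² + y² = O(w²)` is negligible against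
  -- `|w|`.
  by_cases hc : c₀ = 0
  · obtain ⟨C, hC⟩ := h0 hc
    obtain ⟨r₀, hr₀⟩ := hC.exists_forall_of_atTop
    have hne : ∀ r ≥ r₀, w r ≠ 0 := fun r hr hw => by
      have h1 := hr₀ r hr
      rw [hw, abs_zero, mul_zero] at h1
      have h2 := abs_nonpos_iff.1 h1
      have h3 := h.ne_zero r
      simp [hw, h2] at h3
    obtain ⟨σ, hσ, e⟩ := exists_sign_of_ne_zero (hne r₀ le_rfl)
    have hsign : ∀ r ≥ r₀, σ * w r = |w r| := fun r hr => by
      have hpos : 0 < σ * w r := by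
        by_contra hcon
        have hcont : ContinuousOn (fun r => σ * w r) (Set.Icc r₀ r) := fun x _ =>
          ((h.dw x).continuousAt.const_mul σ).continuousWithinAt
        obtain ⟨x, hx, hx0⟩ := intermediate_value_Icc' hr hcont
          ⟨not_lt.1 hcon, by rw [e]; exact abs_nonneg _⟩
        rcases hσ with rfl | rfl
        · exact hne x hx.1 (by simpa using hx0)
        · exact hne x hx.1 (by simpa using hx0)
      rcases hσ with rfl | rfl
      · rw [one_mul] at hpos ⊢; rw [abs_of_pos hpos]
      · rw [abs_of_neg (by linarith)]; ring
    refine ⟨σ, hσ, fun D => ?_⟩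
    have hw0 : Tendsto (fun r => |D| * (1 + C ^ 2) * |w r|) atTop (𝓝 0) := by
      simpa using h.w_tendsto.abs.const_mul (|D| * (1 + C ^ 2))
    filter_upwards [eventually_ge_atTop r₀, hw0.eventually_lt_const one_pos] with r hr h1
    rw [hsign r hr]
    have h2 := abs_pos.2 (hne r hr)
    have h3 : y r ^ 2 ≤ C ^ 2 * w r ^ 2 := by
      have := pow_le_pow_left₀ (abs_nonneg _) (hr₀ r hr) 2
      rwa [mul_pow, sq_abs, sq_abs] at this
    calc D * (w r ^ 2 + y r ^ 2) ≤ |D| * (w r ^ 2 + C ^ 2 * w r ^ 2) :=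
          mul_le_mul (le_abs_self D) (by linarith) (by positivity) (abs_nonneg _)
      _ = |D| * (1 + C ^ 2) * |w r| * |w r| := by rw [← sq_abs (w r)]; ring
      _ < 1 * |w r| := by gcongr
      _ = _ := one_mul _
  · obtain ⟨σ, hσ, e⟩ := exists_sign_of_ne_zero hc
    refine ⟨σ, hσ, fun C => ?_⟩
    have hW' : (fun r => w r - exp (-(l * r)) * (fun _ => c₀) r) =O[atTop] g :=
      hW.congr_left fun r => by ring
    filter_upwards [eventually_lt_of_leading (abs_pos.2 hc) hW' hq hg C] with r hr
    exact hr e.ge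

end PerturbedOsc
end Sign
end WarpedVacuum
end

/-! ### Late time data of the scale factors. -/

noncomputable section
namespace WarpedVacuum
section LateTimeScaleFactors
open Real

variable {m n : ℕ} {hm : 1 < m} {hn : 1 < n} {w θ : ℝ → ℝ}

/-- `log cosh² ≤ cosh² - 1 = tanh² cosh²`, and the hypothesis means `cosh² ≤ 2`. -/
lemma two_mul_log_cosh_le {y : ℝ} (hy : tanh y ^ 2 ≤ 1 / 2) : 2 * log (cosh y) ≤ 2 * tanh y ^ 2 := by
  have h1 := cosh_pos y
  have h2 : tanh y * cosh y = sinh y := by rw [tanh_eq_sinh_div_cosh]; field_simp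
  have h3 := cosh_sq y
  have h4 : log (cosh y ^ 2) ≤ cosh y ^ 2 - 1 := log_le_sub_one_of_pos (by positivity)
  rw [log_pow, Nat.cast_two] at h4
  have h5 : cosh y ^ 2 - 1 = tanh y ^ 2 * cosh y ^ 2 := by rw [← mul_pow, h2]; linarith
  have h6 : cosh y ^ 2 ≤ 2 := by nlinarith [sq_nonneg (cosh y)]
  nlinarith [sq_nonneg (tanh y)]

lemma exists_potential_le (hm : 1 < m) (hn : 1 < n) : ∃ C ≥ 0, ∀ x, (osc m n hm hn).U x ≤ C * x ^ 2 := by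
  have h1 := (osc m n hm hn).V_pos
  have h2 := (osc m n hm hn).κ_pos
  refine ⟨2 * (osc m n hm hn).κ / (osc m n hm hn).V * (2 * (m + n) / (osc m n hm hn).V),
    by positivity, fun x => ?_⟩
  have := abs_le_mul_of_hasDerivAt (osc m n hm hn).U_deriv (osc m n hm hn).U_zero (w := x)
    (C := 2 * (osc m n hm hn).κ / (osc m n hm hn).V * (2 * (m + n) * |x| / (osc m n hm hn).V))
    fun z hz => by
      rw [abs_mul, abs_of_pos (by positivity : 0 < 2 * (osc m n hm hn).κ / (osc m n hm hn).V)]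
      have e : (osc m n hm hn).g z = slope m n z / (osc m n hm hn).V := rfl
      rw [e, abs_div, abs_of_pos h1]
      refine mul_le_mul_of_nonneg_left (div_le_div_of_nonneg_right ((abs_slope_le hm hn z).trans ?_)
        h1.le) (by positivity)
      gcongr
  refine (le_abs_self _).trans (this.trans (le_of_eq ?_))
  rw [← sq_abs x]
  ring

lemma exists_energy_le (h : (osc m n hm hn).IsOrbit w θ) : ∃ C ≥ 0, ∀ᶠ r in atTop,
    (osc m n hm hn).energy (w (-((m + n) * r))) (θ (-((m + n) * r))) ≤
      C * (revW m n w r ^ 2 + revY m n θ r ^ 2) := by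
  have h1 : (1 : ℝ) < m := by exact_mod_cast hm
  have hk : 0 < (m : ℝ) + n := by positivity
  have hV := maxShear_pos hm hn
  obtain ⟨C, hC, hU⟩ := exists_potential_le hm hn
  have ht : Tendsto (fun r => tanh (θ (-(((m : ℝ) + n) * r))) ^ 2) atTop (𝓝 0) := by
    have := ((continuous_tanh.tendsto 0).comp
      (h.tendsto_atBot.2.comp (tendsto_neg_mul_atBot (n := n) hm))).pow 2
    simpa using this
  refine ⟨C + 2 / ((m + n) * maxShear m n) ^ 2, by positivity, ?_⟩
  filter_upwards [ht.eventually_le_const (by norm_num : (0 : ℝ) < 1 / 2)] with r hr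
  have h2 := two_mul_log_cosh_le hr
  have h3 := hU (w (-((m + n) * r)))
  have e : 2 * tanh (θ (-(((m : ℝ) + n) * r))) ^ 2 =
      2 / ((m + n) * maxShear m n) ^ 2 * revY m n θ r ^ 2 := by
    rw [revY]; field_simp
  rw [e] at h2
  have h4 : 0 ≤ C * revY m n θ r ^ 2 := by positivity
  have h5 : 0 ≤ 2 / (((m : ℝ) + n) * maxShear m n) ^ 2 * revW m n w r ^ 2 := by positivity
  simp only [Osc.energy]
  have h6 : (osc m n hm hn).U (w (-((m + n) * r))) ≤ C * revW m n w r ^ 2 := h3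
  linarith

/-- Here `ρ s` is `-τ/k` at proper time `T₁ + s`, with the same `T₁` for both scale factors. The
right inverse of `ρ` transfers statements about arbitrarily large `r` to arbitrarily large `s`. -/
lemma exists_lateTime (h : (osc m n hm hn).IsOrbit w θ) (h0 : (w 0, θ 0) ≠ 0) {c T₀ : ℝ}
    {T σ a b : ℝ → ℝ} (hc : 0 < c) (hT : Clock (tick m n hm hn c w θ) T₀ T σ)
    (hab : ∀ t, T₀ < t → a t = scaleA m n c w (σ t) ∧ b t = scaleB m n c w (σ t)) :
    ∃ (T₁ : ℝ) (ρ : ℝ → ℝ),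
      LateTime c (-(n / (m + n))) (revW m n w) (fun r => revW m n w r ^ 2 + revY m n θ r ^ 2) ρ
        (fun s => a (T₁ + s)) ∧
      LateTime c (m / (m + n)) (revW m n w) (fun r => revW m n w r ^ 2 + revY m n θ r ^ 2) ρ
        (fun s => b (T₁ + s)) ∧
      ∃ s : ℝ → ℝ, Tendsto s atTop atTop ∧ ∀ r, ρ (s r) = r := by
  have h1 : (1 : ℝ) < m := by exact_mod_cast hm
  have h2 : (1 : ℝ) < n := by exact_mod_cast hn
  have hk : 0 < (m : ℝ) + n := by positivity
  have h3 : (2 : ℝ) ≤ m := by exact_mod_cast (hm : 2 ≤ m)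
  have h4 : (2 : ℝ) ≤ n := by exact_mod_cast (hn : 2 ≤ n)
  have hP := perturbedOsc_of_isOrbit h h0
  obtain ⟨C, hC, hE⟩ := exists_energy_le h
  have hr : ∀ r, HasDerivAt (fun r => -(((m : ℝ) + n) * r)) (-((m : ℝ) + n)) r := fun r =>
    ((hasDerivAt_id r).const_mul ((m : ℝ) + n)).fun_neg.congr_deriv (by simp)
  obtain ⟨T₁, D, hD⟩ := hP.exists_clock_limit (by linarith [h3, h4]) hc hC
    (S := fun r => T (-((m + n) * r)))
    (E := fun r => (osc m n hm hn).energy (w (-((m + n) * r))) (θ (-((m + n) * r))))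
    (fun r => Osc.energy_nonneg _ _) hE fun r => by
      refine ((hT.deriv _).comp r (hr r)).congr_deriv ?_
      rw [tick]
      have : -(-(((m : ℝ) + n) * r) / (m + n)) = r := by field_simp
      rw [this]
      field_simp
  have hρ : Tendsto (fun s => -(σ (T₁ + s) / ((m : ℝ) + n))) atTop atTop :=
    tendsto_neg_atBot_atTop.comp ((hT.inv_tendsto_atTop.comp
      (tendsto_atTop_add_const_left _ T₁ tendsto_id)).atBot_div_const hk)
  have hq : Tendsto (fun r => revW m n w r ^ 2 + revY m n θ r ^ 2) atTop (𝓝 0) := by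
    simpa using (hP.w_tendsto.pow 2).add (hP.y_tendsto.pow 2)
  have hclock : (fun s => s - c * exp (-(σ (T₁ + s) / ((m : ℝ) + n)))) =O[atTop] fun s =>
      exp (-(σ (T₁ + s) / ((m : ℝ) + n))) * (revW m n w (-(σ (T₁ + s) / (m + n))) ^ 2 +
        revY m n θ (-(σ (T₁ + s) / (m + n))) ^ 2) := by
    refine IsBigO.of_bound D ?_
    filter_upwards [hρ.eventually hD, eventually_gt_atTop (T₀ - T₁)] with s h5 hs
    have e : -(((m : ℝ) + n) * -(σ (T₁ + s) / (m + n))) = σ (T₁ + s) := by field_simp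
    rw [e, hT.right_inv _ (by linarith), add_sub_cancel_left] at h5
    rwa [norm_eq_abs, norm_eq_abs, abs_of_nonneg (a := exp _ * _) (by positivity)]
  have hrev : ∀ s, revW m n w (-(σ (T₁ + s) / ((m : ℝ) + n))) = w (σ (T₁ + s)) := fun s => by
    rw [revW]; congr 1; field_simp
  refine ⟨T₁, fun s => -(σ (T₁ + s) / ((m : ℝ) + n)),
    ⟨hc, fun r => by nlinarith [sq_nonneg (revY m n θ r)], hq, hρ, hclock, ?_⟩,
    ⟨hc, fun r => by nlinarith [sq_nonneg (revY m n θ r)], hq, hρ, hclock, ?_⟩,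
    fun r => T (-((m + n) * r)) - T₁, ?_, fun r => ?_⟩
  · filter_upwards [eventually_gt_atTop (T₀ - T₁)] with s hs
    rw [(hab _ (by linarith)).1, hrev, scaleA]
    ring_nf
  · filter_upwards [eventually_gt_atTop (T₀ - T₁)] with s hs
    rw [(hab _ (by linarith)).2, hrev, scaleB]
  · simpa [sub_eq_add_neg] using tendsto_atTop_add_const_right _ (-T₁)
      (hT.tendsto_atBot.comp (tendsto_neg_mul_atBot (n := n) hm))
  · simp only [add_sub_cancel, hT.left_inv]
    field_simp

end LateTimeScaleFactors
end WarpedVacuum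
end

/-! ### The Friedmann expansions in the three ranges of dimension. -/

noncomputable section
namespace WarpedVacuum
section Friedmann
open Real

lemma exp_neg_mul_log_sub {s : ℝ} (hs : 0 < s) (μ c : ℝ) :
    exp (-(μ * (log s - log c))) = exp (μ * log c) * s ^ (-μ) := by
  rw [rpow_def_of_pos hs, ← exp_add]; ring_nf

variable {m n : ℕ} {c : ℝ} {W Y N ρ fa fb : ℝ → ℝ}

lemma abs_exp_neg_mul_le {x a : ℝ} (hx : 0 ≤ x) {B : ℝ} (ha : |a| ≤ B) : |exp (-x) * a| ≤ B := by
  rw [abs_mul, abs_of_pos (exp_pos _)]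
  have := exp_le_one_iff.2 (neg_nonpos.2 hx)
  nlinarith [abs_nonneg a, exp_pos (-x)]

/-- Late time behavior for `m + n < 9`. -/
lemma friedmannSpiral (hm : 1 < m) (hn : 1 < n) (hk : m + n < 9)
    (hP : PerturbedOsc ((m : ℝ) + n - 1) W Y N)
    (ha : LateTime c (-(n / (m + n))) W (fun r => W r ^ 2 + Y r ^ 2) ρ fa)
    (hb : LateTime c (m / (m + n)) W (fun r => W r ^ 2 + Y r ^ 2) ρ fb) :
    FriedmannSpiral m n fa fb ∧ ∀ σ : ℝ, σ = 1 ∨ σ = -1 → ∀ C, ∃ᶠ r in atTop,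
      C * (W r ^ 2 + Y r ^ 2) < σ * W r := by
  have h1 : (1 : ℝ) < m := by exact_mod_cast hm
  have h2 : (1 : ℝ) < n := by exact_mod_cast hn
  have h9 : (m : ℝ) + n < 9 := by exact_mod_cast hk
  have hk0 : 0 < (m : ℝ) + n := by positivity
  set K : ℝ := (m : ℝ) + n - 1 with hKdef
  have hK : 0 < K := by linarith
  set ν : ℝ := 1 / 2 * √K * √(9 - (m + n)) with hνdef
  have h9' : 0 < 9 - ((m : ℝ) + n) := by linarith
  have hν : 0 < ν := by positivity
  have hν2 : ν ^ 2 = 2 * K - K ^ 2 / 4 := by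
    rw [hνdef, mul_pow, mul_pow, sq_sqrt hK.le, sq_sqrt h9'.le, hKdef]; ring
  obtain ⟨⟨α, β, hαβ, hW⟩, hq⟩ := hP.spiral hK hν hν2
  obtain ⟨R, δ, hR, hRδ⟩ := PerturbedOsc.exists_amplitude_phase hαβ
  obtain ⟨R', γ, hR', hRγ⟩ := PerturbedOsc.exists_amplitude_phase
    (Or.inl (sqrt_pos.2 h9').ne' : √(9 - ((m : ℝ) + n)) ≠ 0 ∨ √K ≠ 0)
  simp only [hRδ] at hW
  refine ⟨?_, fun σ hσ C => PerturbedOsc.frequently_of_spiral hK hR hν hW hq hσ C⟩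
  have hp : ∀ r, HasDerivAt (fun r => exp (-(K / 2 * r)) * (R * cos (ν * r - δ)))
      (exp (-(K / 2 * r)) * (-(K / 2) * (R * cos (ν * r - δ)) - R * ν * sin (ν * r - δ))) r := by
    intro r
    have h3 := (((hasDerivAt_id r).const_mul ν).sub_const δ).cos.const_mul R
    have h4 := hasDerivAt_exp_mul (-(K / 2)) r
    simp only [neg_mul] at h4
    refine (h4.fun_mul h3).congr_deriv ?_
    simp only [id]; ring
  have hp' : ∀ r ≥ 0, |exp (-(K / 2 * r)) *
      (-(K / 2) * (R * cos (ν * r - δ)) - R * ν * sin (ν * r - δ))| ≤ K / 2 * R + R * ν := by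
    intro r hr
    refine abs_exp_neg_mul_le (by positivity) ((abs_sub _ _).trans ?_)
    rw [abs_mul, abs_mul, abs_mul, abs_neg, abs_of_pos (half_pos hK), abs_of_pos hR,
      abs_of_pos (by positivity : 0 < R * ν)]
    have h3 := abs_cos_le_one (ν * r - δ)
    have h4 := abs_sin_le_one (ν * r - δ)
    exact add_le_add (mul_le_mul_of_nonneg_left (mul_le_of_le_one_right hR.le h3) (by positivity))
      (mul_le_of_le_one_right (by positivity) h4)
  have ea := ha.expansion hp hp' hW hq (ha.exp_isBigO K)
  have eb := hb.expansion hp hp' hW hq (ha.exp_isBigO K)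
  -- The profile comes with amplitude `R` and phase `δ`; the prescribed combination of cosine and
  -- sine has amplitude `R'` and phase `γ`. Then `d₀` absorbs the difference of phases and `c₀` the
  -- quotient of amplitudes.
  let d₀ := exp (log c + (δ - γ) / ν)
  let c₀ := R * exp (K / 2 * log c) / ((m + n) * R')
  have hprof : ∀ s : ℝ, 0 < s → exp (-(K / 2 * (log s - log c))) * (R * cos (ν * (log s - log c) - δ)) =
      (m + n) * c₀ * s ^ (-(K / 2)) * (√(9 - ((m : ℝ) + n)) * cos (-ν * log (s / d₀)) -
        √K * sin (-ν * log (s / d₀))) := by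
    intro s hs
    have e1 := hRγ (ν * log (s / d₀))
    have e2 : ν * log (s / d₀) - γ = ν * (log s - log c) - δ := by
      simp only [d₀]
      rw [log_div hs.ne' (exp_pos _).ne', log_exp]
      field_simp; ring
    rw [e2] at e1
    rw [neg_mul, cos_neg, sin_neg, mul_neg, sub_neg_eq_add, e1, exp_neg_mul_log_sub hs]
    simp only [c₀]
    field_simp
  have eexp : -((m : ℝ) + n - 1) / 2 = -(K / 2) := by rw [hKdef]; ring
  have eφ : ∀ s, -(1 / 2) * √K * √(9 - ((m : ℝ) + n)) * log (s / d₀) = -ν * log (s / d₀) :=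
    fun s => by rw [hνdef]; ring
  have hR0 : 0 < c₀ := by positivity
  have herr : (fun s : ℝ => s * s ^ (-K)) =ᶠ[atTop] fun s => s ^ (-((m : ℝ) + n - 2)) := by
    filter_upwards [eventually_gt_atTop 0] with s hs
    rw [← rpow_one_add' hs.le (by rw [hKdef]; linarith)]
    congr 1; rw [hKdef]; ring
  refine ⟨c₀, d₀, hR0.ne', exp_pos _, ?_, ?_⟩
  · refine ea.congr' ?_ herr
    filter_upwards [eventually_gt_atTop 0] with s hs
    rw [hprof s hs, eexp, ← hKdef, eφ]
    field_simp; ring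
  · refine eb.congr' ?_ herr
    filter_upwards [eventually_gt_atTop 0] with s hs
    rw [hprof s hs, eexp, ← hKdef, eφ]
    field_simp; ring

/-- Late time behavior for `m + n = 9`. -/
lemma friedmannDegenerate (hk : m + n = 9) (hP : PerturbedOsc ((m : ℝ) + n - 1) W Y N)
    (ha : LateTime c (-(n / (m + n))) W (fun r => W r ^ 2 + Y r ^ 2) ρ fa)
    (hb : LateTime c (m / (m + n)) W (fun r => W r ^ 2 + Y r ^ 2) ρ fb) :
    FriedmannDegenerate m n fa fb ∧ ∃ σ : ℝ, (σ = 1 ∨ σ = -1) ∧ ∀ C, ∀ᶠ r in atTop,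
      C * (W r ^ 2 + Y r ^ 2) < σ * W r := by
  have h9 : (m : ℝ) + n = 9 := by exact_mod_cast hk
  rw [h9, show (9 : ℝ) - 1 = 8 by norm_num] at hP
  rw [h9] at ha hb
  obtain ⟨⟨α, β, hαβ, hW⟩, hq⟩ := hP.degenerate
  refine ⟨?_, PerturbedOsc.exists_sign_of_degenerate hαβ hW hq⟩
  have hp : ∀ r, HasDerivAt (fun r => exp (-(4 * r)) * (α + β * r))
      (exp (-(4 * r)) * (β - 4 * α) + exp (-(4 * r)) * (-(4 * β) * r)) r := by
    intro r
    have h3 := ((hasDerivAt_id r).const_mul β).const_add α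
    have h4 := hasDerivAt_exp_mul (-4) r
    simp only [neg_mul] at h4
    refine (h4.fun_mul h3).congr_deriv ?_
    simp only [id]; ring
  have hp' : ∀ r ≥ 0, |exp (-(4 * r)) * (β - 4 * α) + exp (-(4 * r)) * (-(4 * β) * r)| ≤
      |β - 4 * α| + |4 * β| := by
    intro r hr
    refine (abs_add_le _ _).trans (add_le_add (abs_exp_neg_mul_le (by positivity) le_rfl) ?_)
    have h3 : r * exp (-(4 * r)) ≤ 1 := by
      rw [exp_neg, ← div_eq_mul_inv, div_le_one (exp_pos _)]
      have := add_one_le_exp (4 * r)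
      linarith
    have e : exp (-(4 * r)) * (-(4 * β) * r) = -(4 * β) * (r * exp (-(4 * r))) := by ring
    rw [e, abs_mul, abs_neg, abs_of_nonneg (by positivity : 0 ≤ r * exp (-(4 * r)))]
    exact mul_le_of_le_one_right (abs_nonneg _) h3
  have herr := (ha.id_isBigO.pow 2).mul (ha.exp_isBigO 8)
  have ea := ha.expansion hp hp' hW hq herr
  have eb := hb.expansion hp hp' hW hq herr
  -- Read off from `α + β (log s - log c)`, multiplied by `c⁴`; the factor `-1/9` comes from the
  -- coefficients `-n/9` and `m/9` of `W`.
  refine ⟨-(exp (4 * log c) * β / 9), -(exp (4 * log c) * (α - β * log c) / 9), ?_, ?_⟩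
  · refine ea.congr' ?_ EventuallyEq.rfl
    filter_upwards [eventually_gt_atTop 0] with s hs
    rw [exp_neg_mul_log_sub hs]
    ring
  · refine eb.congr' ?_ EventuallyEq.rfl
    filter_upwards [eventually_gt_atTop 0] with s hs
    rw [exp_neg_mul_log_sub hs]
    ring

/-- Late time behavior for `m + n ≥ 10`. -/
lemma friedmannNode (hk : 10 ≤ m + n) (hP : PerturbedOsc ((m : ℝ) + n - 1) W Y N)
    (hN : m = n → ∃ C, ∀ r, |N r| ≤ C * √(W r ^ 2 + Y r ^ 2) ^ 3)
    (ha : LateTime c (-(n / (m + n))) W (fun r => W r ^ 2 + Y r ^ 2) ρ fa)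
    (hb : LateTime c (m / (m + n)) W (fun r => W r ^ 2 + Y r ^ 2) ρ fb) :
    FriedmannNode m n fa fb ∧ ∃ σ : ℝ, (σ = 1 ∨ σ = -1) ∧ ∀ C, ∀ᶠ r in atTop,
      C * (W r ^ 2 + Y r ^ 2) < σ * W r := by
  have h10 : (10 : ℝ) ≤ (m : ℝ) + n := by exact_mod_cast hk
  set K : ℝ := (m : ℝ) + n - 1 with hKdef
  have hK : 9 ≤ K := by linarith
  have hdisc : 0 ≤ K * (((m : ℝ) + n) - 9) := mul_nonneg (by linarith) (by linarith)
  set D := √(K * (((m : ℝ) + n) - 9)) with hD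
  have hD2 : D ^ 2 = K * (K - 8) := by rw [hD, sq_sqrt hdisc, hKdef]; ring
  have hD0 : 0 ≤ D := sqrt_nonneg _
  have hDK : D < K := by nlinarith
  set l : ℝ := 1 / 2 * (K - D) with hl
  have hl0 : 0 < l := by rw [hl]; linarith
  -- This is `2 l ≤ l'` for the rates `(K ∓ D) / 2`. As `D² = K (K - 8)`, it amounts to `K ≥ 9`,
  -- with equality exactly at `m + n = 10`, the resonant case.
  have hKD : K ≤ 3 * D := by nlinarith
  let e : ℝ → ℝ := fun r => if m + n = 10 ∧ m ≠ n then r else 1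
  have he : (∀ r, e r = r) ∨ (∀ r, e r = 1) ∧ (2 * l < 1 / 2 * (K + D) ∨
      ∃ C, ∀ r, |N r| ≤ C * √(W r ^ 2 + Y r ^ 2) ^ 3) := by
    by_cases hc : m + n = 10 ∧ m ≠ n
    · exact Or.inl fun r => if_pos hc
    · refine Or.inr ⟨fun r => if_neg hc, ?_⟩
      by_cases hmn : m = n
      · exact Or.inr (hN hmn)
      · left
        have h11 : 11 ≤ m + n := by
          have : m + n ≠ 10 := fun h => hc ⟨h, hmn⟩
          omega
        have h11' : (11 : ℝ) ≤ (m : ℝ) + n := by exact_mod_cast h11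
        have hK' : 10 ≤ K := by linarith
        have : K < 3 * D := by nlinarith
        rw [hl]; linarith
  obtain ⟨⟨c₁, hW, h0⟩, hq⟩ := hP.node hl0 (l' := 1 / 2 * (K + D)) (by rw [hl]; linarith)
    (by rw [hl]; ring) (by rw [hl]; nlinarith) he
  have hqe : (fun r => exp (-(2 * l * r))) =O[atTop] fun r => e r * exp (-(2 * l * r)) := by
    refine IsBigO.of_bound 1 ?_
    filter_upwards [eventually_ge_atTop 1] with r hr
    have he1 : 1 ≤ e r := by simp only [e]; split_ifs <;> linarith
    rw [one_mul, norm_mul, norm_of_nonneg (by linarith : 0 ≤ e r)]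
    exact le_mul_of_one_le_left (norm_nonneg _) he1
  have hlit : (fun r => e r * exp (-(2 * l * r))) =o[atTop] fun r => exp (-(l * r)) := by
    by_cases hc : m + n = 10 ∧ m ≠ n
    · simpa [e, hc] using pow_mul_exp_isLittleO_exp 1 (by linarith : l < 2 * l)
    · simpa only [e, if_neg hc, one_mul] using exp_isLittleO_exp (by linarith : l < 2 * l)
  refine ⟨?_, hP.exists_sign_of_node hlit hW h0 (hq.trans hqe)⟩
  have hp : ∀ r, HasDerivAt (fun r => c₁ * exp (-(l * r))) (exp (-(l * r)) * (-l * c₁)) r := by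
    intro r
    have h4 := hasDerivAt_exp_mul (-l) r
    simp only [neg_mul] at h4
    exact (h4.const_mul c₁).congr_deriv (by ring)
  have hp' : ∀ r ≥ 0, |exp (-(l * r)) * (-l * c₁)| ≤ |-l * c₁| := fun r hr =>
    abs_exp_neg_mul_le (by positivity) le_rfl
  have herr : (fun s => e (ρ s) * exp (-(2 * l * ρ s))) =O[atTop]
      fun s => s ^ (-2 * l) * if m + n = 10 ∧ m ≠ n then log s else 1 := by
    have h3 := ha.exp_isBigO (2 * l)
    rw [← neg_mul] at h3
    by_cases hc : m + n = 10 ∧ m ≠ n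
    · simp only [e, if_pos hc]
      exact (ha.id_isBigO.mul h3).congr_right fun s => mul_comm _ _
    · simpa only [e, if_neg hc, one_mul, mul_one] using h3
  have ea := ha.expansion hp hp' hW (hq.trans hqe) herr
  have eb := hb.expansion hp hp' hW (hq.trans hqe) herr
  refine ⟨-(c₁ * exp (l * log c) / (m + n)), ?_, ?_⟩
  · refine ea.congr' ?_ EventuallyEq.rfl
    filter_upwards [eventually_gt_atTop 0] with s hs
    rw [exp_neg_mul_log_sub hs]
    change _ = fa s - s * (1 + n * -(c₁ * exp (l * log c) / (m + n)) * s ^ (-l))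
    field_simp
  · refine eb.congr' ?_ EventuallyEq.rfl
    filter_upwards [eventually_gt_atTop 0] with s hs
    rw [exp_neg_mul_log_sub hs]
    change _ = fb s - s * (1 - m * -(c₁ * exp (l * log c) / (m + n)) * s ^ (-l))
    field_simp
    ring

end Friedmann
end WarpedVacuum
end

/-! ### Friedmann type and the oscillation criterion. -/

noncomputable section
namespace WarpedVacuum
section LateTimeConclusion

variable {m n : ℕ} {hm : 1 < m} {hn : 1 < n} {w θ : ℝ → ℝ}

/-- Solutions other than the Friedmann solution are of Friedmann type at late times, and oscillate
about it if and only if `m + n < 9`. -/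
lemma exists_isFriedmannType (h : (osc m n hm hn).IsOrbit w θ) (h0 : (w 0, θ 0) ≠ 0) {c T₀ : ℝ}
    {T σ a b : ℝ → ℝ} (hc : 0 < c) (hT : Clock (tick m n hm hn c w θ) T₀ T σ)
    (hab : ∀ t, T₀ < t → a t = scaleA m n c w (σ t) ∧ b t = scaleB m n c w (σ t)) :
    ∃ T₁ : ℝ, IsFriedmannType m n (fun s => a (T₁ + s)) (fun s => b (T₁ + s)) ∧
      (OscillatesAboutFriedmann (fun s => a (T₁ + s)) ↔ m + n < 9) ∧
      (OscillatesAboutFriedmann (fun s => b (T₁ + s)) ↔ m + n < 9) := by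
  have h1 : (1 : ℝ) < m := by exact_mod_cast hm
  have h2 : (1 : ℝ) < n := by exact_mod_cast hn
  obtain ⟨T₁, ρ, ha, hb, S, hS, hρS⟩ := exists_lateTime h h0 hc hT hab
  have hP := perturbedOsc_of_isOrbit h h0
  have hκa : -((n : ℝ) / (m + n)) ≠ 0 := neg_ne_zero.2 (by positivity)
  have hκb : (m : ℝ) / (m + n) ≠ 0 := by positivity
  have hN : m = n → ∃ C, ∀ r, |perturbation m n (revW m n w r) (revY m n θ r)| ≤
      C * √(revW m n w r ^ 2 + revY m n θ r ^ 2) ^ 3 := fun e => by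
    obtain ⟨C, hC⟩ := exists_abs_perturbation_self_le hm
    subst e
    exact ⟨C, fun r => hC _ _⟩
  refine ⟨T₁, ⟨fun hk => (friedmannSpiral hm hn hk hP ha hb).1,
    fun hk => (friedmannDegenerate hk hP ha hb).1,
    fun hk => (friedmannNode hk hP hN ha hb).1⟩, ?_⟩
  rcases lt_or_ge (m + n) 9 with hk | hk
  · have hfr := (friedmannSpiral hm hn hk hP ha hb).2
    -- A property that recurs for large `r` recurs for large `s`, because `ρ` has a right inverse
    -- tending to infinity.
    have key : ∀ σ : ℝ, σ = 1 ∨ σ = -1 → ∀ C, ∃ᶠ s in atTop,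
        C * (revW m n w (ρ s) ^ 2 + revY m n θ (ρ s) ^ 2) < σ * revW m n w (ρ s) :=
      fun σ hσ C => hS.frequently ((hfr σ hσ C).mono fun r hr => by rwa [hρS])
    have k1 := fun C => by simpa only [one_mul] using key 1 (Or.inl rfl) C
    have k2 := fun C => by simpa only [neg_mul, one_mul] using key (-1) (Or.inr rfl) C
    exact ⟨iff_of_true (ha.oscillates hκa k1 k2) hk, iff_of_true (hb.oscillates hκb k1 k2) hk⟩
  · obtain ⟨σ, hσ, hs⟩ : ∃ σ : ℝ, (σ = 1 ∨ σ = -1) ∧ ∀ C, ∀ᶠ r in atTop,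
        C * (revW m n w r ^ 2 + revY m n θ r ^ 2) < σ * revW m n w r := by
      rcases hk.eq_or_lt with hk | hk
      · exact (friedmannDegenerate hk.symm hP ha hb).2
      · exact (friedmannNode hk hP hN ha hb).2
    exact ⟨iff_of_false (ha.not_oscillates hκa hσ hs) hk.not_gt,
      iff_of_false (hb.not_oscillates hκb hσ hs) hk.not_gt⟩

end LateTimeConclusion
end WarpedVacuum
end

/-! ### The main theorem. -/

theorem mainTheorem4 (m n : ℕ) (hm : 1 < m) (hn : 1 < n) :
    (IsSpiral m n (fixedStar m n) ↔ m + n < 9) ∧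
    (IsNode m n (fixedStar m n) ↔ 9 ≤ m + n) ∧
    ∃ EA EB : Set Vars,
      IsOrbitTendingTo m n (fixedA m n) EA ∧
      IsOrbitTendingTo m n (fixedB m n) EB ∧
      -- the generic states form an open dense subset of the state space
      (∃ O : Set Vars, IsOpen O ∧
        stateSpace m n \ ({fixedStar m n} ∪ EA ∪ EB) = stateSpace m n ∩ O) ∧
      stateSpace m n ⊆ closure (stateSpace m n \ ({fixedStar m n} ∪ EA ∪ EB)) ∧
      ∀ (M : Type*) [TopologicalSpace M] [ChartedSpace (Fin m → ℝ) M]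
        [IsManifold 𝓘(ℝ, Fin m → ℝ) ∞ M] [Nonempty M]
        (N : Type*) [TopologicalSpace N] [ChartedSpace (Fin n → ℝ) N]
        [IsManifold 𝓘(ℝ, Fin n → ℝ) ∞ N] [Nonempty N]
        (g : RMetric m M) (h : RMetric n N),
        IsEinstein (-((m : ℝ) + n - 1)) g → IsEinstein (-((m : ℝ) + n - 1)) h →
        ∀ (I : Set ℝ) (a b : ℝ → ℝ),
          IsMaximalVacuum g h I a b →
          (∃ t ∈ I, meanCurv m n a b t < 0) →
          ∃ T₀ : ℝ, I = Set.Ioi T₀ ∧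
            (∀ t ∈ I, meanCurv m n a b t < 0 ∧ varsAt m n a b t ∈ stateSpace m n) ∧
            ((∃ t ∈ I, varsAt m n a b t ∉ {fixedStar m n} ∪ EA ∪ EB) →
              IsKasnerType m n T₀ a b ∧
              ∃ T₁ : ℝ,
                IsFriedmannType m n (fun s => a (T₁ + s)) (fun s => b (T₁ + s)) ∧
                (OscillatesAboutFriedmann (fun s => a (T₁ + s)) ↔ m + n < 9) ∧
                (OscillatesAboutFriedmann (fun s => b (T₁ + s)) ↔ m + n < 9)) := by
  obtain ⟨EA, EB, hA, hB, hO, hdense, hgen⟩ := exists_exceptional_orbits hm hn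
  refine ⟨isSpiral_fixedStar_iff hm hn, isNode_fixedStar_iff hm hn, EA, EB, hA, hB, hO, hdense, ?_⟩
  intro M _ _ _ _ N _ _ _ _ g h hg hh I a b hv hH
  obtain ⟨w, θ, c, T₀, T, σ, ho, hc, hT, rfl, hab⟩ := hv.exists_orbit hm hn hg hh hH
  refine ⟨T₀, rfl, fun t ht => ?_, fun ⟨t, ht, hX⟩ => ?_⟩
  · obtain ⟨-, -, h1, h2⟩ := hab t ht
    exact ⟨h1, h2 ▸ stateOf_mem hm hn _⟩
  · rw [(hab t ht).2.2.2] at hX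
    obtain ⟨h0, hfate⟩ := hgen w θ ho ⟨_, hX⟩
    refine ⟨?_, exists_isFriedmannType ho h0 hc hT fun t ht => ⟨(hab t ht).1, (hab t ht).2.1⟩⟩
    obtain ⟨P, Q, a₀, b₀, h1, h2, h3, h4, h5, h6⟩ := isKasnerType_of_fate ho hc hT hfate
    refine ⟨P, Q, a₀, b₀, h1, h2, h3, h4, h5.congr' ?_, h6.congr' ?_⟩ <;>
      filter_upwards [self_mem_nhdsWithin] with t ht
    · rw [(hab t ht).1]
    · rw [(hab t ht).2.1]
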